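/- All manifolds are smooth, Hausdorff and second countable, and all contact structures are cooriented. **bLobs.** Let $P$ be a compact manifold with nonempty boundary. A *relative open book* on $P$ is a pair $(B,\vartheta)$ consisting of a nonempty closed codimension-$2$ submanifold $B$ in the interior of $P$ with trivial normal bundle and a smooth fibration $\vartheta\colon P\setminus B\to\mathbb S^1$ whose fibers are transverse to $\partial P$ and which agrees with the normal angular coordinate in some neighborhood $B\times\mathbb D^2$ of $B$. A *bordered Legendrian open book* (bLob) in a contact manifold $(M,\xi)$ of dimension $2k+1$ is a compact embedded $(k+1)$-dimensional submanifold $S$ with boundary such that $\mathcal F=\xi\cap TS$ is a singular foliation, i.e. $(\alpha\wedge d\alpha)|_{TS}=0$ for a contact form $\alpha$ of $\xi$, and such that $S$ has a relative open book $(B,\vartheta)$ for which the regular leaves of $\mathcal F$ lie in the fibers of $\vartheta$ and the singular set $\{p\in S : T_pS\subset\xi_p\}$ equals $\partial S\cup B$. A contact manifold is *$PS$-overtwisted* if it contains a bLob. **Fiber sums.** Let $(M_1,\xi_1)$ and $(M_2,\xi_2)$ be contact manifolds of dimension $2n+1$ and let $(N,\xi_N)$ be a contact manifold of dimension $2n-1$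 that is embedded as a contact submanifold and closed subset, with trivial normal bundle, in both of them. Suppose that, for a positive contact form $\alpha_N$ of $\xi_N$ and some $\epsilon>0$, neighborhoods of $N$ in $M_1$ and in $M_2$ are identified by contactomorphisms (the given embedding on $\{0\}\times N$) with $\mathbb D^2_{\sqrt\epsilon}\times N$, carrying $\ker(\alpha_N+r^2\,d\varphi)$, where $\mathbb D^2_{\sqrt\epsilon}$ is the open disk of radius $\sqrt\epsilon$. Remove $\{0\}\times N$ from them, set $s=r^2$ to obtain $(0,\epsilon)\times\mathbb S^1\times N$ with the form $\alpha_N+s\,d\varphi$, extend $M_1\setminus N$ and $M_2\setminus N$ by enlarging these ends to $(-\epsilon,\epsilon)\times\mathbb S^1\times N$ with the same form, and glue the two extended manifolds along these collars by $(s,\varphi,p)\mapsto(-s,-\varphi,p)$. The resulting contact manifold $(M',\xi')$ is called a *fiber sum* of $M_1$ and $M_2$ along $N$ with contact form $\alpha_N$. **Theorem (Presas).** Let $(M_1,\xi_1)$, $(M_2,\xi_2)$ and $(N,\xi_N)$ be as above: $M_1$ and $M_2$ have dimension $2n+1$ and both contain $(N,\xi_N)$ as a contact submanifold of codimension $2$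 (and closed subset) with trivial normal bundle. Suppose that $(N,\xi_N)$ is $PS$-overtwisted. 1. If $N$ is compact, then for every positive contact form $\alpha_N$ of $\xi_N$ there is a fiber sum of $M_1$ and $M_2$ along $N$ with contact form $\alpha_N$; it is a contact manifold of dimension $2n+1$. 2. Every fiber sum $(M',\xi')$ of $M_1$ and $M_2$ along $N$ is $PS$-overtwisted. More precisely, for every bLob $S$ in $(N,\xi_N)$, the subset $\{0\}\times\mathbb S^1\times S$ of the collar $(-\epsilon,\epsilon)\times\mathbb S^1\times N\subset M'$ is a bLob in $(M',\xi')$. -/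

import Mathlib

open Set Topology
open scoped Manifold ContDiff

universe u

noncomputable section

namespace ContactFiberSum

/-! ### One-forms, contact structures -/

/-- A (not necessarily smooth) one-form on a `d`-dimensional manifold. -/
abbrev OneForm (d : ℕ) (M : Type u) [TopologicalSpace M]
    [ChartedSpace (EuclideanSpace ℝ (Fin d)) M] :=
  ∀ x : M, TangentSpace (𝓡 d) x →L[ℝ] ℝ

namespace OneForm

variable {d : ℕ} {M : Type u} [TopologicalSpace M] [ChartedSpace (EuclideanSpace ℝ (Fin d)) M]

/-- The coordinate expression of the one-form `α` in the chart at `x₀`, that is, the pull-back of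
`α` under the inverse of that chart. -/
def inChart (α : OneForm d M) (x₀ : M) (y : EuclideanSpace ℝ (Fin d)) :
    EuclideanSpace ℝ (Fin d) →L[ℝ] ℝ :=
  (α ((extChartAt (𝓡 d) x₀).symm y)).comp
    (mfderiv 𝓘(ℝ, EuclideanSpace ℝ (Fin d)) (𝓡 d) (extChartAt (𝓡 d) x₀).symm y)

/-- `α` is smooth: its coordinate expressions are. -/
def IsSmooth (α : OneForm d M) : Prop :=
  ∀ x₀ : M, ContDiffOn ℝ ∞ (α.inChart x₀) (extChartAt (𝓡 d) x₀).target

/-- The exterior derivative `dα (u, v)` at `x`, computed in the chart at `x`. -/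
def extDeriv (α : OneForm d M) (x : M) (u v : TangentSpace (𝓡 d) x) : ℝ :=
  let D := mfderiv (𝓡 d) 𝓘(ℝ, EuclideanSpace ℝ (Fin d)) (extChartAt (𝓡 d) x) x
  fderiv ℝ (α.inChart x) (extChartAt (𝓡 d) x x) (D u) (D v) -
    fderiv ℝ (α.inChart x) (extChartAt (𝓡 d) x x) (D v) (D u)

/-- `α` is a contact form: it is smooth, nowhere zero, and `dα` is non-degenerate on `ker α`. -/
structure IsContactForm (α : OneForm d M) : Prop where
  smooth : α.IsSmooth
  ne_zero : ∀ x, α x ≠ 0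
  nondegenerate : ∀ x, ∀ u : TangentSpace (𝓡 d) x, α x u = 0 →
    (∀ v : TangentSpace (𝓡 d) x, α x v = 0 → α.extDeriv x u v = 0) → u = 0

end OneForm

/-- A cooriented contact structure: a field of hyperplanes `plane`, together with the sets `pos`
of vectors that are positively transverse to it, given by a contact form. -/
structure ContactStructure (d : ℕ) (M : Type u) [TopologicalSpace M]
    [ChartedSpace (EuclideanSpace ℝ (Fin d)) M] where
  plane : ∀ x : M, Submodule ℝ (TangentSpace (𝓡 d) x)
  pos : ∀ x : M, Set (TangentSpace (𝓡 d) x)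
  exists_form : ∃ α : OneForm d M, α.IsContactForm ∧
    ∀ x v, (v ∈ plane x ↔ α x v = 0) ∧ (v ∈ pos x ↔ 0 < α x v)

/-- `α` is a positive contact form for the cooriented contact structure `ξ`. -/
def ContactStructure.IsPositiveForm {d : ℕ} {M : Type u} [TopologicalSpace M]
    [ChartedSpace (EuclideanSpace ℝ (Fin d)) M] (ξ : ContactStructure d M) (α : OneForm d M) :
    Prop :=
  α.IsContactForm ∧ ∀ x v, (v ∈ ξ.plane x ↔ α x v = 0) ∧ (v ∈ ξ.pos x ↔ 0 < α x v)

/-! ### Diffeomorphisms between subsets of manifolds -/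

section Diffeo

variable {E : Type*} [NormedAddCommGroup E] [NormedSpace ℝ E] {H : Type*} [TopologicalSpace H]
  (I : ModelWithCorners ℝ E H) {X : Type*} [TopologicalSpace X] [ChartedSpace H X]
  {E' : Type*} [NormedAddCommGroup E'] [NormedSpace ℝ E'] {H' : Type*} [TopologicalSpace H']
  (I' : ModelWithCorners ℝ E' H') {Y : Type*} [TopologicalSpace Y] [ChartedSpace H' Y]

/-- `f` restricts to a diffeomorphism from the subset `s` onto the subset `t`. -/
def IsDiffeoOn (f : X → Y) (s : Set X) (t : Set Y) : Prop :=
  ContMDiffOn I I' ∞ f s ∧ MapsTo f s t ∧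
    ∃ g : Y → X, ContMDiffOn I' I ∞ g t ∧ MapsTo g t s ∧ LeftInvOn g f s ∧ RightInvOn g f t

/-- `f` restricts to a diffeomorphism from the open set `s` onto an open set. -/
def IsOpenDiffeoOn (f : X → Y) (s : Set X) : Prop :=
  IsOpen s ∧ IsOpen (f '' s) ∧ IsDiffeoOn I I' f s (f '' s)

end Diffeo

/-! ### Relative open books -/

section OpenBook

variable {k : ℕ} {P : Type u} [TopologicalSpace P] [ChartedSpace (EuclideanHalfSpace (k + 1)) P]

/-- The tangent space of `∂P` at a boundary point `p`. -/
def boundaryTangent (p : P) : Submodule ℝ (TangentSpace (𝓡∂ (k + 1)) p) :=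
  LinearMap.ker (((EuclideanSpace.proj (0 : Fin (k + 1)) :
      EuclideanSpace ℝ (Fin (k + 1)) →L[ℝ] ℝ).comp
    (mfderiv (𝓡∂ (k + 1)) 𝓘(ℝ, EuclideanSpace ℝ (Fin (k + 1)))
      (extChartAt (𝓡∂ (k + 1)) p) p)).toLinearMap)

/-- `(B, ϑ)` is a relative open book on the manifold with boundary `P` of dimension
`k + 1`.
In `tubular`, the map `x ↦ (π x, z x)` identifies the neighbourhood `U` of `B` with `B × 𝔻`,
with `B` corresponding to `B × {0}`; in particular `B` is a submanifold of codimension two with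
trivial normal bundle. The map `ϑ` only matters away from `B`. -/
structure IsRelativeOpenBook (k : ℕ) {P : Type u} [TopologicalSpace P]
    [ChartedSpace (EuclideanHalfSpace (k + 1)) P] (B : Set P) (ϑ : P → Circle) : Prop where
  boundary_nonempty : ((𝓡∂ (k + 1)).boundary P).Nonempty
  binding_nonempty : B.Nonempty
  binding_closed : IsClosed B
  binding_interior : B ⊆ (𝓡∂ (k + 1)).interior P
  smooth : ContMDiffOn (𝓡∂ (k + 1)) (𝓡 1) ∞ ϑ Bᶜ
  /-- `ϑ : P ∖ B → S¹` is locally trivial. -/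
  fibration : ∀ θ₀ : Circle, ∃ V : Set Circle, IsOpen V ∧ θ₀ ∈ V ∧ ∃ ρ : P → P,
    IsDiffeoOn (𝓡∂ (k + 1)) ((𝓡 1).prod (𝓡∂ (k + 1)))
      (fun x => (ϑ x, ρ x)) (ϑ ⁻¹' V \ B) (V ×ˢ (ϑ ⁻¹' {θ₀} \ B))
  /-- The fibres are transverse to `∂P`. -/
  transverse : ∀ p ∈ (𝓡∂ (k + 1)).boundary P,
    LinearMap.ker (mfderiv (𝓡∂ (k + 1)) (𝓡 1) ϑ p).toLinearMap ⊔ boundaryTangent p = ⊤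
  /-- Near `B`, the map `ϑ` is the normal angular coordinate. -/
  tubular : ∃ (U : Set P) (π : P → P) (z : P → ℂ), IsOpen U ∧ B ⊆ U ∧
    IsDiffeoOn (𝓡∂ (k + 1)) ((𝓡∂ (k + 1)).prod 𝓘(ℝ, ℂ))
      (fun x => (π x, z x)) U (B ×ˢ Metric.ball (0 : ℂ) 1) ∧
    (∀ b ∈ B, π b = b ∧ z b = 0) ∧
    ∀ x ∈ U \ B, z x = ‖z x‖ * (ϑ x : ℂ)

end OpenBook

/-! ### Bordered Legendrian open books -/

section BLob

variable {d : ℕ} {M : Type u} [TopologicalSpace M] [ChartedSpace (EuclideanSpace ℝ (Fin d)) M]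
  (k : ℕ) (ξ : ContactStructure d M)
  {P : Type u} [TopologicalSpace P] [ChartedSpace (EuclideanHalfSpace (k + 1)) P]
  (ι : P → M)

/-- The distribution `ξ ∩ TP` induced by `ξ` on the submanifold `ι : P → M`. -/
def inducedDistribution (p : P) : Submodule ℝ (TangentSpace (𝓡∂ (k + 1)) p) :=
  (ξ.plane (ι p)).comap (mfderiv (𝓡∂ (k + 1)) (𝓡 d) ι p).toLinearMap

/-- The points where `ξ ∩ TP` is singular, that is, where `TP ⊆ ξ`. -/
def singularSet : Set P := {p | inducedDistribution k ξ ι p = ⊤}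

/-- The distribution `ξ ∩ TP` is a singular foliation: `(α ∧ dα)|_{TP} = 0`. -/
def IsFoliated : Prop :=
  ∀ α : OneForm d M, ξ.IsPositiveForm α → ∀ (p : P) (u v w : TangentSpace (𝓡∂ (k + 1)) p),
    let D := mfderiv (𝓡∂ (k + 1)) (𝓡 d) ι p
    α (ι p) (D u) * α.extDeriv (ι p) (D v) (D w) - α (ι p) (D v) * α.extDeriv (ι p) (D u) (D w) +
      α (ι p) (D w) * α.extDeriv (ι p) (D u) (D v) = 0

/-- The regular leaf through a point `p` outside the singular set: the points reached from `p`
along smooth curves that are tangent to `ξ ∩ TP` and avoid the singular set. -/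
def regularLeaf (p : P) : Set P :=
  {q | ∃ γ : ℝ → P, ContMDiff 𝓘(ℝ, ℝ) (𝓡∂ (k + 1)) ∞ γ ∧ γ 0 = p ∧ γ 1 = q ∧
    ∀ t : ℝ, γ t ∉ singularSet k ξ ι ∧
      mfderiv 𝓘(ℝ, ℝ) (𝓡∂ (k + 1)) γ t (1 : ℝ) ∈ inducedDistribution k ξ ι (γ t)}

end BLob

/-- The subset `S` of the `(2n+1)`-dimensional contact manifold `(M, ξ)` is a bordered Legendrian
open book: `S` is the image of a smoothly embedded compact manifold with boundary `P` of dimension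
`n + 1` carrying a Legendrian foliation and a relative open book `(B, ϑ)`, such that the regular
leaves lie in the fibres of `ϑ` and the singular set is `∂P ∪ B`. -/
def IsBLob {n : ℕ} {M : Type u} [TopologicalSpace M]
    [ChartedSpace (EuclideanSpace ℝ (Fin (2 * n + 1))) M]
    (ξ : ContactStructure (2 * n + 1) M) (S : Set M) : Prop :=
  ∃ (P : Type u) (_ : TopologicalSpace P) (_ : ChartedSpace (EuclideanHalfSpace (n + 1)) P)
    (_ : IsManifold (𝓡∂ (n + 1)) ∞ P) (_ : T2Space P) (_ : CompactSpace P)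
    (ι : P → M) (B : Set P) (ϑ : P → Circle),
    range ι = S ∧
    IsEmbedding ι ∧ ContMDiff (𝓡∂ (n + 1)) (𝓡 (2 * n + 1)) ∞ ι ∧
    (∀ p, Function.Injective (mfderiv (𝓡∂ (n + 1)) (𝓡 (2 * n + 1)) ι p)) ∧
    IsFoliated n ξ ι ∧
    IsRelativeOpenBook n B ϑ ∧
    (∀ p, p ∉ singularSet n ξ ι → ∀ q ∈ regularLeaf n ξ ι p, ϑ q = ϑ p) ∧
    singularSet n ξ ι = (𝓡∂ (n + 1)).boundary P ∪ B

/-- A contact manifold is `PS`-overtwisted if it contains a bordered Legendrian open book. -/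
def IsPSOvertwisted {n : ℕ} {M : Type u} [TopologicalSpace M]
    [ChartedSpace (EuclideanSpace ℝ (Fin (2 * n + 1))) M]
    (ξ : ContactStructure (2 * n + 1) M) : Prop :=
  ∃ S : Set M, IsBLob ξ S

/-! ### Contact submanifolds of codimension two and fiber sums -/

section FiberSum

variable {d e : ℕ} {N M : Type u}
  [TopologicalSpace N] [ChartedSpace (EuclideanSpace ℝ (Fin d)) N]
  [TopologicalSpace M] [ChartedSpace (EuclideanSpace ℝ (Fin e)) M]

/-- `j` embeds `(N, ξN)` as a closed subset and contact submanifold of `(M, ξ)`. -/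
structure IsContactEmbedding (ξN : ContactStructure d N) (ξ : ContactStructure e M) (j : N → M) :
    Prop where
  isClosedEmbedding : IsClosedEmbedding j
  smooth : ContMDiff (𝓡 d) (𝓡 e) ∞ j
  immersion : ∀ p, Function.Injective (mfderiv (𝓡 d) (𝓡 e) j p)
  contact : ∀ p v, (mfderiv (𝓡 d) (𝓡 e) j p v ∈ ξ.plane (j p) ↔ v ∈ ξN.plane p) ∧
    (mfderiv (𝓡 d) (𝓡 e) j p v ∈ ξ.pos (j p) ↔ v ∈ ξN.pos p)

/-- The normal bundle `j^* TM / TN` of a submanifold `j : N → M` of codimension two is trivial: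
there are two smooth vector fields along `j` that are linearly independent modulo `TN`. -/
def HasTrivialNormalBundle (d e : ℕ) {N M : Type u}
    [TopologicalSpace N] [ChartedSpace (EuclideanSpace ℝ (Fin d)) N]
    [TopologicalSpace M] [ChartedSpace (EuclideanSpace ℝ (Fin e)) M]
    [IsManifold (𝓡 e) ∞ M] (j : N → M) : Prop :=
  ∃ X Y : ∀ p : N, TangentSpace (𝓡 e) (j p),
    ContMDiff (𝓡 d) (𝓡 e).tangent ∞ (fun p => (⟨j p, X p⟩ : TangentBundle (𝓡 e) M)) ∧
    ContMDiff (𝓡 d) (𝓡 e).tangent ∞ (fun p => (⟨j p, Y p⟩ : TangentBundle (𝓡 e) M)) ∧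
    ∀ (p : N) (a b : ℝ),
      a • X p + b • Y p ∈ LinearMap.range (mfderiv (𝓡 d) (𝓡 e) j p).toLinearMap → a = 0 ∧ b = 0

/-- The form `x dy - y dx = r² dφ` on `ℂ`, at the point `z` and the tangent vector `w`. It
restricts to `dφ` on the unit circle. -/
def angularForm (z w : ℂ) : ℝ := z.re * w.im - z.im * w.re

/-- The form `αN + r² dφ` on `ℂ × N`. -/
def discForm (αN : OneForm d N) (q : ℂ × N)
    (v : TangentSpace (𝓘(ℝ, ℂ).prod (𝓡 d)) q) : ℝ :=
  αN q.2 (mfderiv (𝓘(ℝ, ℂ).prod (𝓡 d)) (𝓡 d) Prod.snd q v) +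
    angularForm q.1 (mfderiv (𝓘(ℝ, ℂ).prod (𝓡 d)) 𝓘(ℝ, ℂ) Prod.fst q v)

/-- The form `αN + s dφ` on `ℝ × S¹ × N`. -/
def collarForm (αN : OneForm d N) (q : ℝ × Circle × N)
    (v : TangentSpace (𝓘(ℝ, ℝ).prod ((𝓡 1).prod (𝓡 d))) q) : ℝ :=
  αN q.2.2 (mfderiv (𝓘(ℝ, ℝ).prod ((𝓡 1).prod (𝓡 d))) (𝓡 d) (fun x => x.2.2) q v) +
    q.1 * angularForm (q.2.1 : ℂ)
      (mfderiv (𝓘(ℝ, ℝ).prod ((𝓡 1).prod (𝓡 d))) 𝓘(ℝ, ℂ) (fun x => (x.2.1 : ℂ)) q v)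

/-- `Ψ` is a contactomorphism from `𝔻_{√ε} × N` (the open disc of radius `√ε`), with the contact
structure `ker (αN + r² dφ)`, onto an open neighbourhood of `j N` in `(M, ξ)`, which restricts
to `j` on `{0} × N`. -/
structure IsModelNeighborhood (ξ : ContactStructure e M) (j : N → M) (αN : OneForm d N) (ε : ℝ)
    (Ψ : ℂ × N → M) : Prop where
  diffeo : IsOpenDiffeoOn (𝓘(ℝ, ℂ).prod (𝓡 d)) (𝓡 e) Ψ (Metric.ball (0 : ℂ) (√ε) ×ˢ univ)
  zero : ∀ p, Ψ (0, p) = j p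
  contact : ∀ q ∈ Metric.ball (0 : ℂ) (√ε) ×ˢ (univ : Set N), ∀ v,
    (mfderiv (𝓘(ℝ, ℂ).prod (𝓡 d)) (𝓡 e) Ψ q v ∈ ξ.plane (Ψ q) ↔ discForm αN q v = 0) ∧
    (mfderiv (𝓘(ℝ, ℂ).prod (𝓡 d)) (𝓡 e) Ψ q v ∈ ξ.pos (Ψ q) ↔ 0 < discForm αN q v)

/-- `f` restricts to a contactomorphism from the open set `s ⊆ (M, ξ)` onto an open subset of
`(M', ξ')`. -/
structure IsOpenContactEmbeddingOn {M' : Type u} [TopologicalSpace M']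
    [ChartedSpace (EuclideanSpace ℝ (Fin e)) M'] (ξ : ContactStructure e M)
    (ξ' : ContactStructure e M') (f : M → M') (s : Set M) : Prop where
  diffeo : IsOpenDiffeoOn (𝓡 e) (𝓡 e) f s
  contact : ∀ x ∈ s, ∀ v,
    (mfderiv (𝓡 e) (𝓡 e) f x v ∈ ξ'.plane (f x) ↔ v ∈ ξ.plane x) ∧
    (mfderiv (𝓡 e) (𝓡 e) f x v ∈ ξ'.pos (f x) ↔ v ∈ ξ.pos x)

end FiberSum

/-- A presentation of the contact manifold `(M', ξ')` as a fiber sum of `(M₁, ξ₁)` and `(M₂, ξ₂)`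
along the codimension two submanifolds `j₁ : N → M₁` and `j₂ : N → M₂`.

In the model neighbourhoods of `N` with `N` removed, one substitutes `s = r²` to obtain
`(0, ε) × S¹ × N` with the contact form `αN + s dφ`, extends to `(-ε, ε) × S¹ × N` with the same
form, and glues the two resulting manifolds along these collars by `(s, φ, p) ↦ (-s, -φ, p)`.
Hence `M'` is covered by (copies of) `M₁ ∖ N`, `M₂ ∖ N` and the collar, with the first two disjoint
and with the collar meeting them exactly in `{s > 0}` and `{s < 0}`, respectively. -/
structure FiberSum {n : ℕ} {N M₁ M₂ M' : Type u}
    [TopologicalSpace N] [ChartedSpace (EuclideanSpace ℝ (Fin (2 * n + 1))) N]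
    [TopologicalSpace M₁] [ChartedSpace (EuclideanSpace ℝ (Fin (2 * (n + 1) + 1))) M₁]
    [TopologicalSpace M₂] [ChartedSpace (EuclideanSpace ℝ (Fin (2 * (n + 1) + 1))) M₂]
    [TopologicalSpace M'] [ChartedSpace (EuclideanSpace ℝ (Fin (2 * (n + 1) + 1))) M']
    (ξN : ContactStructure (2 * n + 1) N)
    (ξ₁ : ContactStructure (2 * (n + 1) + 1) M₁) (ξ₂ : ContactStructure (2 * (n + 1) + 1) M₂)
    (j₁ : N → M₁) (j₂ : N → M₂) (ξ' : ContactStructure (2 * (n + 1) + 1) M') where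
  /-- the contact form `αN` of the models -/
  form : OneForm (2 * n + 1) N
  form_positive : ξN.IsPositiveForm form
  /-- the size `ε` of the models -/
  width : ℝ
  width_pos : 0 < width
  /-- the model neighbourhoods -/
  nbhd₁ : ℂ × N → M₁
  nbhd₂ : ℂ × N → M₂
  isModel₁ : IsModelNeighborhood ξ₁ j₁ form width nbhd₁
  isModel₂ : IsModelNeighborhood ξ₂ j₂ form width nbhd₂
  /-- the inclusions of `M₁ ∖ N` and `M₂ ∖ N` -/
  incl₁ : M₁ → M'
  incl₂ : M₂ → M'
  incl₁_contact : IsOpenContactEmbeddingOn ξ₁ ξ' incl₁ (range j₁)ᶜ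
  incl₂_contact : IsOpenContactEmbeddingOn ξ₂ ξ' incl₂ (range j₂)ᶜ
  /-- the inclusion of the collar `(-ε, ε) × S¹ × N` -/
  collar : ℝ × Circle × N → M'
  collar_diffeo : IsOpenDiffeoOn (𝓘(ℝ, ℝ).prod ((𝓡 1).prod (𝓡 (2 * n + 1))))
    (𝓡 (2 * (n + 1) + 1)) collar (Ioo (-width) width ×ˢ univ)
  collar_contact : ∀ q ∈ Ioo (-width) width ×ˢ (univ : Set (Circle × N)), ∀ v,
    (mfderiv (𝓘(ℝ, ℝ).prod ((𝓡 1).prod (𝓡 (2 * n + 1)))) (𝓡 (2 * (n + 1) + 1)) collar q v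
      ∈ ξ'.plane (collar q) ↔ collarForm form q v = 0) ∧
    (mfderiv (𝓘(ℝ, ℝ).prod ((𝓡 1).prod (𝓡 (2 * n + 1)))) (𝓡 (2 * (n + 1) + 1)) collar q v
      ∈ ξ'.pos (collar q) ↔ 0 < collarForm form q v)
  glue₁ : ∀ s ∈ Ioo 0 width, ∀ (θ : Circle) (p : N),
    collar (s, θ, p) = incl₁ (nbhd₁ (√s * (θ : ℂ), p))
  glue₂ : ∀ s ∈ Ioo 0 width, ∀ (θ : Circle) (p : N),
    collar (-s, θ⁻¹, p) = incl₂ (nbhd₂ (√s * (θ : ℂ), p))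
  cover : incl₁ '' (range j₁)ᶜ ∪ incl₂ '' (range j₂)ᶜ ∪
    collar '' (Ioo (-width) width ×ˢ univ) = univ
  disjoint : Disjoint (incl₁ '' (range j₁)ᶜ) (incl₂ '' (range j₂)ᶜ)
  /-- the middle of the collar is new -/
  disjoint_zero : Disjoint (collar '' ({0} ×ˢ univ))
    (incl₁ '' (range j₁)ᶜ ∪ incl₂ '' (range j₂)ᶜ)

end ContactFiberSum

end

open ContactFiberSum

/-! The second assertion is a computation on one slice. On the collar the contact form is `αN + s
dφ`, with differential `dαN + ds ∧ dφ`. On the slice `s = 0` both extra terms die: the first because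
`s = 0`, the second because `ds` restricts to zero. So the slice sees only `αN`, pulled back from
`N`. For a bLob `S` in `N` with relative open book `(B, ϑ)`, the distribution induced on `S¹ × S` is
the preimage of the one on `S`. It is integrable for the same reason, its singular set is `S¹` times
`∂S ∪ B`, its leaves project into leaves, and `ϑ` composed with the projection is a relative open
book with binding `S¹ × B`. How the fiber sum continues outside the collar plays no role. This is
`isFoliated_collarMid`, `mem_singularSet_collarMid_iff`, `regularLeaf_collarMid` and
`IsRelativeOpenBook.circleProd`, collected in `IsBLob.collar`.

The first assertion needs the standard neighbourhood of a compact contact submanifold of codimension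
two with trivial normal bundle, `exists_modelNeighborhood`. A trivialization of the normal bundle
gives a map from `ℂ × N` to `M` that is an immersion along the zero section (`exists_tubeMap`). It
is sheared until the normal plane lies in the contact hyperplane and is orthogonal to `TN ∩ ξ` for
the differential of the contact form, and stretched until that differential has the correct value on
the plane (`IsTubeMap.exists_standard`). The pulled back form then agrees with a positive multiple
of `αN + r² dφ` along the zero section, to first order as far as the contact condition can tell.
Moser's method removes the remaining difference. It is run in one chart of `N` at a time, by moving
the weight between the two forms along a partition of unity (`IsStandardTube.exists_moser_step`).

Moser's method requires flows that depend smoothly on the initial point. These come from Picard's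
integral equation on a space of continuous curves: the superposition operator is smooth, the
weighted Picard operator is a contraction, and the inverse function theorem makes its fixed point
smooth in the initial value (`exists_smooth_flow`).

Finally, the substitution `s = r²` turns `r² dφ` into `s dφ`, and `(s, φ) ↦ (-s, -φ)` preserves `s
dφ`. So the two ends and the collar fit together: `exists_gluedManifold` builds the manifold,
including the Hausdorff property, and `exists_glued_contactStructure` the contact structure, by
averaging local contact forms that define the same cooriented hyperplanes. -/

noncomputable section

namespace ContactFiberSum

/-! ### Smoothness of superposition operators -/

section Superposition

variable {K : Type*} [TopologicalSpace K] [CompactSpace K]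

/-- Pointwise application of a continuous family of operators to a continuous function. -/
def applyCurve (K : Type*) [TopologicalSpace K] [CompactSpace K] (E F : Type*)
    [NormedAddCommGroup E] [NormedSpace ℝ E] [NormedAddCommGroup F] [NormedSpace ℝ F] :
    C(K, E →L[ℝ] F) →L[ℝ] C(K, E) →L[ℝ] C(K, F) :=
  LinearMap.mkContinuous₂
    (LinearMap.mk₂ ℝ (fun (A : C(K, E →L[ℝ] F)) (h : C(K, E)) => (⟨fun s => A s (h s), by fun_prop⟩ : C(K, F)))
      (fun A A' h => by ext s; simp) (fun c A h => by ext s; simp)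
      (fun A h h' => by ext s; simp) (fun c A h => by ext s; simp)) 1
    (fun A h => by
      rw [ContinuousMap.norm_le _ (by positivity)]
      intro s
      simp only [LinearMap.mk₂_apply, ContinuousMap.coe_mk, one_mul]
      exact ((A s).le_opNorm _).trans
        (mul_le_mul (A.norm_coe_le_norm s) (h.norm_coe_le_norm s) (norm_nonneg _)
          (norm_nonneg (a := A))))

variable {E F : Type u} [NormedAddCommGroup E] [NormedSpace ℝ E] [NormedAddCommGroup F]
  [NormedSpace ℝ F]

/-- Compactness of `K` makes the continuity of `f'` uniform along the image of `γ`: one radius `δ`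
serves all points `γ s`. The mean value inequality on the balls of radius `δ` then bounds the
remainder in the sup norm. -/
lemma hasFDerivAt_postcomp (f : C(E, F)) (f' : C(E, E →L[ℝ] F)) (hf : ∀ x, HasFDerivAt f (f' x) x)
    (γ : C(K, E)) :
    HasFDerivAt (fun γ : C(K, E) => f.comp γ) (applyCurve K E F (f'.comp γ)) γ := by
  rw [hasFDerivAt_iff_isLittleO_nhds_zero, Asymptotics.isLittleO_iff]
  intro ε hε
  have hcont : Continuous fun η : C(K, E) => f'.comp η := f'.continuous_postcomp
  obtain ⟨δ, hδ, hball⟩ := (Metric.continuous_iff (α := C(K, E)) (β := C(K, E →L[ℝ] F))).1 hcont γ ε hε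
  filter_upwards [Metric.ball_mem_nhds (0 : C(K, E)) hδ] with h hh
  rw [ContinuousMap.norm_le _ (by positivity)]
  intro s
  have key : ∀ y ∈ Metric.ball (γ s) δ, ‖f' y - f' (γ s)‖ ≤ ε := by
    intro y hy
    -- Translating `γ` by the constant `y - γ s` gives a map that takes the value `y` at `s` and is
    -- still `δ`-close to `γ`. Continuity of `η ↦ f' ∘ η` thus yields a pointwise bound on the ball.
    have h1 : dist (γ + ContinuousMap.const K (y - γ s)) γ < δ := by
      rw [dist_eq_norm, add_sub_cancel_left]
      rw [mem_ball_iff_norm] at hy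
      refine lt_of_le_of_lt ((ContinuousMap.norm_le _ (norm_nonneg _)).2 fun t => ?_) hy
      simp
    have h2 := (ContinuousMap.dist_lt_iff hε).1 (hball _ h1) s
    simp only [ContinuousMap.comp_apply, ContinuousMap.add_apply, ContinuousMap.const_apply,
      add_sub_cancel] at h2
    rw [← dist_eq_norm]
    exact h2.le
  have hh' : ‖h‖ < δ := by simpa using hh
  have h3 := (convex_ball (γ s) δ).norm_image_sub_le_of_norm_hasFDerivWithin_le'
    (f := f) (f' := fun x => f' x) (φ := f' (γ s)) (C := ε) (x := γ s) (y := γ s + h s)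
    (fun x _ => (hf x).hasFDerivWithinAt) key (Metric.mem_ball_self hδ)
    (by rw [mem_ball_iff_norm, add_sub_cancel_left]
        exact (h.norm_coe_le_norm s).trans_lt hh')
  rw [add_sub_cancel_left] at h3
  exact h3.trans (mul_le_mul_of_nonneg_left (h.norm_coe_le_norm s) hε.le)

/-- The derivative is the superposition operator of `f'` followed by the bounded operator
`applyCurve`, so smoothness follows by induction. The target space is generalized because `f'` takes
its values in a space of operators. -/
lemma contDiff_postcomp_nat (m : ℕ) {F : Type u} [NormedAddCommGroup F] [NormedSpace ℝ F]
    (f : C(E, F)) (hf : ContDiff ℝ m f) :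
    ContDiff ℝ m (fun γ : C(K, E) => f.comp γ) := by
  induction m generalizing F with
  | zero => exact contDiff_zero.2 f.continuous_postcomp
  | succ m ih =>
    have hf' : ContDiff ℝ m (fderiv ℝ f) := hf.fderiv_right (by norm_cast)
    let f' : C(E, E →L[ℝ] F) := ⟨fderiv ℝ f, hf'.continuous⟩
    have hd := hasFDerivAt_postcomp (K := K) f f' fun x =>
      (hf.differentiable (by norm_cast) x).hasFDerivAt
    rw [Nat.cast_add, Nat.cast_one, contDiff_succ_iff_fderiv]
    refine ⟨fun γ => (hd γ).differentiableAt, by simp, ?_⟩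
    rw [funext fun γ => (hd γ).fderiv]
    exact (applyCurve K E F).contDiff.comp (ih f' hf')

lemma contDiff_postcomp (f : C(E, F)) (hf : ContDiff ℝ ∞ f) :
    ContDiff ℝ ∞ (fun γ : C(K, E) => f.comp γ) :=
  contDiff_infty.2 fun m => contDiff_postcomp_nat m f (contDiff_infty.1 hf m)

end Superposition

/-! ### Smooth perturbations of the identity by contractions -/

/-- The fixed point of `y ↦ x + F y` is the solution of `y - F y = x`. The derivative of `y - F y`
is invertible by the Neumann series, since the Lipschitz bound gives `‖F'‖ ≤ c < 1`. The local
inverse is smooth, and by uniqueness of fixed points it is `g`. -/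
lemma exists_contDiff_fixedPoint {X : Type*} [NormedAddCommGroup X] [NormedSpace ℝ X]
    [CompleteSpace X] {F : X → X} (hF : ContDiff ℝ ∞ F) {c : NNReal} (hc : c < 1)
    (hl : LipschitzWith c F) :
    ∃ g : X → X, ContDiff ℝ ∞ g ∧ (∀ x, g x = x + F (g x)) ∧ ∀ x y, y = x + F y → y = g x := by
  have hcon : ∀ x, ContractingWith c fun y => x + F y := fun x =>
    ⟨hc, by simpa using (LipschitzWith.const x).add hl⟩
  let g : X → X := fun x => ContractingWith.fixedPoint _ (hcon x)
  have hg : ∀ x, g x = x + F (g x) := fun x => ((hcon x).fixedPoint_isFixedPt).symm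
  have hu : ∀ x y, y = x + F y → y = g x := fun x y h =>
    (hcon x).fixedPoint_unique (x := y) h.symm
  refine ⟨g, contDiff_iff_contDiffAt.2 fun x₀ => ?_, hg, hu⟩
  set y₀ := g x₀
  have hn : ‖fderiv ℝ F y₀‖ < 1 :=
    (norm_fderiv_le_of_lipschitz ℝ hl).trans_lt (by exact_mod_cast hc)
  let e : X ≃L[ℝ] X := ContinuousLinearEquiv.unitsEquiv ℝ X (Units.oneSub _ hn)
  have hG : ContDiff ℝ ∞ fun y => y - F y := contDiff_id.sub hF
  have hd : HasFDerivAt (fun y => y - F y) (e : X →L[ℝ] X) y₀ := by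
    have : (e : X →L[ℝ] X) = ContinuousLinearMap.id ℝ X - fderiv ℝ F y₀ := by
      rfl
    rw [this]
    exact (hasFDerivAt_id _).sub (hF.differentiable (by simp) _).hasFDerivAt
  have hx₀ : y₀ - F y₀ = x₀ := sub_eq_iff_eq_add.2 (hg x₀)
  have hs := hG.contDiffAt (x := y₀) |>.hasStrictFDerivAt' hd (by simp)
  have hloc := (hG.contDiffAt (x := y₀)).to_localInverse hd (by simp)
  have hev := hs.eventually_right_inverse
  simp only [hx₀] at hloc hev
  refine hloc.congr_of_eventuallyEq ?_
  filter_upwards [hev] with x hx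
  refine (hu x _ ?_).symm
  exact sub_eq_iff_eq_add.1 hx

/-! ### Smooth flows of time-dependent vector fields on the unit time interval -/

section Flow

open unitInterval

set_option linter.unusedSectionVars false

variable {E : Type u} [NormedAddCommGroup E] [NormedSpace ℝ E]

/-- The curve `γ : [0, 1] → E` extended to a map on `ℝ`. -/
def extendCurve (γ : C(I, E)) (s : ℝ) : E := γ (projIcc 0 1 zero_le_one s)

lemma continuous_extendCurve (γ : C(I, E)) : Continuous (extendCurve γ) :=
  γ.continuous.comp continuous_projIcc

@[simp] lemma extendCurve_coe (γ : C(I, E)) (t : I) : extendCurve γ t = γ t := by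
  simp [extendCurve]

lemma norm_extendCurve_le (γ : C(I, E)) (s : ℝ) : ‖extendCurve γ s‖ ≤ ‖γ‖ := γ.norm_coe_le_norm _

/-- The primitive vanishing at `0`, as an operator on continuous curves. -/
def primitive (E : Type u) [NormedAddCommGroup E] [NormedSpace ℝ E] : C(I, E) →L[ℝ] C(I, E) :=
  LinearMap.mkContinuous
    { toFun := fun γ => ⟨fun t => ∫ s in (0 : ℝ)..t, extendCurve γ s,
        (intervalIntegral.continuous_primitive
          (fun a b => (continuous_extendCurve γ).intervalIntegrable a b) 0).comp
          continuous_subtype_val⟩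
      map_add' := fun γ η => by
        ext t
        exact intervalIntegral.integral_add ((continuous_extendCurve γ).intervalIntegrable _ _)
          ((continuous_extendCurve η).intervalIntegrable _ _)
      map_smul' := fun c γ => by
        ext t
        exact intervalIntegral.integral_smul c _ } 1
    (fun γ => by
      rw [ContinuousMap.norm_le _ (by positivity)]
      intro t
      have h := intervalIntegral.norm_integral_le_of_norm_le_const (a := 0) (b := (t : ℝ))
        (f := extendCurve γ) (C := ‖γ‖) fun s _ => norm_extendCurve_le γ s
      refine h.trans ?_
      rw [sub_zero, abs_of_nonneg t.2.1, one_mul]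
      exact mul_le_of_le_one_right (norm_nonneg _) t.2.2)

lemma primitive_apply (γ : C(I, E)) (t : I) :
    primitive E γ t = ∫ s in (0 : ℝ)..t, extendCurve γ s := rfl

@[simp] lemma primitive_zero (γ : C(I, E)) : primitive E γ 0 = 0 := by
  simp [primitive_apply]

lemma hasDerivWithinAt_primitive [CompleteSpace E] (γ : C(I, E)) (t : I) :
    HasDerivWithinAt (extendCurve (primitive E γ)) (γ t) (Icc 0 1) t := by
  have h : HasDerivAt (fun u : ℝ => ∫ s in (0 : ℝ)..u, extendCurve γ s) (extendCurve γ t) t :=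
    intervalIntegral.integral_hasDerivAt_right
      ((continuous_extendCurve γ).intervalIntegrable _ _)
      ((continuous_extendCurve γ).stronglyMeasurableAtFilter _ _)
      (continuous_extendCurve γ).continuousAt
  rw [extendCurve_coe] at h
  refine h.hasDerivWithinAt.congr (fun s hs => ?_) ?_
  · rw [extendCurve, primitive_apply, projIcc_of_mem _ hs]
  · rw [extendCurve_coe, primitive_apply]

/-- Multiplication by `exp (c t)`. -/
def expWeight (E : Type u) [NormedAddCommGroup E] [NormedSpace ℝ E] (c : ℝ) :
    C(I, E) →L[ℝ] C(I, E) :=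
  applyCurve I E E
    ⟨fun t => Real.exp (c * t) • ContinuousLinearMap.id ℝ E, by fun_prop⟩

@[simp] lemma expWeight_apply (c : ℝ) (γ : C(I, E)) (t : I) :
    expWeight E c γ t = Real.exp (c * t) • γ t := rfl

lemma expWeight_neg_cancel (c : ℝ) (γ : C(I, E)) : expWeight E c (expWeight E (-c) γ) = γ := by
  ext t
  simp [smul_smul, ← Real.exp_add]

/-- The curve `t ↦ V (t, γ t)`. -/
def alongCurve {F : Type u} [NormedAddCommGroup F] [NormedSpace ℝ F] (V : C(ℝ × E, F))
    (γ : C(I, E)) : C(I, F) :=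
  ⟨fun t => V (t, γ t), by fun_prop⟩

lemma prodMk_curve_eq : (fun γ : C(I, E) =>
      (⟨fun t => ((t : ℝ), γ t), by fun_prop⟩ : C(I, ℝ × E))) =
    fun γ => (⟨fun t => ((t : ℝ), 0), by fun_prop⟩ : C(I, ℝ × E)) +
        (ContinuousLinearMap.inr ℝ ℝ E).compLeftContinuous ℝ I γ := by
  ext γ t <;> simp

lemma contDiff_prodMk_curve :
    ContDiff ℝ ∞ fun γ : C(I, E) =>
      (⟨fun t => ((t : ℝ), γ t), by fun_prop⟩ : C(I, ℝ × E)) := by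
  rw [prodMk_curve_eq]
  exact contDiff_const.add (ContinuousLinearMap.contDiff _)

lemma hasFDerivAt_prodMk_curve (γ : C(I, E)) :
    HasFDerivAt (fun γ : C(I, E) => (⟨fun t => ((t : ℝ), γ t), by fun_prop⟩ : C(I, ℝ × E)))
      ((ContinuousLinearMap.inr ℝ ℝ E).compLeftContinuous ℝ I) γ := by
  rw [prodMk_curve_eq]
  exact (ContinuousLinearMap.hasFDerivAt _).const_add _

/-- Differentiating `V` in the space variable. -/
def spaceDeriv {F : Type u} [NormedAddCommGroup F] [NormedSpace ℝ F] (V : ℝ × E → F) (q : ℝ × E) :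
    E →L[ℝ] F := (fderiv ℝ V q).comp (ContinuousLinearMap.inr ℝ ℝ E)

/-- Conjugating Picard's operator by the weight `exp (L t)` makes it a contraction on the whole unit
interval, however large the Lipschitz constant is, so no concatenation of short flows is needed. The
linearized equation for the derivative comes from differentiating the integral equation in `x`. -/
lemma exists_smooth_flow [CompleteSpace E] {V : ℝ × E → E} (hV : ContDiff ℝ ∞ V) {K : NNReal}
    (hK : ∀ t, LipschitzWith K fun x => V (t, x)) :
    ∃ Γ : E → C(I, E), ContDiff ℝ ∞ Γ ∧ (∀ x, Γ x 0 = x) ∧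
      (∀ x (t : I), HasDerivWithinAt (extendCurve (Γ x)) (V (t, Γ x t)) (Icc 0 1) t) ∧
      (∀ x v, fderiv ℝ Γ x v 0 = v) ∧
      (∀ x v (t : I), HasDerivWithinAt (extendCurve (fderiv ℝ Γ x v))
        (spaceDeriv V (t, Γ x t) (fderiv ℝ Γ x v t)) (Icc 0 1) t) ∧
      ∀ x, (∀ t, V (t, x) = 0) → Γ x = ContinuousMap.const I x := by
  let Vc : C(ℝ × E, E) := ⟨V, hV.continuous⟩
  have hN : ContDiff ℝ ∞ (alongCurve Vc) :=
    (contDiff_postcomp (K := I) Vc hV).comp contDiff_prodMk_curve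
  -- Chosen so that `K / L ≤ 1 / 2`; the summand `1` keeps `L` positive when `K = 0`.
  let L : ℝ := 2 * (K + 1)
  have hL : 0 < L := by positivity
  let F : C(I, E) → C(I, E) := fun η =>
    expWeight E (-L) (primitive E (alongCurve Vc (expWeight E L η)))
  have hF : ContDiff ℝ ∞ F :=
    (expWeight E (-L)).contDiff.comp ((primitive E).contDiff.comp
      (hN.comp (expWeight E L).contDiff))
  have hlip : LipschitzWith (1 / 2) F := by
    refine LipschitzWith.of_dist_le_mul fun η η' => ?_
    rw [dist_eq_norm, dist_eq_norm, ContinuousMap.norm_le _ (by positivity)]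
    intro t
    have h1 : (F η - F η') t = Real.exp (-L * t) • ∫ s in (0 : ℝ)..t,
        (extendCurve (alongCurve Vc (expWeight E L η)) s -
          extendCurve (alongCurve Vc (expWeight E L η')) s) := by
      rw [intervalIntegral.integral_sub ((continuous_extendCurve _).intervalIntegrable _ _)
        ((continuous_extendCurve _).intervalIntegrable _ _), smul_sub]
      rfl
    have h2 : ‖∫ s in (0 : ℝ)..t, (extendCurve (alongCurve Vc (expWeight E L η)) s -
          extendCurve (alongCurve Vc (expWeight E L η')) s)‖ ≤
        ∫ s in (0 : ℝ)..t, K * ‖η - η'‖ * Real.exp (L * s) := by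
      refine intervalIntegral.norm_integral_le_of_norm_le t.2.1 (Filter.Eventually.of_forall ?_)
        (Continuous.intervalIntegrable (by fun_prop) _ _)
      intro s hs
      have hs' : s ∈ Icc (0 : ℝ) 1 := ⟨hs.1.le, hs.2.trans t.2.2⟩
      have h3 := (hK s).dist_le_mul (Real.exp (L * s) • η ⟨s, hs'⟩) (Real.exp (L * s) • η' ⟨s, hs'⟩)
      rw [dist_eq_norm, dist_eq_norm, ← smul_sub, norm_smul, Real.norm_of_nonneg
        (Real.exp_pos _).le] at h3
      have h4 : ‖η ⟨s, hs'⟩ - η' ⟨s, hs'⟩‖ ≤ ‖η - η'‖ := (η - η').norm_coe_le_norm _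
      simp only [extendCurve, projIcc_of_mem zero_le_one hs']
      calc _ ≤ _ := h3
        _ ≤ K * (Real.exp (L * s) * ‖η - η'‖) := by gcongr
        _ = _ := by ring
    have h5 : ∫ s in (0 : ℝ)..t, K * ‖η - η'‖ * Real.exp (L * s) =
        K * ‖η - η'‖ * ((Real.exp (L * t) - 1) / L) := by
      rw [intervalIntegral.integral_const_mul,
        intervalIntegral.integral_comp_mul_left (fun s => Real.exp s) hL.ne', integral_exp,
        mul_zero, Real.exp_zero, smul_eq_mul, inv_mul_eq_div]
    rw [h1, norm_smul, Real.norm_of_nonneg (Real.exp_pos _).le]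
    refine (mul_le_mul_of_nonneg_left (h2.trans_eq h5) (Real.exp_pos _).le).trans ?_
    have h6 : Real.exp (-L * t) * Real.exp (L * t) = 1 := by
      rw [← Real.exp_add]; simp
    have h7 : (K : ℝ) / L ≤ 1 / 2 := by
      rw [div_le_div_iff₀ hL two_pos]; simp only [L]; linarith [K.2]
    have h8 : Real.exp (-L * t) * ((Real.exp (L * t) - 1)) ≤ 1 := by
      rw [mul_sub, h6]; linarith [Real.exp_pos (-L * t)]
    calc Real.exp (-L * t) * (K * ‖η - η'‖ * ((Real.exp (L * t) - 1) / L))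
        = (K / L) * (Real.exp (-L * t) * (Real.exp (L * t) - 1)) * ‖η - η'‖ := by ring
      _ ≤ (1 / 2) * 1 * ‖η - η'‖ := by
          gcongr
          refine mul_nonneg (Real.exp_pos _).le (sub_nonneg.2 (Real.one_le_exp ?_))
          exact mul_nonneg hL.le t.2.1
      _ = _ := by simp
  obtain ⟨g, hg, hfix, huniq⟩ := exists_contDiff_fixedPoint hF (c := 1 / 2) (by norm_num) hlip
  let c : E →L[ℝ] C(I, E) := ContinuousLinearMap.const ℝ I
  let Γ : E → C(I, E) := fun x => expWeight E L (g (expWeight E (-L) (c x)))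
  have hΓ : ContDiff ℝ ∞ Γ := (expWeight E L).contDiff.comp
    (hg.comp ((expWeight E (-L)).contDiff.comp c.contDiff))
  have hΓeq : ∀ x, Γ x = c x + primitive E (alongCurve Vc (Γ x)) := by
    intro x
    have h := congrArg (expWeight E L) (hfix (expWeight E (-L) (c x)))
    simpa only [map_add, expWeight_neg_cancel, F] using h
  -- Uniqueness for the integral equation. It identifies the flow line of a point where the field
  -- vanishes at all times with a constant curve.
  have hu : ∀ x γ, γ = c x + primitive E (alongCurve Vc γ) → γ = Γ x := by
    intro x γ h
    have h' : expWeight E (-L) γ = g (expWeight E (-L) (c x)) := by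
      refine huniq _ _ ?_
      simp only [F, expWeight_neg_cancel]
      rw [← map_add, ← h]
    simp only [Γ]
    rw [← h', expWeight_neg_cancel]
  let V' : C(ℝ × E, E →L[ℝ] E) := ⟨spaceDeriv V, by
    exact ((hV.continuous_fderiv (by simp)).clm_comp continuous_const)⟩
  have hD : ∀ γ, HasFDerivAt (alongCurve Vc) (applyCurve I E E (alongCurve V' γ)) γ := by
    intro γ
    have h1 := hasFDerivAt_postcomp (K := I) Vc ⟨fderiv ℝ V, hV.continuous_fderiv (by simp)⟩
      (fun q => (hV.differentiable (by simp) q).hasFDerivAt)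
      ⟨fun t => ((t : ℝ), γ t), by fun_prop⟩
    exact h1.comp γ (hasFDerivAt_prodMk_curve γ)
  have hΓd : ∀ x v, fderiv ℝ Γ x v =
      c v + primitive E (applyCurve I E E (alongCurve V' (Γ x)) (fderiv ℝ Γ x v)) := by
    intro x v
    have h1 : HasFDerivAt Γ (fderiv ℝ Γ x) x := (hΓ.differentiable (by simp) x).hasFDerivAt
    have h2 : HasFDerivAt (fun x => c x + primitive E (alongCurve Vc (Γ x)))
        (c + (primitive E).comp ((applyCurve I E E (alongCurve V' (Γ x))).comp (fderiv ℝ Γ x))) x :=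
      c.hasFDerivAt.add ((primitive E).hasFDerivAt.comp x ((hD (Γ x)).comp x h1))
    rw [← funext hΓeq] at h2
    exact congrArg (fun A => A v) (h1.unique h2)
  refine ⟨Γ, hΓ, fun x => ?_, fun x t => ?_, fun x v => ?_, fun x v t => ?_, fun x hx => ?_⟩
  · rw [hΓeq x]
    simp [c]
  · have h := (hasDerivWithinAt_primitive (alongCurve Vc (Γ x)) t).const_add x
    refine h.congr (fun s hs => ?_) ?_
    · conv_lhs => rw [hΓeq x]
      rfl
    · conv_lhs => rw [hΓeq x]
      rfl
  · rw [hΓd x v]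
    simp [c]
  · have h := (hasDerivWithinAt_primitive
      (applyCurve I E E (alongCurve V' (Γ x)) (fderiv ℝ Γ x v)) t).const_add v
    refine h.congr (fun s hs => ?_) ?_
    · conv_lhs => rw [hΓd x v]
      rfl
    · conv_lhs => rw [hΓd x v]
      rfl
  · refine (hu x _ ?_).symm
    ext t
    have : alongCurve Vc (ContinuousMap.const I x) = 0 := by
      ext s
      exact hx s
    rw [this, map_zero, add_zero]
    rfl

end Flow

/-! ### Linear algebra of contact forms -/

section LinearContact

variable {E : Type u} [NormedAddCommGroup E] [NormedSpace ℝ E]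

instance : IsBoundedSMul ℝ (E →L[ℝ] E →L[ℝ] ℝ) :=
  NormedSpace.toIsBoundedSMul (𝕜 := ℝ) (E := E →L[ℝ] E →L[ℝ] ℝ)

/-- The covector `b` is nonzero and the bilinear form `w` is non-degenerate on its kernel. -/
def IsContactPair (b : E →L[ℝ] ℝ) (w : E →L[ℝ] E →L[ℝ] ℝ) : Prop :=
  b ≠ 0 ∧ ∀ u, b u = 0 → (∀ v, b v = 0 → w u v = 0) → u = 0

/-- The map `(v, c) ↦ (w (v, ·) + c b, b v)`. It is invertible if and only if `(b, w)` is a contact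
pair. -/
def contactMap (b : E →L[ℝ] ℝ) (w : E →L[ℝ] E →L[ℝ] ℝ) : (E × ℝ) →L[ℝ] ((E →L[ℝ] ℝ) × ℝ) :=
  (w.coprod (ContinuousLinearMap.toSpanSingleton ℝ b)).prod
    (b.comp (ContinuousLinearMap.fst ℝ E ℝ))

@[simp] lemma contactMap_apply (b : E →L[ℝ] ℝ) (w : E →L[ℝ] E →L[ℝ] ℝ) (q : E × ℝ) :
    contactMap b w q = (w q.1 + q.2 • b, b q.1) := rfl

lemma exists_eq_smul_of_ker_le {b f : E →L[ℝ] ℝ} (h : ∀ v, b v = 0 → f v = 0) :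
    ∃ c : ℝ, f = c • b := by
  by_cases hb : b = 0
  · refine ⟨0, ?_⟩
    ext v
    simp [h v (by simp [hb])]
  · obtain ⟨r, hr⟩ : ∃ r, b r ≠ 0 := by
      by_contra! h'
      exact hb (by ext v; simp [h' v])
    refine ⟨f r / b r, ?_⟩
    ext v
    have := h (v - (b v / b r) • r) (by simp [hr])
    simp only [map_sub, map_smul, smul_eq_mul, sub_eq_zero] at this
    simp only [_root_.smul_apply, smul_eq_mul, this]
    ring

/-- A covector that vanishes on `ker b` is a multiple of `b`, so a degenerate direction of `w` on
`ker b` is a solution of `w u + c b = 0`, `b u = 0`. A condition on a varying hyperplane becomes the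
invertibility of a map between fixed spaces, which is open and lets solutions of linear systems
depend smoothly on parameters. -/
lemma isContactPair_iff_injective {b : E →L[ℝ] ℝ} {w : E →L[ℝ] E →L[ℝ] ℝ} :
    IsContactPair b w ↔ Function.Injective (contactMap b w) := by
  rw [injective_iff_map_eq_zero]
  constructor
  · rintro ⟨hb, hw⟩ ⟨v, c⟩ h
    simp only [contactMap_apply, Prod.mk_eq_zero] at h
    have hv : v = 0 := hw v h.2 fun u hu => by
      have := congrArg (fun f => f u) h.1
      simpa [hu] using this
    subst hv
    simpa [hb] using h
  · intro h
    refine ⟨?_, fun u hu hw => ?_⟩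
    · rintro rfl
      have := h (0, 1) (by simp)
      simp at this
    · obtain ⟨c, hc⟩ := exists_eq_smul_of_ker_le (b := b) (f := w u) hw
      have := h (u, -c) (by
        rw [contactMap_apply, hu, hc]
        exact Prod.ext (by ext v; simp) rfl)
      exact (Prod.mk_eq_zero.1 this).1

lemma IsContactPair.exists_equiv [FiniteDimensional ℝ E] {b : E →L[ℝ] ℝ}
    {w : E →L[ℝ] E →L[ℝ] ℝ} (h : IsContactPair b w) :
    ∃ e : (E × ℝ) ≃L[ℝ] ((E →L[ℝ] ℝ) × ℝ), (e : (E × ℝ) →L[ℝ] _) = contactMap b w := by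
  have hdim : Module.finrank ℝ (E × ℝ) = Module.finrank ℝ ((E →L[ℝ] ℝ) × ℝ) := by
    rw [Module.finrank_prod, Module.finrank_prod,
      ← (LinearMap.toContinuousLinearMap (𝕜 := ℝ) (E := E) (F' := ℝ)).finrank_eq,
      Module.finrank_linearMap, Module.finrank_self, mul_one]
  exact ⟨(LinearEquiv.ofInjectiveOfFinrankEq (contactMap b w).toLinearMap
    (isContactPair_iff_injective.1 h) hdim).toContinuousLinearEquiv, rfl⟩

/-- The exterior derivative of a one-form on a normed space. -/
def dForm (b : E → E →L[ℝ] ℝ) (x : E) : E →L[ℝ] E →L[ℝ] ℝ :=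
  fderiv ℝ b x - (fderiv ℝ b x).flip

@[simp] lemma dForm_apply (b : E → E →L[ℝ] ℝ) (x u v : E) :
    dForm b x u v = fderiv ℝ b x u v - fderiv ℝ b x v u := rfl

lemma contDiffAt_dForm {b : E → E →L[ℝ] ℝ} {x : E} (hb : ContDiffAt ℝ ∞ b x) :
    ContDiffAt ℝ ∞ (dForm b) x := by
  have h : ContDiffAt ℝ ∞ (fderiv ℝ b) x := hb.fderiv_right (m := ∞) (by simp)
  have hfl : ContDiff ℝ ∞ fun A : E →L[ℝ] E →L[ℝ] ℝ => A.flip :=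
    IsBoundedLinearMap.contDiff
      { map_add := fun _ _ => rfl
        map_smul := fun _ _ => rfl
        bound := ⟨1, one_pos, fun A => by rw [ContinuousLinearMap.opNorm_flip, one_mul]⟩ }
  exact h.sub (hfl.contDiffAt.comp x h)

lemma contDiffAt_contactMap {X : Type*} [NormedAddCommGroup X] [NormedSpace ℝ X]
    {b : X → E →L[ℝ] ℝ} {w : X → E →L[ℝ] E →L[ℝ] ℝ} {x : X}
    (hb : ContDiffAt ℝ ∞ b x) (hw : ContDiffAt ℝ ∞ w x) :
    ContDiffAt ℝ ∞ (fun x => contactMap (b x) (w x)) x := by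
  have h : (fun x => contactMap (b x) (w x)) = fun x =>
      (ContinuousLinearMap.inl ℝ (E →L[ℝ] ℝ) ℝ).comp ((w x).comp (ContinuousLinearMap.fst ℝ E ℝ) +
        (ContinuousLinearMap.snd ℝ E ℝ).smulRight (b x)) +
      (ContinuousLinearMap.inr ℝ (E →L[ℝ] ℝ) ℝ).comp ((b x).comp (ContinuousLinearMap.fst ℝ E ℝ)) := by
    funext x
    refine ContinuousLinearMap.ext fun q => Prod.ext ?_ ?_ <;> simp
  rw [h]
  have h1 : ContDiffAt ℝ ∞ (fun x => (ContinuousLinearMap.snd ℝ E ℝ).smulRight (b x)) x :=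
    contDiffAt_const.smulRight hb
  exact (contDiffAt_const.clm_comp ((hw.clm_comp contDiffAt_const).add h1)).add
    (contDiffAt_const.clm_comp (hb.clm_comp contDiffAt_const))

/-- If the form and its differential at one point are such that `(b x, db x)` is a contact pair, then
the solution of a linear system governed by the contact map depends smoothly on `x`. -/
lemma contDiffAt_inverse_contactMap [FiniteDimensional ℝ E] {X : Type*} [NormedAddCommGroup X]
    [NormedSpace ℝ X] {b : X → E →L[ℝ] ℝ} {w : X → E →L[ℝ] E →L[ℝ] ℝ} {x : X}
    {r : X → (E →L[ℝ] ℝ) × ℝ}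
    (hb : ContDiffAt ℝ ∞ b x) (hw : ContDiffAt ℝ ∞ w x) (hr : ContDiffAt ℝ ∞ r x)
    (h : IsContactPair (b x) (w x)) :
    ContDiffAt ℝ ∞ (fun x => (contactMap (b x) (w x)).inverse (r x)) x := by
  obtain ⟨e, he⟩ := h.exists_equiv
  have : CompleteSpace E := FiniteDimensional.complete ℝ E
  have h1 := contDiffAt_map_inverse (n := ∞) e
  rw [he] at h1
  exact (ContDiffAt.comp x h1 (contDiffAt_contactMap hb hw)).clm_apply hr

lemma IsContactPair.contactMap_inverse [FiniteDimensional ℝ E] {b : E →L[ℝ] ℝ}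
    {w : E →L[ℝ] E →L[ℝ] ℝ} (h : IsContactPair b w) (r : (E →L[ℝ] ℝ) × ℝ) :
    contactMap b w ((contactMap b w).inverse r) = r := by
  obtain ⟨e, he⟩ := h.exists_equiv
  rw [← he, ContinuousLinearMap.inverse_equiv]
  exact e.apply_symm_apply r

end LinearContact

/-! ### Scalar linear differential equations -/

/-- The integrating factor `exp (-∫ m)` makes the product constant. This turns the infinitesimal
conformal factor in Moser's argument into a positive one. -/
lemma linear_ode_eq {h m : ℝ → ℝ} (hm : Continuous m)
    (hd : ∀ t ∈ Icc (0 : ℝ) 1, HasDerivWithinAt h (m t * h t) (Icc 0 1) t) :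
    h 1 = Real.exp (∫ s in (0 : ℝ)..1, m s) * h 0 := by
  let M : ℝ → ℝ := fun t => ∫ s in (0 : ℝ)..t, m s
  have hM : ∀ t, HasDerivAt M (m t) t := fun t =>
    intervalIntegral.integral_hasDerivAt_right (hm.intervalIntegrable _ _)
      (hm.stronglyMeasurableAtFilter _ _) hm.continuousAt
  have hg : ∀ t ∈ Icc (0 : ℝ) 1,
      HasDerivWithinAt (fun t => Real.exp (-M t) * h t) 0 (Icc 0 1) t := by
    intro t ht
    have := ((hM t).neg.exp.hasDerivWithinAt (s := Icc 0 1)).mul (hd t ht)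
    refine this.congr_deriv ?_
    simp only [Pi.neg_apply]
    ring
  have hc := constant_of_derivWithin_zero (fun t ht => (hg t ht).differentiableWithinAt)
    (fun t ht => (hg t (Ico_subset_Icc_self ht)).derivWithin
      (uniqueDiffOn_Icc zero_lt_one t (Ico_subset_Icc_self ht))) 1 (right_mem_Icc.2 zero_le_one)
  have h0 : M 0 = 0 := by simp [M]
  simp only [h0, neg_zero, Real.exp_zero, one_mul] at hc
  change h 1 = Real.exp (M 1) * h 0
  rw [← hc, ← mul_assoc, ← Real.exp_add]
  simp

/-! ### Moser's method near a compact set -/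

section Moser

open unitInterval

variable {E : Type u} [NormedAddCommGroup E] [NormedSpace ℝ E] [FiniteDimensional ℝ E]

lemma exists_contDiff_cutoff {K U : Set E} (hK : IsCompact K) (hU : IsOpen U) (hKU : K ⊆ U) :
    ∃ χ : E → ℝ, ContDiff ℝ ∞ χ ∧ HasCompactSupport χ ∧ tsupport χ ⊆ U ∧
      ∀ᶠ x in 𝓝ˢ K, χ x = 1 := by
  obtain ⟨L, hL, hKL, hLU⟩ := exists_compact_between hK hU hKU
  obtain ⟨f, hf1, hf0, -⟩ := exists_contMDiffMap_one_nhds_of_subset_interior 𝓘(ℝ, E) (n := ⊤)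
    hK.isClosed hKL
  have hs : Function.support f ⊆ L := fun x hx => by
    by_contra h
    exact hx (hf0 x h)
  have ht : tsupport f ⊆ L := closure_minimal hs hL.isClosed
  exact ⟨f, f.contMDiff.contDiff, hL.of_isClosed_subset (isClosed_tsupport _) ht, ht.trans hLU, hf1⟩

lemma deriv_smoothTransition_eq_zero {t : ℝ} (ht : t ∉ Icc (0 : ℝ) 1) :
    deriv Real.smoothTransition t = 0 := by
  rw [mem_Icc, not_and_or, not_le, not_le] at ht
  rcases ht with ht | ht
  · have : Real.smoothTransition =ᶠ[𝓝 t] fun _ => 0 := by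
      filter_upwards [Iio_mem_nhds ht] with s hs
      exact Real.smoothTransition.zero_of_nonpos (le_of_lt hs)
    rw [this.deriv_eq, deriv_const]
  · have : Real.smoothTransition =ᶠ[𝓝 t] fun _ => 1 := by
      filter_upwards [Ioi_mem_nhds ht] with s hs
      exact Real.smoothTransition.one_of_one_le (le_of_lt hs)
    rw [this.deriv_eq, deriv_const]

/-- The Moser vector field of the path `b + τ(t) g`, together with the conformal factor. -/
lemma exists_moser_field {b g : E → E →L[ℝ] ℝ} {K : Set E} (hK : IsCompact K)
    (hb : ∀ᶠ x in 𝓝ˢ K, ContDiffAt ℝ ∞ b x) (hg : ∀ᶠ x in 𝓝ˢ K, ContDiffAt ℝ ∞ g x)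
    (hcontact : ∀ x ∈ K, ∀ s ∈ Icc (0 : ℝ) 1,
      IsContactPair (b x + s • g x) (dForm b x + s • dForm g x)) :
    ∃ Z : ℝ × E → E × ℝ, ContDiff ℝ ∞ Z ∧ HasCompactSupport Z ∧
      (∀ t x, g x = 0 → Z (t, x) = 0) ∧
      ∀ᶠ x in 𝓝ˢ K, ∀ t,
        contactMap (b x + Real.smoothTransition t • g x)
          (dForm b x + Real.smoothTransition t • dForm g x) (Z (t, x)) =
          (-(deriv Real.smoothTransition t • g x), 0) := by
  obtain ⟨O, hO, hKO, hbg⟩ := eventually_nhdsSet_iff_exists.1 (hb.and hg)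
  have hEc : CompleteSpace E := FiniteDimensional.complete ℝ E
  let A : ℝ × E → (E × ℝ) →L[ℝ] ((E →L[ℝ] ℝ) × ℝ) := fun q =>
    contactMap (b q.2 + q.1 • g q.2) (dForm b q.2 + q.1 • dForm g q.2)
  have hbs : ∀ q : ℝ × E, q.2 ∈ O → ContDiffAt ℝ ∞ (fun q : ℝ × E => b q.2 + q.1 • g q.2) q :=
    fun q hq => ((hbg _ hq).1.comp q contDiffAt_snd).add
      (contDiffAt_fst.smul ((hbg _ hq).2.comp q contDiffAt_snd))
  have hws : ∀ q : ℝ × E, q.2 ∈ O →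
      ContDiffAt ℝ ∞ (fun q : ℝ × E => dForm b q.2 + q.1 • dForm g q.2) q :=
    fun q hq => ((contDiffAt_dForm (hbg _ hq).1).comp q contDiffAt_snd).add
      (contDiffAt_fst.smul ((contDiffAt_dForm (hbg _ hq).2).comp q contDiffAt_snd))
  have hA : ∀ q : ℝ × E, q.2 ∈ O → ContDiffAt ℝ ∞ A q := fun q hq =>
    contDiffAt_contactMap (hbs q hq) (hws q hq)
  -- The parameters at which the linear system is uniquely solvable form an open set around `[0, 1]
  -- × K`. By the tube lemma it contains `[0, 1] × O₂` for a neighbourhood `O₂` of `K`.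
  let G : Set (ℝ × E) := {q | q.2 ∈ O ∧ A q ∈ range
    (ContinuousLinearEquiv.toContinuousLinearMap : ((E × ℝ) ≃L[ℝ] ((E →L[ℝ] ℝ) × ℝ)) → _)}
  have hG : IsOpen G := by
    rw [isOpen_iff_mem_nhds]
    rintro q ⟨hq, hq'⟩
    exact ((hO.preimage continuous_snd).mem_nhds hq |> Filter.inter_mem) <|
      (hA q hq).continuousAt.preimage_mem_nhds (ContinuousLinearEquiv.isOpen.mem_nhds hq')
  have hKG : Icc (0 : ℝ) 1 ×ˢ K ⊆ G := fun q hq =>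
    ⟨hKO hq.2, (hcontact q.2 hq.2 q.1 hq.1).exists_equiv⟩
  obtain ⟨u, O₂, hu, hO₂, h01u, hKO₂, huO₂⟩ := generalized_tube_lemma isCompact_Icc hK hG hKG
  have hO₂O : O₂ ⊆ O := fun x hx => (huO₂ (a := (0, x)) ⟨h01u (by simp), hx⟩).1
  obtain ⟨χ, hχ, hχc, hχO, hχ1⟩ := exists_contDiff_cutoff hK hO₂ hKO₂
  have hτ01 : ∀ t, Real.smoothTransition t ∈ Icc (0 : ℝ) 1 := fun t =>
    ⟨Real.smoothTransition.nonneg t, Real.smoothTransition.le_one t⟩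
  have hτ : ContDiff ℝ ∞ Real.smoothTransition := Real.smoothTransition.contDiff
  have hτ' : ContDiff ℝ ∞ (deriv Real.smoothTransition) := (contDiff_infty_iff_deriv.1 hτ).2
  let R : ℝ × E → (E →L[ℝ] ℝ) × ℝ := fun q => (-(deriv Real.smoothTransition q.1 • g q.2), 0)
  -- With `β_t = b + τ(t) g`, this is the pair `(V, c)` that solves `V ⌟ dβ_t + c β_t = -τ'(t) g`
  -- and `β_t(V) = 0`, cut off in space. Since `τ'` vanishes outside `[0, 1]`, the support is
  -- compact in time as well, which later gives a global Lipschitz bound.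
  let Z : ℝ × E → E × ℝ := fun q => χ q.2 • (A (Real.smoothTransition q.1, q.2)).inverse (R q)
  have hpair : ∀ t, ∀ x ∈ O₂, ∃ e : (E × ℝ) ≃L[ℝ] ((E →L[ℝ] ℝ) × ℝ),
      (e : (E × ℝ) →L[ℝ] _) = A (Real.smoothTransition t, x) := fun t x hx =>
    (huO₂ (a := (Real.smoothTransition t, x)) ⟨h01u (hτ01 t), hx⟩).2
  have hZ : ContDiff ℝ ∞ Z := by
    rw [contDiff_iff_contDiffAt]
    intro q
    by_cases hq : q.2 ∈ tsupport χ
    · obtain ⟨e, he⟩ := hpair q.1 q.2 (hχO hq)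
      have h1 : ContDiffAt ℝ ∞ (fun q : ℝ × E => A (Real.smoothTransition q.1, q.2)) q :=
        ContDiffAt.comp (g := A) q (hA (Real.smoothTransition q.1, q.2) (hO₂O (hχO hq)))
          ((hτ.contDiffAt.comp q contDiffAt_fst).prodMk contDiffAt_snd)
      have h2 := contDiffAt_map_inverse (n := ∞) e
      rw [he] at h2
      have h3 : ContDiffAt ℝ ∞ R q := ContDiffAt.prodMk
        ((hτ'.contDiffAt.comp q contDiffAt_fst).smul
          ((hbg _ (hO₂O (hχO hq))).2.comp q contDiffAt_snd)).neg contDiffAt_const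
      exact (hχ.contDiffAt.comp q contDiffAt_snd).smul ((ContDiffAt.comp (g := ContinuousLinearMap.inverse) q h2 h1).clm_apply h3)
    · have : Z =ᶠ[𝓝 q] fun _ => 0 := by
        filter_upwards [((isClosed_tsupport χ).isOpen_compl.preimage continuous_snd).mem_nhds hq]
          with r hr
        simp only [Z, image_eq_zero_of_notMem_tsupport hr, zero_smul]
      exact contDiffAt_const.congr_of_eventuallyEq this
  refine ⟨Z, hZ, ?_, fun t x hx => ?_, ?_⟩
  · refine HasCompactSupport.intro (isCompact_Icc (a := (0 : ℝ)) (b := 1) |>.prod hχc) fun q hq => ?_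
    by_cases h1 : q.2 ∈ tsupport χ
    · have h2 : q.1 ∉ Icc (0 : ℝ) 1 := fun h => hq ⟨h, h1⟩
      simp only [Z, R, deriv_smoothTransition_eq_zero h2, zero_smul, neg_zero]
      rw [show ((0 : E →L[ℝ] ℝ), (0 : ℝ)) = 0 from rfl, map_zero, smul_zero]
    · simp only [Z, image_eq_zero_of_notMem_tsupport h1, zero_smul]
  · simp only [Z, R, hx, smul_zero, neg_zero]
    rw [show ((0 : E →L[ℝ] ℝ), (0 : ℝ)) = 0 from rfl, map_zero, smul_zero]
  · filter_upwards [hχ1, hO₂.mem_nhdsSet.2 hKO₂] with x hx1 hx2 t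
    obtain ⟨e, he⟩ := hpair t x hx2
    simp only [Z, hx1, one_smul]
    change A (Real.smoothTransition t, x) _ = R (t, x)
    rw [← he, ContinuousLinearMap.inverse_equiv]
    exact e.apply_symm_apply _

/-- Let `b` and `b + g` be one-forms such that all `b + s g` satisfy the contact condition along `K`
and such that `g` vanishes along `K`. Then some smooth map which fixes the zeros of `g` pulls back
`b + g` to a positive multiple of `b` near `K`. -/
lemma exists_moser_map {b g : E → E →L[ℝ] ℝ} {K : Set E} (hK : IsCompact K)
    (hb : ∀ᶠ x in 𝓝ˢ K, ContDiffAt ℝ ∞ b x) (hg : ∀ᶠ x in 𝓝ˢ K, ContDiffAt ℝ ∞ g x)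
    (hg0 : ∀ x ∈ K, g x = 0)
    (hcontact : ∀ x ∈ K, ∀ s ∈ Icc (0 : ℝ) 1,
      IsContactPair (b x) (dForm b x + s • dForm g x)) :
    ∃ ψ : E → E, ContDiff ℝ ∞ ψ ∧ (∀ x, g x = 0 → ψ x = x) ∧
      ∀ᶠ x in 𝓝ˢ K, ∃ l : ℝ, 0 < l ∧
        ∀ v, (b (ψ x) + g (ψ x)) (fderiv ℝ ψ x v) = l * b x v := by
  obtain ⟨Z, hZ, hZc, hZ0, hZeq⟩ := exists_moser_field hK hb hg fun x hx s hs => by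
    rw [hg0 x hx, smul_zero, add_zero]; exact hcontact x hx s hs
  have hEc : CompleteSpace E := FiniteDimensional.complete ℝ E
  let V : ℝ × E → E := fun q => (Z q).1
  have hV : ContDiff ℝ ∞ V := contDiff_fst.comp hZ
  have hVc : HasCompactSupport V := hZc.comp_left (g := Prod.fst) rfl
  obtain ⟨C, hC⟩ := hV.lipschitzWith_of_hasCompactSupport hVc (by simp)
  have hCt : ∀ t, LipschitzWith C fun x => V (t, x) := fun t => by
    refine LipschitzWith.of_dist_le_mul fun x y => ?_
    have := hC.dist_le_mul (t, x) (t, y)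
    rwa [Prod.dist_eq, dist_self, max_eq_right dist_nonneg] at this
  obtain ⟨Γ, hΓ, hΓ0, hΓt, hΓ'0, hΓ't, hΓc⟩ := exists_smooth_flow hV hCt
  let ev : C(I, E) →L[ℝ] E := ContinuousMap.evalCLM ℝ (1 : I)
  refine ⟨fun x => Γ x 1, ev.contDiff.comp hΓ, fun x hx => ?_, ?_⟩
  · change Γ x 1 = x
    rw [hΓc x fun t => by simp only [V, hZ0 t x hx]; rfl]
    rfl
  obtain ⟨O, hO, hKO, hOp⟩ := eventually_nhdsSet_iff_exists.1 ((hb.and hg).and hZeq)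
  -- Points of `K` are zeros of `g` and therefore stationary. Trajectories that start near them
  -- remain in `O` up to time one, because `Γ` is continuous for the sup norm.
  have hstay : ∀ᶠ x in 𝓝ˢ K, ∀ t, Γ x t ∈ O := by
    rw [eventually_nhdsSet_iff_forall]
    intro x hx
    have h1 : {γ : C(I, E) | MapsTo γ univ O} ∈ 𝓝 (Γ x) := by
      refine (ContinuousMap.isOpen_setOfPred_mapsTo isCompact_univ hO).mem_nhds fun t _ => ?_
      rw [hΓc x fun t => by simp only [V, hZ0 t x (hg0 x hx)]; rfl]
      exact hKO hx
    filter_upwards [hΓ.continuous.continuousAt.preimage_mem_nhds h1] with y hy t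
    exact hy (mem_univ t)
  filter_upwards [hstay] with x hx
  -- The logarithmic derivative of the conformal factor along the trajectory.
  let m : ℝ → ℝ := fun t => -(Z (t, extendCurve (Γ x) t)).2
  have hm : Continuous m := by
    have := continuous_extendCurve (Γ x)
    have := hZ.continuous
    fun_prop
  refine ⟨Real.exp (∫ s in (0 : ℝ)..1, m s), Real.exp_pos _, fun v => ?_⟩
  let τ := Real.smoothTransition
  have hτ : ContDiff ℝ ∞ τ := Real.smoothTransition.contDiff
  let y : ℝ → E := extendCurve (Γ x)
  let w : ℝ → E := extendCurve (fderiv ℝ Γ x v)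
  -- The pull-back of `β_t` under the flow at time `t`, evaluated on `v`; `w t` is the image of `v`
  -- under the derivative of the flow.
  let h : ℝ → ℝ := fun t => (b (y t) + τ t • g (y t)) (w t)
  have hode : ∀ t ∈ Icc (0 : ℝ) 1, HasDerivWithinAt h (m t * h t) (Icc 0 1) t := by
    intro t ht
    have hyO : y t ∈ O := hx _
    obtain ⟨⟨hbt, hgt⟩, hZt⟩ := hOp _ hyO
    have hy : HasDerivWithinAt y (V (t, y t)) (Icc 0 1) t := by
      have := hΓt x ⟨t, ht⟩
      simpa only [← extendCurve_coe] using this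
    have hw : HasDerivWithinAt w (spaceDeriv V (t, y t) (w t)) (Icc 0 1) t := by
      have := hΓ't x v ⟨t, ht⟩
      simpa only [← extendCurve_coe] using this
    have hb' := (hbt.differentiableAt (by simp)).hasFDerivAt
    have hg' := (hgt.differentiableAt (by simp)).hasFDerivAt
    have hτ' : HasDerivWithinAt τ (deriv τ t) (Icc 0 1) t :=
      (hτ.differentiable (by simp) t).hasDerivAt.hasDerivWithinAt
    have h1 := ((hb'.comp_hasDerivWithinAt t hy).add
      (hτ'.smul (hg'.comp_hasDerivWithinAt t hy))).clm_apply hw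
    refine h1.congr_deriv ?_
    -- the field is tangent to the kernels near `y t`
    have hker : (fun z => (b z + τ t • g z) (V (t, z))) =ᶠ[𝓝 (y t)] fun _ => 0 := by
      filter_upwards [hO.mem_nhds hyO] with z hz
      exact congrArg Prod.snd ((hOp z hz).2 t)
    have hVd : HasFDerivAt (fun z => V (t, z)) (spaceDeriv V (t, y t)) (y t) := by
      have h2 : HasFDerivAt (fun z : E => (t, z)) (ContinuousLinearMap.inr ℝ ℝ E) (y t) :=
        hasFDerivAt_prodMk_right t (y t)
      exact ((hV.differentiable (by simp) (t, y t)).hasFDerivAt).comp (y t) h2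
    have hkd := ((hb'.add (hg'.const_smul (τ t))).clm_apply hVd).unique
      ((hasFDerivAt_const (0 : ℝ) (y t)).congr_of_eventuallyEq hker)
    have hkd' := congrArg (fun L => L (w t)) hkd
    have hZ1 := congrArg (fun q => q.1 (w t)) (hZt t)
    simp only [contactMap_apply] at hZ1
    simp only [dForm_apply, _root_.add_apply, _root_.smul_apply, Pi.add_apply,
      Pi.smul_apply, ContinuousLinearMap.comp_apply, ContinuousLinearMap.flip_apply, smul_eq_mul,
      _root_.neg_apply, _root_.zero_apply, smul_add, Pi.smul_apply',
      Function.comp_apply, m, h, show (Z (t, y t)).1 = V (t, y t) from rfl,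
      show Real.smoothTransition = τ from rfl,
      show extendCurve (Γ x) t = y t from rfl] at hkd' hZ1 ⊢
    -- Cartan's formula for the Lie derivative: `hkd'` says that `d(β_t(V))` vanishes on `w t`, and
    -- `hZ1` is the Moser equation evaluated on `w t`.
    linear_combination hkd' + hZ1
  have hfin := linear_ode_eq hm hode
  have hψ : fderiv ℝ (fun x => Γ x 1) x v = fderiv ℝ Γ x v 1 := by
    have h1 := ev.hasFDerivAt.comp x (hΓ.differentiable (by simp) x).hasFDerivAt
    have h2 : fderiv ℝ (fun x => Γ x 1) x = ev.comp (fderiv ℝ Γ x) := h1.fderiv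
    rw [h2]
    rfl
  have e1 : ∀ γ : C(I, E), extendCurve γ 1 = γ 1 := fun γ => extendCurve_coe γ 1
  have e0 : ∀ γ : C(I, E), extendCurve γ 0 = γ 0 := fun γ => extendCurve_coe γ 0
  simp only [h, y, w, e1, e0, hΓ0, hΓ'0, τ, Real.smoothTransition.zero, zero_smul, add_zero,
    Real.smoothTransition.one, one_smul] at hfin
  rw [hψ]
  exact hfin

end Moser

/-! ### Derivatives of maps between manifolds as maps between the model spaces -/

section ModelDeriv

variable {E : Type*} [NormedAddCommGroup E] [NormedSpace ℝ E] {H : Type*} [TopologicalSpace H]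
  {I : ModelWithCorners ℝ E H} {X : Type*} [TopologicalSpace X] [ChartedSpace H X]
  {E' : Type*} [NormedAddCommGroup E'] [NormedSpace ℝ E'] {H' : Type*} [TopologicalSpace H']
  {I' : ModelWithCorners ℝ E' H'} {Y : Type*} [TopologicalSpace Y] [ChartedSpace H' Y]
  {E'' : Type*} [NormedAddCommGroup E''] [NormedSpace ℝ E''] {H'' : Type*} [TopologicalSpace H'']
  {I'' : ModelWithCorners ℝ E'' H''} {Z : Type*} [TopologicalSpace Z] [ChartedSpace H'' Z]

/-- The derivative `mfderiv`, with the tangent spaces identified with the model spaces. -/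
def tderiv (I : ModelWithCorners ℝ E H) (I' : ModelWithCorners ℝ E' H') (f : X → Y) (x : X) :
    E →L[ℝ] E' :=
  mfderiv I I' f x

lemma tderiv_comp {f : X → Y} {g : Y → Z} {x : X} {y : Y} (hg : MDifferentiableAt I' I'' g y)
    (hf : MDifferentiableAt I I' f x) (h : f x = y) :
    tderiv I I'' (g ∘ f) x = (tderiv I' I'' g y).comp (tderiv I I' f x) := by
  subst h
  exact mfderiv_comp x hg hf

lemma tderiv_comp_apply {f : X → Y} {g : Y → Z} {x : X} {y : Y}
    (hg : MDifferentiableAt I' I'' g y) (hf : MDifferentiableAt I I' f x) (h : f x = y) (v : E) :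
    tderiv I I'' (g ∘ f) x v = tderiv I' I'' g y (tderiv I I' f x v) := by
  rw [tderiv_comp hg hf h]; rfl

lemma tderiv_congr {f g : X → Y} {x : X} (h : f =ᶠ[𝓝 x] g) : tderiv I I' f x = tderiv I I' g x :=
  h.mfderiv_eq

lemma tderiv_eq_fderiv {f : E → E'} {x : E} : tderiv 𝓘(ℝ, E) 𝓘(ℝ, E') f x = fderiv ℝ f x :=
  mfderiv_eq_fderiv

lemma tderiv_id {x : X} : tderiv I I (id : X → X) x = ContinuousLinearMap.id ℝ E := mfderiv_id

lemma tderiv_of_eventuallyEq_id {f : X → X} {x : X} (h : ∀ᶠ z in 𝓝 x, f z = z) :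
    tderiv I I f x = ContinuousLinearMap.id ℝ E := by
  rw [tderiv_congr (g := id) h, tderiv_id]

lemma contMDiffAt_extChartAt_symm [I.Boundaryless] [IsManifold I ∞ X] (x : X) {y : E}
    (hy : y ∈ (extChartAt I x).target) :
    ContMDiffAt 𝓘(ℝ, E) I ∞ (extChartAt I x).symm y :=
  (contMDiffOn_extChartAt_symm x).contMDiffAt ((isOpen_extChartAt_target x).mem_nhds hy)

lemma eventually_mdifferentiableAt [IsManifold I ∞ X] [IsManifold I' ∞ Y] {f : X → Y} {x : X}
    (hf : ContMDiffAt I I' ∞ f x) : ∀ᶠ z in 𝓝 x, MDifferentiableAt I I' f z := by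
  have : IsManifold I 1 X := .of_le (n := ∞) (by simp)
  have : IsManifold I' 1 Y := .of_le (n := ∞) (by simp)
  have h1 : ContMDiffAt I I' 1 f x := hf.of_le (by simp)
  filter_upwards [(contMDiffAt_iff_contMDiffAt_nhds (by simp)).1 h1] with z hz
  exact hz.mdifferentiableAt (by simp)

/-- If `g ∘ f` is the identity near `x`, then so is the composition of the derivatives. -/
lemma tderiv_left_inverse {f : X → Y} {g : Y → X} {x : X} {y : Y} (hxy : f x = y)
    (hf : MDifferentiableAt I I' f x) (hg : MDifferentiableAt I' I g y)
    (h : ∀ᶠ z in 𝓝 x, g (f z) = z) (v : E) : tderiv I' I g y (tderiv I I' f x v) = v := by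
  rw [← tderiv_comp_apply hg hf hxy, tderiv_of_eventuallyEq_id (f := g ∘ f) h]
  rfl

section Chart

set_option linter.unusedSectionVars false

variable [I.Boundaryless] [IsManifold I ∞ X]

lemma eventually_extChartAt_symm (x : X) {z : X} (hz : z ∈ (extChartAt I x).source) :
    ∀ᶠ w in 𝓝 z, (extChartAt I x).symm (extChartAt I x w) = w := by
  filter_upwards [(isOpen_extChartAt_source x).mem_nhds hz] with w hw
  exact (extChartAt I x).left_inv hw

lemma eventually_extChartAt_right_inv (x : X) {y : E} (hy : y ∈ (extChartAt I x).target) :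
    ∀ᶠ w in 𝓝 y, extChartAt I x ((extChartAt I x).symm w) = w := by
  filter_upwards [(isOpen_extChartAt_target x).mem_nhds hy] with w hw
  exact (extChartAt I x).right_inv hw

lemma mdifferentiableAt_chart {x z : X} (hz : z ∈ (extChartAt I x).source) :
    MDifferentiableAt I 𝓘(ℝ, E) (extChartAt I x) z :=
  (contMDiffAt_extChartAt' (n := ∞) (by rwa [extChartAt_source] at hz)).mdifferentiableAt (by simp)

lemma mdifferentiableAt_chart_symm {x : X} {y : E} (hy : y ∈ (extChartAt I x).target) :
    MDifferentiableAt 𝓘(ℝ, E) I (extChartAt I x).symm y :=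
  (contMDiffAt_extChartAt_symm x hy).mdifferentiableAt (by simp)

lemma tderiv_chart_symm_chart {x z : X} (hz : z ∈ (extChartAt I x).source) (v : E) :
    tderiv 𝓘(ℝ, E) I (extChartAt I x).symm (extChartAt I x z)
      (tderiv I 𝓘(ℝ, E) (extChartAt I x) z v) = v :=
  tderiv_left_inverse rfl (mdifferentiableAt_chart hz)
    (mdifferentiableAt_chart_symm ((extChartAt I x).map_source hz)) (eventually_extChartAt_symm x hz)
    v

lemma tderiv_chart_chart_symm {x : X} {y : E} (hy : y ∈ (extChartAt I x).target) (v : E) :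
    tderiv I 𝓘(ℝ, E) (extChartAt I x) ((extChartAt I x).symm y)
      (tderiv 𝓘(ℝ, E) I (extChartAt I x).symm y v) = v :=
  tderiv_left_inverse rfl (mdifferentiableAt_chart_symm hy)
    (mdifferentiableAt_chart ((extChartAt I x).map_target hy))
    (eventually_extChartAt_right_inv x hy) v

end Chart

/-- The inverse function theorem. -/
lemma exists_local_inverse [FiniteDimensional ℝ E] [FiniteDimensional ℝ E']
    [I.Boundaryless] [I'.Boundaryless]
    [IsManifold I ∞ X] [IsManifold I' ∞ Y] {f : X → Y} {x : X} (hf : ContMDiffAt I I' ∞ f x)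
    (hd : Function.Injective (tderiv I I' f x))
    (hdim : Module.finrank ℝ E = Module.finrank ℝ E') :
    ∃ g : Y → X, ContMDiffAt I' I ∞ g (f x) ∧ g (f x) = x ∧ (∀ᶠ y in 𝓝 (f x), f (g y) = y) ∧
      ∀ᶠ z in 𝓝 x, g (f z) = z := by
  have hEc : CompleteSpace E := FiniteDimensional.complete ℝ E
  let φ := extChartAt I x
  let φ' := extChartAt I' (f x)
  let F : E → E' := φ' ∘ f ∘ φ.symm
  have hxs : x ∈ φ.source := mem_extChartAt_source x
  have hfs : f x ∈ φ'.source := mem_extChartAt_source (f x)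
  have hφx : φ x ∈ φ.target := mem_extChartAt_target x
  have hφ : ContMDiffAt 𝓘(ℝ, E) I ∞ φ.symm (φ x) := contMDiffAt_extChartAt_symm x hφx
  have hxx : φ.symm (φ x) = x := extChartAt_to_inv x
  have hφ' : ContMDiffAt I' 𝓘(ℝ, E') ∞ φ' (f x) := contMDiffAt_extChartAt
  have hφ's : ContMDiffAt 𝓘(ℝ, E') I' ∞ φ'.symm (φ' (f x)) :=
    contMDiffAt_extChartAt_symm _ (mem_extChartAt_target (f x))
  have hfφ : ContMDiffAt 𝓘(ℝ, E) I' ∞ (f ∘ φ.symm) (φ x) :=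
    ContMDiffAt.comp (φ x) (by rw [hxx]; exact hf) hφ
  have hF : ContDiffAt ℝ ∞ F (φ x) := by
    rw [← contMDiffAt_iff_contDiffAt]
    exact ContMDiffAt.comp (φ x) (by rw [Function.comp_apply, hxx]; exact hφ') hfφ
  have hFx : F (φ x) = φ' (f x) := by simp only [F, Function.comp_apply, hxx]
  have hFd : Function.Injective (fderiv ℝ F (φ x)) := by
    intro u v huv
    rw [← tderiv_eq_fderiv, tderiv_comp (hφ'.mdifferentiableAt (by simp))
      (hfφ.mdifferentiableAt (by simp)) (by rw [Function.comp_apply, hxx]),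
      tderiv_comp (hf.mdifferentiableAt (by simp)) (hφ.mdifferentiableAt (by simp)) hxx] at huv
    have h1 := congrArg (tderiv 𝓘(ℝ, E') I' φ'.symm (φ' (f x))) huv
    simp only [ContinuousLinearMap.comp_apply] at h1
    rw [tderiv_chart_symm_chart hfs, tderiv_chart_symm_chart hfs] at h1
    have h2 := congrArg (tderiv I 𝓘(ℝ, E) φ x) (hd h1)
    have h3 : ∀ w, tderiv I 𝓘(ℝ, E) φ x (tderiv 𝓘(ℝ, E) I φ.symm (φ x) w) = w := fun w => by
      have := tderiv_chart_chart_symm (I := I) hφx w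
      rwa [hxx] at this
    rwa [h3, h3] at h2
  let e : E ≃L[ℝ] E' := (LinearEquiv.ofInjectiveOfFinrankEq (fderiv ℝ F (φ x)).toLinearMap hFd
    hdim).toContinuousLinearEquiv
  have he : HasFDerivAt F (e : E →L[ℝ] E') (φ x) := (hF.differentiableAt (by simp)).hasFDerivAt
  let G : E' → E := hF.localInverse he (by simp)
  have hstrict := hF.hasStrictFDerivAt' he (by simp)
  have hG : ContDiffAt ℝ ∞ G (φ' (f x)) := hFx ▸ hF.to_localInverse he (by simp)
  have hGx : G (φ' (f x)) = φ x := by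
    rw [← hFx]; exact hF.localInverse_apply_image he (by simp)
  have hr : ∀ᶠ y in 𝓝 (φ' (f x)), F (G y) = y := hFx ▸ hstrict.eventually_right_inverse
  have hl : ∀ᶠ y in 𝓝 (φ x), G (F y) = y := hstrict.eventually_left_inverse
  have hGc : ContMDiffAt I' 𝓘(ℝ, E) ∞ (G ∘ φ') (f x) :=
    ContMDiffAt.comp (f x) (contMDiffAt_iff_contDiffAt.2 hG) hφ'
  have hgc : ContMDiffAt I' I ∞ (φ.symm ∘ G ∘ φ') (f x) :=
    ContMDiffAt.comp (f x) (by rw [Function.comp_apply, hGx]; exact hφ) hGc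
  have hgx : (φ.symm ∘ G ∘ φ') (f x) = x := by simp only [Function.comp_apply, hGx, hxx]
  refine ⟨φ.symm ∘ G ∘ φ', hgc, hgx, ?_, ?_⟩
  · have h1 : ∀ᶠ y in 𝓝 (f x), f ((φ.symm ∘ G ∘ φ') y) ∈ φ'.source := by
      have : ContinuousAt (fun y => f ((φ.symm ∘ G ∘ φ') y)) (f x) :=
        ContinuousAt.comp (g := f) (by rw [hgx]; exact hf.continuousAt) hgc.continuousAt
      exact this.preimage_mem_nhds ((isOpen_extChartAt_source (f x)).mem_nhds (by rw [hgx]; exact hfs))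
    filter_upwards [h1, hφ'.continuousAt.eventually hr,
      (isOpen_extChartAt_source (f x)).mem_nhds hfs] with y hy1 hy2 hy3
    exact φ'.injOn hy1 hy3 hy2
  · have hfx : ∀ᶠ z in 𝓝 x, f z ∈ φ'.source :=
      hf.continuousAt.preimage_mem_nhds ((isOpen_extChartAt_source (f x)).mem_nhds hfs)
    filter_upwards [(continuousAt_extChartAt (I := I) x).eventually hl,
      (isOpen_extChartAt_source (I := I) x).mem_nhds hxs] with z hz1 hz2
    have hz3 : φ.symm (φ z) = z := φ.left_inv hz2
    change φ.symm (G (φ' (f z))) = z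
    have hz4 : G (φ' (f (φ.symm (φ z)))) = φ z := hz1
    rw [hz3] at hz4
    rw [hz4, hz3]

/-- An injective smooth map between open subsets of manifolds of the same dimension is a
diffeomorphism onto an open set if its derivatives are injective. -/
lemma isOpenDiffeoOn_of_injective [FiniteDimensional ℝ E] [FiniteDimensional ℝ E']
    [I.Boundaryless] [I'.Boundaryless]
    [IsManifold I ∞ X] [IsManifold I' ∞ Y] {f : X → Y} {s : Set X} [Nonempty X] (hs : IsOpen s)
    (hf : ∀ x ∈ s, ContMDiffAt I I' ∞ f x) (hd : ∀ x ∈ s, Function.Injective (tderiv I I' f x))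
    (hinj : InjOn f s) (hdim : Module.finrank ℝ E = Module.finrank ℝ E') :
    IsOpenDiffeoOn I I' f s := by
  have key : ∀ x ∈ s, ∃ g : Y → X, ContMDiffAt I' I ∞ g (f x) ∧
      ∀ᶠ y in 𝓝 (f x), g y ∈ s ∧ f (g y) = y := by
    intro x hx
    obtain ⟨g, hg, hgx, hr, -⟩ := exists_local_inverse (hf x hx) (hd x hx) hdim
    refine ⟨g, hg, ?_⟩
    filter_upwards [hr, hg.continuousAt.preimage_mem_nhds (hs.mem_nhds (by rw [hgx]; exact hx))] with y h1 h2
    exact ⟨h2, h1⟩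
  refine ⟨hs, ?_, fun x hx => (hf x hx).contMDiffWithinAt, mapsTo_image f s,
    Function.invFunOn f s, ?_, ?_, ?_, ?_⟩
  · rw [isOpen_iff_mem_nhds]
    rintro _ ⟨x, hx, rfl⟩
    obtain ⟨g, -, hg⟩ := key x hx
    filter_upwards [hg] with y hy
    exact ⟨g y, hy⟩
  · rintro _ ⟨x, hx, rfl⟩
    obtain ⟨g, hg, hgs⟩ := key x hx
    -- Injectivity on `s` forces the global inverse to agree near `f x` with the smooth local
    -- inverse.
    refine (hg.congr_of_eventuallyEq ?_).contMDiffWithinAt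
    filter_upwards [hgs] with y hy
    have hy' : y ∈ f '' s := ⟨g y, hy⟩
    exact hinj (Function.invFunOn_mem hy') hy.1 ((Function.invFunOn_eq hy').trans hy.2.symm)
  · exact fun y hy => Function.invFunOn_mem hy
  · exact hinj.leftInvOn_invFunOn
  · exact fun y hy => Function.invFunOn_eq hy

end ModelDeriv

/-! ### Pull-backs of one-forms -/

section PullbackVector

variable {F G : Type u} [NormedAddCommGroup F] [NormedSpace ℝ F] [NormedAddCommGroup G]
  [NormedSpace ℝ G]

/-- The pull-back of a one-form on a normed space. -/
def pullVec (f : F → G) (b : G → G →L[ℝ] ℝ) (y : F) : F →L[ℝ] ℝ := (b (f y)).comp (fderiv ℝ f y)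

lemma contDiffAt_pullVec {f : F → G} {b : G → G →L[ℝ] ℝ} {y : F} (hf : ContDiffAt ℝ ∞ f y)
    (hb : ContDiffAt ℝ ∞ b (f y)) : ContDiffAt ℝ ∞ (pullVec f b) y :=
  (hb.comp y hf).clm_comp (hf.fderiv_right (m := ∞) (by simp))

/-- The terms that contain the second derivative of `f` cancel by its symmetry. -/
lemma dForm_pullVec {f : F → G} {b : G → G →L[ℝ] ℝ} {y : F} (hf : ContDiffAt ℝ ∞ f y)
    (hb : DifferentiableAt ℝ b (f y)) (u v : F) :
    dForm (pullVec f b) y u v = dForm b (f y) (fderiv ℝ f y u) (fderiv ℝ f y v) := by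
  have h1 : HasFDerivAt (fun y => b (f y)) ((fderiv ℝ b (f y)).comp (fderiv ℝ f y)) y :=
    hb.hasFDerivAt.comp y (hf.differentiableAt (by simp)).hasFDerivAt
  have h2 : HasFDerivAt (fderiv ℝ f) (fderiv ℝ (fderiv ℝ f) y) y :=
    ((hf.fderiv_right (m := ∞) (by simp)).differentiableAt (by simp)).hasFDerivAt
  have h3 : fderiv ℝ (pullVec f b) y = _ := (h1.clm_comp h2).fderiv
  have h4 : fderiv ℝ (fderiv ℝ f) y u v = fderiv ℝ (fderiv ℝ f) y v u :=
    (hf.isSymmSndFDerivAt (by simp; exact WithTop.coe_le_coe.2 le_top)).eq u v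
  simp [dForm_apply, h3, h4]

lemma dForm_congr {b b' : F → F →L[ℝ] ℝ} {y : F} (h : b =ᶠ[𝓝 y] b') : dForm b y = dForm b' y := by
  rw [dForm, dForm, h.fderiv_eq]

lemma dForm_smul {b : F → F →L[ℝ] ℝ} {f : F → ℝ} {y : F} (hf : DifferentiableAt ℝ f y)
    (hb : DifferentiableAt ℝ b y) (u v : F) :
    dForm (fun y => f y • b y) y u v =
      f y * dForm b y u v + fderiv ℝ f y u * b y v - fderiv ℝ f y v * b y u := by
  have h : fderiv ℝ (fun y => f y • b y) y = _ := (hf.hasFDerivAt.smul hb.hasFDerivAt).fderiv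
  rw [dForm_apply, h]
  simp
  ring

lemma dForm_add {b b' : F → F →L[ℝ] ℝ} {y : F} (hb : DifferentiableAt ℝ b y)
    (hb' : DifferentiableAt ℝ b' y) :
    dForm (fun y => b y + b' y) y = dForm b y + dForm b' y := by
  have h : fderiv ℝ (fun y => b y + b' y) y = _ := (hb.hasFDerivAt.add hb'.hasFDerivAt).fderiv
  ext u v
  rw [dForm_apply, h]
  simp
  ring

/-- The contact condition only depends on the conformal class of a form. -/
lemma isContactPair_smul {b : F → F →L[ℝ] ℝ} {f : F → ℝ} {y : F} (hf : DifferentiableAt ℝ f y)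
    (hb : DifferentiableAt ℝ b y) (hfy : f y ≠ 0) (h : IsContactPair (b y) (dForm b y)) :
    IsContactPair (f y • b y) (dForm (fun y => f y • b y) y) := by
  refine ⟨smul_ne_zero hfy h.1, fun u hu hw => h.2 u ?_ fun v hv => ?_⟩
  · simpa [hfy] using hu
  · have hu' : b y u = 0 := by simpa [hfy] using hu
    have := hw v (by simp [hv])
    rw [dForm_smul hf hb] at this
    simpa [hv, hu', hfy] using this

end PullbackVector

/-! ### Pull-backs of one-forms on manifolds under parametrizations -/

section Pullback

set_option linter.unusedSectionVars false

variable {d : ℕ} {M : Type u} [TopologicalSpace M] [ChartedSpace (EuclideanSpace ℝ (Fin d)) M]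
  {F G : Type} [NormedAddCommGroup F] [NormedSpace ℝ F] [NormedAddCommGroup G]
  [NormedSpace ℝ G]

/-- The covector `α x` as a functional on the model space. -/
def OneForm.cov (α : OneForm d M) (x : M) : EuclideanSpace ℝ (Fin d) →L[ℝ] ℝ := α x

/-- The exterior derivative at `x` as a bilinear form on the model space. -/
def OneForm.dcov (α : OneForm d M) (x : M) :
    EuclideanSpace ℝ (Fin d) →L[ℝ] EuclideanSpace ℝ (Fin d) →L[ℝ] ℝ :=
  (dForm (α.inChart x) (extChartAt (𝓡 d) x x)).bilinearComp
    (tderiv (𝓡 d) 𝓘(ℝ, _) (extChartAt (𝓡 d) x) x) (tderiv (𝓡 d) 𝓘(ℝ, _) (extChartAt (𝓡 d) x) x)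

/-- The pull-back of the one-form `α` under the parametrization `c`. -/
def OneForm.pull (α : OneForm d M) (c : F → M) (y : F) : F →L[ℝ] ℝ :=
  (α.cov (c y)).comp (tderiv 𝓘(ℝ, F) (𝓡 d) c y)

variable [IsManifold (𝓡 d) ∞ M]

lemma OneForm.pull_comp (α : OneForm d M) {c : G → M} {f : F → G} {y : F}
    (hc : MDifferentiableAt 𝓘(ℝ, G) (𝓡 d) c (f y)) (hf : DifferentiableAt ℝ f y) :
    α.pull (c ∘ f) y = pullVec f (α.pull c) y := by
  ext v
  simp only [OneForm.pull, pullVec, ContinuousLinearMap.comp_apply]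
  rw [tderiv_comp hc hf.mdifferentiableAt rfl, tderiv_eq_fderiv]
  rfl

lemma OneForm.pull_congr (α : OneForm d M) {c c' : F → M} {y : F} (h : c =ᶠ[𝓝 y] c') :
    α.pull c =ᶠ[𝓝 y] α.pull c' := by
  filter_upwards [h.eventuallyEq_nhds] with z hz
  rw [OneForm.pull, OneForm.pull, tderiv_congr hz, hz.eq_of_nhds]

lemma OneForm.pull_comp_eventuallyEq (α : OneForm d M) {c : G → M} {f : F → G} {y : F}
    (hc : ContMDiffAt 𝓘(ℝ, G) (𝓡 d) ∞ c (f y)) (hf : ContDiffAt ℝ ∞ f y) :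
    α.pull (c ∘ f) =ᶠ[𝓝 y] pullVec f (α.pull c) := by
  filter_upwards [hf.continuousAt.eventually (eventually_mdifferentiableAt hc),
    eventually_mdifferentiableAt (contMDiffAt_iff_contDiffAt.2 hf)] with z hz1 hz2
  exact α.pull_comp hz1 hz2.differentiableAt

/-- The local representation of a form under a parametrization in terms of the chart. -/
lemma OneForm.pull_eventuallyEq_inChart (α : OneForm d M) {c : F → M} {y : F} {x : M}
    (hx : c y ∈ (extChartAt (𝓡 d) x).source)
    (hc : ContMDiffAt 𝓘(ℝ, F) (𝓡 d) ∞ c y) :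
    ContDiffAt ℝ ∞ (extChartAt (𝓡 d) x ∘ c) y ∧
      α.pull c =ᶠ[𝓝 y] pullVec (extChartAt (𝓡 d) x ∘ c) (α.inChart x) := by
  have hf : ContDiffAt ℝ ∞ (extChartAt (𝓡 d) x ∘ c) y := by
    rw [← contMDiffAt_iff_contDiffAt]
    exact ContMDiffAt.comp y (contMDiffAt_extChartAt' (by rwa [extChartAt_source] at hx)) hc
  refine ⟨hf, ?_⟩
  have h1 : c =ᶠ[𝓝 y] (extChartAt (𝓡 d) x).symm ∘ (extChartAt (𝓡 d) x ∘ c) := by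
    filter_upwards [hc.continuousAt.eventually (eventually_extChartAt_symm x hx)] with z hz
    exact hz.symm
  exact (α.pull_congr h1).trans (α.pull_comp_eventuallyEq (contMDiffAt_extChartAt_symm x
    ((extChartAt (𝓡 d) x).map_source hx)) hf)

/-- `α` is smooth near `x` in the chart at `x`. -/
def OneForm.SmoothAt (α : OneForm d M) (x : M) : Prop :=
  ContDiffAt ℝ ∞ (α.inChart x) (extChartAt (𝓡 d) x x)

lemma OneForm.SmoothAt.contDiffAt_pull {α : OneForm d M} {c : F → M} {y : F}
    (h : α.SmoothAt (c y)) (hc : ContMDiffAt 𝓘(ℝ, F) (𝓡 d) ∞ c y) :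
    ContDiffAt ℝ ∞ (α.pull c) y := by
  obtain ⟨hf, he⟩ := α.pull_eventuallyEq_inChart (mem_extChartAt_source (c y)) hc
  exact (contDiffAt_pullVec hf h).congr_of_eventuallyEq he

/-- Naturality of the exterior derivative. The definition uses the preferred chart at each point; by
this lemma any smooth parametrization may be used instead, and `c` need not even be an immersion. -/
lemma OneForm.SmoothAt.dForm_pull {α : OneForm d M} {c : F → M} {y : F}
    (h : α.SmoothAt (c y)) (hc : ContMDiffAt 𝓘(ℝ, F) (𝓡 d) ∞ c y) (u v : F) :
    dForm (α.pull c) y u v = α.dcov (c y) (tderiv 𝓘(ℝ, F) (𝓡 d) c y u)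
      (tderiv 𝓘(ℝ, F) (𝓡 d) c y v) := by
  obtain ⟨hf, he⟩ := α.pull_eventuallyEq_inChart (mem_extChartAt_source (c y)) hc
  rw [dForm_congr he, dForm_pullVec hf (h.differentiableAt (by simp)),
    ← tderiv_eq_fderiv, tderiv_comp (mdifferentiableAt_chart (mem_extChartAt_source (c y)))
      (hc.mdifferentiableAt (by simp)) rfl]
  rfl

/-- The inverse of any chart is a parametrization, so `contDiffAt_pull` carries smoothness from the
preferred chart at a point to every other chart around it. -/
lemma OneForm.isSmooth_iff {α : OneForm d M} : α.IsSmooth ↔ ∀ x, α.SmoothAt x := by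
  refine ⟨fun h x => (h x).contDiffAt (extChartAt_target_mem_nhds x), fun h x y hy => ?_⟩
  exact (SmoothAt.contDiffAt_pull (h _) (contMDiffAt_extChartAt_symm x hy)).contDiffWithinAt

/-- Smoothness of a form can be checked in a parametrization. -/
lemma OneForm.smoothAt_of_pull [FiniteDimensional ℝ F] {α : OneForm d M} {c : F → M} {y : F}
    (hc : ContMDiffAt 𝓘(ℝ, F) (𝓡 d) ∞ c y)
    (hd : Function.Injective (tderiv 𝓘(ℝ, F) (𝓡 d) c y)) (hdim : Module.finrank ℝ F = d)
    (h : ContDiffAt ℝ ∞ (α.pull c) y) : α.SmoothAt (c y) := by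
  obtain ⟨g, hg, hgx, hr, -⟩ := exists_local_inverse hc hd (by simp [hdim])
  let φ := extChartAt (𝓡 d) (c y)
  have hφ : ContMDiffAt 𝓘(ℝ, _) (𝓡 d) ∞ φ.symm (φ (c y)) :=
    contMDiffAt_extChartAt_symm _ (mem_extChartAt_target (c y))
  have hxx : φ.symm (φ (c y)) = c y := extChartAt_to_inv (c y)
  have hgφ : ContDiffAt ℝ ∞ (g ∘ φ.symm) (φ (c y)) := by
    rw [← contMDiffAt_iff_contDiffAt]
    exact ContMDiffAt.comp _ (by rw [hxx]; exact hg) hφ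
  have hgy : (g ∘ φ.symm) (φ (c y)) = y := by rw [Function.comp_apply, hxx, hgx]
  have h1 : (φ.symm : _ → M) =ᶠ[𝓝 (φ (c y))] c ∘ (g ∘ φ.symm) := by
    filter_upwards [hφ.continuousAt.eventually (by rw [hxx]; exact hr)] with z hz
    exact hz.symm
  have h2 : α.inChart (c y) =ᶠ[𝓝 (φ (c y))] pullVec (g ∘ φ.symm) (α.pull c) :=
    (α.pull_congr h1).trans (α.pull_comp_eventuallyEq (by rw [hgy]; exact hc) hgφ)
  exact (contDiffAt_pullVec hgφ (by rw [hgy]; exact h)).congr_of_eventuallyEq h2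

/-- The contact condition at `x`. -/
def OneForm.ContactAt (α : OneForm d M) (x : M) : Prop := IsContactPair (α.cov x) (α.dcov x)

lemma OneForm.isContactForm_iff {α : OneForm d M} :
    α.IsContactForm ↔ ∀ x, α.SmoothAt x ∧ α.ContactAt x :=
  ⟨fun h x => ⟨isSmooth_iff.1 h.smooth x, h.ne_zero x, h.nondegenerate x⟩,
    fun h => ⟨isSmooth_iff.2 fun x => (h x).1, fun x => (h x).2.1, fun x => (h x).2.2⟩⟩

/-- The contact condition can be checked in a parametrization. -/
lemma OneForm.SmoothAt.isContactPair_pull_iff [FiniteDimensional ℝ F] {α : OneForm d M} {c : F → M}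
    {y : F} (h : α.SmoothAt (c y)) (hc : ContMDiffAt 𝓘(ℝ, F) (𝓡 d) ∞ c y)
    (hd : Function.Injective (tderiv 𝓘(ℝ, F) (𝓡 d) c y)) (hdim : Module.finrank ℝ F = d) :
    IsContactPair (α.pull c y) (dForm (α.pull c) y) ↔ α.ContactAt (c y) := by
  have hsurj : Function.Surjective (tderiv 𝓘(ℝ, F) (𝓡 d) c y) :=
    (LinearMap.injective_iff_surjective_of_finrank_eq_finrank (f :=
      (tderiv 𝓘(ℝ, F) (𝓡 d) c y).toLinearMap) (by simp [hdim])).1 hd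
  constructor
  · rintro ⟨h1, h2⟩
    refine ⟨fun h0 => h1 ?_, fun u hu hw => ?_⟩
    · ext v
      exact congrArg (fun L => L (tderiv 𝓘(ℝ, F) (𝓡 d) c y v)) h0
    · obtain ⟨u, rfl⟩ := hsurj u
      rw [h2 u hu fun v hv => ?_, map_zero]
      rw [h.dForm_pull hc]
      exact hw _ hv
  · rintro ⟨h1, h2⟩
    refine ⟨fun h0 => h1 ?_, fun u hu hw => hd ?_⟩
    · ext v
      obtain ⟨v, rfl⟩ := hsurj v
      exact congrArg (fun L => L v) h0
    · rw [map_zero]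
      refine h2 _ hu fun v hv => ?_
      obtain ⟨v, rfl⟩ := hsurj v
      rw [← h.dForm_pull hc]
      exact hw v hv

end Pullback

/-! ### Prescribing normal derivatives along the zero section -/

section NormalDerivative

set_option linter.unusedSectionVars false

variable {d e : ℕ} {N M : Type u}
  [TopologicalSpace N] [ChartedSpace (EuclideanSpace ℝ (Fin d)) N] [IsManifold (𝓡 d) ∞ N]
  [TopologicalSpace M] [ChartedSpace (EuclideanSpace ℝ (Fin e)) M] [IsManifold (𝓡 e) ∞ M]

/-- `Φ : ℂ × N → M` is smooth near `{0} × N` and restricts to `j` there. -/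
structure IsTubeMap (d e : ℕ) {N M : Type u}
    [TopologicalSpace N] [ChartedSpace (EuclideanSpace ℝ (Fin d)) N]
    [TopologicalSpace M] [ChartedSpace (EuclideanSpace ℝ (Fin e)) M]
    (j : N → M) (Φ : ℂ × N → M) : Prop where
  zero : ∀ p, Φ (0, p) = j p
  smooth : ∀ p, ∀ᶠ q in 𝓝 ((0 : ℂ), p), ContMDiffAt (𝓘(ℝ, ℂ).prod (𝓡 d)) (𝓡 e) ∞ Φ q

lemma IsTubeMap.contMDiffAt {j : N → M} {Φ : ℂ × N → M} (h : IsTubeMap d e j Φ) (p : N) :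
    ContMDiffAt (𝓘(ℝ, ℂ).prod (𝓡 d)) (𝓡 e) ∞ Φ (0, p) := (h.smooth p).self_of_nhds

lemma IsTubeMap.contMDiff {j : N → M} {Φ : ℂ × N → M} (h : IsTubeMap d e j Φ) :
    ContMDiff (𝓡 d) (𝓡 e) ∞ j := by
  intro p
  have h1 : ContMDiffAt (𝓡 d) (𝓘(ℝ, ℂ).prod (𝓡 d)) ∞ (fun p : N => ((0 : ℂ), p)) p :=
    contMDiffAt_const.prodMk contMDiffAt_id
  exact (ContMDiffAt.comp p (h.contMDiffAt p) h1).congr_of_eventuallyEq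
    (Filter.Eventually.of_forall fun q => (h.zero q).symm)

lemma tderiv_add {E H X F : Type*} [NormedAddCommGroup E] [NormedSpace ℝ E] [TopologicalSpace H]
    {I : ModelWithCorners ℝ E H} [TopologicalSpace X] [ChartedSpace H X]
    [NormedAddCommGroup F] [NormedSpace ℝ F] {f g : X → F} {x : X}
    (hf : MDifferentiableAt I 𝓘(ℝ, F) f x) (hg : MDifferentiableAt I 𝓘(ℝ, F) g x) :
    tderiv I 𝓘(ℝ, F) (f + g) x = tderiv I 𝓘(ℝ, F) f x + tderiv I 𝓘(ℝ, F) g x :=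
  mfderiv_add hf hg

lemma tderiv_fst {p : N} {z : ℂ} (v : ℂ × EuclideanSpace ℝ (Fin d)) :
    tderiv (𝓘(ℝ, ℂ).prod (𝓡 d)) 𝓘(ℝ, ℂ) (Prod.fst : ℂ × N → ℂ) (z, p) v = v.1 := by
  rw [tderiv, mfderiv_fst]; rfl

lemma tderiv_snd {p : N} {z : ℂ} (v : ℂ × EuclideanSpace ℝ (Fin d)) :
    tderiv (𝓘(ℝ, ℂ).prod (𝓡 d)) (𝓡 d) (Prod.snd : ℂ × N → N) (z, p) v = v.2 := by
  rw [tderiv, mfderiv_snd]; rfl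

/-- Derivative along the zero section of a map that is linear in the fibres. -/
lemma tderiv_clm_apply_fst {F : Type} [NormedAddCommGroup F] [NormedSpace ℝ F]
    {A : ℂ × N → ℂ →L[ℝ] F} {p : N}
    (hA : MDifferentiableAt (𝓘(ℝ, ℂ).prod (𝓡 d)) 𝓘(ℝ, ℂ →L[ℝ] F) A (0, p))
    (v : ℂ × EuclideanSpace ℝ (Fin d)) :
    tderiv (𝓘(ℝ, ℂ).prod (𝓡 d)) 𝓘(ℝ, F) (fun q => A q q.1) (0, p) v = A (0, p) v.1 := by
  have hB : HasFDerivAt (fun r : (ℂ →L[ℝ] F) × ℂ => r.1 r.2) _ (A (0, p), (0 : ℂ)) :=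
    (hasFDerivAt_fst (𝕜 := ℝ)).clm_apply hasFDerivAt_snd
  have hfst : MDifferentiableAt (𝓘(ℝ, ℂ).prod (𝓡 d)) 𝓘(ℝ, ℂ) (Prod.fst : ℂ × N → ℂ) (0, p) :=
    mdifferentiableAt_fst
  have hg : MDifferentiableAt (𝓘(ℝ, ℂ).prod (𝓡 d)) 𝓘(ℝ, (ℂ →L[ℝ] F) × ℂ)
      (fun q : ℂ × N => (A q, q.1)) (0, p) := hA.prodMk_space hfst
  have h1 := tderiv_comp_apply (f := fun q : ℂ × N => (A q, q.1))
    (g := fun r : (ℂ →L[ℝ] F) × ℂ => r.1 r.2) hB.differentiableAt.mdifferentiableAt hg rfl v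
  rw [tderiv_eq_fderiv, hB.fderiv] at h1
  have h2 : (tderiv (𝓘(ℝ, ℂ).prod (𝓡 d)) 𝓘(ℝ, (ℂ →L[ℝ] F) × ℂ)
      (fun q : ℂ × N => (A q, q.1)) (0, p) v).2 = v.1 := by
    have h3 := tderiv_comp_apply (g := (Prod.snd : (ℂ →L[ℝ] F) × ℂ → ℂ))
      (differentiableAt_snd.mdifferentiableAt) hg rfl v
    rw [tderiv_eq_fderiv, fderiv_snd] at h3
    rw [← tderiv_fst (d := d) (p := p) (z := 0) v]
    exact h3.symm
  refine h1.trans ?_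
  simp [h2]

/-- In the chart of `M` at `x₀`, the term `ρ(p) D(p) z` is added to `Φ (z, p)`. It vanishes for `z =
0` and is linear in `z`, so the zero section is kept and its normal derivative changes by exactly
this term. Only germs along the zero section matter, which is why it is enough that `Φ` stays in the
chart domain nearby. -/
lemma IsTubeMap.exists_add_chart {j : N → M} {Φ : ℂ × N → M} (h : IsTubeMap d e j Φ) (x₀ : M)
    {ρ : N → ℝ} (hρ : ContMDiff (𝓡 d) 𝓘(ℝ) ∞ ρ)
    (hsupp : tsupport ρ ⊆ j ⁻¹' (extChartAt (𝓡 e) x₀).source)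
    {D : N → ℂ →L[ℝ] EuclideanSpace ℝ (Fin e)}
    (hD : ∀ p ∈ j ⁻¹' (extChartAt (𝓡 e) x₀).source, ContMDiffAt (𝓡 d) 𝓘(ℝ, ℂ →L[ℝ] EuclideanSpace ℝ (Fin e)) ∞ D p) :
    ∃ Φ', IsTubeMap d e j Φ' ∧ ∀ p v,
      tderiv (𝓘(ℝ, ℂ).prod (𝓡 d)) (𝓡 e) Φ' (0, p) v =
        tderiv (𝓘(ℝ, ℂ).prod (𝓡 d)) (𝓡 e) Φ (0, p) v +
          ρ p • tderiv 𝓘(ℝ, _) (𝓡 e) (extChartAt (𝓡 e) x₀).symm (extChartAt (𝓡 e) x₀ (j p))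
            (D p v.1) := by
  classical
  let φ := extChartAt (𝓡 e) x₀
  let A : ℂ × N → ℂ →L[ℝ] EuclideanSpace ℝ (Fin e) := fun q => ρ q.2 • D q.2
  let G : ℂ × N → EuclideanSpace ℝ (Fin e) := φ ∘ Φ + fun q => A q q.1
  -- The two branches agree wherever `ρ` vanishes and `Φ` lies in the chart domain, since `G` is
  -- then the coordinate expression of `Φ`.
  let Φ' : ℂ × N → M := fun q => if q.2 ∈ tsupport ρ then φ.symm (G q) else Φ q
  have hoff : ∀ p, p ∉ tsupport ρ → Φ' =ᶠ[𝓝 ((0 : ℂ), p)] Φ := by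
    intro p hp
    filter_upwards [((isClosed_tsupport ρ).isOpen_compl.preimage continuous_snd).mem_nhds hp]
      with q hq
    exact if_neg hq
  have hon : ∀ p, j p ∈ φ.source → Φ' =ᶠ[𝓝 ((0 : ℂ), p)] φ.symm ∘ G := by
    intro p hp
    have h1 : ∀ᶠ q in 𝓝 ((0 : ℂ), p), Φ q ∈ φ.source :=
      (h.contMDiffAt p).continuousAt.preimage_mem_nhds
        ((isOpen_extChartAt_source x₀).mem_nhds (by rw [h.zero]; exact hp))
    filter_upwards [h1] with q hq
    by_cases hq2 : q.2 ∈ tsupport ρ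
    · exact if_pos hq2
    · have : G q = φ (Φ q) := by
        simp [G, A, image_eq_zero_of_notMem_tsupport hq2]
      rw [Function.comp_apply, this, φ.left_inv hq]
      exact if_neg hq2
  have hAs : ∀ q : ℂ × N, j q.2 ∈ φ.source →
      ContMDiffAt (𝓘(ℝ, ℂ).prod (𝓡 d)) 𝓘(ℝ, ℂ →L[ℝ] EuclideanSpace ℝ (Fin e)) ∞ A q := fun q hq =>
    (ContMDiffAt.comp q hρ.contMDiffAt contMDiffAt_snd).smul
      (ContMDiffAt.comp q (hD q.2 hq) contMDiffAt_snd)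
  have hBs : ∀ q : ℂ × N, j q.2 ∈ φ.source →
      ContMDiffAt (𝓘(ℝ, ℂ).prod (𝓡 d)) 𝓘(ℝ, EuclideanSpace ℝ (Fin e)) ∞ (fun q => A q q.1) q :=
    fun q hq => (hAs q hq).clm_apply contMDiffAt_fst
  have hφΦ : ∀ q : ℂ × N, Φ q ∈ φ.source →
      ContMDiffAt (𝓘(ℝ, ℂ).prod (𝓡 d)) (𝓡 e) ∞ Φ q →
      ContMDiffAt (𝓘(ℝ, ℂ).prod (𝓡 d)) 𝓘(ℝ, EuclideanSpace ℝ (Fin e)) ∞ (φ ∘ Φ) q :=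
    fun q hq hs => ContMDiffAt.comp q
      (contMDiffAt_extChartAt' (by rwa [← extChartAt_source (𝓡 e)])) hs
  have hG0 : ∀ p, G (0, p) = φ (j p) := fun p => by simp [G, h.zero]
  have hGs : ∀ q : ℂ × N, Φ q ∈ φ.source → j q.2 ∈ φ.source →
      ContMDiffAt (𝓘(ℝ, ℂ).prod (𝓡 d)) (𝓡 e) ∞ Φ q →
      ContMDiffAt (𝓘(ℝ, ℂ).prod (𝓡 d)) 𝓘(ℝ, EuclideanSpace ℝ (Fin e)) ∞ G q :=
    fun q hq hq' hs => (hφΦ q hq hs).add (hBs q hq')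
  have hsmooth_on : ∀ p, j p ∈ φ.source → ∀ᶠ q in 𝓝 ((0 : ℂ), p),
      ContMDiffAt (𝓘(ℝ, ℂ).prod (𝓡 d)) 𝓘(ℝ, EuclideanSpace ℝ (Fin e)) ∞ G q ∧
        G q ∈ φ.target := by
    intro p hp
    have h1 : ∀ᶠ q in 𝓝 ((0 : ℂ), p), Φ q ∈ φ.source :=
      (h.contMDiffAt p).continuousAt.preimage_mem_nhds
        ((isOpen_extChartAt_source x₀).mem_nhds (by rw [h.zero]; exact hp))
    have h2 : ∀ᶠ q in 𝓝 ((0 : ℂ), p), j q.2 ∈ φ.source :=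
      (h.contMDiff.continuous.comp continuous_snd).continuousAt.preimage_mem_nhds
        ((isOpen_extChartAt_source x₀).mem_nhds hp)
    have h3 : ∀ᶠ q in 𝓝 ((0 : ℂ), p), G q ∈ φ.target := by
      have hc := (hGs (0, p) (by rw [h.zero]; exact hp) hp (h.contMDiffAt p)).continuousAt
      exact hc.preimage_mem_nhds ((isOpen_extChartAt_target x₀).mem_nhds
        (by rw [hG0]; exact φ.map_source hp))
    filter_upwards [h1, h2, h3, h.smooth p] with q hq1 hq2 hq3 hq4
    exact ⟨hGs q hq1 hq2 hq4, hq3⟩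
  refine ⟨Φ', ⟨fun p => ?_, fun p => ?_⟩, fun p v => ?_⟩
  · by_cases hp : p ∈ tsupport ρ
    · rw [(hon p (hsupp hp)).self_of_nhds, Function.comp_apply, hG0]
      exact φ.left_inv (hsupp hp)
    · rw [(hoff p hp).self_of_nhds, h.zero]
  · by_cases hp : p ∈ tsupport ρ
    · filter_upwards [hsmooth_on p (hsupp hp), (hon p (hsupp hp)).eventuallyEq_nhds] with q hq1 hq2
      exact (ContMDiffAt.comp q (contMDiffAt_extChartAt_symm x₀ hq1.2) hq1.1).congr_of_eventuallyEq
        hq2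
    · filter_upwards [h.smooth p, (hoff p hp).eventuallyEq_nhds] with q hq1 hq2
      exact hq1.congr_of_eventuallyEq hq2
  · by_cases hp : p ∈ tsupport ρ
    · have hps := hsupp hp
      have hG := (hsmooth_on p hps).self_of_nhds
      rw [tderiv_congr (hon p hps), tderiv_comp_apply (mdifferentiableAt_chart_symm
        (φ.map_source hps)) (hG.1.mdifferentiableAt (by simp)) (hG0 p),
        tderiv_add ((hφΦ _ (by rw [h.zero]; exact hps)
          (h.contMDiffAt p)).mdifferentiableAt (by simp))
          ((hBs (0, p) hps).mdifferentiableAt (by simp)), _root_.add_apply, map_add,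
        tderiv_clm_apply_fst ((hAs (0, p) hps).mdifferentiableAt (by simp)),
        tderiv_comp_apply (mdifferentiableAt_chart hps)
          ((h.contMDiffAt p).mdifferentiableAt (by simp)) (h.zero p), tderiv_chart_symm_chart hps]
      simp only [A, _root_.smul_apply, map_smul]
      rfl
    · rw [tderiv_congr (hoff p hp), image_eq_zero_of_notMem_tsupport hp, zero_smul, add_zero]

/-- A finite number of changes of the normal derivative, each in one chart. -/
lemma IsTubeMap.exists_add {ι : Type*} (s : Finset ι) {j : N → M} {Φ : ℂ × N → M}
    (h : IsTubeMap d e j Φ) (x : ι → M) {ρ : ι → N → ℝ} (hρ : ∀ i, ContMDiff (𝓡 d) 𝓘(ℝ) ∞ (ρ i))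
    (hsupp : ∀ i, tsupport (ρ i) ⊆ j ⁻¹' (extChartAt (𝓡 e) (x i)).source)
    {D : ι → N → ℂ →L[ℝ] EuclideanSpace ℝ (Fin e)}
    (hD : ∀ i, ∀ p ∈ j ⁻¹' (extChartAt (𝓡 e) (x i)).source,
      ContMDiffAt (𝓡 d) 𝓘(ℝ, ℂ →L[ℝ] EuclideanSpace ℝ (Fin e)) ∞ (D i) p) :
    ∃ Φ', IsTubeMap d e j Φ' ∧ ∀ p v,
      tderiv (𝓘(ℝ, ℂ).prod (𝓡 d)) (𝓡 e) Φ' (0, p) v =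
        tderiv (𝓘(ℝ, ℂ).prod (𝓡 d)) (𝓡 e) Φ (0, p) v +
          ∑ i ∈ s, ρ i p • tderiv 𝓘(ℝ, _) (𝓡 e) (extChartAt (𝓡 e) (x i)).symm
            (extChartAt (𝓡 e) (x i) (j p)) (D i p v.1) := by
  classical
  induction s using Finset.induction_on with
  | empty => exact ⟨Φ, h, fun p v => by simp⟩
  | insert i s hi ih =>
    obtain ⟨Φ₁, h₁, hd₁⟩ := ih
    obtain ⟨Φ₂, h₂, hd₂⟩ := h₁.exists_add_chart (x i) (hρ i) (hsupp i) (hD i)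
    refine ⟨Φ₂, h₂, fun p v => ?_⟩
    rw [hd₂, hd₁, Finset.sum_insert hi]
    abel

end NormalDerivative

/-! ### Construction of a tube map from a trivial normal bundle -/

section Tube

set_option linter.unusedSectionVars false

variable {d e : ℕ} {N M : Type u}
  [TopologicalSpace N] [ChartedSpace (EuclideanSpace ℝ (Fin d)) N] [IsManifold (𝓡 d) ∞ N]
  [TopologicalSpace M] [ChartedSpace (EuclideanSpace ℝ (Fin e)) M] [IsManifold (𝓡 e) ∞ M]

/-- A finite smooth partition of unity on a compact manifold subordinate to an open cover. -/
lemma exists_finite_partition [CompactSpace N] [T2Space N] (U : N → Set N)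
    (hU : ∀ p, IsOpen (U p)) (hp : ∀ p, p ∈ U p) :
    ∃ (s : Finset N) (ρ : N → N → ℝ), (∀ i, ContMDiff (𝓡 d) 𝓘(ℝ) ∞ (ρ i)) ∧
      (∀ i, tsupport (ρ i) ⊆ U i) ∧ (∀ i p, 0 ≤ ρ i p) ∧ ∀ p, ∑ i ∈ s, ρ i p = 1 := by
  obtain ⟨f, hf⟩ := SmoothPartitionOfUnity.exists_isSubordinate (𝓡 d) isClosed_univ U hU
    (fun p _ => mem_iUnion.2 ⟨p, hp p⟩)
  have hfin : {i | (Function.support (f i)).Nonempty}.Finite :=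
    f.locallyFinite.finite_nonempty_of_compact
  refine ⟨hfin.toFinset, fun i => f i, fun i => (f i).contMDiff, hf, fun i p => f.nonneg i p,
    fun p => ?_⟩
  rw [← f.sum_eq_one (mem_univ p)]
  refine (finsum_eq_sum_of_support_subset _ fun i hi => ?_).symm
  simp only [Finite.coe_toFinset, Set.mem_ofPred_eq]
  exact ⟨p, hi⟩

lemma contMDiffAt_of_chart {F : Type*} [NormedAddCommGroup F] [NormedSpace ℝ F] {f : N → F}
    {i p : N} (hp : p ∈ (extChartAt (𝓡 d) i).source)
    (hf : ContDiffAt ℝ ∞ (f ∘ (extChartAt (𝓡 d) i).symm) (extChartAt (𝓡 d) i p)) :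
    ContMDiffAt (𝓡 d) 𝓘(ℝ, F) ∞ f p := by
  have h : ContMDiffAt (𝓡 d) 𝓘(ℝ, F) ∞ ((f ∘ (extChartAt (𝓡 d) i).symm) ∘ extChartAt (𝓡 d) i) p :=
    ContMDiffAt.comp p (contMDiffAt_iff_contDiffAt.2 hf)
      (contMDiffAt_extChartAt' (by rwa [← extChartAt_source (𝓡 d)]))
  refine h.congr_of_eventuallyEq ?_
  filter_upwards [eventually_extChartAt_symm i hp] with q hq
  simp only [Function.comp_apply, hq]

/-- The coordinate expressions of a smooth vector field along a map are smooth. -/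
lemma contMDiffAt_coord_field {j : N → M} {X : ∀ p, TangentSpace (𝓡 e) (j p)}
    (hX : ContMDiff (𝓡 d) (𝓡 e).tangent ∞ (fun p => (⟨j p, X p⟩ : TangentBundle (𝓡 e) M)))
    {x₀ : M} {p : N} (hp : j p ∈ (extChartAt (𝓡 e) x₀).source) :
    ContMDiffAt (𝓡 d) 𝓘(ℝ, EuclideanSpace ℝ (Fin e)) ∞
      (fun p => tderiv (𝓡 e) 𝓘(ℝ, EuclideanSpace ℝ (Fin e)) (extChartAt (𝓡 e) x₀) (j p) (X p)) p := by
  have : IsManifold (𝓡 e) 1 M := .of_le (n := ∞) (by simp)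
  have : IsManifold (𝓡 e) (∞ + 1) M := by simpa using (inferInstance : IsManifold (𝓡 e) ∞ M)
  let t := trivializationAt (EuclideanSpace ℝ (Fin e)) (TangentSpace (𝓡 e) (M := M)) x₀
  have hbase : t.baseSet = (chartAt (EuclideanSpace ℝ (Fin e)) x₀).source :=
    TangentBundle.trivializationAt_baseSet x₀
  rw [extChartAt_source] at hp
  have h1 := ((t.contMDiffAt_iff (n := ∞) (IM := 𝓡 d) (IB := 𝓡 e)
    (f := fun p => (⟨j p, X p⟩ : TangentBundle (𝓡 e) M)) (x₀ := p)
    (by rw [t.mem_source, hbase]; exact hp)).1 (hX p))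
  refine h1.2.congr_of_eventuallyEq ?_
  filter_upwards [h1.1.continuousAt.preimage_mem_nhds
    ((chartAt (EuclideanSpace ℝ (Fin e)) x₀).open_source.mem_nhds hp)] with q hq
  have h2 := TangentBundle.continuousLinearMapAt_trivializationAt (I := 𝓡 e) (𝕜 := ℝ) hq
  have h3 : t.continuousLinearMapAt ℝ (j q) (X q) = (t ⟨j q, X q⟩).2 :=
    t.continuousLinearMapAt_apply_of_mem (R := ℝ) (by rw [hbase]; exact hq) _
  rw [← h3]
  exact (congrArg (fun L => L (X q)) h2).symm

/-- The parametrization of `ℂ × N` by the chart of `N` at `i`. -/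
def slab (d : ℕ) {N : Type u} [TopologicalSpace N] [ChartedSpace (EuclideanSpace ℝ (Fin d)) N]
    (i : N) (x : ℂ × EuclideanSpace ℝ (Fin d)) : ℂ × N := (x.1, (extChartAt (𝓡 d) i).symm x.2)

lemma contMDiffAt_slab {i : N} {x : ℂ × EuclideanSpace ℝ (Fin d)}
    (hx : x.2 ∈ (extChartAt (𝓡 d) i).target) :
    ContMDiffAt 𝓘(ℝ, ℂ × EuclideanSpace ℝ (Fin d)) (𝓘(ℝ, ℂ).prod (𝓡 d)) ∞ (slab d i) x :=
  (contMDiffAt_iff_contDiffAt.2 contDiffAt_fst).prodMk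
    (ContMDiffAt.comp x (contMDiffAt_extChartAt_symm i hx)
      (contMDiffAt_iff_contDiffAt.2 contDiffAt_snd))

lemma tderiv_slab {i : N} {x : ℂ × EuclideanSpace ℝ (Fin d)}
    (hx : x.2 ∈ (extChartAt (𝓡 d) i).target) (v : ℂ × EuclideanSpace ℝ (Fin d)) :
    tderiv 𝓘(ℝ, ℂ × EuclideanSpace ℝ (Fin d)) (𝓘(ℝ, ℂ).prod (𝓡 d)) (slab d i) x v =
      (v.1, tderiv 𝓘(ℝ, _) (𝓡 d) (extChartAt (𝓡 d) i).symm x.2 v.2) := by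
  have hs := (contMDiffAt_slab hx).mdifferentiableAt (by simp)
  have h1 := tderiv_comp_apply (g := (Prod.fst : ℂ × N → ℂ)) (I'' := 𝓘(ℝ, ℂ))
    mdifferentiableAt_fst hs rfl v
  have h2 := tderiv_comp_apply (g := (Prod.snd : ℂ × N → N)) (I'' := 𝓡 d)
    mdifferentiableAt_snd hs rfl v
  have h3 := tderiv_comp_apply (f := (Prod.snd : ℂ × EuclideanSpace ℝ (Fin d) → _))
    (mdifferentiableAt_chart_symm hx) differentiableAt_snd.mdifferentiableAt rfl v
  rw [tderiv_eq_fderiv, fderiv_snd] at h3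
  refine Prod.ext ?_ ?_
  · refine (tderiv_fst (d := d) (p := (slab d i x).2) (z := (slab d i x).1) _).symm.trans (h1.symm.trans ?_)
    have h4 : (Prod.fst ∘ slab d i : ℂ × EuclideanSpace ℝ (Fin d) → ℂ) = Prod.fst := rfl
    rw [h4, tderiv_eq_fderiv, fderiv_fst]
    rfl
  · refine (tderiv_snd (d := d) (p := (slab d i x).2) (z := (slab d i x).1) _).symm.trans (h2.symm.trans ?_)
    exact h3

/-- The local representation of a tube map in the chart at `i` is smooth near the zero section. -/
lemma IsTubeMap.eventually_comp_slab {j : N → M} {Φ : ℂ × N → M} (h : IsTubeMap d e j Φ) (i : N)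
    {y : EuclideanSpace ℝ (Fin d)} (hy : y ∈ (extChartAt (𝓡 d) i).target) :
    ∀ᶠ x in 𝓝 ((0 : ℂ), y), x.2 ∈ (extChartAt (𝓡 d) i).target ∧
      ContMDiffAt (𝓘(ℝ, ℂ).prod (𝓡 d)) (𝓡 e) ∞ Φ (slab d i x) ∧
      ContMDiffAt 𝓘(ℝ, ℂ × EuclideanSpace ℝ (Fin d)) (𝓡 e) ∞ (Φ ∘ slab d i) x := by
  have hs := contMDiffAt_slab (i := i) (x := ((0 : ℂ), y)) hy
  filter_upwards [continuousAt_snd.preimage_mem_nhds ((isOpen_extChartAt_target i).mem_nhds hy),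
    hs.continuousAt.eventually (h.smooth _)] with x hx1 hx2
  exact ⟨hx1, hx2, ContMDiffAt.comp x hx2 (contMDiffAt_slab hx1)⟩

lemma IsTubeMap.tderiv_comp_slab {j : N → M} {Φ : ℂ × N → M} (h : IsTubeMap d e j Φ) (i : N)
    {y : EuclideanSpace ℝ (Fin d)} (hy : y ∈ (extChartAt (𝓡 d) i).target)
    (v : ℂ × EuclideanSpace ℝ (Fin d)) :
    tderiv 𝓘(ℝ, ℂ × EuclideanSpace ℝ (Fin d)) (𝓡 e) (Φ ∘ slab d i) (0, y) v =
      tderiv (𝓘(ℝ, ℂ).prod (𝓡 d)) (𝓡 e) Φ (0, (extChartAt (𝓡 d) i).symm y)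
        (v.1, tderiv 𝓘(ℝ, _) (𝓡 d) (extChartAt (𝓡 d) i).symm y v.2) := by
  rw [tderiv_comp_apply ((h.contMDiffAt _).mdifferentiableAt (by simp))
    ((contMDiffAt_slab (x := ((0 : ℂ), y)) hy).mdifferentiableAt (by simp)) rfl, tderiv_slab hy]

lemma IsTubeMap.tderiv_tangent {j : N → M} {Φ : ℂ × N → M} (h : IsTubeMap d e j Φ) (p : N)
    (u : EuclideanSpace ℝ (Fin d)) :
    tderiv (𝓘(ℝ, ℂ).prod (𝓡 d)) (𝓡 e) Φ (0, p) (0, u) = tderiv (𝓡 d) (𝓡 e) j p u := by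
  have h1 : MDifferentiableAt (𝓡 d) (𝓘(ℝ, ℂ).prod (𝓡 d)) (fun p : N => ((0 : ℂ), p)) p :=
    mdifferentiableAt_const.prodMk mdifferentiableAt_id
  have h2 : j = Φ ∘ fun p : N => ((0 : ℂ), p) := funext fun q => (h.zero q).symm
  rw [h2, tderiv_comp_apply ((h.contMDiffAt p).mdifferentiableAt (by simp)) h1 rfl]
  congr 1
  refine Prod.ext ?_ ?_
  · have h3 := tderiv_comp_apply (g := (Prod.fst : ℂ × N → ℂ)) (I'' := 𝓘(ℝ, ℂ))
      mdifferentiableAt_fst h1 rfl u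
    rw [tderiv_fst] at h3
    rw [← h3]
    have h4 : (Prod.fst ∘ fun p : N => ((0 : ℂ), p)) = fun _ => 0 := rfl
    rw [h4, tderiv, mfderiv_const]
    rfl
  · have h3 := tderiv_comp_apply (g := (Prod.snd : ℂ × N → N)) (I'' := 𝓡 d)
      mdifferentiableAt_snd h1 rfl u
    rw [tderiv_snd] at h3
    rw [← h3]
    have h4 : (Prod.snd ∘ fun p : N => ((0 : ℂ), p)) = id := rfl
    rw [h4, tderiv_id]
    rfl

/-- A tube map whose derivative along the zero section is injective. -/
lemma exists_tubeMap [CompactSpace N] [T2Space N] {j : N → M} (hj : ContMDiff (𝓡 d) (𝓡 e) ∞ j)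
    (hinj : ∀ p, Function.Injective (tderiv (𝓡 d) (𝓡 e) j p))
    (hν : HasTrivialNormalBundle d e j) :
    ∃ Φ, IsTubeMap d e j Φ ∧
      ∀ p, Function.Injective (tderiv (𝓘(ℝ, ℂ).prod (𝓡 d)) (𝓡 e) Φ (0, p)) := by
  obtain ⟨X, Y, hX, hY, hXY⟩ := hν
  let X' : N → EuclideanSpace ℝ (Fin e) := fun p => X p
  let Y' : N → EuclideanSpace ℝ (Fin e) := fun p => Y p
  have h₀ : IsTubeMap d e j (j ∘ Prod.snd) :=
    ⟨fun p => rfl, fun p => Filter.Eventually.of_forall fun q =>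
      ContMDiffAt.comp q hj.contMDiffAt contMDiffAt_snd⟩
  obtain ⟨s, ρ, hρ, hsupp, -, hsum⟩ := exists_finite_partition (d := d)
    (fun p => j ⁻¹' (extChartAt (𝓡 e) (j p)).source)
    (fun p => (isOpen_extChartAt_source (j p)).preimage hj.continuous)
    (fun p => mem_extChartAt_source (j p))
  -- The coordinate expression of `z ↦ re z X + im z Y`. After applying the inverse chart it no
  -- longer depends on `i`, and as the weights sum to one, the total normal derivative of the tube
  -- map is this map itself.
  let D : N → N → ℂ →L[ℝ] EuclideanSpace ℝ (Fin e) := fun i p =>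
    Complex.reCLM.smulRight (tderiv (𝓡 e) 𝓘(ℝ, EuclideanSpace ℝ (Fin e)) (extChartAt (𝓡 e) (j i))
      (j p) (X' p)) +
    Complex.imCLM.smulRight (tderiv (𝓡 e) 𝓘(ℝ, EuclideanSpace ℝ (Fin e)) (extChartAt (𝓡 e) (j i))
      (j p) (Y' p))
  have hsm : ∀ l : ℂ →L[ℝ] ℝ, ContDiff ℝ ∞ fun v : EuclideanSpace ℝ (Fin e) => l.smulRight v :=
    fun l => contDiff_const.smulRight contDiff_id
  have hD : ∀ i, ∀ p ∈ j ⁻¹' (extChartAt (𝓡 e) (j i)).source,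
      ContMDiffAt (𝓡 d) 𝓘(ℝ, ℂ →L[ℝ] EuclideanSpace ℝ (Fin e)) ∞ (D i) p := fun i p hp =>
    (ContMDiffAt.comp p (hsm _).contDiffAt.contMDiffAt (contMDiffAt_coord_field hX hp)).add
      (ContMDiffAt.comp p (hsm _).contDiffAt.contMDiffAt (contMDiffAt_coord_field hY hp))
  obtain ⟨Φ, hΦ, hd⟩ := h₀.exists_add s j hρ hsupp hD
  refine ⟨Φ, hΦ, fun p => ?_⟩
  have hd' : ∀ v : ℂ × EuclideanSpace ℝ (Fin d),
      tderiv (𝓘(ℝ, ℂ).prod (𝓡 d)) (𝓡 e) Φ (0, p) v =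
        tderiv (𝓡 d) (𝓡 e) j p v.2 +
          (v.1.re • X' p + v.1.im • Y' p) := by
    intro v
    rw [hd, tderiv_comp_apply (hj.mdifferentiable (by simp) p) mdifferentiableAt_snd rfl,
      tderiv_snd]
    congr 1
    have h1 : ∀ i ∈ s, ρ i p • tderiv 𝓘(ℝ, _) (𝓡 e) (extChartAt (𝓡 e) (j i)).symm
        (extChartAt (𝓡 e) (j i) (j p)) (D i p v.1) = ρ i p •
          (v.1.re • X' p + v.1.im • Y' p) := by
      intro i _
      by_cases hi : p ∈ tsupport (ρ i)
      · congr 1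
        simp only [D, _root_.add_apply, ContinuousLinearMap.smulRight_apply, map_add,
          map_smul]
        rw [tderiv_chart_symm_chart (hsupp i hi), tderiv_chart_symm_chart (hsupp i hi)]
        rfl
      · rw [image_eq_zero_of_notMem_tsupport hi, zero_smul, zero_smul]
    rw [Finset.sum_congr rfl h1, ← Finset.sum_smul, hsum, one_smul]
  rw [injective_iff_map_eq_zero]
  intro v hv
  rw [hd'] at hv
  -- A vector in the kernel exhibits a combination of `X` and `Y` as tangent to `N`.
  have hz := hXY p v.1.re v.1.im ⟨-v.2, by
    change tderiv (𝓡 d) (𝓡 e) j p (-v.2) = _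
    rw [map_neg]
    exact (eq_neg_of_add_eq_zero_right hv).symm⟩
  have hv1 : v.1 = 0 := Complex.ext hz.1 hz.2
  refine Prod.ext hv1 (hinj p ?_)
  rw [Prod.snd_zero, map_zero]
  simpa [hv1] using hv

end Tube

/-! ### The derivative of a tube map normal to the zero section -/

section NormalCorrection

set_option linter.unusedSectionVars false

variable {E : Type} [NormedAddCommGroup E] [NormedSpace ℝ E] [FiniteDimensional ℝ E]

/-- The restriction of the form `b` on `ℂ × E` to `{0} × E`. -/
def zeroSection (b : ℂ × E → ℂ × E →L[ℝ] ℝ) (y : E) : E →L[ℝ] ℝ :=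
  (b (0, y)).comp (ContinuousLinearMap.inr ℝ ℂ E)

lemma zeroSection_eq_pullVec (b : ℂ × E → ℂ × E →L[ℝ] ℝ) :
    zeroSection b = pullVec (fun y : E => ((0 : ℂ), y)) b := by
  ext y v
  rw [pullVec, (hasFDerivAt_prodMk_right (𝕜 := ℝ) (0 : ℂ) y).fderiv]
  rfl

lemma contDiffAt_zeroSection {b : ℂ × E → ℂ × E →L[ℝ] ℝ} {y : E} (hb : ContDiffAt ℝ ∞ b (0, y)) :
    ContDiffAt ℝ ∞ (zeroSection b) y := by
  rw [zeroSection_eq_pullVec]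
  exact contDiffAt_pullVec (contDiffAt_const.prodMk contDiffAt_id) hb

lemma dForm_zeroSection {b : ℂ × E → ℂ × E →L[ℝ] ℝ} {y : E} (hb : ContDiffAt ℝ ∞ b (0, y))
    (u v : E) : dForm (zeroSection b) y u v = dForm b (0, y) (0, u) (0, v) := by
  have h : ContDiffAt ℝ ∞ (fun y : E => ((0 : ℂ), y)) y := contDiffAt_const.prodMk contDiffAt_id
  rw [zeroSection_eq_pullVec, dForm_pullVec h
    (hb.differentiableAt (by simp)), (hasFDerivAt_prodMk_right (𝕜 := ℝ) (0 : ℂ) y).fderiv]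
  rfl

/-- The vector `D` such that `(z, D)` lies in the kernel of `b` and is orthogonal to the kernel of
`b` in `{0} × E`. -/
def normalVector (b : ℂ × E → ℂ × E →L[ℝ] ℝ) (y : E) (z : ℂ) : E :=
  ((contactMap (zeroSection b y) (dForm (zeroSection b) y)).inverse
    (-((dForm b (0, y) (z, 0)).comp (ContinuousLinearMap.inr ℝ ℂ E)), -b (0, y) (z, 0))).1

/-- `normalVector` as a linear map. -/
def normalCorrection (b : ℂ × E → ℂ × E →L[ℝ] ℝ) (y : E) : ℂ →L[ℝ] E :=
  Complex.reCLM.smulRight (normalVector b y 1) + Complex.imCLM.smulRight (normalVector b y Complex.I)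

lemma contDiffAt_normalVector {b : ℂ × E → ℂ × E →L[ℝ] ℝ} {y : E}
    (hb : ContDiffAt ℝ ∞ b (0, y)) (hc : IsContactPair (zeroSection b y) (dForm (zeroSection b) y))
    (z : ℂ) : ContDiffAt ℝ ∞ (fun y => normalVector b y z) y := by
  have h0 : ContDiffAt ℝ ∞ (fun y : E => ((0 : ℂ), y)) y := contDiffAt_const.prodMk contDiffAt_id
  have hA := contDiffAt_zeroSection hb
  have h1 : ContDiffAt ℝ ∞ (fun y => b (0, y) (z, 0)) y :=
    (hb.comp y h0).clm_apply contDiffAt_const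
  have h2 : ContDiffAt ℝ ∞ (fun y => dForm b (0, y) (z, 0)) y :=
    ((contDiffAt_dForm hb).comp y h0).clm_apply contDiffAt_const
  exact contDiffAt_fst.comp y (contDiffAt_inverse_contactMap hA (contDiffAt_dForm hA)
    ((h2.clm_comp contDiffAt_const).neg.prodMk h1.neg) hc)

lemma contDiffAt_normalCorrection {b : ℂ × E → ℂ × E →L[ℝ] ℝ} {y : E}
    (hb : ContDiffAt ℝ ∞ b (0, y)) (hc : IsContactPair (zeroSection b y) (dForm (zeroSection b) y)) :
    ContDiffAt ℝ ∞ (normalCorrection b) y :=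
  (contDiffAt_const.smulRight (contDiffAt_normalVector hb hc 1)).add
    (contDiffAt_const.smulRight (contDiffAt_normalVector hb hc Complex.I))

/-- The two components of the linear system solved by `normalVector`. The second says that `(z, D)`
lies in the kernel. The first leaves a multiple of the restricted form, which disappears on vectors
`u` in its kernel. -/
lemma normalVector_spec {b : ℂ × E → ℂ × E →L[ℝ] ℝ} {y : E} (hb : ContDiffAt ℝ ∞ b (0, y))
    (hc : IsContactPair (zeroSection b y) (dForm (zeroSection b) y)) (z : ℂ) :
    b (0, y) (z, normalVector b y z) = 0 ∧
      ∀ u, b (0, y) (0, u) = 0 → dForm b (0, y) (z, normalVector b y z) (0, u) = 0 := by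
  have h := hc.contactMap_inverse
    (-((dForm b (0, y) (z, 0)).comp (ContinuousLinearMap.inr ℝ ℂ E)), -b (0, y) (z, 0))
  rw [contactMap_apply, Prod.ext_iff] at h
  have hs : (z, normalVector b y z) = (z, 0) + (0, normalVector b y z) := by simp
  constructor
  · have h2 : b (0, y) (0, normalVector b y z) = -b (0, y) (z, 0) := h.2
    rw [hs, map_add, h2, add_neg_cancel]
  · intro u hu
    have h1 := congrArg (fun L => L u) h.1
    have hu' : zeroSection b y u = 0 := hu
    simp only [_root_.add_apply, _root_.smul_apply, hu', smul_zero, add_zero] at h1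
    rw [dForm_zeroSection hb] at h1
    rw [hs, map_add, _root_.add_apply]
    change dForm b (0, y) (0, normalVector b y z) (0, u) = -dForm b (0, y) (z, 0) (0, u) at h1
    rw [h1, add_neg_cancel]

lemma normalCorrection_spec {b : ℂ × E → ℂ × E →L[ℝ] ℝ} {y : E} (hb : ContDiffAt ℝ ∞ b (0, y))
    (hc : IsContactPair (zeroSection b y) (dForm (zeroSection b) y)) (z : ℂ) :
    b (0, y) (z, normalCorrection b y z) = 0 ∧
      ∀ u, b (0, y) (0, u) = 0 → dForm b (0, y) (z, normalCorrection b y z) (0, u) = 0 := by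
  have hs : (z, normalCorrection b y z) = z.re • ((1 : ℂ), normalVector b y 1) +
      z.im • (Complex.I, normalVector b y Complex.I) := by
    refine Prod.ext ?_ rfl
    apply Complex.ext <;> simp
  have h1 := normalVector_spec hb hc 1
  have h2 := normalVector_spec hb hc Complex.I
  rw [hs]
  refine ⟨by rw [map_add, map_smul, map_smul, h1.1, h2.1]; simp, fun u hu => ?_⟩
  rw [map_add, map_smul, map_smul, _root_.add_apply, _root_.smul_apply, _root_.smul_apply,
    h1.2 u hu, h2.2 u hu]
  simp

end NormalCorrection

/-! ### Contact forms in the coordinates of a tube map -/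

section TubePull

set_option linter.unusedSectionVars false

variable {d e : ℕ} {N M : Type u}
  [TopologicalSpace N] [ChartedSpace (EuclideanSpace ℝ (Fin d)) N] [IsManifold (𝓡 d) ∞ N]
  [TopologicalSpace M] [ChartedSpace (EuclideanSpace ℝ (Fin e)) M] [IsManifold (𝓡 e) ∞ M]
  {j : N → M} {Φ : ℂ × N → M} {α : OneForm e M} {αN : OneForm d N}

lemma IsTubeMap.pull_slab_apply (h : IsTubeMap d e j Φ) (α : OneForm e M) (i : N)
    {y : EuclideanSpace ℝ (Fin d)} (hy : y ∈ (extChartAt (𝓡 d) i).target)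
    (v : ℂ × EuclideanSpace ℝ (Fin d)) :
    α.pull (Φ ∘ slab d i) (0, y) v = α.cov (j ((extChartAt (𝓡 d) i).symm y))
      (tderiv (𝓘(ℝ, ℂ).prod (𝓡 d)) (𝓡 e) Φ (0, (extChartAt (𝓡 d) i).symm y)
        (v.1, tderiv 𝓘(ℝ, _) (𝓡 d) (extChartAt (𝓡 d) i).symm y v.2)) := by
  rw [← h.tderiv_comp_slab i hy, ← h.zero]
  rfl

lemma IsTubeMap.contDiffAt_pull_slab (h : IsTubeMap d e j Φ) (hα : ∀ x, α.SmoothAt x) (i : N)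
    {y : EuclideanSpace ℝ (Fin d)} (hy : y ∈ (extChartAt (𝓡 d) i).target) :
    ContDiffAt ℝ ∞ (α.pull (Φ ∘ slab d i)) (0, y) :=
  (hα _).contDiffAt_pull (h.eventually_comp_slab i hy).self_of_nhds.2.2

lemma IsTubeMap.dForm_pull_slab (h : IsTubeMap d e j Φ) (hα : ∀ x, α.SmoothAt x) (i : N)
    {y : EuclideanSpace ℝ (Fin d)} (hy : y ∈ (extChartAt (𝓡 d) i).target)
    (v w : ℂ × EuclideanSpace ℝ (Fin d)) :
    dForm (α.pull (Φ ∘ slab d i)) (0, y) v w = α.dcov (j ((extChartAt (𝓡 d) i).symm y))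
      (tderiv (𝓘(ℝ, ℂ).prod (𝓡 d)) (𝓡 e) Φ (0, (extChartAt (𝓡 d) i).symm y)
        (v.1, tderiv 𝓘(ℝ, _) (𝓡 d) (extChartAt (𝓡 d) i).symm y v.2))
      (tderiv (𝓘(ℝ, ℂ).prod (𝓡 d)) (𝓡 e) Φ (0, (extChartAt (𝓡 d) i).symm y)
        (w.1, tderiv 𝓘(ℝ, _) (𝓡 d) (extChartAt (𝓡 d) i).symm y w.2)) := by
  rw [(hα _).dForm_pull (h.eventually_comp_slab i hy).self_of_nhds.2.2, h.tderiv_comp_slab i hy,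
    h.tderiv_comp_slab i hy, ← h.zero]
  rfl

/-- The zero section of the local representation is the form `h αN`. -/
lemma IsTubeMap.zeroSection_pull_slab (h : IsTubeMap d e j Φ) {f : N → ℝ}
    (hf : ∀ p u, α.cov (j p) (tderiv (𝓡 d) (𝓡 e) j p u) = f p * αN.cov p u) (i : N)
    {y : EuclideanSpace ℝ (Fin d)} (hy : y ∈ (extChartAt (𝓡 d) i).target) :
    zeroSection (α.pull (Φ ∘ slab d i)) y =
      f ((extChartAt (𝓡 d) i).symm y) • αN.pull (extChartAt (𝓡 d) i).symm y := by
  ext u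
  change α.pull (Φ ∘ slab d i) (0, y) (0, u) = _
  rw [h.pull_slab_apply α i hy, h.tderiv_tangent, hf]
  rfl

lemma contDiffAt_comp_chart_symm {F : Type*} [NormedAddCommGroup F] [NormedSpace ℝ F] {f : N → F}
    {i : N} {y : EuclideanSpace ℝ (Fin d)} (hy : y ∈ (extChartAt (𝓡 d) i).target)
    (hf : ContMDiffAt (𝓡 d) 𝓘(ℝ, F) ∞ f ((extChartAt (𝓡 d) i).symm y)) :
    ContDiffAt ℝ ∞ (fun y => f ((extChartAt (𝓡 d) i).symm y)) y :=
  contMDiffAt_iff_contDiffAt.1 (ContMDiffAt.comp y hf (contMDiffAt_extChartAt_symm i hy))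

lemma OneForm.isContactPair_pull_chart_symm (hα : ∀ x, αN.SmoothAt x) (hc : ∀ x, αN.ContactAt x)
    (i : N) {y : EuclideanSpace ℝ (Fin d)} (hy : y ∈ (extChartAt (𝓡 d) i).target) :
    IsContactPair (αN.pull (extChartAt (𝓡 d) i).symm y)
      (dForm (αN.pull (extChartAt (𝓡 d) i).symm) y) :=
  ((hα _).isContactPair_pull_iff (contMDiffAt_extChartAt_symm i hy)
    (Function.LeftInverse.injective fun v => tderiv_chart_chart_symm hy v) (by simp)).2 (hc _)

/-- In the chart the restricted form is `f αN` with `f` nowhere zero, and multiplication by such a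
function preserves the contact condition. -/
lemma IsTubeMap.isContactPair_zeroSection (h : IsTubeMap d e j Φ) {f : N → ℝ}
    (hfs : ContMDiff (𝓡 d) 𝓘(ℝ) ∞ f) (hf0 : ∀ p, f p ≠ 0)
    (hf : ∀ p u, α.cov (j p) (tderiv (𝓡 d) (𝓡 e) j p u) = f p * αN.cov p u)
    (hα : ∀ x, αN.SmoothAt x) (hc : ∀ x, αN.ContactAt x) (i : N)
    {y : EuclideanSpace ℝ (Fin d)} (hy : y ∈ (extChartAt (𝓡 d) i).target) :
    IsContactPair (zeroSection (α.pull (Φ ∘ slab d i)) y)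
      (dForm (zeroSection (α.pull (Φ ∘ slab d i))) y) := by
  have he : zeroSection (α.pull (Φ ∘ slab d i)) =ᶠ[𝓝 y] fun y =>
      f ((extChartAt (𝓡 d) i).symm y) • αN.pull (extChartAt (𝓡 d) i).symm y := by
    filter_upwards [(isOpen_extChartAt_target i).mem_nhds hy] with z hz
    exact h.zeroSection_pull_slab hf i hz
  rw [dForm_congr he, he.self_of_nhds]
  exact isContactPair_smul
    ((contDiffAt_comp_chart_symm hy hfs.contMDiffAt).differentiableAt (by simp))
    (((hα _).contDiffAt_pull (contMDiffAt_extChartAt_symm i hy)).differentiableAt (by simp))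
    (hf0 _) (OneForm.isContactPair_pull_chart_symm hα hc i hy)

/-- The conformal factor of a contact embedding. -/
lemma exists_conformal_factor (hj : ContMDiff (𝓡 d) (𝓡 e) ∞ j) (hα : ∀ x, α.SmoothAt x)
    (hαN : ∀ x, αN.SmoothAt x) (hc : ∀ x, αN.cov x ≠ 0)
    (h0 : ∀ p u, αN.cov p u = 0 → α.cov (j p) (tderiv (𝓡 d) (𝓡 e) j p u) = 0)
    (h1 : ∀ p u, 0 < αN.cov p u → 0 < α.cov (j p) (tderiv (𝓡 d) (𝓡 e) j p u)) :
    ∃ f : N → ℝ, ContMDiff (𝓡 d) 𝓘(ℝ) ∞ f ∧ (∀ p, 0 < f p) ∧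
      ∀ p u, α.cov (j p) (tderiv (𝓡 d) (𝓡 e) j p u) = f p * αN.cov p u := by
  have key : ∀ p, ∃ f : ℝ, (α.cov (j p)).comp (tderiv (𝓡 d) (𝓡 e) j p) = f • αN.cov p := fun p =>
    exists_eq_smul_of_ker_le (h0 p)
  choose f hf using key
  have hf' : ∀ p u, α.cov (j p) (tderiv (𝓡 d) (𝓡 e) j p u) = f p * αN.cov p u := fun p u =>
    congrArg (fun L => L u) (hf p)
  have hex : ∀ p, ∃ u, αN.cov p u ≠ 0 := fun p => by
    by_contra! h
    exact hc p (by ext u; exact h u)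
  refine ⟨f, fun p => ?_, fun p => ?_, hf'⟩
  · have hp := mem_extChartAt_source (I := 𝓡 d) p
    have hy := mem_extChartAt_target (I := 𝓡 d) p
    refine contMDiffAt_of_chart hp ?_
    obtain ⟨u, hu⟩ := hex p
    let u' := tderiv (𝓡 d) 𝓘(ℝ, EuclideanSpace ℝ (Fin d)) (extChartAt (𝓡 d) p) p u
    let φ := extChartAt (𝓡 d) p
    have hcs := contMDiffAt_extChartAt_symm (I := 𝓡 d) p hy
    have hb1 : ContDiffAt ℝ ∞ (fun y => αN.pull φ.symm y u') (φ p) :=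
      ((hαN _).contDiffAt_pull hcs).clm_apply contDiffAt_const
    have hb2 : ContDiffAt ℝ ∞ (fun y => α.pull (j ∘ φ.symm) y u') (φ p) :=
      ((hα _).contDiffAt_pull (ContMDiffAt.comp _ hj.contMDiffAt hcs)).clm_apply contDiffAt_const
    have hne : αN.pull φ.symm (φ p) u' ≠ 0 := by
      change αN.cov (φ.symm (φ p)) (tderiv 𝓘(ℝ, EuclideanSpace ℝ (Fin d)) (𝓡 d) φ.symm (φ p) u') ≠ 0
      rw [tderiv_chart_symm_chart hp, extChartAt_to_inv]
      exact hu
    -- Near `p` the factor is the quotient of the values of the two forms on one fixed coordinate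
    -- vector on which `αN` does not vanish.
    refine (hb2.div hb1 hne).congr_of_eventuallyEq ?_
    filter_upwards [hb1.continuousAt.eventually_ne hne, extChartAt_target_mem_nhds (I := 𝓡 d) p]
      with z hz hzt
    rw [Pi.div_apply, eq_div_iff hz]
    change _ = α.cov (j (φ.symm z)) (tderiv 𝓘(ℝ, EuclideanSpace ℝ (Fin d)) (𝓡 e) (j ∘ φ.symm) z u')
    rw [tderiv_comp_apply (hj.mdifferentiable (by simp) _) (mdifferentiableAt_chart_symm hzt) rfl, hf']
    rfl
  · obtain ⟨u, hu⟩ := hex p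
    rcases hu.lt_or_gt with hu | hu
    · have h2 := h1 p (-u) (by rw [map_neg]; linarith)
      rw [map_neg, map_neg, hf'] at h2
      nlinarith
    · have h2 := h1 p u hu
      rw [hf'] at h2
      nlinarith

/-- Reparametrization of a tube map. -/
lemma IsTubeMap.comp (h : IsTubeMap d e j Φ) {Θ : ℂ × N → ℂ × N} (h0 : ∀ p, Θ (0, p) = (0, p))
    (hΘ : ∀ p, ∀ᶠ q in 𝓝 ((0 : ℂ), p),
      ContMDiffAt (𝓘(ℝ, ℂ).prod (𝓡 d)) (𝓘(ℝ, ℂ).prod (𝓡 d)) ∞ Θ q) :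
    IsTubeMap d e j (Φ ∘ Θ) := by
  refine ⟨fun p => by rw [Function.comp_apply, h0, h.zero], fun p => ?_⟩
  have hc : Filter.Tendsto Θ (𝓝 ((0 : ℂ), p)) (𝓝 (0, p)) := by
    have := (hΘ p).self_of_nhds.continuousAt
    rwa [ContinuousAt, h0] at this
  filter_upwards [hΘ p, hc.eventually (h.smooth p)] with q h1 h2
  exact ContMDiffAt.comp q h2 h1

lemma tderiv_ext_prod {x : N} {z : ℂ} {Θ : ℂ × N → ℂ × N} 
    (hΘ : MDifferentiableAt (𝓘(ℝ, ℂ).prod (𝓡 d)) (𝓘(ℝ, ℂ).prod (𝓡 d)) Θ (z, x))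
    (v : ℂ × EuclideanSpace ℝ (Fin d)) :
    tderiv (𝓘(ℝ, ℂ).prod (𝓡 d)) (𝓘(ℝ, ℂ).prod (𝓡 d)) Θ (z, x) v =
      (tderiv (𝓘(ℝ, ℂ).prod (𝓡 d)) 𝓘(ℝ, ℂ) (Prod.fst ∘ Θ) (z, x) v,
        tderiv (𝓘(ℝ, ℂ).prod (𝓡 d)) (𝓡 d) (Prod.snd ∘ Θ) (z, x) v) := by
  refine Prod.ext ?_ ?_
  · rw [tderiv_comp_apply (g := (Prod.fst : ℂ × N → ℂ)) (I'' := 𝓘(ℝ, ℂ))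
      mdifferentiableAt_fst hΘ rfl v]
    exact (tderiv_fst (p := (Θ (z, x)).2) (z := (Θ (z, x)).1) _).symm
  · rw [tderiv_comp_apply (g := (Prod.snd : ℂ × N → N)) (I'' := 𝓡 d)
      mdifferentiableAt_snd hΘ rfl v]
    exact (tderiv_snd (p := (Θ (z, x)).2) (z := (Θ (z, x)).1) _).symm

end TubePull

/-! ### Adapting a tube map to the contact form -/

section GoodTube

set_option linter.unusedSectionVars false

variable {d e : ℕ} {N M : Type u}
  [TopologicalSpace N] [ChartedSpace (EuclideanSpace ℝ (Fin d)) N] [IsManifold (𝓡 d) ∞ N]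
  [TopologicalSpace M] [ChartedSpace (EuclideanSpace ℝ (Fin e)) M] [IsManifold (𝓡 e) ∞ M]
  {j : N → M} {Φ : ℂ × N → M} {α : OneForm e M} {αN : OneForm d N}

/-- A tube map can be sheared along the zero section. -/
lemma IsTubeMap.exists_shear [CompactSpace N] [T2Space N] (h : IsTubeMap d e j Φ)
    {D : N → EuclideanSpace ℝ (Fin d) → ℂ →L[ℝ] EuclideanSpace ℝ (Fin d)}
    (hD : ∀ i, ∀ y ∈ (extChartAt (𝓡 d) i).target, ContDiffAt ℝ ∞ (D i) y) :
    ∃ (s : Finset N) (ρ : N → N → ℝ) (Φ' : ℂ × N → M), (∀ p, ∑ i ∈ s, ρ i p = 1) ∧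
      (∀ i, tsupport (ρ i) ⊆ (extChartAt (𝓡 d) i).source) ∧ IsTubeMap d e j Φ' ∧
      ∀ p v, tderiv (𝓘(ℝ, ℂ).prod (𝓡 d)) (𝓡 e) Φ' (0, p) v =
        tderiv (𝓘(ℝ, ℂ).prod (𝓡 d)) (𝓡 e) Φ (0, p) (v.1, v.2 + ∑ i ∈ s, ρ i p •
          tderiv 𝓘(ℝ, _) (𝓡 d) (extChartAt (𝓡 d) i).symm (extChartAt (𝓡 d) i p)
            (D i (extChartAt (𝓡 d) i p) v.1)) := by
  obtain ⟨s, ρ, hρ, hsupp, -, hsum⟩ := exists_finite_partition (d := d)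
    (fun p : N => (extChartAt (𝓡 d) p).source) (fun p => isOpen_extChartAt_source p)
    (fun p => mem_extChartAt_source p)
  -- The projection to `N` is a tube map over the identity of `N`. Changing its normal derivative
  -- gives a map `θ` from `ℂ × N` to `N`, and the shear is `(z, p) ↦ (z, θ (z, p))`.
  have h₀ : IsTubeMap d d (id : N → N) Prod.snd :=
    ⟨fun p => rfl, fun p => Filter.Eventually.of_forall fun q => contMDiffAt_snd⟩
  have hD' : ∀ i : N, ∀ p ∈ (id : N → N) ⁻¹' (extChartAt (𝓡 d) i).source,
      ContMDiffAt (𝓡 d) 𝓘(ℝ, ℂ →L[ℝ] EuclideanSpace ℝ (Fin d)) ∞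
        (fun p => D i (extChartAt (𝓡 d) i p)) p := by
    intro i p hp
    exact ContMDiffAt.comp p
      (contMDiffAt_iff_contDiffAt.2 (hD i _ ((extChartAt (𝓡 d) i).map_source hp)))
      (contMDiffAt_extChartAt' (by rw [← extChartAt_source (𝓡 d)]; exact hp))
  obtain ⟨θ, hθ, hd⟩ := h₀.exists_add s id hρ hsupp hD'
  have hΘ : ∀ p, ∀ᶠ q in 𝓝 ((0 : ℂ), p),
      ContMDiffAt (𝓘(ℝ, ℂ).prod (𝓡 d)) (𝓘(ℝ, ℂ).prod (𝓡 d)) ∞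
        (fun q : ℂ × N => (q.1, θ q)) q := fun p => by
    filter_upwards [hθ.smooth p] with q hq
    exact contMDiffAt_fst.prodMk hq
  have h0 : ∀ p, (fun q : ℂ × N => (q.1, θ q)) (0, p) = (0, p) := fun p =>
    Prod.ext rfl (hθ.zero p)
  refine ⟨s, ρ, Φ ∘ fun q => (q.1, θ q), hsum, hsupp, h.comp h0 hΘ, fun p v => ?_⟩
  have hm := (hΘ p).self_of_nhds.mdifferentiableAt (by simp : (∞ : WithTop ℕ∞) ≠ 0)
  rw [tderiv_comp_apply ((h.contMDiffAt _).mdifferentiableAt (by simp)) hm (h0 p),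
    tderiv_ext_prod hm]
  have h1 : (Prod.fst ∘ fun q : ℂ × N => (q.1, θ q)) = Prod.fst := rfl
  have h2 : (Prod.snd ∘ fun q : ℂ × N => (q.1, θ q)) = θ := rfl
  rw [h1, h2, tderiv_fst, hd, tderiv_snd]
  rfl

/-- The tube map can be chosen orthogonal to the zero section. -/
lemma IsTubeMap.exists_orthogonal [CompactSpace N] [T2Space N] (h : IsTubeMap d e j Φ)
    (hinj : ∀ p, Function.Injective (tderiv (𝓘(ℝ, ℂ).prod (𝓡 d)) (𝓡 e) Φ (0, p)))
    (hα : ∀ x, α.SmoothAt x) (hαN : ∀ x, αN.SmoothAt x) (hcN : ∀ x, αN.ContactAt x)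
    {f : N → ℝ} (hfs : ContMDiff (𝓡 d) 𝓘(ℝ) ∞ f) (hf0 : ∀ p, 0 < f p)
    (hf : ∀ p u, α.cov (j p) (tderiv (𝓡 d) (𝓡 e) j p u) = f p * αN.cov p u) :
    ∃ Φ', IsTubeMap d e j Φ' ∧
      (∀ p, Function.Injective (tderiv (𝓘(ℝ, ℂ).prod (𝓡 d)) (𝓡 e) Φ' (0, p))) ∧
      (∀ p v, α.cov (j p) (tderiv (𝓘(ℝ, ℂ).prod (𝓡 d)) (𝓡 e) Φ' (0, p) v) =
        f p * αN.cov p v.2) ∧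
      ∀ p z u, αN.cov p u = 0 →
        α.dcov (j p) (tderiv (𝓘(ℝ, ℂ).prod (𝓡 d)) (𝓡 e) Φ' (0, p) (z, 0))
          (tderiv (𝓘(ℝ, ℂ).prod (𝓡 d)) (𝓡 e) Φ' (0, p) (0, u)) = 0 := by
  have hcz : ∀ i, ∀ y ∈ (extChartAt (𝓡 d) i).target, _ := fun i y hy =>
    h.isContactPair_zeroSection hfs (fun p => (hf0 p).ne') hf hαN hcN i hy
  obtain ⟨s, ρ, Φ', hsum, hsupp, hΦ', hd⟩ := h.exists_shear
    (D := fun i => normalCorrection (α.pull (Φ ∘ slab d i)))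
    (fun i y hy => contDiffAt_normalCorrection (h.contDiffAt_pull_slab hα i hy) (hcz i y hy))
  have hspec : ∀ (i p : N), p ∈ (extChartAt (𝓡 d) i).source → ∀ z : ℂ,
      α.cov (j p) (tderiv (𝓘(ℝ, ℂ).prod (𝓡 d)) (𝓡 e) Φ (0, p) (z,
        tderiv 𝓘(ℝ, _) (𝓡 d) (extChartAt (𝓡 d) i).symm (extChartAt (𝓡 d) i p)
          (normalCorrection (α.pull (Φ ∘ slab d i)) (extChartAt (𝓡 d) i p) z))) = 0 ∧
      ∀ u, αN.cov p u = 0 → α.dcov (j p) (tderiv (𝓘(ℝ, ℂ).prod (𝓡 d)) (𝓡 e) Φ (0, p) (z,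
        tderiv 𝓘(ℝ, _) (𝓡 d) (extChartAt (𝓡 d) i).symm (extChartAt (𝓡 d) i p)
          (normalCorrection (α.pull (Φ ∘ slab d i)) (extChartAt (𝓡 d) i p) z)))
          (tderiv (𝓘(ℝ, ℂ).prod (𝓡 d)) (𝓡 e) Φ (0, p) (0, u)) = 0 := by
    intro i p hp z
    have hy := (extChartAt (𝓡 d) i).map_source hp
    have hpp := (extChartAt (𝓡 d) i).left_inv hp
    obtain ⟨h1, h2⟩ := normalCorrection_spec (h.contDiffAt_pull_slab hα i hy) (hcz i _ hy) z
    rw [h.pull_slab_apply α i hy, hpp] at h1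
    refine ⟨h1, fun u hu => ?_⟩
    have h3 := h2 (tderiv (𝓡 d) 𝓘(ℝ, _) (extChartAt (𝓡 d) i) p u) (by
      rw [h.pull_slab_apply α i hy, hpp]
      change α.cov (j p) (tderiv (𝓘(ℝ, ℂ).prod (𝓡 d)) (𝓡 e) Φ (0, p) (0, _)) = 0
      rw [h.tderiv_tangent, tderiv_chart_symm_chart hp, hf, hu, mul_zero])
    rw [h.dForm_pull_slab hα i hy, hpp] at h3
    simp only [tderiv_chart_symm_chart hp] at h3
    exact h3
  -- Since the weights sum to one, the normal derivative of `Φ'` is the average of the vectors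
  -- corrected in the single charts. Being in `ker α` and being orthogonal to `TN ∩ ker α` are
  -- linear conditions, so the average inherits them.
  have hcomb : ∀ p (v : ℂ × EuclideanSpace ℝ (Fin d)),
      tderiv (𝓘(ℝ, ℂ).prod (𝓡 d)) (𝓡 e) Φ' (0, p) v =
      tderiv (𝓡 d) (𝓡 e) j p v.2 + ∑ i ∈ s, ρ i p •
        tderiv (𝓘(ℝ, ℂ).prod (𝓡 d)) (𝓡 e) Φ (0, p) (v.1,
        tderiv 𝓘(ℝ, _) (𝓡 d) (extChartAt (𝓡 d) i).symm (extChartAt (𝓡 d) i p)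
          (normalCorrection (α.pull (Φ ∘ slab d i)) (extChartAt (𝓡 d) i p) v.1)) := by
    intro p v
    rw [hd, ← h.tderiv_tangent]
    simp only [← map_smul, ← map_sum, ← map_add]
    congr 1
    refine Prod.ext ?_ ?_
    · simp only [Prod.fst_add, Prod.fst_sum, Prod.smul_fst, zero_add]
      rw [← Finset.sum_smul, hsum, one_smul]
    · simp only [Prod.snd_add, Prod.snd_sum, Prod.smul_snd, map_smul]
  refine ⟨Φ', hΦ', fun p => ?_, fun p v => ?_, fun p z u hu => ?_⟩
  · rw [injective_iff_map_eq_zero]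
    intro v hv
    rw [hd] at hv
    have h1 := (injective_iff_map_eq_zero _).1 (hinj p) _ hv
    have hv1 : v.1 = 0 := congrArg Prod.fst h1
    refine Prod.ext hv1 ?_
    have h2 := congrArg Prod.snd h1
    simpa [hv1] using h2
  · rw [hcomb, map_add, hf, map_sum, Finset.sum_eq_zero, add_zero]
    intro i _
    by_cases hi : p ∈ tsupport (ρ i)
    · rw [map_smul, (hspec i p (hsupp i hi) v.1).1, smul_zero]
    · rw [image_eq_zero_of_notMem_tsupport hi, zero_smul, map_zero]
  · have h0 : tderiv (𝓡 d) (𝓡 e) j p (z, (0 : EuclideanSpace ℝ (Fin d))).2 = 0 := map_zero _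
    rw [hcomb, hΦ'.tderiv_tangent p u, ← h.tderiv_tangent p u, h0, zero_add, map_sum, _root_.sum_apply, Finset.sum_eq_zero]
    intro i _
    by_cases hi : p ∈ tsupport (ρ i)
    · rw [map_smul, _root_.smul_apply, (hspec i p (hsupp i hi) z).2 u hu, smul_zero]
    · rw [image_eq_zero_of_notMem_tsupport hi, zero_smul, map_zero]
      rfl

/-- A tube map can be stretched in one normal direction. -/
lemma IsTubeMap.exists_stretch (h : IsTubeMap d e j Φ) {κ : N → ℝ}
    (hκ : ContMDiff (𝓡 d) 𝓘(ℝ) ∞ κ) :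
    ∃ Φ', IsTubeMap d e j Φ' ∧ ∀ p v, tderiv (𝓘(ℝ, ℂ).prod (𝓡 d)) (𝓡 e) Φ' (0, p) v =
      tderiv (𝓘(ℝ, ℂ).prod (𝓡 d)) (𝓡 e) Φ (0, p) (⟨v.1.re, κ p * v.1.im⟩, v.2) := by
  let A : ℂ × N → ℂ →L[ℝ] ℂ := fun q =>
    Complex.reCLM.smulRight (1 : ℂ) + κ q.2 • Complex.imCLM.smulRight Complex.I
  have hA : ContMDiff (𝓘(ℝ, ℂ).prod (𝓡 d)) 𝓘(ℝ, ℂ →L[ℝ] ℂ) ∞ A :=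
    contMDiff_const.add ((hκ.comp contMDiff_snd).smul contMDiff_const)
  have hm : ContMDiff (𝓘(ℝ, ℂ).prod (𝓡 d)) 𝓘(ℝ, ℂ) ∞ fun q : ℂ × N => A q q.1 :=
    hA.clm_apply contMDiff_fst
  have h0 : ∀ p, (fun q : ℂ × N => (A q q.1, q.2)) (0, p) = (0, p) := fun p => by simp
  have hΘ : ContMDiff (𝓘(ℝ, ℂ).prod (𝓡 d)) (𝓘(ℝ, ℂ).prod (𝓡 d)) ∞
      fun q : ℂ × N => (A q q.1, q.2) := hm.prodMk contMDiff_snd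
  refine ⟨Φ ∘ fun q => (A q q.1, q.2), h.comp h0 fun p =>
    Filter.Eventually.of_forall fun q => hΘ q, fun p v => ?_⟩
  have hmd := hΘ.mdifferentiable (by simp) ((0 : ℂ), p)
  rw [tderiv_comp_apply ((h.contMDiffAt _).mdifferentiableAt (by simp)) hmd (h0 p),
    tderiv_ext_prod hmd]
  have h1 : (Prod.fst ∘ fun q : ℂ × N => (A q q.1, q.2)) = fun q : ℂ × N => A q q.1 := rfl
  have h2 : (Prod.snd ∘ fun q : ℂ × N => (A q q.1, q.2)) = Prod.snd := rfl
  rw [h1, h2, tderiv_snd, tderiv_clm_apply_fst (hA.mdifferentiable (by simp) _)]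
  congr 1
  refine Prod.ext ?_ rfl
  apply Complex.ext <;> simp [A]

/-- A tube map that induces the standard contact structure along the zero section. -/
lemma IsTubeMap.exists_standard [CompactSpace N] [T2Space N] (hde : e = d + 2)
    (h : IsTubeMap d e j Φ)
    (hinj : ∀ p, Function.Injective (tderiv (𝓘(ℝ, ℂ).prod (𝓡 d)) (𝓡 e) Φ (0, p)))
    (hα : ∀ x, α.SmoothAt x) (hc : ∀ x, α.ContactAt x)
    (hαN : ∀ x, αN.SmoothAt x) (hcN : ∀ x, αN.ContactAt x)
    {f : N → ℝ} (hfs : ContMDiff (𝓡 d) 𝓘(ℝ) ∞ f) (hf0 : ∀ p, 0 < f p)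
    (hf : ∀ p u, α.cov (j p) (tderiv (𝓡 d) (𝓡 e) j p u) = f p * αN.cov p u) :
    ∃ Φ', IsTubeMap d e j Φ' ∧
      (∀ p v, α.cov (j p) (tderiv (𝓘(ℝ, ℂ).prod (𝓡 d)) (𝓡 e) Φ' (0, p) v) =
        f p * αN.cov p v.2) ∧
      (∀ p z u, αN.cov p u = 0 →
        α.dcov (j p) (tderiv (𝓘(ℝ, ℂ).prod (𝓡 d)) (𝓡 e) Φ' (0, p) (z, 0))
          (tderiv (𝓘(ℝ, ℂ).prod (𝓡 d)) (𝓡 e) Φ' (0, p) (0, u)) = 0) ∧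
      ∀ p, α.dcov (j p) (tderiv (𝓘(ℝ, ℂ).prod (𝓡 d)) (𝓡 e) Φ' (0, p) (1, 0))
          (tderiv (𝓘(ℝ, ℂ).prod (𝓡 d)) (𝓡 e) Φ' (0, p) (Complex.I, 0)) = 2 * f p := by
  obtain ⟨Φ₂, h₂, hinj₂, h₂a, h₂b⟩ := h.exists_orthogonal hinj hα hαN hcN hfs hf0 hf
  let L : N → ℂ × EuclideanSpace ℝ (Fin d) →L[ℝ] EuclideanSpace ℝ (Fin e) := fun p =>
    tderiv (𝓘(ℝ, ℂ).prod (𝓡 d)) (𝓡 e) Φ₂ (0, p)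
  let wn : N → ℝ := fun p => α.dcov (j p) (L p (1, 0)) (L p (Complex.I, 0))
  have hLim : ∀ p (z : ℂ), L p (z, 0) = z.re • L p (1, 0) + z.im • L p (Complex.I, 0) := by
    intro p z
    rw [← map_smul, ← map_smul, ← map_add]
    congr 1
    refine Prod.ext ?_ (by simp)
    apply Complex.ext <;> simp
  have halt : ∀ p u v, α.dcov (j p) u v = -α.dcov (j p) v u := by
    intro p u v
    simp [OneForm.dcov]
  -- If `dα` vanished on the normal plane, the image of `(1, 0)` would be orthogonal to all of `ker
  -- α`: to the plane itself by assumption, and to `TN ∩ ker α` by the choice of `Φ₂`. The dimension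
  -- hypothesis ensures that these two span `ker α`.
  have hwz : ∀ p, wn p ≠ 0 := by
    intro p hp
    have hself : α.dcov (j p) (L p (1, 0)) (L p (1, 0)) = 0 := by
      have := halt p (L p (1, 0)) (L p (1, 0))
      linarith
    have hz : L p (1, 0) = 0 := by
      refine (hc (j p)).2 _ (by rw [h₂a]; simp) fun v hv => ?_
      obtain ⟨v, rfl⟩ := (LinearMap.injective_iff_surjective_of_finrank_eq_finrank
        (f := (L p).toLinearMap) (by simp [hde, add_comm])).1 (hinj₂ p) v
      have hv' : αN.cov p v.2 = 0 := by
        have : f p * αN.cov p v.2 = 0 := (h₂a p v).symm.trans hv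
        exact (mul_eq_zero.1 this).resolve_left (hf0 p).ne'
      have hs : L p v = L p (v.1, 0) + L p (0, v.2) := by
        rw [← map_add]; simp
      change α.dcov (j p) (L p (1, 0)) (L p v) = 0
      rw [hs, map_add, hLim p v.1, map_add, map_smul, map_smul, hself, smul_zero, zero_add]
      have h3 : α.dcov (j p) (L p (1, 0)) (L p (Complex.I, 0)) = 0 := hp
      rw [h3, smul_zero, zero_add]
      exact h₂b p 1 v.2 hv'
    have := (injective_iff_map_eq_zero _).1 (hinj₂ p) _ hz
    simp at this
  have hwzs : ContMDiff (𝓡 d) 𝓘(ℝ) ∞ wn := by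
    intro p
    have hy := mem_extChartAt_target (I := 𝓡 d) p
    refine contMDiffAt_of_chart (mem_extChartAt_source p) ?_
    have hsm : ContDiffAt ℝ ∞ (fun y => dForm (α.pull (Φ₂ ∘ slab d p)) (0, y) (1, 0)
        (Complex.I, 0)) (extChartAt (𝓡 d) p p) :=
      (((contDiffAt_dForm (h₂.contDiffAt_pull_slab hα p hy)).comp _
        (contDiffAt_const.prodMk contDiffAt_id)).clm_apply contDiffAt_const).clm_apply
          contDiffAt_const
    refine hsm.congr_of_eventuallyEq ?_
    filter_upwards [extChartAt_target_mem_nhds (I := 𝓡 d) p] with y hy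
    rw [h₂.dForm_pull_slab hα p hy]
    simp only [map_zero]
    rfl
  -- The target value is `2 f` because `d(r² dφ) = 2 dx ∧ dy`. The factor may be negative, in which
  -- case the stretch also reverses the orientation of the normal plane.
  have hκ : ContMDiff (𝓡 d) 𝓘(ℝ) ∞ fun p => 2 * f p / wn p :=
    (contMDiff_const.mul hfs).div₀ hwzs hwz
  obtain ⟨Φ₃, h₃, hd⟩ := h₂.exists_stretch hκ
  refine ⟨Φ₃, h₃, fun p v => by rw [hd, h₂a], fun p z u hu => ?_, fun p => ?_⟩
  · rw [h₃.tderiv_tangent, ← h₂.tderiv_tangent, hd]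
    exact h₂b p _ u hu
  · rw [hd, hd]
    have h4 : L p (⟨(1 : ℂ).re, 2 * f p / wn p * (1 : ℂ).im⟩, 0) = L p (1, 0) := by
      rw [hLim p ⟨_, _⟩]; simp
    have h5 : L p (⟨Complex.I.re, 2 * f p / wn p * Complex.I.im⟩, 0) =
        (2 * f p / wn p) • L p (Complex.I, 0) := by
      rw [hLim p ⟨_, _⟩]; simp
    change α.dcov (j p) (L p (⟨(1 : ℂ).re, _⟩, 0)) (L p (⟨Complex.I.re, _⟩, 0)) = _
    rw [h4, h5, map_smul, smul_eq_mul]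
    exact div_mul_cancel₀ _ (hwz p)

end GoodTube

/-! ### The standard jet along the zero section -/

section StandardJet

set_option linter.unusedSectionVars false

variable {E : Type} [NormedAddCommGroup E] [NormedSpace ℝ E] [FiniteDimensional ℝ E]

/-- The form `b` on `ℂ × E` agrees with `A + c r² dφ` along `{0} × E` to the order that matters for
the contact structure. -/
structure HasStandardJet (A : E → E →L[ℝ] ℝ) (c : ℝ) (b : ℂ × E → ℂ × E →L[ℝ] ℝ) (y : E) :
    Prop where
  smooth : ContDiffAt ℝ ∞ b (0, y)
  zero : ∀ v, b (0, y) v = A y v.2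
  zeroSection_eq : zeroSection b =ᶠ[𝓝 y] A
  mixed : ∀ z u, A y u = 0 → dForm b (0, y) (z, 0) (0, u) = 0
  normal : dForm b (0, y) (1, 0) (Complex.I, 0) = 2 * c

lemma dForm_swap (b : E → E →L[ℝ] ℝ) (x u v : E) : dForm b x u v = -dForm b x v u := by
  simp

lemma dForm_smul_of_eq_zero {b : E → E →L[ℝ] ℝ} {f : E → ℝ} {y : E} (hf : DifferentiableAt ℝ f y)
    (hb : DifferentiableAt ℝ b y) (h0 : b y = 0) :
    dForm (fun y => f y • b y) y = f y • dForm b y := by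
  ext u v
  rw [dForm_smul hf hb, h0]
  simp

/-- The two forms agree at `(0, y)`, so the derivative of `τ` does not enter the differential there.
What remains is an affine combination of two differentials with the same prescribed values. -/
lemma HasStandardJet.interpolate {A : E → E →L[ℝ] ℝ} {c : ℝ} {b b' : ℂ × E → ℂ × E →L[ℝ] ℝ} {y : E}
    (h : HasStandardJet A c b y) (h' : HasStandardJet A c b' y) {τ : ℂ × E → ℝ}
    (hτ : ContDiffAt ℝ ∞ τ (0, y)) :
    HasStandardJet A c (fun x => b x + τ x • (b' x - b x)) y := by
  have hs : ContDiffAt ℝ ∞ (fun x => b' x - b x) (0, y) := h'.smooth.sub h.smooth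
  have hsm : ContDiffAt ℝ ∞ (fun x => τ x • (b' x - b x)) (0, y) := hτ.smul hs
  have h0 : b' (0, y) - b (0, y) = 0 := by
    refine ContinuousLinearMap.ext fun v => ?_
    rw [_root_.sub_apply, h.zero, h'.zero, sub_self]
    rfl
  have hneg : dForm (fun x => b' x - b x) (0, y) = dForm b' (0, y) - dForm b (0, y) := by
    have h1 : fderiv ℝ (fun x => b' x - b x) (0, y) = _ :=
      ((h'.smooth.differentiableAt (by simp)).hasFDerivAt.sub
        (h.smooth.differentiableAt (by simp)).hasFDerivAt).fderiv
    rw [dForm, h1]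
    refine ContinuousLinearMap.ext fun u => ContinuousLinearMap.ext fun v => ?_
    simp
    ring
  have hd : dForm (fun x => b x + τ x • (b' x - b x)) (0, y) =
      dForm b (0, y) + τ (0, y) • (dForm b' (0, y) - dForm b (0, y)) := by
    rw [dForm_add (h.smooth.differentiableAt (by simp))
      (hsm.differentiableAt (by simp)), dForm_smul_of_eq_zero
      (hτ.differentiableAt (by simp)) (hs.differentiableAt (by simp)) h0, hneg]
  refine ⟨h.smooth.add (hτ.smul hs), fun v => ?_, ?_, fun z u hu => ?_, ?_⟩
  · simp only [h0, smul_zero, add_zero, h.zero]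
  · filter_upwards [h.zeroSection_eq, h'.zeroSection_eq] with z h1 h2
    have h3 : zeroSection (fun x => b x + τ x • (b' x - b x)) z =
      zeroSection b z + τ (0, z) • (zeroSection b' z - zeroSection b z) := rfl
    rw [h3, h1, h2, sub_self, smul_zero, add_zero]
  · rw [hd]
    simp only [_root_.add_apply, _root_.smul_apply, _root_.sub_apply, h.mixed z u hu,
      h'.mixed z u hu]
    simp
  · rw [hd]
    simp only [_root_.add_apply, _root_.smul_apply, _root_.sub_apply, h.normal, h'.normal]
    simp

/-- The kernel at `(0, y)` is the sum of `ℂ` and `ker A`, and the differential is block diagonal on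
it: `2 c` times the area form on the first summand, the differential of `A` on the second. Both
blocks are non-degenerate. -/
lemma HasStandardJet.isContactPair {A : E → E →L[ℝ] ℝ} {c : ℝ} {b : ℂ × E → ℂ × E →L[ℝ] ℝ} {y : E}
    (h : HasStandardJet A c b y) (hc : c ≠ 0) (hA : IsContactPair (A y) (dForm A y)) :
    IsContactPair (b (0, y)) (dForm b (0, y)) := by
  have hsec : ∀ u v, dForm b (0, y) (0, u) (0, v) = dForm A y u v := fun u v => by
    rw [← dForm_zeroSection h.smooth, dForm_congr h.zeroSection_eq]
  constructor
  · intro h0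
    refine hA.1 ?_
    ext u
    rw [← h.zero (0, u), h0]
    rfl
  · intro u hu hw
    rw [h.zero] at hu
    have hz : ∀ z : ℂ, ((z, 0) : ℂ × E) = z.re • ((1 : ℂ), (0 : E)) + z.im • (Complex.I, (0 : E)) := by
      intro z
      refine Prod.ext ?_ (by simp)
      apply Complex.ext <;> simp
    have hu' : u = (u.1, 0) + (0, u.2) := by simp
    have hself : ∀ v, dForm b (0, y) v v = 0 := fun v => by simp
    have hn : ∀ z z' : ℂ, dForm b (0, y) (z, 0) (z', 0) =
        2 * c * (z.re * z'.im - z.im * z'.re) := by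
      intro z z'
      rw [hz z, hz z']
      simp only [map_add, map_smul, _root_.add_apply, _root_.smul_apply, hself, h.normal,
        dForm_swap b (0, y) (Complex.I, 0) (1, 0), smul_eq_mul]
      ring
    have hu2 : u.2 = 0 := by
      refine hA.2 _ hu fun v hv => ?_
      have h1 := hw (0, v) (by rw [h.zero]; exact hv)
      rw [hu', map_add, _root_.add_apply, h.mixed _ _ hv, zero_add, hsec] at h1
      exact h1
    have hw' : ∀ z' : ℂ, 2 * c * (u.1.re * z'.im - u.1.im * z'.re) = 0 := by
      intro z'
      have h1 := hw (z', 0) (by rw [h.zero]; exact map_zero _)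
      have h2 : u = (u.1, 0) := Prod.ext rfl hu2
      rw [h2, hn] at h1
      exact h1
    have h1 := hw' Complex.I
    have h2 := hw' 1
    refine Prod.ext (Complex.ext ?_ ?_) hu2
    · simpa [hc] using h1
    · simpa [hc] using h2

/-- The form `r² dφ`. -/
def angularCLM : ℂ →L[ℝ] ℂ →L[ℝ] ℝ :=
  Complex.reCLM.smulRight Complex.imCLM - Complex.imCLM.smulRight Complex.reCLM

@[simp] lemma angularCLM_apply (z w : ℂ) : angularCLM z w = angularForm z w := rfl

/-- The form `f (a + r² dφ)`. -/
def discModel (f : E → ℝ) (a : E → E →L[ℝ] ℝ) (x : ℂ × E) : ℂ × E →L[ℝ] ℝ :=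
  f x.2 • ((a x.2).comp (ContinuousLinearMap.snd ℝ ℂ E) +
    (angularCLM x.1).comp (ContinuousLinearMap.fst ℝ ℂ E))

lemma discModel_apply (f : E → ℝ) (a : E → E →L[ℝ] ℝ) (x v : ℂ × E) :
    discModel f a x v = f x.2 * (a x.2 v.2 + angularForm x.1 v.1) := rfl

lemma contDiffAt_discModel {f : E → ℝ} {a : E → E →L[ℝ] ℝ} {x : ℂ × E}
    (hf : ContDiffAt ℝ ∞ f x.2) (ha : ContDiffAt ℝ ∞ a x.2) :
    ContDiffAt ℝ ∞ (discModel f a) x :=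
  (hf.comp x contDiffAt_snd).smul (((ha.comp x contDiffAt_snd).clm_comp contDiffAt_const).add
    ((angularCLM.contDiff.contDiffAt.comp x contDiffAt_fst).clm_comp contDiffAt_const))

/-- The form `r² dφ` vanishes at the origin, hence the derivative of `f` contributes nothing there
except through `f a`, and `d(r² dφ) = 2 dx ∧ dy` gives the normal value. -/
lemma hasStandardJet_discModel {f : E → ℝ} {a : E → E →L[ℝ] ℝ} {y : E}
    (hf : ContDiffAt ℝ ∞ f y) (ha : ContDiffAt ℝ ∞ a y) :
    HasStandardJet (fun y => f y • a y) (f y) (discModel f a) y := by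
  have hA : ContDiffAt ℝ ∞ (fun y => f y • a y) y := hf.smul ha
  have h1 : ContDiffAt ℝ ∞ (pullVec (Prod.snd : ℂ × E → E) (fun y => f y • a y)) (0, y) :=
    contDiffAt_pullVec contDiffAt_snd hA
  have h2 : ContDiffAt ℝ ∞ (pullVec (Prod.fst : ℂ × E → ℂ) angularCLM) (0, y) :=
    contDiffAt_pullVec contDiffAt_fst angularCLM.contDiff.contDiffAt
  have hf' : ContDiffAt ℝ ∞ (fun x : ℂ × E => f x.2) (0, y) := hf.comp (0, y) contDiffAt_snd
  have hf2 : ContDiffAt ℝ ∞ (fun x : ℂ × E => f x.2 • pullVec (Prod.fst : ℂ × E → ℂ) angularCLM x)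
    (0, y) := hf'.smul h2
  have hsplit : discModel f a = fun x => pullVec (Prod.snd : ℂ × E → E) (fun y => f y • a y) x +
      f x.2 • pullVec (Prod.fst : ℂ × E → ℂ) angularCLM x := by
    refine funext fun x => ContinuousLinearMap.ext fun v => ?_
    rw [discModel_apply]
    simp only [pullVec, fderiv_snd, fderiv_fst]
    simp
    ring
  have h0 : pullVec (Prod.fst : ℂ × E → ℂ) angularCLM (0, y) = 0 := by
    refine ContinuousLinearMap.ext fun v => ?_
    simp [pullVec]
  have hd : ∀ u v, dForm (discModel f a) (0, y) u v =
      dForm (fun y => f y • a y) y u.2 v.2 + f y * (2 * angularForm u.1 v.1) := by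
    intro u v
    rw [hsplit, dForm_add (h1.differentiableAt (by simp)) (hf2.differentiableAt (by simp)),
      dForm_smul_of_eq_zero (hf'.differentiableAt (by simp)) (h2.differentiableAt (by simp)) h0,
      _root_.add_apply, _root_.add_apply,
      dForm_pullVec contDiffAt_snd (hA.differentiableAt (by simp)), _root_.smul_apply,
      _root_.smul_apply, dForm_pullVec contDiffAt_fst
        (angularCLM.contDiff.contDiffAt.differentiableAt (n := ∞) (by simp))]
    simp only [fderiv_snd, fderiv_fst, ContinuousLinearMap.coe_fst', ContinuousLinearMap.coe_snd',
      dForm_apply angularCLM, ContinuousLinearMap.fderiv, angularCLM_apply, smul_eq_mul]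
    congr 2
    simp only [angularForm]
    ring
  refine ⟨contDiffAt_discModel hf ha, fun v => ?_, ?_, fun z u hu => ?_, ?_⟩
  · rw [discModel_apply]
    simp [angularForm]
  · refine Filter.Eventually.of_forall fun z => ?_
    ext u
    change discModel f a (0, z) (0, u) = _
    rw [discModel_apply]
    simp [angularForm]
  · rw [hd]
    simp [angularForm]
  · rw [hd]
    simp [angularForm]
    ring

/-- The contact condition only depends on the conformal class. -/
lemma isContactPair_of_conformal {b c : E → E →L[ℝ] ℝ} {x : E} (hb : ContDiffAt ℝ ∞ b x)
    (hc : ContDiffAt ℝ ∞ c x) (hcb : IsContactPair (b x) (dForm b x))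
    (h : ∀ᶠ x in 𝓝 x, ∃ l : ℝ, 0 < l ∧ ∀ v, c x v = l * b x v) :
    IsContactPair (c x) (dForm c x) := by
  refine ⟨fun h0 => hcb.1 ?_, fun u hu hw => ?_⟩
  · obtain ⟨l, hl0, hl⟩ := h.self_of_nhds
    refine ContinuousLinearMap.ext fun v => ?_
    have h1 := hl v
    rw [h0] at h1
    exact (mul_eq_zero.1 h1.symm).resolve_left hl0.ne'
  · obtain ⟨w, hw0⟩ : ∃ w, b x w ≠ 0 := by
      by_contra! h0
      exact hcb.1 (by ext w; exact h0 w)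
    have hbw : ContDiffAt ℝ ∞ (fun x => b x w) x := hb.clm_apply contDiffAt_const
    -- The conformal factor is given only pointwise; evaluation on a fixed vector shows that it is
    -- smooth.
    have hl : ContDiffAt ℝ ∞ (fun x => c x w / b x w) x :=
      (hc.clm_apply contDiffAt_const).div hbw hw0
    have heq : c =ᶠ[𝓝 x] fun x => (c x w / b x w) • b x := by
      filter_upwards [h, hbw.continuousAt.eventually_ne hw0] with z ⟨l, _, hl⟩ hz
      ext v
      rw [_root_.smul_apply, hl, hl, mul_div_cancel_right₀ _ hz, smul_eq_mul]
    obtain ⟨l, hl0, hlx⟩ := h.self_of_nhds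
    have hbu : b x u = 0 := by
      rw [hlx] at hu
      exact (mul_eq_zero.1 hu).resolve_left hl0.ne'
    refine hcb.2 u hbu fun v hv => ?_
    have h1 := hw v (by rw [hlx, hv, mul_zero])
    rw [dForm_congr heq, dForm_smul (hl.differentiableAt (by simp)) (hb.differentiableAt (by simp)),
      hbu, hv, hlx, mul_div_cancel_right₀ _ hw0, mul_zero, mul_zero, add_zero, sub_zero] at h1
    exact (mul_eq_zero.1 h1).resolve_left hl0.ne'

end StandardJet

/-! ### Moser's method along the zero section, one chart at a time -/

section Moser

set_option linter.unusedSectionVars false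

variable {d e : ℕ} {N M : Type u}
  [TopologicalSpace N] [ChartedSpace (EuclideanSpace ℝ (Fin d)) N] [IsManifold (𝓡 d) ∞ N]
  [TopologicalSpace M] [ChartedSpace (EuclideanSpace ℝ (Fin e)) M] [IsManifold (𝓡 e) ∞ M]
  {j : N → M} {Φ Ψ : ℂ × N → M} {α : OneForm e M} {αN : OneForm d N} {f : N → ℝ}

/-- The tube map `Φ` induces the contact structure of `α_N + r² dφ` along the zero section. -/
structure IsStandardTube (α : OneForm e M) (αN : OneForm d N) (f : N → ℝ) (j : N → M)
    (Φ : ℂ × N → M) : Prop extends IsTubeMap d e j Φ where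
  factor_smooth : ContMDiff (𝓡 d) 𝓘(ℝ) ∞ f
  factor_pos : ∀ p, 0 < f p
  form_zero : ∀ p v, α.cov (j p) (tderiv (𝓘(ℝ, ℂ).prod (𝓡 d)) (𝓡 e) Φ (0, p) v) =
    f p * αN.cov p v.2
  form_mixed : ∀ p z u, αN.cov p u = 0 →
    α.dcov (j p) (tderiv (𝓘(ℝ, ℂ).prod (𝓡 d)) (𝓡 e) Φ (0, p) (z, 0))
      (tderiv (𝓘(ℝ, ℂ).prod (𝓡 d)) (𝓡 e) Φ (0, p) (0, u)) = 0
  form_normal : ∀ p, α.dcov (j p) (tderiv (𝓘(ℝ, ℂ).prod (𝓡 d)) (𝓡 e) Φ (0, p) (1, 0))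
    (tderiv (𝓘(ℝ, ℂ).prod (𝓡 d)) (𝓡 e) Φ (0, p) (Complex.I, 0)) = 2 * f p

lemma IsStandardTube.hasStandardJet (h : IsStandardTube α αN f j Φ) (hα : ∀ x, α.SmoothAt x) (i : N)
    {y : EuclideanSpace ℝ (Fin d)} (hy : y ∈ (extChartAt (𝓡 d) i).target) :
    HasStandardJet (fun y => f ((extChartAt (𝓡 d) i).symm y) • αN.pull (extChartAt (𝓡 d) i).symm y)
      (f ((extChartAt (𝓡 d) i).symm y)) (α.pull (Φ ∘ slab d i)) y := by
  have ht := h.toIsTubeMap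
  have hf : ∀ p u, α.cov (j p) (tderiv (𝓡 d) (𝓡 e) j p u) = f p * αN.cov p u := fun p u => by
    rw [← ht.tderiv_tangent, h.form_zero]
  refine ⟨ht.contDiffAt_pull_slab hα i hy, fun v => ?_, ?_, fun z u hu => ?_, ?_⟩
  · rw [ht.pull_slab_apply α i hy, h.form_zero]
    rfl
  · filter_upwards [(isOpen_extChartAt_target i).mem_nhds hy] with z hz
    exact ht.zeroSection_pull_slab hf i hz
  · rw [ht.dForm_pull_slab hα i hy]
    simp only [map_zero]
    refine h.form_mixed _ _ _ ?_
    exact (mul_eq_zero.1 hu).resolve_left (h.factor_pos _).ne'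
  · rw [ht.dForm_pull_slab hα i hy]
    simp only [map_zero]
    exact h.form_normal _

/-- The interpolation between the pull-back of `α` under `Φ` and the model form. -/
def tubeForm (α : OneForm e M) (αN : OneForm d N) (f : N → ℝ) (Φ : ℂ × N → M) (τ : N → ℝ)
    (q : ℂ × N) (v : ℂ × EuclideanSpace ℝ (Fin d)) : ℝ :=
  α.cov (Φ q) (tderiv (𝓘(ℝ, ℂ).prod (𝓡 d)) (𝓡 e) Φ q v) + τ q.2 *
    (f q.2 * (αN.cov q.2 v.2 + angularForm q.1 v.1) -
      α.cov (Φ q) (tderiv (𝓘(ℝ, ℂ).prod (𝓡 d)) (𝓡 e) Φ q v))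

/-- The local representation of `tubeForm` in the chart at `i`. -/
def slabForm (α : OneForm e M) (αN : OneForm d N) (f : N → ℝ) (Φ : ℂ × N → M) (i : N) (τ : N → ℝ)
    (x : ℂ × EuclideanSpace ℝ (Fin d)) : ℂ × EuclideanSpace ℝ (Fin d) →L[ℝ] ℝ :=
  α.pull (Φ ∘ slab d i) x + τ ((extChartAt (𝓡 d) i).symm x.2) •
    (discModel (fun y => f ((extChartAt (𝓡 d) i).symm y)) (αN.pull (extChartAt (𝓡 d) i).symm) x -
      α.pull (Φ ∘ slab d i) x)

/-- This identity carries the Moser maps, which are built in a chart of `N`, back to statements on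
`ℂ × N`. -/
lemma slabForm_apply (τ : N → ℝ) {i : N} {x : ℂ × EuclideanSpace ℝ (Fin d)}
    (hx : x.2 ∈ (extChartAt (𝓡 d) i).target)
    (hΦ : MDifferentiableAt (𝓘(ℝ, ℂ).prod (𝓡 d)) (𝓡 e) Φ (slab d i x))
    (v : ℂ × EuclideanSpace ℝ (Fin d)) :
    slabForm α αN f Φ i τ x v = tubeForm α αN f Φ τ (slab d i x)
      (tderiv 𝓘(ℝ, ℂ × EuclideanSpace ℝ (Fin d)) (𝓘(ℝ, ℂ).prod (𝓡 d)) (slab d i) x v) := by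
  have h1 : α.pull (Φ ∘ slab d i) x v = α.cov (Φ (slab d i x))
      (tderiv (𝓘(ℝ, ℂ).prod (𝓡 d)) (𝓡 e) Φ (slab d i x)
        (tderiv 𝓘(ℝ, ℂ × EuclideanSpace ℝ (Fin d)) (𝓘(ℝ, ℂ).prod (𝓡 d)) (slab d i) x v)) := by
    rw [← tderiv_comp_apply hΦ ((contMDiffAt_slab hx).mdifferentiableAt (by simp)) rfl]
    rfl
  have h2 : slabForm α αN f Φ i τ x v = α.pull (Φ ∘ slab d i) x v +
      τ ((extChartAt (𝓡 d) i).symm x.2) * (f ((extChartAt (𝓡 d) i).symm x.2) *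
        (αN.pull (extChartAt (𝓡 d) i).symm x.2 v.2 + angularForm x.1 v.1) -
        α.pull (Φ ∘ slab d i) x v) := rfl
  rw [h2, h1, tubeForm, tderiv_slab hx]
  rfl

lemma eventually_contDiffAt_slabForm (h : IsTubeMap d e j Φ) (hα : ∀ x, α.SmoothAt x)
    (hαN : ∀ x, αN.SmoothAt x) (hf : ContMDiff (𝓡 d) 𝓘(ℝ) ∞ f) {τ : N → ℝ}
    (hτ : ContMDiff (𝓡 d) 𝓘(ℝ) ∞ τ) (i : N)
    {y : EuclideanSpace ℝ (Fin d)} (hy : y ∈ (extChartAt (𝓡 d) i).target) :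
    ∀ᶠ x in 𝓝 ((0 : ℂ), y), ContDiffAt ℝ ∞ (slabForm α αN f Φ i τ) x := by
  filter_upwards [h.eventually_comp_slab i hy] with x ⟨hx, _, hx2⟩
  have h1 : ContDiffAt ℝ ∞ (α.pull (Φ ∘ slab d i)) x := (hα _).contDiffAt_pull hx2
  have h2 : ContDiffAt ℝ ∞ (fun x : ℂ × EuclideanSpace ℝ (Fin d) =>
      τ ((extChartAt (𝓡 d) i).symm x.2)) x :=
    (contDiffAt_comp_chart_symm hx hτ.contMDiffAt).comp x contDiffAt_snd
  exact h1.add (h2.smul ((contDiffAt_discModel (contDiffAt_comp_chart_symm hx hf.contMDiffAt)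
    ((hαN _).contDiffAt_pull (contMDiffAt_extChartAt_symm i hx))).sub h1))

/-- The pull-back of `α` and the model have the same standard jet, and `HasStandardJet.interpolate`
keeps it for every smooth weight. There is no restriction to values in `[0, 1]`, so partial sums of
a partition of unity need no separate care. -/
lemma IsStandardTube.isContactPair_slabForm (h : IsStandardTube α αN f j Φ)
    (hα : ∀ x, α.SmoothAt x) (hαN : ∀ x, αN.SmoothAt x) (hcN : ∀ x, αN.ContactAt x) {τ : N → ℝ}
    (hτ : ContMDiff (𝓡 d) 𝓘(ℝ) ∞ τ) (i : N)
    {y : EuclideanSpace ℝ (Fin d)} (hy : y ∈ (extChartAt (𝓡 d) i).target) :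
    IsContactPair (slabForm α αN f Φ i τ (0, y)) (dForm (slabForm α αN f Φ i τ) (0, y)) ∧
    ∀ v, slabForm α αN f Φ i τ (0, y) v =
      f ((extChartAt (𝓡 d) i).symm y) * αN.pull (extChartAt (𝓡 d) i).symm y v.2 := by
  have hfs := contDiffAt_comp_chart_symm hy (h.factor_smooth.contMDiffAt)
  have has := (hαN _).contDiffAt_pull (contMDiffAt_extChartAt_symm i hy)
  have hτs := contDiffAt_comp_chart_symm hy (hτ.contMDiffAt)
  have hj := (h.hasStandardJet hα i hy).interpolate (hasStandardJet_discModel hfs has)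
    (τ := fun x => τ ((extChartAt (𝓡 d) i).symm x.2)) (ContDiffAt.comp
      (g := fun y => τ ((extChartAt (𝓡 d) i).symm y)) ((0 : ℂ), y) hτs contDiffAt_snd)
  refine ⟨hj.isContactPair (h.factor_pos _).ne' ?_, hj.zero⟩
  exact isContactPair_smul (hfs.differentiableAt (by simp)) (has.differentiableAt (by simp))
    (h.factor_pos _).ne' (OneForm.isContactPair_pull_chart_symm hαN hcN i hy)

lemma contMDiffAt_prod_chart {i : N} {q : ℂ × N} (hq : q.2 ∈ (extChartAt (𝓡 d) i).source) :
    ContMDiffAt (𝓘(ℝ, ℂ).prod (𝓡 d)) 𝓘(ℝ, ℂ × EuclideanSpace ℝ (Fin d)) ∞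
      (fun q : ℂ × N => (q.1, extChartAt (𝓡 d) i q.2)) q :=
  contMDiffAt_fst.prodMk_space (ContMDiffAt.comp q
    (contMDiffAt_extChartAt' (by rwa [← extChartAt_source (𝓡 d)])) contMDiffAt_snd)

/-- One step of Moser's method, in the chart at `i`. -/
lemma IsStandardTube.exists_moser_step [CompactSpace N] (h : IsStandardTube α αN f j Φ)
    (hα : ∀ x, α.SmoothAt x) (hαN : ∀ x, αN.SmoothAt x) (hcN : ∀ x, αN.ContactAt x)
    {σ ρ : N → ℝ} (hσ : ContMDiff (𝓡 d) 𝓘(ℝ) ∞ σ) (hρ : ContMDiff (𝓡 d) 𝓘(ℝ) ∞ ρ) (i : N)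
    (hsupp : tsupport ρ ⊆ (extChartAt (𝓡 d) i).source) (hΨ : IsTubeMap d e j Ψ)
    (hl : ∀ p, ∀ᶠ q in 𝓝 ((0 : ℂ), p), ∃ l : ℝ, 0 < l ∧ ∀ v,
      α.cov (Ψ q) (tderiv (𝓘(ℝ, ℂ).prod (𝓡 d)) (𝓡 e) Ψ q v) = l * tubeForm α αN f Φ σ q v) :
    ∃ Ψ', IsTubeMap d e j Ψ' ∧ ∀ p, ∀ᶠ q in 𝓝 ((0 : ℂ), p), ∃ l : ℝ, 0 < l ∧ ∀ v,
      α.cov (Ψ' q) (tderiv (𝓘(ℝ, ℂ).prod (𝓡 d)) (𝓡 e) Ψ' q v) =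
        l * tubeForm α αN f Φ (σ + ρ) q v := by
  classical
  let φ := extChartAt (𝓡 d) i
  let K : Set (ℂ × EuclideanSpace ℝ (Fin d)) := {0} ×ˢ (φ '' tsupport ρ)
  have hK : IsCompact K := isCompact_singleton.prod
    ((isClosed_tsupport ρ).isCompact.image_of_continuousOn
      ((continuousOn_extChartAt i).mono hsupp))
  have hKt : ∀ x ∈ K, x = (0, x.2) ∧ x.2 ∈ φ.target := by
    rintro ⟨z, y⟩ ⟨hz, p, hp, hpy⟩
    rw [mem_singleton_iff] at hz
    dsimp only at hz hpy ⊢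
    exact ⟨by rw [hz], by rw [← hpy]; exact φ.map_source (hsupp hp)⟩
  let b := slabForm α αN f Φ i (σ + ρ)
  -- The path ends at weight `σ` and starts at `σ + ρ`, so that the Moser map pulls the form that
  -- `Ψ` already realizes back to a multiple of the one wanted next.
  let g := fun x => slabForm α αN f Φ i σ x - slabForm α αN f Φ i (σ + ρ) x
  have hσρ : ContMDiff (𝓡 d) 𝓘(ℝ) ∞ (σ + ρ) := hσ.add hρ
  have hdiff : ∀ x, g x = ρ (φ.symm x.2) • (α.pull (Φ ∘ slab d i) x -
      discModel (fun y => f (φ.symm y)) (αN.pull φ.symm) x) := by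
    intro x
    simp only [g, slabForm, Pi.add_apply]
    module
  have hev : ∀ {τ : N → ℝ}, ContMDiff (𝓡 d) 𝓘(ℝ) ∞ τ →
      ∀ᶠ x in 𝓝ˢ K, ContDiffAt ℝ ∞ (slabForm α αN f Φ i τ) x := by
    intro τ hτ
    rw [eventually_nhdsSet_iff_forall]
    intro x hx
    rw [(hKt x hx).1]
    exact eventually_contDiffAt_slabForm h.toIsTubeMap hα hαN h.factor_smooth hτ i (hKt x hx).2
  have hg0 : ∀ y ∈ φ.target, g (0, y) = 0 := by
    intro y hy
    refine ContinuousLinearMap.ext fun v => ?_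
    change slabForm α αN f Φ i σ (0, y) v - slabForm α αN f Φ i (σ + ρ) (0, y) v = 0
    rw [(h.isContactPair_slabForm hα hαN hcN hσ i hy).2,
      (h.isContactPair_slabForm hα hαN hcN hσρ i hy).2, sub_self]
  have hcont : ∀ x ∈ K, ∀ s ∈ Icc (0 : ℝ) 1,
      IsContactPair (b x) (dForm b x + s • dForm g x) := by
    intro x hx s _
    obtain ⟨hx1, hx2⟩ := hKt x hx
    -- Each form `b + s g` of the path is again a `slabForm`, with this weight, and so satisfies the
    -- contact condition along the zero section.
    have hτ : ContMDiff (𝓡 d) 𝓘(ℝ) ∞ fun p => (σ + ρ) p - s * ρ p :=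
      hσρ.sub (contMDiff_const.mul hρ)
    have hc := (h.isContactPair_slabForm hα hαN hcN hτ i hx2)
    have hc' := (h.isContactPair_slabForm hα hαN hcN hσρ i hx2).2
    rw [← hx1] at hc hc'
    have hbx : slabForm α αN f Φ i (fun p => (σ + ρ) p - s * ρ p) x = b x :=
      ContinuousLinearMap.ext fun v => by rw [hc.2, hc']
    have hfun : slabForm α αN f Φ i (fun p => (σ + ρ) p - s * ρ p) = fun x => b x + s • g x := by
      funext x
      rw [hdiff]
      simp only [b, slabForm, Pi.add_apply, φ]
      module
    have hbs := ((hev hσρ).self_of_nhdsSet x hx).differentiableAt (by simp : (∞ : WithTop ℕ∞) ≠ 0)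
    have hgs : DifferentiableAt ℝ g x :=
      (((hev hσ).self_of_nhdsSet x hx).differentiableAt (by simp)).sub hbs
    have hd : dForm (fun x => b x + s • g x) x = dForm b x + s • dForm g x := by
      have h1 : fderiv ℝ (fun x => b x + s • g x) x = _ :=
        (hbs.hasFDerivAt.add (hgs.hasFDerivAt.const_smul s)).fderiv
      rw [dForm, h1]
      refine ContinuousLinearMap.ext fun u => ContinuousLinearMap.ext fun v => ?_
      simp
      ring
    rw [← hd, ← hfun, ← hbx]
    exact hc.1
  obtain ⟨ψ, hψ, hψ0, hψl⟩ := exists_moser_map hK (hev hσρ) ((hev hσ).and (hev hσρ) |>.mono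
    fun x hx => hx.1.sub hx.2) (fun x hx => by rw [(hKt x hx).1]; exact hg0 _ (hKt x hx).2) hcont
  let c : ℂ × N → ℂ × EuclideanSpace ℝ (Fin d) := fun q => (q.1, φ q.2)
  -- The difference `g` carries a factor `ρ`, so `ψ` fixes every point over a zero of `ρ`. As `ρ` is
  -- supported inside the chart, extension by the identity is smooth along the zero section.
  let W : ℂ × N → ℂ × N := fun q => if q.2 ∈ φ.source then slab d i (ψ (c q)) else q
  have hslab : ∀ q : ℂ × N, q.2 ∈ φ.source → slab d i (c q) = q := fun q hq =>
    Prod.ext rfl (φ.left_inv hq)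
  have hWid : ∀ q : ℂ × N, ρ q.2 = 0 → W q = q := by
    intro q hq
    by_cases hs : q.2 ∈ φ.source
    · simp only [W, if_pos hs]
      have hleft : φ.symm (c q).2 = q.2 := φ.left_inv hs
      rw [hψ0 _ (show g (c q) = 0 by rw [hdiff, hleft, hq, zero_smul]), hslab q hs]
    · simp only [W, if_neg hs]
  have hsource : ∀ p ∈ φ.source, ∀ᶠ q in 𝓝 ((0 : ℂ), p), q.2 ∈ φ.source := fun p hp =>
    continuousAt_snd.eventually ((isOpen_extChartAt_source i).mem_nhds hp)
  have hψc : ∀ p ∈ φ.source, ψ (c (0, p)) = (0, φ p) := fun p hp =>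
    hψ0 _ (hg0 _ (φ.map_source hp))
  have hcc : ∀ p ∈ φ.source, Filter.Tendsto (fun q => ψ (c q)) (𝓝 ((0 : ℂ), p)) (𝓝 (0, φ p)) := by
    intro p hp
    rw [← hψc p hp]
    exact ContinuousAt.comp (f := c) (g := ψ) hψ.continuous.continuousAt
      (contMDiffAt_prod_chart (q := ((0 : ℂ), p)) hp).continuousAt
  have htarget : ∀ p ∈ φ.source, ∀ᶠ q in 𝓝 ((0 : ℂ), p), (ψ (c q)).2 ∈ φ.target := by
    intro p hp
    refine (hcc p hp).eventually (p := fun x => x.2 ∈ φ.target) ?_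
    exact continuousAt_snd.eventually ((isOpen_extChartAt_target i).mem_nhds (φ.map_source hp))
  have hWeq : ∀ q : ℂ × N, q.2 ∈ φ.source → W =ᶠ[𝓝 q] fun q => slab d i (ψ (c q)) := by
    intro q hq
    filter_upwards [continuousAt_snd.eventually ((isOpen_extChartAt_source i).mem_nhds hq)]
      with z hz
    simp only [W]
    exact if_pos hz
  have hW0 : ∀ p, W (0, p) = (0, p) := by
    intro p
    by_cases hs : p ∈ φ.source
    · have h1 : W (0, p) = slab d i (ψ (c (0, p))) := if_pos hs
      rw [h1, hψc p hs]
      exact hslab (0, p) hs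
    · exact if_neg hs
  have hoff : ∀ p, p ∉ tsupport ρ → ∀ᶠ q in 𝓝 ((0 : ℂ), p), W =ᶠ[𝓝 q] id ∧ ρ q.2 = 0 := by
    intro p hp
    have hopen : IsOpen {q : ℂ × N | q.2 ∈ (tsupport ρ)ᶜ} :=
      (isClosed_tsupport ρ).isOpen_compl.preimage continuous_snd
    filter_upwards [hopen.mem_nhds (x := ((0 : ℂ), p)) hp] with q hq
    refine ⟨?_, image_eq_zero_of_notMem_tsupport hq⟩
    filter_upwards [hopen.mem_nhds hq] with z hz
    exact hWid z (image_eq_zero_of_notMem_tsupport hz)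
  have hsm : ∀ q : ℂ × N, q.2 ∈ φ.source → (ψ (c q)).2 ∈ φ.target →
      ContMDiffAt (𝓘(ℝ, ℂ).prod (𝓡 d)) (𝓘(ℝ, ℂ).prod (𝓡 d)) ∞ (fun q => slab d i (ψ (c q))) q :=
    fun q h1 h2 => ContMDiffAt.comp q (contMDiffAt_slab h2)
      (ContMDiffAt.comp q (contMDiffAt_iff_contDiffAt.2 hψ.contDiffAt) (contMDiffAt_prod_chart h1))
  have hWs : ∀ p, ∀ᶠ q in 𝓝 ((0 : ℂ), p),
      ContMDiffAt (𝓘(ℝ, ℂ).prod (𝓡 d)) (𝓘(ℝ, ℂ).prod (𝓡 d)) ∞ W q := by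
    intro p
    by_cases hp : p ∈ tsupport ρ
    · filter_upwards [hsource p (hsupp hp), htarget p (hsupp hp)] with q h1 h2
      exact (hsm q h1 h2).congr_of_eventuallyEq (hWeq q h1)
    · filter_upwards [hoff p hp] with q hq
      exact contMDiffAt_id.congr_of_eventuallyEq hq.1
  refine ⟨Ψ ∘ W, hΨ.comp hW0 hWs, fun p => ?_⟩
  by_cases hp : p ∈ tsupport ρ
  · have hps := hsupp hp
    have hWp : slab d i (ψ (c (0, p))) = (0, p) := by
      rw [hψc p hps]; exact hslab (0, p) hps
    have hWc : Filter.Tendsto (fun q => slab d i (ψ (c q))) (𝓝 ((0 : ℂ), p)) (𝓝 (0, p)) := by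
      have := (hsm (0, p) hps (by rw [hψc p hps]; exact φ.map_source hps)).continuousAt
      rwa [ContinuousAt, hWp] at this
    have hcq : ContinuousAt c ((0 : ℂ), p) :=
      (contMDiffAt_prod_chart (q := ((0 : ℂ), p)) hps).continuousAt
    have hmos := hcq.eventually ((eventually_nhdsSet_iff_forall.1 hψl) (0, φ p)
      ⟨rfl, mem_image_of_mem φ hp⟩)
    filter_upwards [hsource p hps, htarget p hps, hmos,
      hWc.eventually (hl p), hWc.eventually (hΨ.smooth p),
      hWc.eventually (h.smooth p), h.smooth p] with q h1 h2 ⟨l, hl0, h3⟩ ⟨m, hm0, h4⟩ h5 h6 h7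
    refine ⟨m * l, mul_pos hm0 hl0, fun v => ?_⟩
    have hWq : W q = slab d i (ψ (c q)) := if_pos h1
    have hdW : tderiv (𝓘(ℝ, ℂ).prod (𝓡 d)) (𝓘(ℝ, ℂ).prod (𝓡 d)) W q v =
        tderiv 𝓘(ℝ, ℂ × EuclideanSpace ℝ (Fin d)) (𝓘(ℝ, ℂ).prod (𝓡 d)) (slab d i) (ψ (c q))
          (fderiv ℝ ψ (c q) (tderiv (𝓘(ℝ, ℂ).prod (𝓡 d)) 𝓘(ℝ, ℂ × EuclideanSpace ℝ (Fin d)) c q v)) := by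
      have e1 : (fun q => slab d i (ψ (c q))) = slab d i ∘ (ψ ∘ c) := rfl
      have hcd := (contMDiffAt_prod_chart (i := i) h1).mdifferentiableAt
        (by simp : (∞ : WithTop ℕ∞) ≠ 0)
      have hψd : MDifferentiableAt 𝓘(ℝ, ℂ × EuclideanSpace ℝ (Fin d))
        𝓘(ℝ, ℂ × EuclideanSpace ℝ (Fin d)) ψ (c q) :=
        (hψ.differentiable (by simp) _).mdifferentiableAt
      rw [tderiv_congr (hWeq q h1), e1, tderiv_comp_apply
        ((contMDiffAt_slab h2).mdifferentiableAt (by simp)) (hψd.comp q hcd) rfl,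
        tderiv_comp_apply hψd hcd rfl, tderiv_eq_fderiv]
    have hid : tderiv 𝓘(ℝ, ℂ × EuclideanSpace ℝ (Fin d)) (𝓘(ℝ, ℂ).prod (𝓡 d)) (slab d i) (c q)
        (tderiv (𝓘(ℝ, ℂ).prod (𝓡 d)) 𝓘(ℝ, ℂ × EuclideanSpace ℝ (Fin d)) c q v) = v :=
      tderiv_left_inverse rfl ((contMDiffAt_prod_chart (i := i) h1).mdifferentiableAt (by simp))
        ((contMDiffAt_slab (φ.map_source h1)).mdifferentiableAt (by simp))
        (by filter_upwards [continuousAt_snd.eventually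
              ((isOpen_extChartAt_source (I := 𝓡 d) i).mem_nhds h1)] with z hz
            exact hslab z hz) v
    have h7' : MDifferentiableAt (𝓘(ℝ, ℂ).prod (𝓡 d)) (𝓡 e) Φ (slab d i (c q)) := by
      rw [hslab q h1]; exact h7.mdifferentiableAt (by simp)
    have hWd : MDifferentiableAt (𝓘(ℝ, ℂ).prod (𝓡 d)) (𝓘(ℝ, ℂ).prod (𝓡 d)) W q :=
      ((hsm q h1 h2).congr_of_eventuallyEq (hWeq q h1)).mdifferentiableAt (by simp)
    have h8 := slabForm_apply (α := α) (αN := αN) (f := f) (σ + ρ) (φ.map_source h1) h7'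
      (tderiv (𝓘(ℝ, ℂ).prod (𝓡 d)) 𝓘(ℝ, ℂ × EuclideanSpace ℝ (Fin d)) c q v)
    rw [hid, hslab q h1] at h8
    have h9 := h3 (tderiv (𝓘(ℝ, ℂ).prod (𝓡 d)) 𝓘(ℝ, ℂ × EuclideanSpace ℝ (Fin d)) c q v)
    simp only [add_sub_cancel] at h9
    rw [tderiv_comp_apply (h5.mdifferentiableAt (by simp)) hWd hWq, Function.comp_apply, hWq, h4,
      hdW, ← slabForm_apply σ h2 (h6.mdifferentiableAt (by simp)), h9, h8, mul_assoc]
  · filter_upwards [hoff p hp, hl p] with q ⟨h1, h2⟩ ⟨l, hl0, h3⟩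
    refine ⟨l, hl0, fun v => ?_⟩
    have h4 : Ψ ∘ W =ᶠ[𝓝 q] Ψ := h1.fun_comp Ψ
    rw [tderiv_congr h4, h4.eq_of_nhds, h3, tubeForm, tubeForm, Pi.add_apply, h2, add_zero]

/-- Moser's method: there is a tube map that pulls the contact structure back to the model. -/
lemma IsStandardTube.exists_model [CompactSpace N] [T2Space N] (h : IsStandardTube α αN f j Φ)
    (hα : ∀ x, α.SmoothAt x) (hαN : ∀ x, αN.SmoothAt x) (hcN : ∀ x, αN.ContactAt x) :
    ∃ Ψ, IsTubeMap d e j Ψ ∧ ∀ p, ∀ᶠ q in 𝓝 ((0 : ℂ), p), ∃ l : ℝ, 0 < l ∧ ∀ v,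
      α.cov (Ψ q) (tderiv (𝓘(ℝ, ℂ).prod (𝓡 d)) (𝓡 e) Ψ q v) =
        l * (αN.cov q.2 v.2 + angularForm q.1 v.1) := by
  classical
  obtain ⟨s, ρ, hρ, hsupp, -, hsum⟩ := exists_finite_partition (d := d)
    (fun p : N => (extChartAt (𝓡 d) p).source) (fun p => isOpen_extChartAt_source p)
    (fun p => mem_extChartAt_source p)
  -- The weight grows from `0`, where the form is the pull-back under `Φ`, to the full sum `1`,
  -- where it is `f (αN + r² dφ)`.
  have key : ∀ t : Finset N, ContMDiff (𝓡 d) 𝓘(ℝ) ∞ (∑ i ∈ t, ρ i) ∧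
      ∃ Ψ, IsTubeMap d e j Ψ ∧ ∀ p, ∀ᶠ q in 𝓝 ((0 : ℂ), p), ∃ l : ℝ, 0 < l ∧ ∀ v,
        α.cov (Ψ q) (tderiv (𝓘(ℝ, ℂ).prod (𝓡 d)) (𝓡 e) Ψ q v) =
          l * tubeForm α αN f Φ (∑ i ∈ t, ρ i) q v := by
    intro t
    induction t using Finset.induction_on with
    | empty =>
      refine ⟨contMDiff_const (c := (0 : ℝ)), Φ, h.toIsTubeMap, fun p =>
        Filter.Eventually.of_forall fun q => ⟨1, one_pos, fun v => ?_⟩⟩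
      simp [tubeForm]
    | insert i t hi ih =>
      obtain ⟨hs, Ψ, hΨ, hl⟩ := ih
      rw [Finset.sum_insert hi, add_comm]
      exact ⟨hs.add (hρ i), h.exists_moser_step hα hαN hcN hs (hρ i) i (hsupp i) hΨ hl⟩
  obtain ⟨-, Ψ, hΨ, hl⟩ := key s
  refine ⟨Ψ, hΨ, fun p => ?_⟩
  filter_upwards [hl p] with q ⟨l, hl0, hlq⟩
  refine ⟨l * f q.2, mul_pos hl0 (h.factor_pos _), fun v => ?_⟩
  rw [hlq, tubeForm, Finset.sum_apply, hsum]
  ring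

/-- A map that pulls a contact structure back to the model is an immersion. -/
lemma IsTubeMap.injective_of_model (h : IsTubeMap d e j Ψ)
    (hα : ∀ x, α.SmoothAt x) (hαN : ∀ x, αN.SmoothAt x) (hcN : ∀ x, αN.ContactAt x)
    (hl : ∀ p, ∀ᶠ q in 𝓝 ((0 : ℂ), p), ∃ l : ℝ, 0 < l ∧ ∀ v,
      α.cov (Ψ q) (tderiv (𝓘(ℝ, ℂ).prod (𝓡 d)) (𝓡 e) Ψ q v) =
        l * (αN.cov q.2 v.2 + angularForm q.1 v.1)) (p : N) :
    Function.Injective (tderiv (𝓘(ℝ, ℂ).prod (𝓡 d)) (𝓡 e) Ψ (0, p)) := by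
  let φ := extChartAt (𝓡 d) p
  have hp : p ∈ φ.source := mem_extChartAt_source p
  have hy : φ p ∈ φ.target := mem_extChartAt_target p
  have hpp : φ.symm (φ p) = p := extChartAt_to_inv p
  have hs0 : slab d p (0, φ p) = (0, p) := Prod.ext rfl hpp
  have has := (hαN _).contDiffAt_pull (contMDiffAt_extChartAt_symm (I := 𝓡 d) p hy)
  have hjet := hasStandardJet_discModel (f := fun _ => (1 : ℝ)) contDiffAt_const has
  have hc := hjet.isContactPair one_ne_zero (by
    have h1 : (fun y => (1 : ℝ) • αN.pull φ.symm y) = αN.pull φ.symm := by simp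
    have h2 := OneForm.isContactPair_pull_chart_symm hαN hcN p hy
    rw [← h1] at h2
    exact h2)
  have hpull := h.contDiffAt_pull_slab hα p hy
  have hconf : ∀ᶠ x in 𝓝 ((0 : ℂ), φ p), ∃ l : ℝ, 0 < l ∧ ∀ v,
      α.pull (Ψ ∘ slab d p) x v = l * discModel (fun _ => (1 : ℝ)) (αN.pull φ.symm) x v := by
    have hcs := (contMDiffAt_slab (i := p) (x := ((0 : ℂ), φ p)) hy).continuousAt
    have hev : ∀ᶠ x in 𝓝 ((0 : ℂ), φ p), ∃ l : ℝ, 0 < l ∧ ∀ v,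
        α.cov (Ψ (slab d p x)) (tderiv (𝓘(ℝ, ℂ).prod (𝓡 d)) (𝓡 e) Ψ (slab d p x) v) =
        l * (αN.cov (slab d p x).2 v.2 + angularForm (slab d p x).1 v.1) :=
      hcs.eventually (by rw [hs0]; exact hl p)
    filter_upwards [hev, h.eventually_comp_slab p hy] with x ⟨l, hl0, hlx⟩ ⟨hx1, hx2, _⟩
    refine ⟨l, hl0, fun v => ?_⟩
    have h1 := hlx (tderiv 𝓘(ℝ, ℂ × EuclideanSpace ℝ (Fin d)) (𝓘(ℝ, ℂ).prod (𝓡 d)) (slab d p) x v)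
    rw [← tderiv_comp_apply (hx2.mdifferentiableAt (by simp))
      ((contMDiffAt_slab hx1).mdifferentiableAt (by simp)) rfl, tderiv_slab hx1] at h1
    rw [discModel_apply, one_mul]
    exact h1
  rw [injective_iff_map_eq_zero]
  intro v hv
  let u : ℂ × EuclideanSpace ℝ (Fin d) := (v.1, tderiv (𝓡 d) 𝓘(ℝ, _) φ p v.2)
  have huv : ((u.1, tderiv 𝓘(ℝ, _) (𝓡 d) φ.symm (φ p) u.2) : ℂ × EuclideanSpace ℝ (Fin d)) = v :=
    Prod.ext rfl (tderiv_chart_symm_chart hp v.2)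
  -- A vector killed by the derivative of `Ψ` is killed by the pull-backs of `α` and `dα`. Those
  -- form a contact pair, being conformal to the model, so the vector is zero. Injectivity thus need
  -- not be tracked through the Moser steps.
  have hu0 : u = 0 := by
    refine (isContactPair_of_conformal hjet.smooth hpull hc hconf).2 _ ?_ fun w _ => ?_
    · rw [h.pull_slab_apply α p hy, hpp, huv, hv, map_zero]
    · rw [h.dForm_pull_slab hα p hy, hpp, huv, hv, map_zero]
      rfl
  rw [← huv, hu0]
  exact Prod.ext rfl (map_zero _)

end Moser

/-! ### The standard neighbourhood of a contact submanifold -/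

section ModelNeighborhood

variable {d e : ℕ} {N M : Type u}
  [TopologicalSpace N] [ChartedSpace (EuclideanSpace ℝ (Fin d)) N] [IsManifold (𝓡 d) ∞ N]
  [TopologicalSpace M] [ChartedSpace (EuclideanSpace ℝ (Fin e)) M] [IsManifold (𝓡 e) ∞ M]
  {j : N → M}

lemma discForm_eq (αN : OneForm d N) (q : ℂ × N) (v : ℂ × EuclideanSpace ℝ (Fin d)) :
    discForm αN q v = αN.cov q.2 v.2 + angularForm q.1 v.1 := by
  have h1 := tderiv_fst (d := d) (p := q.2) (z := q.1) v
  have h2 := tderiv_snd (d := d) (p := q.2) (z := q.1) v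
  change αN.cov q.2 (tderiv (𝓘(ℝ, ℂ).prod (𝓡 d)) (𝓡 d) (Prod.snd : ℂ × N → N) (q.1, q.2) v) +
    angularForm q.1 (tderiv (𝓘(ℝ, ℂ).prod (𝓡 d)) 𝓘(ℝ, ℂ) (Prod.fst : ℂ × N → ℂ) (q.1, q.2) v) = _
  rw [h1, h2]

/-- The neighbourhood theorem for contact submanifolds of codimension two with trivial normal
bundle. -/
theorem exists_modelNeighborhood [CompactSpace N] [T2Space N] [T2Space M] [Nonempty N]
    (hde : e = d + 2) {ξN : ContactStructure d N} {ξ : ContactStructure e M}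
    (hj : IsContactEmbedding ξN ξ j) (hν : HasTrivialNormalBundle d e j) {αN : OneForm d N}
    (hαN : ξN.IsPositiveForm αN) :
    ∃ ε > 0, ∃ Ψ : ℂ × N → M, ∀ ε' ≤ ε, IsModelNeighborhood ξ j αN ε' Ψ := by
  obtain ⟨α, hα, hαξ⟩ := ξ.exists_form
  have hcα := OneForm.isContactForm_iff.1 hα
  have hcN := OneForm.isContactForm_iff.1 hαN.1
  obtain ⟨f, hfs, hf0, hf⟩ := exists_conformal_factor (α := α) (αN := αN) hj.smooth
    (fun x => (hcα x).1) (fun x => (hcN x).1) (fun x => (hcN x).2.1)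
    (fun p u hu => (hαξ _ _).1.1 ((hj.contact p u).1.2 ((hαN.2 p u).1.2 hu)))
    (fun p u hu => (hαξ _ _).2.1 ((hj.contact p u).2.2 ((hαN.2 p u).2.2 hu)))
  obtain ⟨Φ₁, h₁, hinj₁⟩ := exists_tubeMap hj.smooth hj.immersion hν
  obtain ⟨Φ, hΦ, ha, hb, hc⟩ := h₁.exists_standard hde hinj₁ (fun x => (hcα x).1)
    (fun x => (hcα x).2) (fun x => (hcN x).1) (fun x => (hcN x).2) hfs hf0 hf
  have hst : IsStandardTube α αN f j Φ := ⟨hΦ, hfs, hf0, ha, hb, hc⟩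
  obtain ⟨Ψ, hΨ, hl⟩ := hst.exists_model (fun x => (hcα x).1) (fun x => (hcN x).1)
    (fun x => (hcN x).2)
  have hinj := hΨ.injective_of_model (fun x => (hcα x).1) (fun x => (hcN x).1)
    (fun x => (hcN x).2) hl
  have hdim : Module.finrank ℝ (ℂ × EuclideanSpace ℝ (Fin d)) =
      Module.finrank ℝ (EuclideanSpace ℝ (Fin e)) := by simp [hde, add_comm]
  have hloc : ∀ p, (∀ᶠ q in 𝓝 ((0 : ℂ), p),
      Function.Injective (tderiv (𝓘(ℝ, ℂ).prod (𝓡 d)) (𝓡 e) Ψ q)) ∧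
      ∃ U ∈ 𝓝 ((0 : ℂ), p), InjOn Ψ U := by
    intro p
    obtain ⟨g, hg, hgx, -, hgl⟩ := exists_local_inverse (hΨ.contMDiffAt p) (hinj p) hdim
    refine ⟨?_, _, hgl, fun x hx y hy hxy => ?_⟩
    · filter_upwards [hgl.eventually_nhds, hΨ.smooth p,
        (hΨ.contMDiffAt p).continuousAt.eventually (eventually_mdifferentiableAt hg)] with q h1 h2 h3
      exact Function.LeftInverse.injective (g := tderiv (𝓡 e) (𝓘(ℝ, ℂ).prod (𝓡 d)) g (Ψ q))
        fun v => tderiv_left_inverse rfl (h2.mdifferentiableAt (by simp)) h3 h1 v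
    · rw [← show g (Ψ x) = x from hx, ← show g (Ψ y) = y from hy, hxy]
  have hzero : InjOn Ψ (({0} : Set ℂ) ×ˢ (univ : Set N)) := by
    rintro ⟨z, p⟩ ⟨hz, -⟩ ⟨z', p'⟩ ⟨hz', -⟩ hpp
    rw [mem_singleton_iff] at hz hz'
    dsimp only at hz hz'
    rw [hz, hz', hΨ.zero, hΨ.zero] at hpp
    rw [hz, hz', hj.isClosedEmbedding.injective hpp]
  -- Injectivity on the compact zero section together with local injectivity at its points gives
  -- injectivity on a neighbourhood.
  obtain ⟨U, hU, hUinj⟩ := hzero.exists_mem_nhdsSet (isCompact_singleton.prod isCompact_univ)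
    (fun x hx => by
      obtain ⟨z, p⟩ := x
      rw [show z = 0 from hx.1]
      exact (hΨ.contMDiffAt p).continuousAt)
    (fun x hx => by
      obtain ⟨z, p⟩ := x
      rw [show z = 0 from hx.1]
      exact (hloc p).2)
  have hU' : ∀ p, ∀ᶠ q in 𝓝 ((0 : ℂ), p), q ∈ U := fun p =>
    (mem_nhdsSet_iff_forall.1 hU) (0, p) ⟨rfl, mem_univ _⟩
  -- Compactness of `N` replaces the neighbourhoods of the single points `(0, p)` by one disc that
  -- serves all `p`.
  have hev := isCompact_univ.eventually_forall_of_forall_eventually (x₀ := (0 : ℂ))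
    (P := fun z p => ((z, p) ∈ U ∧ ContMDiffAt (𝓘(ℝ, ℂ).prod (𝓡 d)) (𝓡 e) ∞ Ψ (z, p)) ∧
      Function.Injective (tderiv (𝓘(ℝ, ℂ).prod (𝓡 d)) (𝓡 e) Ψ (z, p)) ∧
      ∃ l : ℝ, 0 < l ∧ ∀ v, α.cov (Ψ (z, p)) (tderiv (𝓘(ℝ, ℂ).prod (𝓡 d)) (𝓡 e) Ψ (z, p) v) =
        l * (αN.cov p v.2 + angularForm z v.1))
    (fun p _ => ((hU' p).and (hΨ.smooth p)).and ((hloc p).1.and (hl p)))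
  obtain ⟨r, hr, hball⟩ := Metric.eventually_nhds_iff_ball.1 hev
  -- The square appears because the model of size `ε` uses the disc of radius `√ε`. All smaller
  -- sizes are kept so that the neighbourhoods in `M₁` and `M₂` can be given a common one.
  refine ⟨r ^ 2, by positivity, Ψ, fun ε' hε' => ?_⟩
  have hsub : ∀ q ∈ Metric.ball (0 : ℂ) (√ε') ×ˢ (univ : Set N), _ := fun q hq =>
    hball q.1 (Metric.ball_subset_ball (Real.sqrt_le_iff.2 ⟨hr.le, hε'⟩) hq.1) q.2 (mem_univ _)
  refine ⟨?_, hΨ.zero, fun q hq v => ?_⟩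
  · exact isOpenDiffeoOn_of_injective (Metric.isOpen_ball.prod isOpen_univ)
      (fun q hq => (hsub q hq).1.2) (fun q hq => (hsub q hq).2.1)
      (hUinj.mono fun q hq => (hsub q hq).1.1) hdim
  · obtain ⟨l, hl0, hlq⟩ := (hsub q hq).2.2
    have h1 := hlq v
    have h2 := discForm_eq αN q v
    constructor
    · refine ((hαξ _ _).1).trans ?_
      change α.cov (Ψ q) (tderiv (𝓘(ℝ, ℂ).prod (𝓡 d)) (𝓡 e) Ψ q v) = 0 ↔ _
      rw [h2]
      refine (Eq.congr_left h1).trans ?_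
      rw [mul_eq_zero, or_iff_right hl0.ne']
    · refine ((hαξ _ _).2).trans ?_
      change 0 < α.cov (Ψ q) (tderiv (𝓘(ℝ, ℂ).prod (𝓡 d)) (𝓡 e) Ψ q v) ↔ _
      rw [h2]
      refine (iff_of_eq (congrArg (0 < ·) h1)).trans ?_
      exact mul_pos_iff_of_pos_left hl0

end ModelNeighborhood

/-! ### Gluing manifolds -/

section GlueCharts

variable {E : Type*} [NormedAddCommGroup E] [NormedSpace ℝ E] {X : Type*}

/-- A set with smoothly compatible charts is a manifold. -/
lemma exists_manifold_of_charts {m : ℕ} {X : Type u}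
    (A : Set (PartialEquiv X (EuclideanSpace ℝ (Fin m)))) (hcover : ∀ x, ∃ c ∈ A, x ∈ c.source)
    (hcompat : ∀ c ∈ A, ∀ c' ∈ A, IsOpen (c.symm.trans c').source ∧
      ContDiffOn ℝ ∞ (c.symm.trans c') (c.symm.trans c').source) :
    ∃ (_ : TopologicalSpace X) (_ : ChartedSpace (EuclideanSpace ℝ (Fin m)) X)
      (_ : IsManifold (𝓡 m) ∞ X), ∀ c ∈ A, IsOpen c.source ∧ IsOpen c.target ∧
        ContMDiffOn (𝓡 m) 𝓘(ℝ, EuclideanSpace ℝ (Fin m)) ∞ c c.source ∧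
        ContMDiffOn 𝓘(ℝ, EuclideanSpace ℝ (Fin m)) (𝓡 m) ∞ c.symm c.target := by
  choose chart hchart hmem using hcover
  let C : ChartedSpaceCore (EuclideanSpace ℝ (Fin m)) X :=
    { atlas := A
      chartAt := chart
      mem_chart_source := hmem
      chart_mem_atlas := hchart
      open_source := fun c c' hc hc' => (hcompat c hc c' hc').1
      continuousOn_toFun := fun c c' hc hc' => (hcompat c hc c' hc').2.continuousOn }
  let := C.toTopologicalSpace
  let := C.toChartedSpace
  have hatlas : ∀ e ∈ atlas (EuclideanSpace ℝ (Fin m)) X, ∃ c, ∃ hc : c ∈ A,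
      e = C.openPartialHomeomorph c hc := by
    intro e he
    obtain ⟨c, hc⟩ := mem_iUnion.1 he
    obtain ⟨hc, he⟩ := mem_iUnion.1 hc
    exact ⟨c, hc, he⟩
  have : IsManifold (𝓡 m) ∞ X := by
    refine isManifold_of_contDiffOn _ _ _ fun e e' he he' => ?_
    obtain ⟨c, hc, rfl⟩ := hatlas e he
    obtain ⟨c', hc', rfl⟩ := hatlas e' he'
    have h := (hcompat c hc c' hc').2
    simp only [mfld_simps]
    exact h
  refine ⟨inferInstance, inferInstance, inferInstance, fun c hc => ?_⟩
  have hmax : C.openPartialHomeomorph c hc ∈ IsManifold.maximalAtlas (𝓡 m) ∞ X :=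
    IsManifold.subset_maximalAtlas (mem_iUnion.2 ⟨c, mem_iUnion.2 ⟨hc, rfl⟩⟩)
  exact ⟨C.open_source' hc, C.open_target hc, contMDiffOn_of_mem_maximalAtlas hmax,
    contMDiffOn_symm_of_mem_maximalAtlas hmax⟩

end GlueCharts

/-! ### Charts induced by partial bijections -/

section Pieces

set_option linter.unusedSectionVars false

variable {E : Type*} [NormedAddCommGroup E] [NormedSpace ℝ E] {X : Type*}
  {E₁ : Type*} [NormedAddCommGroup E₁] [NormedSpace ℝ E₁] {H₁ : Type*} [TopologicalSpace H₁]
  {I₁ : ModelWithCorners ℝ E₁ H₁} [I₁.Boundaryless]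
  {Y₁ : Type*} [TopologicalSpace Y₁] [ChartedSpace H₁ Y₁] [IsManifold I₁ ∞ Y₁]
  {E₂ : Type*} [NormedAddCommGroup E₂] [NormedSpace ℝ E₂] {H₂ : Type*} [TopologicalSpace H₂]
  {I₂ : ModelWithCorners ℝ E₂ H₂} [I₂.Boundaryless]
  {Y₂ : Type*} [TopologicalSpace Y₂] [ChartedSpace H₂ Y₂] [IsManifold I₂ ∞ Y₂]

/-- The chart of `X` at `f y` that is induced by a chart of `Y₁` under a partial bijection `f`. -/
def pieceChart (I₁ : ModelWithCorners ℝ E₁ H₁) (f : PartialEquiv Y₁ X) (L : E₁ ≃L[ℝ] E) (y : Y₁) :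
    PartialEquiv X E :=
  f.symm.trans ((extChartAt I₁ y).trans L.toEquiv.toPartialEquiv)

/-- Up to linear isomorphisms the transition map is an inverse chart of `Y₁`, the transition between
the pieces, and a chart of `Y₂`. -/
lemma pieceChart_compat {f₁ : PartialEquiv Y₁ X} {f₂ : PartialEquiv Y₂ X} (L₁ : E₁ ≃L[ℝ] E)
    (L₂ : E₂ ≃L[ℝ] E) (ho : IsOpen (f₁.trans f₂.symm).source)
    (hs : ContMDiffOn I₁ I₂ ∞ (f₁.trans f₂.symm) (f₁.trans f₂.symm).source) (y₁ : Y₁) (y₂ : Y₂) :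
    IsOpen ((pieceChart I₁ f₁ L₁ y₁).symm.trans (pieceChart I₂ f₂ L₂ y₂)).source ∧
    ContDiffOn ℝ ∞ ((pieceChart I₁ f₁ L₁ y₁).symm.trans (pieceChart I₂ f₂ L₂ y₂))
      ((pieceChart I₁ f₁ L₁ y₁).symm.trans (pieceChart I₂ f₂ L₂ y₂)).source := by
  let G := f₁.trans f₂.symm
  let φ₁ := extChartAt I₁ y₁
  let φ₂ := extChartAt I₂ y₂
  have hsrc : ((pieceChart I₁ f₁ L₁ y₁).symm.trans (pieceChart I₂ f₂ L₂ y₂)).source =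
      L₁.symm ⁻¹' (φ₁.target ∩ φ₁.symm ⁻¹' (G.source ∩ G ⁻¹' φ₂.source)) := by
    ext x
    simp [pieceChart, G, φ₁, φ₂, PartialEquiv.trans_source]
    tauto
  have hG : IsOpen (G.source ∩ G ⁻¹' φ₂.source) :=
    hs.continuousOn.isOpen_inter_preimage ho (isOpen_extChartAt_source y₂)
  rw [hsrc]
  refine ⟨((continuousOn_extChartAt_symm y₁).isOpen_inter_preimage (isOpen_extChartAt_target y₁)
    hG).preimage L₁.symm.continuous, fun x hx => ContDiffAt.contDiffWithinAt ?_⟩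
  have h1 : ContMDiffAt 𝓘(ℝ, E) 𝓘(ℝ, E₁) ∞ L₁.symm x :=
    contMDiffAt_iff_contDiffAt.2 L₁.symm.contDiff.contDiffAt
  have h2 := contMDiffAt_extChartAt_symm (I := I₁) y₁ hx.1
  have h3 : ContMDiffAt I₁ I₂ ∞ G (φ₁.symm (L₁.symm x)) := hs.contMDiffAt (ho.mem_nhds hx.2.1)
  have h4 : ContMDiffAt I₂ 𝓘(ℝ, E₂) ∞ φ₂ (G (φ₁.symm (L₁.symm x))) :=
    contMDiffAt_extChartAt' (by have := hx.2.2; rwa [← extChartAt_source I₂])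
  have h5 : ContMDiffAt 𝓘(ℝ, E₂) 𝓘(ℝ, E) ∞ L₂ (φ₂ (G (φ₁.symm (L₁.symm x)))) :=
    contMDiffAt_iff_contDiffAt.2 L₂.contDiff.contDiffAt
  rw [← contMDiffAt_iff_contDiffAt]
  exact ContMDiffAt.comp (g := L₂) (f := φ₂ ∘ G ∘ φ₁.symm ∘ L₁.symm) x h5
    (ContMDiffAt.comp x h4 (ContMDiffAt.comp x h3 (ContMDiffAt.comp x h2 h1)))

/-- The transition map between the pieces `f₁ : s₁ → X` and `f₂ : s₂ → X` is a diffeomorphism. -/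
def IsGlued (I₁ : ModelWithCorners ℝ E₁ H₁) (I₂ : ModelWithCorners ℝ E₂ H₂) (f₁ : Y₁ → X)
    (s₁ : Set Y₁) (f₂ : Y₂ → X) (s₂ : Set Y₂) : Prop :=
  ∃ (A : Set Y₁) (h : Y₁ → Y₂), A ⊆ s₁ ∧ IsOpenDiffeoOn I₁ I₂ h A ∧
    (∀ y ∈ A, h y ∈ s₂ ∧ f₂ (h y) = f₁ y) ∧ ∀ y ∈ s₁, f₁ y ∈ f₂ '' s₂ → y ∈ A

lemma isGlued_refl {f₁ : Y₁ → X} {s₁ : Set Y₁} (hs : IsOpen s₁) : IsGlued I₁ I₁ f₁ s₁ f₁ s₁ :=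
  ⟨s₁, id, subset_rfl, ⟨hs, by rwa [image_id], contMDiffOn_id, by simp [MapsTo],
    id, contMDiffOn_id, by simp [MapsTo], fun _ _ => rfl, fun _ _ => rfl⟩,
    fun y hy => ⟨hy, rfl⟩, fun y hy _ => hy⟩

variable [Nonempty Y₁] [Nonempty Y₂]

/-- The overlap is `A` when seen from the first piece and the open image of `A` when seen from the
second; the transition maps are the given diffeomorphism and its inverse. One asymmetric gluing
datum therefore serves both directions. -/
lemma IsGlued.compat {f₁ : Y₁ → X} {s₁ : Set Y₁} {f₂ : Y₂ → X} {s₂ : Set Y₂}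
    (h : IsGlued I₁ I₂ f₁ s₁ f₂ s₂) (h₁ : InjOn f₁ s₁) (h₂ : InjOn f₂ s₂) :
    (IsOpen ((h₁.toPartialEquiv f₁ s₁).trans (h₂.toPartialEquiv f₂ s₂).symm).source ∧
      ContMDiffOn I₁ I₂ ∞ ((h₁.toPartialEquiv f₁ s₁).trans (h₂.toPartialEquiv f₂ s₂).symm)
        ((h₁.toPartialEquiv f₁ s₁).trans (h₂.toPartialEquiv f₂ s₂).symm).source) ∧
    IsOpen ((h₂.toPartialEquiv f₂ s₂).trans (h₁.toPartialEquiv f₁ s₁).symm).source ∧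
      ContMDiffOn I₂ I₁ ∞ ((h₂.toPartialEquiv f₂ s₂).trans (h₁.toPartialEquiv f₁ s₁).symm)
        ((h₂.toPartialEquiv f₂ s₂).trans (h₁.toPartialEquiv f₁ s₁).symm).source := by
  obtain ⟨A, t, hA, ⟨hAo, htA, hts, -, g, hgs, hgm, hgl, hgr⟩, ht, hmem⟩ := h
  let F₁ := h₁.toPartialEquiv f₁ s₁
  let F₂ := h₂.toPartialEquiv f₂ s₂
  have hF₁ : ∀ y ∈ s₁, F₁.symm (f₁ y) = y := fun y hy => F₁.left_inv hy
  have hF₂ : ∀ y ∈ s₂, F₂.symm (f₂ y) = y := fun y hy => F₂.left_inv hy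
  have hsrc : (F₁.trans F₂.symm).source = A := by
    ext y
    refine ⟨fun hy => hmem y hy.1 hy.2, fun hy => ⟨hA hy, ?_⟩⟩
    exact ⟨t y, (ht y hy).1, (ht y hy).2⟩
  have hsrc' : (F₂.trans F₁.symm).source = t '' A := by
    ext y
    constructor
    · rintro ⟨hy, z, hz, hzy⟩
      have hzA : z ∈ A := hmem z hz ⟨y, hy, hzy.symm⟩
      exact ⟨z, hzA, h₂ (ht z hzA).1 hy ((ht z hzA).2.trans hzy)⟩
    · rintro ⟨z, hz, rfl⟩
      exact ⟨(ht z hz).1, z, hA hz, (ht z hz).2.symm⟩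
  refine ⟨?_, ?_⟩
  · change IsOpen (F₁.trans F₂.symm).source ∧ ContMDiffOn I₁ I₂ ∞ (F₁.trans F₂.symm)
      (F₁.trans F₂.symm).source
    rw [hsrc]
    refine ⟨hAo, hts.congr fun y hy => ?_⟩
    change F₂.symm (f₁ y) = t y
    rw [← (ht y hy).2, hF₂ _ (ht y hy).1]
  · change IsOpen (F₂.trans F₁.symm).source ∧ ContMDiffOn I₂ I₁ ∞ (F₂.trans F₁.symm)
      (F₂.trans F₁.symm).source
    rw [hsrc']
    refine ⟨htA, hgs.congr fun y hy => ?_⟩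
    obtain ⟨z, hz, rfl⟩ := hy
    change F₁.symm (f₂ (t z)) = g (t z)
    rw [(ht z hz).2, hF₁ _ (hA hz), hgl hz]

/-- In the induced chart at `f₁ y`, the map `f₁` is read as the chart of `Y₁` at `y` followed by
`L`, and its inverse as the inverse of that. -/
lemma isOpenDiffeoOn_piece {m : ℕ} {X : Type u} [TopologicalSpace X]
    [ChartedSpace (EuclideanSpace ℝ (Fin m)) X] [IsManifold (𝓡 m) ∞ X] {f₁ : Y₁ → X} {s₁ : Set Y₁}
    (h₁ : InjOn f₁ s₁) (hs₁ : IsOpen s₁) (L : E₁ ≃L[ℝ] EuclideanSpace ℝ (Fin m))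
    (h : ∀ y, ∀ c, c = pieceChart I₁ (h₁.toPartialEquiv f₁ s₁) L y → IsOpen c.source ∧
      IsOpen c.target ∧
      ContMDiffOn (𝓡 m) 𝓘(ℝ, EuclideanSpace ℝ (Fin m)) ∞ c c.source ∧
      ContMDiffOn 𝓘(ℝ, EuclideanSpace ℝ (Fin m)) (𝓡 m) ∞ c.symm c.target) :
    IsOpenDiffeoOn I₁ (𝓡 m) f₁ s₁ := by
  let F := h₁.toPartialEquiv f₁ s₁
  have hF : ∀ y ∈ s₁, F.symm (f₁ y) = y := fun y hy => F.left_inv hy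
  let c := fun y => pieceChart I₁ F L y
  have hcs : ∀ y ∈ s₁, f₁ y ∈ (c y).source := by
    intro y hy
    simp only [c, pieceChart, PartialEquiv.trans_source]
    refine ⟨mem_image_of_mem f₁ hy, ?_, trivial⟩
    rw [hF y hy]
    exact mem_extChartAt_source y
  have hopen : IsOpen (f₁ '' s₁) := by
    rw [isOpen_iff_mem_nhds]
    rintro _ ⟨y, hy, rfl⟩
    refine Filter.mem_of_superset ((h y _ rfl).1.mem_nhds (hcs y hy)) ?_
    intro x hx
    exact hx.1
  refine ⟨hs₁, hopen, fun y hy => ContMDiffAt.contMDiffWithinAt ?_, mapsTo_image _ _, F.symm,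
    ?_, ?_, hF, ?_⟩
  · have h1 : ContMDiffAt 𝓘(ℝ, EuclideanSpace ℝ (Fin m)) (𝓡 m) ∞ (c y).symm (L (extChartAt I₁ y y)) := by
      refine (h y _ rfl).2.2.2.contMDiffAt ((h y _ rfl).2.1.mem_nhds ?_)
      have h2 := (c y).map_source (hcs y hy)
      have h3 : c y (f₁ y) = L (extChartAt I₁ y (F.symm (f₁ y))) := rfl
      rwa [h3, hF y hy] at h2
    have h4 : ContMDiffAt I₁ 𝓘(ℝ, EuclideanSpace ℝ (Fin m)) ∞ (fun z => L (extChartAt I₁ y z)) y :=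
      ContMDiffAt.comp y (contMDiffAt_iff_contDiffAt.2 L.contDiff.contDiffAt) contMDiffAt_extChartAt
    refine (ContMDiffAt.comp y h1 h4).congr_of_eventuallyEq ?_
    filter_upwards [eventually_extChartAt_symm (I := I₁) y (mem_extChartAt_source y), hs₁.mem_nhds hy]
      with z hz hzs
    change f₁ z = f₁ ((extChartAt I₁ y).symm (L.symm (L (extChartAt I₁ y z))))
    rw [L.symm_apply_apply, hz]
  · rintro _ ⟨y, hy, rfl⟩
    refine ContMDiffAt.contMDiffWithinAt ?_
    have h1 : ContMDiffAt (𝓡 m) 𝓘(ℝ, EuclideanSpace ℝ (Fin m)) ∞ (c y) (f₁ y) :=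
      (h y _ rfl).2.2.1.contMDiffAt ((h y _ rfl).1.mem_nhds (hcs y hy))
    have h3 : c y (f₁ y) = L (extChartAt I₁ y y) := by
      change L (extChartAt I₁ y (F.symm (f₁ y))) = _
      rw [hF y hy]
    have h4 : ContMDiffAt 𝓘(ℝ, EuclideanSpace ℝ (Fin m)) I₁ ∞
        (fun z => (extChartAt I₁ y).symm (L.symm z)) (c y (f₁ y)) := by
      rw [h3]
      exact ContMDiffAt.comp _ (by
        rw [L.symm_apply_apply]
        exact contMDiffAt_extChartAt_symm y (mem_extChartAt_target y))
        (contMDiffAt_iff_contDiffAt.2 L.symm.contDiff.contDiffAt)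
    refine (ContMDiffAt.comp _ h4 h1).congr_of_eventuallyEq ?_
    filter_upwards [(h y _ rfl).1.mem_nhds (hcs y hy)] with x hx
    change F.symm x = (extChartAt I₁ y).symm (L.symm (L (extChartAt I₁ y (F.symm x))))
    rw [L.symm_apply_apply]
    exact ((extChartAt I₁ y).left_inv hx.2.1).symm
  · exact fun x hx => F.map_target hx
  · exact fun x hx => F.right_inv hx

end Pieces

/-! ### Diffeomorphisms onto open subsets -/

section Diffeos

set_option linter.unusedSectionVars false

variable {E : Type*} [NormedAddCommGroup E] [NormedSpace ℝ E] {H : Type*} [TopologicalSpace H]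
  {I : ModelWithCorners ℝ E H} {X : Type*} [TopologicalSpace X] [ChartedSpace H X]
  {E' : Type*} [NormedAddCommGroup E'] [NormedSpace ℝ E'] {H' : Type*} [TopologicalSpace H']
  {I' : ModelWithCorners ℝ E' H'} {Y : Type*} [TopologicalSpace Y] [ChartedSpace H' Y]
  {E'' : Type*} [NormedAddCommGroup E''] [NormedSpace ℝ E''] {H'' : Type*} [TopologicalSpace H'']
  {I'' : ModelWithCorners ℝ E'' H''} {Z : Type*} [TopologicalSpace Z] [ChartedSpace H'' Z]

lemma IsOpenDiffeoOn.contMDiffAt {f : X → Y} {s : Set X} (h : IsOpenDiffeoOn I I' f s) {x : X}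
    (hx : x ∈ s) : ContMDiffAt I I' ∞ f x :=
  h.2.2.1.contMDiffAt (h.1.mem_nhds hx)

lemma IsOpenDiffeoOn.mdifferentiableAt {f : X → Y} {s : Set X} (h : IsOpenDiffeoOn I I' f s) {x : X}
    (hx : x ∈ s) : MDifferentiableAt I I' f x :=
  (h.contMDiffAt hx).mdifferentiableAt (by simp)

lemma IsOpenDiffeoOn.injOn {f : X → Y} {s : Set X} (h : IsOpenDiffeoOn I I' f s) : InjOn f s := by
  obtain ⟨-, -, -, -, g, -, -, hg, -⟩ := h
  exact hg.injOn

/-- A smooth inverse together with its derivative. -/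
lemma IsOpenDiffeoOn.exists_inverse {f : X → Y} {s : Set X} (h : IsOpenDiffeoOn I I' f s) :
    ∃ g : Y → X, (∀ x ∈ s, ContMDiffAt I' I ∞ g (f x)) ∧ (∀ x ∈ s, g (f x) = x) ∧
      (∀ x ∈ s, ∀ v, tderiv I' I g (f x) (tderiv I I' f x v) = v) ∧
      ∀ x ∈ s, ∀ v, tderiv I I' f x (tderiv I' I g (f x) v) = v := by
  obtain ⟨hs, hfs, -, -, g, hg, -, hl, hr⟩ := id h
  have hgs : ∀ x ∈ s, ContMDiffAt I' I ∞ g (f x) := fun x hx =>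
    hg.contMDiffAt (hfs.mem_nhds (mem_image_of_mem f hx))
  refine ⟨g, hgs, fun x hx => hl hx, fun x hx v => ?_, fun x hx v => ?_⟩
  · exact tderiv_left_inverse rfl (h.mdifferentiableAt hx)
      ((hgs x hx).mdifferentiableAt (by simp))
      (by filter_upwards [hs.mem_nhds hx] with z hz using hl hz) v
  · exact tderiv_left_inverse (hl hx) ((hgs x hx).mdifferentiableAt (by simp))
      (h.mdifferentiableAt hx)
      (by filter_upwards [hfs.mem_nhds (mem_image_of_mem f hx)] with z hz using hr hz) v

lemma IsOpenDiffeoOn.injective_tderiv {f : X → Y} {s : Set X} (h : IsOpenDiffeoOn I I' f s) {x : X}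
    (hx : x ∈ s) : Function.Injective (tderiv I I' f x) := by
  obtain ⟨g, -, -, hg, -⟩ := h.exists_inverse
  exact Function.LeftInverse.injective (hg x hx)

lemma IsOpenDiffeoOn.exists_openPartialHomeomorph {f : X → Y} {s : Set X}
    (h : IsOpenDiffeoOn I I' f s) :
    ∃ e : OpenPartialHomeomorph X Y, (e : X → Y) = f ∧ e.source = s ∧ e.target = f '' s := by
  obtain ⟨hs, hfs, hf, hm, g, hg, hgm, hl, hr⟩ := h
  let e : OpenPartialHomeomorph X Y :=
    { toFun := f
      invFun := g
      source := s
      target := f '' s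
      map_source' := hm
      map_target' := hgm
      left_inv' := hl
      right_inv' := hr
      open_source := hs
      open_target := hfs
      continuousOn_toFun := hf.continuousOn
      continuousOn_invFun := hg.continuousOn }
  exact ⟨e, rfl, rfl, rfl⟩

lemma IsOpenDiffeoOn.isOpen_image {f : X → Y} {s t : Set X} (h : IsOpenDiffeoOn I I' f s)
    (ht : IsOpen t) (hts : t ⊆ s) : IsOpen (f '' t) := by
  obtain ⟨e, rfl, rfl, -⟩ := h.exists_openPartialHomeomorph
  exact e.isOpen_image_of_subset_source ht hts

lemma IsOpenDiffeoOn.mono {f : X → Y} {s t : Set X} (h : IsOpenDiffeoOn I I' f s)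
    (ht : IsOpen t) (hts : t ⊆ s) : IsOpenDiffeoOn I I' f t := by
  refine ⟨ht, h.isOpen_image ht hts, h.2.2.1.mono hts, mapsTo_image f t, ?_⟩
  obtain ⟨-, -, -, -, g, hg, -, hl, hr⟩ := h
  refine ⟨g, hg.mono (image_mono hts), ?_, hl.mono hts, hr.mono (image_mono hts)⟩
  rintro _ ⟨x, hx, rfl⟩
  rwa [hl (hts hx)]

lemma IsOpenDiffeoOn.comp {f : X → Y} {s : Set X} {f' : Y → Z} {t : Set Y}
    (h' : IsOpenDiffeoOn I' I'' f' t) (h : IsOpenDiffeoOn I I' f s) (hst : MapsTo f s t) :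
    IsOpenDiffeoOn I I'' (f' ∘ f) s := by
  have h'' := h'.mono h.2.1 hst.image_subset
  refine ⟨h.1, by rw [image_comp]; exact h''.2.1, h'.2.2.1.comp h.2.2.1 hst, mapsTo_image _ s, ?_⟩
  obtain ⟨-, -, -, -, g, hg, hgm, hl, hr⟩ := h
  obtain ⟨-, -, -, -, g', hg', hgm', hl', hr'⟩ := h''
  rw [image_comp]
  exact ⟨g ∘ g', hg.comp hg' hgm', hgm.comp hgm', fun x hx => by
    rw [Function.comp_apply, Function.comp_apply, hl' (mem_image_of_mem f hx), hl hx], fun x hx => by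
    rw [Function.comp_apply, Function.comp_apply, hr (hgm' hx), hr' hx]⟩

lemma IsOpenDiffeoOn.secondCountable [SecondCountableTopology X] {f : X → Y} {s : Set X}
    (h : IsOpenDiffeoOn I I' f s) : SecondCountableTopology (f '' s) := by
  obtain ⟨e, -, rfl, ht⟩ := h.exists_openPartialHomeomorph
  rw [← ht]
  exact e.toHomeomorphSourceTarget.symm.secondCountableTopology

lemma IsOpenDiffeoOn.separated [T2Space X] {f : X → Y} {s : Set X}
    (h : IsOpenDiffeoOn I I' f s) {y y' : Y} (hy : y ∈ f '' s) (hy' : y' ∈ f '' s) (hne : y ≠ y') :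
    SeparatedNhds {y} {y'} := by
  obtain ⟨x, hx, rfl⟩ := hy
  obtain ⟨x', hx', rfl⟩ := hy'
  obtain ⟨U, V, hU, hV, hxU, hxV, hd⟩ := t2_separation (fun hxx : x = x' => hne (by rw [hxx]))
  refine ⟨f '' (U ∩ s), f '' (V ∩ s), h.isOpen_image (hU.inter h.1) inter_subset_right,
    h.isOpen_image (hV.inter h.1) inter_subset_right, by simpa using ⟨x, ⟨hxU, hx⟩, rfl⟩,
    by simpa using ⟨x', ⟨hxV, hx'⟩, rfl⟩, ?_⟩
  rw [Set.disjoint_left]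
  rintro _ ⟨z, hz, rfl⟩ ⟨w, hw, hzw⟩
  rw [h.injOn hw.2 hz.2 hzw] at hw
  exact Set.disjoint_left.1 hd hz.1 hw.1

end Diffeos

/-! ### Manifolds glued from three pieces -/

section ThreePieces

set_option linter.unusedSectionVars false

variable {m : ℕ} {X : Type u}
  {Y₁ : Type*} [TopologicalSpace Y₁] [ChartedSpace (EuclideanSpace ℝ (Fin m)) Y₁]
  [IsManifold (𝓡 m) ∞ Y₁] [Nonempty Y₁]
  {Y₂ : Type*} [TopologicalSpace Y₂] [ChartedSpace (EuclideanSpace ℝ (Fin m)) Y₂]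
  [IsManifold (𝓡 m) ∞ Y₂] [Nonempty Y₂]
  {E₃ : Type*} [NormedAddCommGroup E₃] [NormedSpace ℝ E₃] {H₃ : Type*} [TopologicalSpace H₃]
  {I₃ : ModelWithCorners ℝ E₃ H₃} [I₃.Boundaryless]
  {Y₃ : Type*} [TopologicalSpace Y₃] [ChartedSpace H₃ Y₃] [IsManifold I₃ ∞ Y₃] [Nonempty Y₃]
  {f₁ : Y₁ → X} {s₁ : Set Y₁} {f₂ : Y₂ → X} {s₂ : Set Y₂} {f₃ : Y₃ → X} {s₃ : Set Y₃}

lemma mem_pieceChart_source (hf : InjOn f₃ s₃) (L : E₃ ≃L[ℝ] EuclideanSpace ℝ (Fin m)) {y : Y₃}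
    (hy : y ∈ s₃) : f₃ y ∈ (pieceChart I₃ (hf.toPartialEquiv f₃ s₃) L y).source := by
  have h : (hf.toPartialEquiv f₃ s₃).symm (f₃ y) = y := (hf.toPartialEquiv f₃ s₃).left_inv hy
  simp only [pieceChart, PartialEquiv.trans_source]
  refine ⟨mem_image_of_mem f₃ hy, ?_, trivial⟩
  rw [h]
  exact mem_extChartAt_source y

/-- The nine kinds of pairs of charts reduce to the three gluing hypotheses, used in both
directions, and to the trivial gluing of each piece with itself. -/
lemma exists_manifold_of_pieces (L : E₃ ≃L[ℝ] EuclideanSpace ℝ (Fin m))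
    (h₁ : InjOn f₁ s₁) (h₂ : InjOn f₂ s₂) (h₃ : InjOn f₃ s₃)
    (hs₁ : IsOpen s₁) (hs₂ : IsOpen s₂) (hs₃ : IsOpen s₃)
    (h₁₂ : IsGlued (𝓡 m) (𝓡 m) f₁ s₁ f₂ s₂) (h₃₁ : IsGlued I₃ (𝓡 m) f₃ s₃ f₁ s₁)
    (h₃₂ : IsGlued I₃ (𝓡 m) f₃ s₃ f₂ s₂) (hcover : f₁ '' s₁ ∪ f₂ '' s₂ ∪ f₃ '' s₃ = univ) :
    ∃ (_ : TopologicalSpace X) (_ : ChartedSpace (EuclideanSpace ℝ (Fin m)) X)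
      (_ : IsManifold (𝓡 m) ∞ X), IsOpenDiffeoOn (𝓡 m) (𝓡 m) f₁ s₁ ∧
        IsOpenDiffeoOn (𝓡 m) (𝓡 m) f₂ s₂ ∧ IsOpenDiffeoOn I₃ (𝓡 m) f₃ s₃ := by
  let L₀ := ContinuousLinearEquiv.refl ℝ (EuclideanSpace ℝ (Fin m))
  let c₁ := fun y => pieceChart (𝓡 m) (h₁.toPartialEquiv f₁ s₁) L₀ y
  let c₂ := fun y => pieceChart (𝓡 m) (h₂.toPartialEquiv f₂ s₂) L₀ y
  let c₃ := fun y => pieceChart I₃ (h₃.toPartialEquiv f₃ s₃) L y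
  obtain ⟨t, c, hm, h⟩ := exists_manifold_of_charts (range c₁ ∪ range c₂ ∪ range c₃) (fun x => by
    have hx := mem_univ x
    rw [← hcover] at hx
    rcases hx with (⟨y, hy, rfl⟩ | ⟨y, hy, rfl⟩) | ⟨y, hy, rfl⟩
    · exact ⟨c₁ y, Or.inl (Or.inl ⟨y, rfl⟩), mem_pieceChart_source _ _ hy⟩
    · exact ⟨c₂ y, Or.inl (Or.inr ⟨y, rfl⟩), mem_pieceChart_source _ _ hy⟩
    · exact ⟨c₃ y, Or.inr ⟨y, rfl⟩, mem_pieceChart_source _ _ hy⟩) (by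
    have r₁ := ((isGlued_refl (I₁ := 𝓡 m) (f₁ := f₁) hs₁).compat h₁ h₁).1
    have r₂ := ((isGlued_refl (I₁ := 𝓡 m) (f₁ := f₂) hs₂).compat h₂ h₂).1
    have r₃ := ((isGlued_refl (I₁ := I₃) (f₁ := f₃) hs₃).compat h₃ h₃).1
    have r₁₂ := h₁₂.compat h₁ h₂
    have r₃₁ := h₃₁.compat h₃ h₁
    have r₃₂ := h₃₂.compat h₃ h₂
    clear_value L₀
    rintro _ ((⟨y, rfl⟩ | ⟨y, rfl⟩) | ⟨y, rfl⟩) _ ((⟨z, rfl⟩ | ⟨z, rfl⟩) | ⟨z, rfl⟩)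
    · exact pieceChart_compat L₀ L₀ r₁.1 r₁.2 y z
    · exact pieceChart_compat L₀ L₀ r₁₂.1.1 r₁₂.1.2 y z
    · exact pieceChart_compat L₀ L r₃₁.2.1 r₃₁.2.2 y z
    · exact pieceChart_compat L₀ L₀ r₁₂.2.1 r₁₂.2.2 y z
    · exact pieceChart_compat L₀ L₀ r₂.1 r₂.2 y z
    · exact pieceChart_compat L₀ L r₃₂.2.1 r₃₂.2.2 y z
    · exact pieceChart_compat L L₀ r₃₁.1.1 r₃₁.1.2 y z
    · exact pieceChart_compat L L₀ r₃₂.1.1 r₃₂.1.2 y z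
    · exact pieceChart_compat L L r₃.1 r₃.2 y z)
  refine ⟨t, c, hm, isOpenDiffeoOn_piece h₁ hs₁ L₀ ?_, isOpenDiffeoOn_piece h₂ hs₂ L₀ ?_,
    isOpenDiffeoOn_piece h₃ hs₃ L ?_⟩
  · rintro y _ rfl
    exact h _ (Or.inl (Or.inl ⟨y, rfl⟩))
  · rintro y _ rfl
    exact h _ (Or.inl (Or.inr ⟨y, rfl⟩))
  · rintro y _ rfl
    exact h _ (Or.inr ⟨y, rfl⟩)

/-- Points of one piece are separated inside it, and points of the first two pieces by disjointness.
Only a point outside the third piece and a point that lies just in the third can fail to be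
separated, and this is what the last two hypotheses exclude. Countability passes from a finite open
cover. -/
lemma topology_of_pieces [TopologicalSpace X] [ChartedSpace (EuclideanSpace ℝ (Fin m)) X]
    [T2Space Y₁] [T2Space Y₂] [T2Space Y₃] [SecondCountableTopology Y₁]
    [SecondCountableTopology Y₂] [SecondCountableTopology Y₃]
    (h₁ : IsOpenDiffeoOn (𝓡 m) (𝓡 m) f₁ s₁) (h₂ : IsOpenDiffeoOn (𝓡 m) (𝓡 m) f₂ s₂)
    (h₃ : IsOpenDiffeoOn I₃ (𝓡 m) f₃ s₃) (hcover : f₁ '' s₁ ∪ f₂ '' s₂ ∪ f₃ '' s₃ = univ)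
    (h₁₂ : Disjoint (f₁ '' s₁) (f₂ '' s₂))
    (h₁₃ : SeparatedNhds (f₁ '' s₁ \ f₃ '' s₃) (f₃ '' s₃ \ f₁ '' s₁))
    (h₂₃ : SeparatedNhds (f₂ '' s₂ \ f₃ '' s₃) (f₃ '' s₃ \ f₂ '' s₂)) :
    T2Space X ∧ SecondCountableTopology X := by
  have hsep : ∀ {A B : Set X} {x y : X}, SeparatedNhds A B → x ∈ A → y ∈ B →
      SeparatedNhds {x} {y} := fun h hx hy =>
    h.mono (singleton_subset_iff.2 hx) (singleton_subset_iff.2 hy)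
  have key₁ : ∀ x ∈ f₁ '' s₁, ∀ y, x ≠ y → SeparatedNhds {x} {y} := by
    intro x hx y hxy
    by_cases hy₁ : y ∈ f₁ '' s₁
    · exact h₁.separated hx hy₁ hxy
    · have hy := mem_univ y
      rw [← hcover] at hy
      rcases hy with (hy | hy) | hy
      · exact absurd hy hy₁
      · exact hsep ⟨_, _, h₁.2.1, h₂.2.1, subset_rfl, subset_rfl, h₁₂⟩ hx hy
      · by_cases hx₃ : x ∈ f₃ '' s₃
        · exact h₃.separated hx₃ hy hxy
        · exact hsep h₁₃ ⟨hx, hx₃⟩ ⟨hy, hy₁⟩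
  have key₂ : ∀ x ∈ f₂ '' s₂, ∀ y, x ≠ y → SeparatedNhds {x} {y} := by
    intro x hx y hxy
    by_cases hy₂ : y ∈ f₂ '' s₂
    · exact h₂.separated hx hy₂ hxy
    · have hy := mem_univ y
      rw [← hcover] at hy
      rcases hy with (hy | hy) | hy
      · exact (key₁ y hy x hxy.symm).symm
      · exact absurd hy hy₂
      · by_cases hx₃ : x ∈ f₃ '' s₃
        · exact h₃.separated hx₃ hy hxy
        · exact hsep h₂₃ ⟨hx, hx₃⟩ ⟨hy, hy₂⟩
  have key : ∀ x y : X, x ≠ y → SeparatedNhds {x} {y} := by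
    intro x y hxy
    have hx := mem_univ x
    have hy := mem_univ y
    rw [← hcover] at hx hy
    rcases hx with (hx | hx) | hx
    · exact key₁ x hx y hxy
    · exact key₂ x hx y hxy
    rcases hy with (hy | hy) | hy
    · exact (key₁ y hy x hxy.symm).symm
    · exact (key₂ y hy x hxy.symm).symm
    · exact h₃.separated hx hy hxy
  refine ⟨⟨fun x y hxy => ?_⟩, ?_⟩
  · obtain ⟨U, V, hU, hV, hx, hy, hd⟩ := key x y hxy
    exact ⟨U, V, hU, hV, singleton_subset_iff.1 hx, singleton_subset_iff.1 hy, hd⟩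
  · have i₁ := h₁.secondCountable
    have i₂ := h₂.secondCountable
    have i₃ := h₃.secondCountable
    let U : Option Bool → Set X := fun i => i.elim (f₃ '' s₃) fun b => bif b then f₁ '' s₁ else f₂ '' s₂
    have hU : ∀ i, IsOpen (U i) := by
      rintro (_ | _ | _)
      exacts [h₃.2.1, h₂.2.1, h₁.2.1]
    have hU' : ∀ i, SecondCountableTopology (U i) := by
      rintro (_ | _ | _)
      exacts [i₃, i₂, i₁]
    refine TopologicalSpace.secondCountableTopology_of_countable_cover hU ?_
    rw [eq_univ_iff_forall]
    intro x
    have hx := mem_univ x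
    rw [← hcover] at hx
    rcases hx with (hx | hx) | hx
    exacts [mem_iUnion.2 ⟨some true, hx⟩, mem_iUnion.2 ⟨some false, hx⟩, mem_iUnion.2 ⟨none, hx⟩]

end ThreePieces

/-! ### Contact structures from local contact forms -/

section Patch

set_option linter.unusedSectionVars false

variable {m : ℕ} {X : Type u} [TopologicalSpace X] [ChartedSpace (EuclideanSpace ℝ (Fin m)) X]
  [IsManifold (𝓡 m) ∞ X]

/-- If `b v = 0`, then neither `v` nor `-v` is positive for `b`, hence neither is for `c`, so `c v =
0`. Equal open half-spaces thus force equal kernels, and a common positive vector fixes the sign of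
the factor. -/
lemma exists_pos_eq_smul {E : Type*} [NormedAddCommGroup E] [NormedSpace ℝ E] {b c : E →L[ℝ] ℝ}
    (hb : b ≠ 0) (h : ∀ v, 0 < b v ↔ 0 < c v) : ∃ l : ℝ, 0 < l ∧ ∀ v, c v = l * b v := by
  have hker : ∀ v, b v = 0 → c v = 0 := by
    intro v hv
    have h1 := h v
    have h2 := h (-v)
    simp only [map_neg, hv, neg_zero, lt_irrefl, false_iff, not_lt, Left.neg_nonpos_iff] at h1 h2
    exact le_antisymm h1 h2
  obtain ⟨l, hl⟩ := exists_eq_smul_of_ker_le hker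
  obtain ⟨v, hv⟩ : ∃ v, 0 < b v := by
    obtain ⟨v, hv⟩ : ∃ v, b v ≠ 0 := by
      by_contra! h0
      exact hb (ContinuousLinearMap.ext h0)
    rcases hv.lt_or_gt with hv | hv
    · exact ⟨-v, by rw [map_neg]; linarith⟩
    · exact ⟨v, hv⟩
  refine ⟨l, ?_, fun v => by rw [hl]; rfl⟩
  have h1 := (h v).1 hv
  rw [hl, _root_.smul_apply, smul_eq_mul] at h1
  exact (pos_iff_pos_of_mul_pos h1).2 hv

lemma OneForm.smoothAt_iff_pull {α : OneForm m X} {i x : X} (hx : x ∈ (extChartAt (𝓡 m) i).source) :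
    α.SmoothAt x ↔ ContDiffAt ℝ ∞ (α.pull (extChartAt (𝓡 m) i).symm) (extChartAt (𝓡 m) i x) := by
  have hy := (extChartAt (𝓡 m) i).map_source hx
  have hxx := (extChartAt (𝓡 m) i).left_inv hx
  have hc := contMDiffAt_extChartAt_symm (I := 𝓡 m) i hy
  constructor
  · intro h
    exact SmoothAt.contDiffAt_pull (by rwa [hxx]) hc
  · intro h
    have := OneForm.smoothAt_of_pull hc
      (Function.LeftInverse.injective fun v => tderiv_chart_chart_symm hy v) (by simp) h
    rwa [hxx] at this

lemma OneForm.contactAt_iff_pull {α : OneForm m X} {i x : X} (hx : x ∈ (extChartAt (𝓡 m) i).source)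
    (h : α.SmoothAt x) : α.ContactAt x ↔ IsContactPair
      (α.pull (extChartAt (𝓡 m) i).symm (extChartAt (𝓡 m) i x))
      (dForm (α.pull (extChartAt (𝓡 m) i).symm) (extChartAt (𝓡 m) i x)) := by
  have hy := (extChartAt (𝓡 m) i).map_source hx
  have hxx := (extChartAt (𝓡 m) i).left_inv hx
  have h2 := SmoothAt.isContactPair_pull_iff (by rwa [hxx]) (contMDiffAt_extChartAt_symm (I := 𝓡 m) i hy)
      (Function.LeftInverse.injective fun v => tderiv_chart_chart_symm hy v) (by simp) (α := α)
  rw [hxx] at h2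
  exact h2.symm

/-- The form `∑ i, ρ i • α i`. -/
def sumForm {ι : Type*} [Fintype ι] (ρ : ι → X → ℝ) (α : ι → OneForm m X) : OneForm m X :=
  fun x => (∑ i, ρ i x • (α i).cov x : EuclideanSpace ℝ (Fin m) →L[ℝ] ℝ)

lemma sumForm_cov {ι : Type*} [Fintype ι] (ρ : ι → X → ℝ) (α : ι → OneForm m X) (x : X) :
    (sumForm ρ α).cov x = ∑ i, ρ i x • (α i).cov x := rfl

/-- Contact forms on the members of an open cover that define the same cooriented hyperplane field
define a contact structure. -/
lemma exists_contactStructure {ι : Type} [Fintype ι] [T2Space X] [SigmaCompactSpace X] (U : ι → Set X)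
    (hU : ∀ i, IsOpen (U i)) (hcover : ⋃ i, U i = univ) (α : ι → OneForm m X)
    (hα : ∀ i, ∀ x ∈ U i, (α i).SmoothAt x ∧ (α i).ContactAt x)
    (hpos : ∀ i k, ∀ x ∈ U i ∩ U k, ∀ v, 0 < (α i).cov x v ↔ 0 < (α k).cov x v) :
    ∃ ξ : ContactStructure m X, ∀ i, ∀ x ∈ U i, ∀ v,
      (v ∈ ξ.plane x ↔ (α i).cov x v = 0) ∧ (v ∈ ξ.pos x ↔ 0 < (α i).cov x v) := by
  obtain ⟨f, hf⟩ := SmoothPartitionOfUnity.exists_isSubordinate (𝓡 m) isClosed_univ U hU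
    (by rw [hcover])
  let β := sumForm (fun i x => f i x) α
  have hsum : ∀ x, ∑ i, f i x = 1 := fun x => by
    rw [← f.sum_eq_one (mem_univ x), finsum_eq_sum_of_fintype]
  have hU0 : ∀ i x, x ∉ U i → f i x = 0 := fun i x hx =>
    image_eq_zero_of_notMem_tsupport fun h => hx (hf i h)
  -- At a point of `U i` every form with nonzero weight is a positive multiple of `α i`, and so is
  -- the average. The contact condition for `β` then follows from its conformal invariance.
  have hl : ∀ i, ∀ x ∈ U i, ∃ l : ℝ, 0 < l ∧ ∀ v, β.cov x v = l * (α i).cov x v := by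
    intro i x hx
    have h1 : ∀ k, ∃ l : ℝ, 0 < l ∧ (x ∈ U k → ∀ v, (α k).cov x v = l * (α i).cov x v) := by
      intro k
      by_cases hk : x ∈ U k
      · obtain ⟨l, hl0, hl⟩ := exists_pos_eq_smul (hα i x hx).2.1 (hpos i k x ⟨hx, hk⟩)
        exact ⟨l, hl0, fun _ => hl⟩
      · exact ⟨1, one_pos, fun h => absurd h hk⟩
    choose l hl0 hl using h1
    refine ⟨∑ k, f k x * l k, ?_, fun v => ?_⟩
    · obtain ⟨k, hk⟩ : ∃ k, 0 < f k x := by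
        by_contra! h0
        have := hsum x
        rw [Finset.sum_eq_zero fun k _ => le_antisymm (h0 k) (f.nonneg k x)] at this
        exact zero_ne_one this
      exact Finset.sum_pos' (fun k _ => mul_nonneg (f.nonneg k x) (hl0 k).le)
        ⟨k, Finset.mem_univ k, mul_pos hk (hl0 k)⟩
    · rw [sumForm_cov, _root_.sum_apply, Finset.sum_mul]
      refine Finset.sum_congr rfl fun k _ => ?_
      rw [_root_.smul_apply, smul_eq_mul]
      by_cases hk : x ∈ U k
      · rw [hl k hk, mul_assoc]
      · rw [hU0 k x hk, zero_mul, zero_mul, zero_mul]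
  have hβs : ∀ x, β.SmoothAt x := by
    intro x
    have hx := mem_extChartAt_source (I := 𝓡 m) x
    rw [OneForm.smoothAt_iff_pull hx]
    have h1 : β.pull (extChartAt (𝓡 m) x).symm = fun y =>
        ∑ i, f i ((extChartAt (𝓡 m) x).symm y) • (α i).pull (extChartAt (𝓡 m) x).symm y := by
      funext y
      refine ContinuousLinearMap.ext fun v => ?_
      change β.cov _ _ = _
      rw [sumForm_cov, _root_.sum_apply, _root_.sum_apply]
      rfl
    rw [h1]
    refine ContDiffAt.sum fun i _ => ?_
    by_cases hi : x ∈ tsupport (f i)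
    · refine ContDiffAt.smul (contDiffAt_comp_chart_symm (mem_extChartAt_target x)
        ((f i).contMDiff.contMDiffAt)) ?_
      exact (OneForm.smoothAt_iff_pull hx).1 (hα i x (hf i hi)).1
    · refine (contDiffAt_const (c := 0)).congr_of_eventuallyEq ?_
      have hc : ContinuousAt (extChartAt (𝓡 m) x).symm (extChartAt (𝓡 m) x x) :=
        continuousAt_extChartAt_symm x
      have h2 : ∀ᶠ y in 𝓝 (extChartAt (𝓡 m) x x), (extChartAt (𝓡 m) x).symm y ∉ tsupport (f i) := by
        refine hc.preimage_mem_nhds (t := (tsupport (f i))ᶜ) ?_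
        rw [extChartAt_to_inv]
        exact (isClosed_tsupport _).isOpen_compl.mem_nhds hi
      filter_upwards [h2] with y hy
      rw [image_eq_zero_of_notMem_tsupport hy, zero_smul]
  have hβc : ∀ x, β.ContactAt x := by
    intro x
    have hx := mem_extChartAt_source (I := 𝓡 m) x
    have hxU := mem_univ x
    rw [← hcover] at hxU
    obtain ⟨i, hi⟩ := mem_iUnion.1 hxU
    rw [OneForm.contactAt_iff_pull hx (hβs x)]
    refine isContactPair_of_conformal ((OneForm.smoothAt_iff_pull hx).1 (hα i x hi).1)
      ((OneForm.smoothAt_iff_pull hx).1 (hβs x))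
      ((OneForm.contactAt_iff_pull hx (hα i x hi).1).1 (hα i x hi).2) ?_
    have hc : ContinuousAt (extChartAt (𝓡 m) x).symm (extChartAt (𝓡 m) x x) :=
      continuousAt_extChartAt_symm x
    have h2 : ∀ᶠ y in 𝓝 (extChartAt (𝓡 m) x x), (extChartAt (𝓡 m) x).symm y ∈ U i := by
      refine hc.eventually ?_
      rw [extChartAt_to_inv]
      exact (hU i).mem_nhds hi
    filter_upwards [h2] with y hy
    obtain ⟨l, hl0, hly⟩ := hl i _ hy
    exact ⟨l, hl0, fun v => hly _⟩
  refine ⟨⟨fun x => LinearMap.ker (β x).toLinearMap, fun x => {v | 0 < β x v}, β,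
    OneForm.isContactForm_iff.2 fun x => ⟨hβs x, hβc x⟩, fun x v => ⟨Iff.rfl, Iff.rfl⟩⟩,
    fun i x hx v => ?_⟩
  obtain ⟨l, hl0, hlx⟩ := hl i x hx
  exact ⟨(Eq.congr_left (hlx v)).trans (mul_eq_zero.trans (or_iff_right hl0.ne')),
    (iff_of_eq (congrArg (0 < ·) (hlx v))).trans (mul_pos_iff_of_pos_left hl0)⟩

variable {E : Type*} [NormedAddCommGroup E] [NormedSpace ℝ E] {H : Type*} [TopologicalSpace H]
  {I : ModelWithCorners ℝ E H} {Y : Type*} [TopologicalSpace Y] [ChartedSpace H Y]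
  [IsManifold I ∞ Y]

/-- The image of a form under a diffeomorphism onto an open set. -/
lemma IsOpenDiffeoOn.exists_push {f : Y → X} {s : Set Y} (h : IsOpenDiffeoOn I (𝓡 m) f s)
    (β : Y → E →L[ℝ] ℝ) :
    ∃ α : OneForm m X, (∀ y ∈ s, ∀ v, α.cov (f y) (tderiv I (𝓡 m) f y v) = β y v) ∧
      ∀ {F : Type} [NormedAddCommGroup F] [NormedSpace ℝ F] [FiniteDimensional ℝ F] (c : F → Y)
        (z : F), c z ∈ s → ContMDiffAt 𝓘(ℝ, F) I ∞ c z →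
        Function.Injective (tderiv 𝓘(ℝ, F) I c z) → Module.finrank ℝ F = m →
        ∀ b : F → F →L[ℝ] ℝ, (∀ᶠ z in 𝓝 z, ∀ v, b z v = β (c z) (tderiv 𝓘(ℝ, F) I c z v)) →
          ContDiffAt ℝ ∞ b z → IsContactPair (b z) (dForm b z) →
          α.SmoothAt (f (c z)) ∧ α.ContactAt (f (c z)) := by
  obtain ⟨g, hg, hgf, hgd, hgd'⟩ := h.exists_inverse
  let α : OneForm m X := fun x => ((β (g x)).comp (tderiv (𝓡 m) I g x) :
    EuclideanSpace ℝ (Fin m) →L[ℝ] ℝ)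
  have hα : ∀ y ∈ s, ∀ v, α.cov (f y) (tderiv I (𝓡 m) f y v) = β y v := by
    intro y hy v
    change β (g (f y)) (tderiv (𝓡 m) I g (f y) (tderiv I (𝓡 m) f y v)) = _
    rw [hgd y hy, hgf y hy]
  refine ⟨α, hα, ?_⟩
  intro F _ _ _ c z hz hc hinj hdim b hb hbs hbc
  have hfc : ContMDiffAt 𝓘(ℝ, F) (𝓡 m) ∞ (f ∘ c) z := ContMDiffAt.comp z (h.contMDiffAt hz) hc
  have hev : α.pull (f ∘ c) =ᶠ[𝓝 z] b := by
    filter_upwards [hb, hc.continuousAt.eventually (h.1.mem_nhds hz),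
      eventually_mdifferentiableAt hc] with w hw hws hwc
    refine ContinuousLinearMap.ext fun v => ?_
    change α.cov (f (c w)) (tderiv 𝓘(ℝ, F) (𝓡 m) (f ∘ c) w v) = _
    rw [tderiv_comp_apply (h.mdifferentiableAt hws) hwc rfl, hα _ hws, hw]
  have hinj' : Function.Injective (tderiv 𝓘(ℝ, F) (𝓡 m) (f ∘ c) z) := by
    rw [tderiv_comp (h.mdifferentiableAt hz) (hc.mdifferentiableAt (by simp)) rfl]
    exact (h.injective_tderiv hz).comp hinj
  have hs : α.SmoothAt ((f ∘ c) z) := OneForm.smoothAt_of_pull hfc hinj' hdim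
    (hbs.congr_of_eventuallyEq hev)
  refine ⟨hs, (hs.isContactPair_pull_iff hfc hinj' hdim).1 ?_⟩
  rw [dForm_congr hev, hev.eq_of_nhds]
  exact hbc

end Patch

/-! ### Derivatives on products and on the circle -/

section Products

set_option linter.unusedSectionVars false

variable {E : Type*} [NormedAddCommGroup E] [NormedSpace ℝ E] {H : Type*} [TopologicalSpace H]
  {I : ModelWithCorners ℝ E H} {X : Type*} [TopologicalSpace X] [ChartedSpace H X]
  {E' : Type*} [NormedAddCommGroup E'] [NormedSpace ℝ E'] {H' : Type*} [TopologicalSpace H']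
  {I' : ModelWithCorners ℝ E' H'} {Y : Type*} [TopologicalSpace Y] [ChartedSpace H' Y]
  {E'' : Type*} [NormedAddCommGroup E''] [NormedSpace ℝ E''] {H'' : Type*} [TopologicalSpace H'']
  {I'' : ModelWithCorners ℝ E'' H''} {Z : Type*} [TopologicalSpace Z] [ChartedSpace H'' Z]

lemma tderiv_prodMk {f : X → Y} {g : X → Z} {x : X} (hf : MDifferentiableAt I I' f x)
    (hg : MDifferentiableAt I I'' g x) (v : E) :
    tderiv I (I'.prod I'') (fun x => (f x, g x)) x v = (tderiv I I' f x v, tderiv I I'' g x v) := by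
  unfold tderiv
  rw [mfderiv_prodMk hf hg]
  rfl

lemma tderiv_comp_fst {f : X → Z} {q : X × Y} (hf : MDifferentiableAt I I'' f q.1) (v : E × E') :
    tderiv (I.prod I') I'' (fun q : X × Y => f q.1) q v = tderiv I I'' f q.1 v.1 := by
  refine (tderiv_comp_apply (g := f) (f := Prod.fst) hf mdifferentiableAt_fst rfl v).trans ?_
  congr 1
  exact congrArg (fun L : E × E' →L[ℝ] E => L v) (mfderiv_fst (I := I) (I' := I') (x := q))

lemma tderiv_comp_snd {f : Y → Z} {q : X × Y} (hf : MDifferentiableAt I' I'' f q.2) (v : E × E') :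
    tderiv (I.prod I') I'' (fun q : X × Y => f q.2) q v = tderiv I' I'' f q.2 v.2 := by
  refine (tderiv_comp_apply (g := f) (f := Prod.snd) hf mdifferentiableAt_snd rfl v).trans ?_
  congr 1
  exact congrArg (fun L : E × E' →L[ℝ] E' => L v) (mfderiv_snd (I := I) (I' := I') (x := q))

end Products

section CircleDeriv

attribute [local instance] finrank_real_complex_fact'

lemma contMDiff_circle_coe : ContMDiff (𝓡 1) 𝓘(ℝ, ℂ) ∞ (fun θ : Circle => (θ : ℂ)) :=
  contMDiff_coe_sphere (E := ℂ) (n := 1)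

lemma mdifferentiable_circle_coe (θ : Circle) :
    MDifferentiableAt (𝓡 1) 𝓘(ℝ, ℂ) (fun θ : Circle => (θ : ℂ)) θ :=
  (contMDiff_circle_coe θ).mdifferentiableAt (by simp)

lemma mdifferentiable_circle_inv (θ : Circle) :
    MDifferentiableAt (𝓡 1) (𝓡 1) (fun θ : Circle => θ⁻¹) θ :=
  ((contMDiff_inv (𝓡 1) ∞) θ).mdifferentiableAt (by simp)

/-- The derivative of the inclusion of the circle into the plane. -/
def circleDeriv (θ : Circle) : EuclideanSpace ℝ (Fin 1) →L[ℝ] ℂ :=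
  tderiv (𝓡 1) 𝓘(ℝ, ℂ) (fun θ : Circle => (θ : ℂ)) θ

lemma circleDeriv_injective (θ : Circle) : Function.Injective (circleDeriv θ) :=
  injective_mvfderiv_subtypeVal_sphere (E := ℂ) (n := 1) θ

lemma normSq_circle (θ : Circle) : (θ : ℂ).re * (θ : ℂ).re + (θ : ℂ).im * (θ : ℂ).im = 1 := by
  rw [← Complex.normSq_apply, Circle.normSq_coe]

lemma tderiv_comp_circle_coe {F : Type*} [NormedAddCommGroup F] [NormedSpace ℝ F] {g : ℂ → F}
    {L : ℂ →L[ℝ] F} {θ : Circle} (hg : HasFDerivAt g L θ) (τ : EuclideanSpace ℝ (Fin 1)) :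
    tderiv (𝓡 1) 𝓘(ℝ, F) (fun θ : Circle => g θ) θ τ = L (circleDeriv θ τ) := by
  refine (tderiv_comp_apply (g := g) (f := fun θ : Circle => (θ : ℂ))
    hg.differentiableAt.mdifferentiableAt (mdifferentiable_circle_coe θ) rfl τ).trans ?_
  rw [tderiv_eq_fderiv, hg.fderiv]
  rfl

lemma circleDeriv_orthogonal (θ : Circle) (τ : EuclideanSpace ℝ (Fin 1)) :
    (θ : ℂ).re * (circleDeriv θ τ).re + (θ : ℂ).im * (circleDeriv θ τ).im = 0 := by
  have hr : HasFDerivAt (fun z : ℂ => z.re) Complex.reCLM (θ : ℂ) := Complex.reCLM.hasFDerivAt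
  have hi : HasFDerivAt (fun z : ℂ => z.im) Complex.imCLM (θ : ℂ) := Complex.imCLM.hasFDerivAt
  have h1 := tderiv_comp_circle_coe ((hr.mul hr).add (hi.mul hi)) τ
  have h2 : (fun θ : Circle => ((fun z : ℂ => z.re) * (fun z : ℂ => z.re) +
      (fun z : ℂ => z.im) * (fun z : ℂ => z.im)) (θ : ℂ)) = fun _ => (1 : ℝ) :=
    funext fun θ => normSq_circle θ
  rw [h2] at h1
  have h3 : tderiv (𝓡 1) 𝓘(ℝ, ℝ) (fun _ : Circle => (1 : ℝ)) θ = 0 := mfderiv_const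
  rw [h3] at h1
  simp at h1
  linarith

/-- A tangent vector of the circle at `θ` is orthogonal to `θ`, hence a real multiple of `I θ`, and
`angularForm` reads off the multiple. -/
lemma circleDeriv_eq (θ : Circle) (τ : EuclideanSpace ℝ (Fin 1)) :
    circleDeriv θ τ = angularForm θ (circleDeriv θ τ) * (Complex.I * θ) := by
  have h1 := circleDeriv_orthogonal θ τ
  have h2 := normSq_circle θ
  apply Complex.ext
  · simp [angularForm]
    linear_combination (circleDeriv θ τ).re * (-h2) + (θ : ℂ).re * h1
  · simp [angularForm]
    linear_combination (circleDeriv θ τ).im * (-h2) + (θ : ℂ).im * h1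

lemma eq_zero_of_angularForm {θ : Circle} {τ : EuclideanSpace ℝ (Fin 1)}
    (h : angularForm θ (circleDeriv θ τ) = 0) : τ = 0 := by
  refine (circleDeriv_injective θ).eq_iff.1 ?_
  rw [circleDeriv_eq, h, map_zero]
  simp

lemma circleDeriv_inv (θ : Circle) (τ : EuclideanSpace ℝ (Fin 1)) :
    circleDeriv θ⁻¹ (tderiv (𝓡 1) (𝓡 1) (fun θ : Circle => θ⁻¹) θ τ) =
      (starRingEnd ℂ) (circleDeriv θ τ) := by
  have h1 := tderiv_comp_apply (g := fun θ : Circle => (θ : ℂ)) (f := fun θ : Circle => θ⁻¹)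
    (mdifferentiable_circle_coe θ⁻¹) (mdifferentiable_circle_inv θ) rfl τ
  refine h1.symm.trans ?_
  have h2 : ((fun θ : Circle => (θ : ℂ)) ∘ fun θ : Circle => θ⁻¹) =
      fun θ : Circle => Complex.conjCLE (θ : ℂ) := by
    funext θ
    exact Circle.coe_inv_eq_conj θ
  rw [h2, tderiv_comp_circle_coe Complex.conjCLE.hasFDerivAt]
  simp

/-- On the circle inversion is complex conjugation, which reverses the angle. -/
lemma angularForm_circleDeriv_inv (θ : Circle) (τ : EuclideanSpace ℝ (Fin 1)) :
    angularForm (θ⁻¹ : Circle)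
      (circleDeriv θ⁻¹ (tderiv (𝓡 1) (𝓡 1) (fun θ : Circle => θ⁻¹) θ τ)) =
      -angularForm θ (circleDeriv θ τ) := by
  rw [circleDeriv_inv, Circle.coe_inv_eq_conj]
  simp [angularForm]
  ring

lemma mdifferentiable_circleExp (t : ℝ) : MDifferentiableAt 𝓘(ℝ, ℝ) (𝓡 1) Circle.exp t :=
  ((contMDiff_circleExp (m := ∞)) t).mdifferentiableAt (by simp)

/-- In the angle parameter `dφ` becomes `dt`. For this reason the collar is parametrized by
`Circle.exp` and not by the charts of the circle. -/
lemma angularForm_circleExp (t τ : ℝ) : angularForm (Circle.exp t)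
    (circleDeriv (Circle.exp t) (tderiv 𝓘(ℝ, ℝ) (𝓡 1) Circle.exp t τ)) = τ := by
  have h1 := tderiv_comp_apply (g := fun θ : Circle => (θ : ℂ)) (f := Circle.exp)
    (mdifferentiable_circle_coe _) (mdifferentiable_circleExp t) rfl τ
  have h2 : HasDerivAt (fun t : ℝ => Complex.exp (t * Complex.I))
      (Complex.exp (t * Complex.I) * (1 * Complex.I)) t :=
    (((hasDerivAt_id t).ofReal_comp).mul_const Complex.I).cexp
  have h3 : ((fun θ : Circle => (θ : ℂ)) ∘ Circle.exp) = fun t : ℝ => Complex.exp (t * Complex.I) := by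
    funext t
    exact Circle.coe_exp t
  rw [h3, tderiv_eq_fderiv, h2.hasFDerivAt.fderiv] at h1
  rw [circleDeriv, ← h1]
  simp [angularForm]
  linear_combination τ * Real.sin_sq_add_cos_sq t

end CircleDeriv

/-! ### The collar -/

section Collar

set_option linter.unusedSectionVars false

variable {d : ℕ} {N : Type u}
  [TopologicalSpace N] [ChartedSpace (EuclideanSpace ℝ (Fin d)) N] [IsManifold (𝓡 d) ∞ N]

/-- The model of `ℝ × S¹ × N`. -/
abbrev collarModel (d : ℕ) := 𝓘(ℝ, ℝ).prod ((𝓡 1).prod (𝓡 d))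

/-- The model space of `ℝ × S¹ × N`. -/
abbrev CollarSpace (d : ℕ) := ℝ × EuclideanSpace ℝ (Fin 1) × EuclideanSpace ℝ (Fin d)

/-- The form `αN + s dφ` as a functional on the model space. -/
def collarCLM (αN : OneForm d N) (q : ℝ × Circle × N) : CollarSpace d →L[ℝ] ℝ :=
  (αN.cov q.2.2).comp (ContinuousLinearMap.snd ℝ _ _ ∘L ContinuousLinearMap.snd ℝ _ _) +
    q.1 • (angularCLM (q.2.1 : ℂ)).comp
      (circleDeriv q.2.1 ∘L ContinuousLinearMap.fst ℝ _ _ ∘L ContinuousLinearMap.snd ℝ _ _)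

lemma collarCLM_apply (αN : OneForm d N) (q : ℝ × Circle × N) (v : CollarSpace d) :
    collarCLM αN q v =
      αN.cov q.2.2 v.2.2 + q.1 * angularForm (q.2.1 : ℂ) (circleDeriv q.2.1 v.2.1) := rfl

lemma tderiv_collar_circle (q : ℝ × Circle × N) (v : CollarSpace d) :
    tderiv (collarModel d) 𝓘(ℝ, ℂ) (fun q : ℝ × Circle × N => (q.2.1 : ℂ)) q v =
      circleDeriv q.2.1 v.2.1 := by
  have h : MDifferentiableAt ((𝓡 1).prod (𝓡 d)) 𝓘(ℝ, ℂ) (fun q : Circle × N => (q.1 : ℂ)) q.2 :=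
    (mdifferentiable_circle_coe q.2.1).comp q.2 mdifferentiableAt_fst
  rw [tderiv_comp_snd (f := fun q : Circle × N => (q.1 : ℂ)) h,
    tderiv_comp_fst (f := fun θ : Circle => (θ : ℂ)) (mdifferentiable_circle_coe q.2.1)]
  rfl

lemma tderiv_collar_base (q : ℝ × Circle × N) (v : CollarSpace d) :
    tderiv (collarModel d) (𝓡 d) (fun q : ℝ × Circle × N => q.2.2) q v = v.2.2 := by
  rw [tderiv_comp_snd (f := fun q : Circle × N => q.2) mdifferentiableAt_snd,
    tderiv_comp_snd (f := fun x : N => x) mdifferentiableAt_id]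
  exact congrArg (fun L : EuclideanSpace ℝ (Fin d) →L[ℝ] _ => L v.2.2) (tderiv_id (I := 𝓡 d))

lemma tderiv_collar_height (q : ℝ × Circle × N) (v : CollarSpace d) :
    tderiv (collarModel d) 𝓘(ℝ, ℝ) (fun q : ℝ × Circle × N => q.1) q v = v.1 := by
  rw [tderiv_comp_fst (f := fun x : ℝ => x) mdifferentiableAt_id]
  exact congrArg (fun L : ℝ →L[ℝ] _ => L v.1) (tderiv_id (I := 𝓘(ℝ, ℝ)))

lemma collarForm_eq (αN : OneForm d N) (q : ℝ × Circle × N) (v : CollarSpace d) :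
    collarForm αN q v = collarCLM αN q v := by
  rw [collarCLM_apply, ← tderiv_collar_circle q v]
  exact congrArg (αN.cov q.2.2 · + _) (tderiv_collar_base q v)

/-- The map `(s, θ, p) ↦ (√s θ, p)`. -/
def polar (q : ℝ × Circle × N) : ℂ × N := (√q.1 • (q.2.1 : ℂ), q.2.2)

lemma contMDiffAt_polar {q : ℝ × Circle × N} (hq : 0 < q.1) :
    ContMDiffAt (collarModel d) (𝓘(ℝ, ℂ).prod (𝓡 d)) ∞ polar q := by
  have h1 : ContMDiffAt (collarModel d) 𝓘(ℝ, ℝ) ∞ (fun q : ℝ × Circle × N => √q.1) q :=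
    ContMDiffAt.comp (g := Real.sqrt) q (Real.contDiffAt_sqrt hq.ne').contMDiffAt contMDiffAt_fst
  have h2 : ContMDiffAt (collarModel d) 𝓘(ℝ, ℂ) ∞ (fun q : ℝ × Circle × N => (q.2.1 : ℂ)) q :=
    ContMDiffAt.comp (g := fun θ : Circle => (θ : ℂ)) q (contMDiff_circle_coe _)
      (contMDiffAt_fst.comp q contMDiffAt_snd)
  exact (h1.smul h2).prodMk (contMDiffAt_snd.comp q contMDiffAt_snd)

lemma tderiv_polar {q : ℝ × Circle × N} (hq : 0 < q.1) (v : CollarSpace d) :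
    tderiv (collarModel d) (𝓘(ℝ, ℂ).prod (𝓡 d)) polar q v =
      (√q.1 • circleDeriv q.2.1 v.2.1 + (v.1 / (2 * √q.1)) • (q.2.1 : ℂ), v.2.2) := by
  have h2 : MDifferentiableAt (collarModel d) 𝓘(ℝ, ℂ) (fun q : ℝ × Circle × N => (q.2.1 : ℂ)) q :=
    MDifferentiableAt.comp (g := fun θ : Circle => (θ : ℂ)) q (mdifferentiable_circle_coe _)
      (mdifferentiableAt_fst.comp q mdifferentiableAt_snd)
  have h3 : MDifferentiableAt (collarModel d) 𝓘(ℝ, ℝ × ℂ)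
      (fun q : ℝ × Circle × N => (q.1, (q.2.1 : ℂ))) q :=
    mdifferentiableAt_fst.prodMk_space h2
  have h4 : HasFDerivAt (fun x : ℝ × ℂ => √x.1 • x.2) _ (q.1, (q.2.1 : ℂ)) :=
    ((hasFDerivAt_fst (𝕜 := ℝ) (p := (q.1, (q.2.1 : ℂ)))).sqrt hq.ne').smul
      (hasFDerivAt_snd (𝕜 := ℝ) (p := (q.1, (q.2.1 : ℂ))))
  have h5 : tderiv (collarModel d) 𝓘(ℝ, ℂ) (fun q : ℝ × Circle × N => √q.1 • (q.2.1 : ℂ)) q v =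
      √q.1 • circleDeriv q.2.1 v.2.1 + (v.1 / (2 * √q.1)) • (q.2.1 : ℂ) := by
    have h6 := tderiv_comp_apply (g := fun x : ℝ × ℂ => √x.1 • x.2)
      (f := fun q : ℝ × Circle × N => (q.1, (q.2.1 : ℂ))) h4.differentiableAt.mdifferentiableAt h3
      rfl v
    have h7 : tderiv (collarModel d) 𝓘(ℝ, ℝ × ℂ)
        (fun q : ℝ × Circle × N => (q.1, (q.2.1 : ℂ))) q v = (v.1, circleDeriv q.2.1 v.2.1) := by
      rw [← tderiv_collar_circle q v, ← tderiv_collar_height q v]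
      have h8 := tderiv_comp_apply (g := (Prod.fst : ℝ × ℂ → ℝ))
        differentiableAt_fst.mdifferentiableAt h3 rfl v
      have h9 := tderiv_comp_apply (g := (Prod.snd : ℝ × ℂ → ℂ))
        differentiableAt_snd.mdifferentiableAt h3 rfl v
      rw [tderiv_eq_fderiv, fderiv_fst] at h8
      rw [tderiv_eq_fderiv, fderiv_snd] at h9
      exact Prod.ext h8.symm h9.symm
    refine h6.trans ?_
    rw [h7, tderiv_eq_fderiv, h4.fderiv]
    simp
    ring
  refine (tderiv_prodMk (f := fun q : ℝ × Circle × N => √q.1 • (q.2.1 : ℂ))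
    (h4.differentiableAt.mdifferentiableAt.comp q h3)
    (mdifferentiableAt_snd.comp q mdifferentiableAt_snd) v).trans ?_
  rw [h5]
  exact congrArg (Prod.mk _) (tderiv_collar_base q v)

/-- The radial part of the derivative contributes nothing to `x dy - y dx`; the angular part
contributes `√s · √s = s` times `dφ`. -/
lemma discForm_polar (αN : OneForm d N) {q : ℝ × Circle × N} (hq : 0 < q.1) (v : CollarSpace d) :
    discForm αN (polar q) (tderiv (collarModel d) (𝓘(ℝ, ℂ).prod (𝓡 d)) polar q v) =
      collarCLM αN q v := by
  rw [discForm_eq, tderiv_polar hq, collarCLM_apply]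
  congr 1
  have h := Real.mul_self_sqrt hq.le
  simp only [polar, angularForm, Complex.add_re, Complex.add_im, Complex.smul_re, Complex.smul_im,
    smul_eq_mul]
  linear_combination ((q.2.1 : ℂ).re * (circleDeriv q.2.1 v.2.1).im -
    (q.2.1 : ℂ).im * (circleDeriv q.2.1 v.2.1).re) * h

lemma injective_tderiv_polar {q : ℝ × Circle × N} (hq : 0 < q.1) :
    Function.Injective (tderiv (collarModel d) (𝓘(ℝ, ℂ).prod (𝓡 d)) polar q) := by
  refine (injective_iff_map_eq_zero _).2 fun v hv => ?_
  rw [tderiv_polar hq, Prod.mk_eq_zero] at hv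
  have hr : 0 < √q.1 := Real.sqrt_pos.2 hq
  have h1 := congrArg Complex.re hv.1
  have h2 := congrArg Complex.im hv.1
  simp only [Complex.add_re, Complex.add_im, Complex.smul_re, Complex.smul_im, smul_eq_mul,
    Complex.zero_re, Complex.zero_im] at h1 h2
  have h3 := circleDeriv_orthogonal q.2.1 v.2.1
  have h4 := normSq_circle q.2.1
  -- The inner product with `θ` isolates the radial component; below, `angularForm` isolates the
  -- angular one.
  have h5 : v.1 / (2 * √q.1) = 0 := by
    linear_combination (q.2.1 : ℂ).re * h1 + (q.2.1 : ℂ).im * h2 - √q.1 * h3 -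
      v.1 / (2 * √q.1) * h4
  have h6 : v.1 = 0 := by
    rcases div_eq_zero_iff.1 h5 with h | h
    · exact h
    · exact absurd h (by positivity)
  have h7 : angularForm q.2.1 (circleDeriv q.2.1 v.2.1) = 0 := by
    rw [h5] at h1 h2
    refine (mul_eq_zero.1 (?_ : √q.1 * _ = 0)).resolve_left hr.ne'
    unfold angularForm
    linear_combination (q.2.1 : ℂ).re * h2 - (q.2.1 : ℂ).im * h1
  exact Prod.ext h6 (Prod.ext (eq_zero_of_angularForm h7) hv.2)

lemma norm_polar_fst (q : ℝ × Circle × N) : ‖(polar q).1‖ = √q.1 := by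
  rw [polar, norm_smul, Circle.norm_coe, mul_one, Real.norm_of_nonneg (Real.sqrt_nonneg _)]

lemma injOn_polar : InjOn (polar (N := N)) (Ioi 0 ×ˢ univ) := by
  rintro ⟨s, θ, p⟩ ⟨hs, -⟩ ⟨s', θ', p'⟩ ⟨hs', -⟩ h
  have h1 := congrArg (fun x => ‖x.1‖) h
  simp only [norm_polar_fst] at h1
  have h2 : s = s' := (Real.sqrt_inj (le_of_lt hs) (le_of_lt hs')).1 h1
  subst h2
  obtain ⟨h3, h4⟩ := Prod.ext_iff.1 h
  have h5 : (θ : ℂ) = θ' := smul_right_injective ℂ (Real.sqrt_pos.2 hs).ne' h3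
  have h6 : p = p' := h4
  rw [Circle.ext h5, h6]

/-- The map `(s, θ, p) ↦ (-s, θ⁻¹, p)`. -/
def reflect (q : ℝ × Circle × N) : ℝ × Circle × N := (-q.1, q.2.1⁻¹, q.2.2)

lemma reflect_reflect (q : ℝ × Circle × N) : reflect (reflect q) = q := by simp [reflect]

lemma contMDiff_reflect : ContMDiff (collarModel d) (collarModel d) ∞ (reflect (N := N)) :=
  contMDiff_fst.neg.prodMk (((contMDiff_inv (𝓡 1) ∞).comp
    (contMDiff_fst.comp contMDiff_snd)).prodMk (contMDiff_snd.comp contMDiff_snd))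

lemma tderiv_reflect (q : ℝ × Circle × N) (v : CollarSpace d) :
    tderiv (collarModel d) (collarModel d) reflect q v =
      (-v.1, tderiv (𝓡 1) (𝓡 1) (fun θ : Circle => θ⁻¹) q.2.1 v.2.1, v.2.2) := by
  have h1 : MDifferentiableAt (collarModel d) (𝓡 1) (fun q : ℝ × Circle × N => q.2.1⁻¹) q :=
    MDifferentiableAt.comp (g := fun θ : Circle => θ⁻¹) q (mdifferentiable_circle_inv _)
      (mdifferentiableAt_fst.comp q mdifferentiableAt_snd)
  have h2 : MDifferentiableAt (collarModel d) (𝓡 d) (fun q : ℝ × Circle × N => q.2.2) q :=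
    mdifferentiableAt_snd.comp q mdifferentiableAt_snd
  have h3 : MDifferentiableAt (collarModel d) 𝓘(ℝ, ℝ) (fun q : ℝ × Circle × N => -q.1) q :=
    (contMDiff_fst.neg (f := fun q : ℝ × Circle × N => q.1) q).mdifferentiableAt (n := ∞) (by simp)
  refine (tderiv_prodMk h3 (h1.prodMk h2) v).trans ?_
  rw [tderiv_prodMk h1 h2, tderiv_collar_base]
  refine Prod.ext ?_ (Prod.ext ?_ rfl)
  · refine (tderiv_comp_fst (f := fun s : ℝ => -s) (differentiableAt_id.neg.mdifferentiableAt) v).trans ?_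
    rw [tderiv_eq_fderiv]
    simp
  · refine (tderiv_comp_snd (f := fun q : Circle × N => q.1⁻¹) (MDifferentiableAt.comp
      (g := fun θ : Circle => θ⁻¹) _ (mdifferentiable_circle_inv _) mdifferentiableAt_fst) v).trans ?_
    exact tderiv_comp_fst (f := fun θ : Circle => θ⁻¹) (mdifferentiable_circle_inv _) v.2

/-- Both `s` and `dφ` change sign. This is why the gluing map preserves the contact form and its
coorientation. -/
lemma collarCLM_reflect (αN : OneForm d N) (q : ℝ × Circle × N) (v : CollarSpace d) :
    collarCLM αN (reflect q) (tderiv (collarModel d) (collarModel d) reflect q v) =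
      collarCLM αN q v := by
  rw [tderiv_reflect, collarCLM_apply, collarCLM_apply]
  congr 1
  change -q.1 * angularForm (q.2.1⁻¹ : Circle) (circleDeriv q.2.1⁻¹ _) = _
  rw [angularForm_circleDeriv_inv, neg_mul_neg]

end Collar

/-! ### The contact condition on the collar -/

section CollarContact

set_option linter.unusedSectionVars false

variable {d : ℕ} {N : Type u}
  [TopologicalSpace N] [ChartedSpace (EuclideanSpace ℝ (Fin d)) N] [IsManifold (𝓡 d) ∞ N]

/-- The form `a + s dφ` on `ℝ × ℝ × E`. -/
def stripForm {E : Type} [NormedAddCommGroup E] [NormedSpace ℝ E] (a : E → E →L[ℝ] ℝ)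
    (x : ℝ × ℝ × E) : ℝ × ℝ × E →L[ℝ] ℝ :=
  pullVec (fun x : ℝ × ℝ × E => x.2.2) a x +
    x.1 • (ContinuousLinearMap.fst ℝ ℝ E ∘L ContinuousLinearMap.snd ℝ ℝ (ℝ × E))

section Strip

variable {E : Type} [NormedAddCommGroup E] [NormedSpace ℝ E] {a : E → E →L[ℝ] ℝ} {x : ℝ × ℝ × E}

lemma fderiv_snd_snd (x v : ℝ × ℝ × E) : fderiv ℝ (fun x : ℝ × ℝ × E => x.2.2) x v = v.2.2 := by
  have h : HasFDerivAt (fun x : ℝ × ℝ × E => x.2.2)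
      (ContinuousLinearMap.snd ℝ ℝ E ∘L ContinuousLinearMap.snd ℝ ℝ (ℝ × E)) x :=
    (ContinuousLinearMap.snd ℝ ℝ E ∘L ContinuousLinearMap.snd ℝ ℝ (ℝ × E)).hasFDerivAt
  rw [h.fderiv]
  rfl

lemma fderiv_fst_fst (x v : ℝ × ℝ × E) : fderiv ℝ (fun x : ℝ × ℝ × E => x.1) x v = v.1 := by
  have h : HasFDerivAt (fun x : ℝ × ℝ × E => x.1) (ContinuousLinearMap.fst ℝ ℝ (ℝ × E)) x :=
    (ContinuousLinearMap.fst ℝ ℝ (ℝ × E)).hasFDerivAt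
  rw [h.fderiv]
  rfl

lemma stripForm_apply (a : E → E →L[ℝ] ℝ) (x v : ℝ × ℝ × E) :
    stripForm a x v = a x.2.2 v.2.2 + x.1 * v.2.1 := by
  change a x.2.2 (fderiv ℝ (fun x : ℝ × ℝ × E => x.2.2) x v) + _ = _
  rw [fderiv_snd_snd]
  rfl

lemma contDiffAt_stripForm (ha : ContDiffAt ℝ ∞ a x.2.2) : ContDiffAt ℝ ∞ (stripForm a) x :=
  (contDiffAt_pullVec (contDiffAt_snd.comp x contDiffAt_snd) ha).add
    (contDiffAt_fst.smul contDiffAt_const)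

lemma dForm_stripForm (ha : ContDiffAt ℝ ∞ a x.2.2) (u v : ℝ × ℝ × E) :
    dForm (stripForm a) x u v = dForm a x.2.2 u.2.2 v.2.2 + u.1 * v.2.1 - v.1 * u.2.1 := by
  have h2 : ContDiffAt ℝ ∞ (fun x : ℝ × ℝ × E => x.2.2) x := contDiffAt_snd.comp x contDiffAt_snd
  have h1 := (contDiffAt_pullVec h2 ha).differentiableAt (by simp)
  let c : ℝ × ℝ × E →L[ℝ] ℝ := ContinuousLinearMap.fst ℝ ℝ E ∘L ContinuousLinearMap.snd ℝ ℝ (ℝ × E)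
  have h3 : DifferentiableAt ℝ ((fun x : ℝ × ℝ × E => x.1) • fun _ : ℝ × ℝ × E => c) x :=
    differentiableAt_fst.smul (differentiableAt_const c)
  have h4 : dForm (fun _ : ℝ × ℝ × E => c) x u v = 0 := by
    simp [dForm]
  have h5 := dForm_smul (b := fun _ : ℝ × ℝ × E => c) (f := fun x : ℝ × ℝ × E => x.1) (y := x)
    differentiableAt_fst (differentiableAt_const c) u v
  rw [h4, fderiv_fst_fst, fderiv_fst_fst] at h5
  have h6 := dForm_add h1 h3
  have h7 := dForm_pullVec h2 (ha.differentiableAt (by simp)) u v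
  rw [fderiv_snd_snd, fderiv_snd_snd] at h7
  change dForm (fun y => pullVec (fun x : ℝ × ℝ × E => x.2.2) a y +
    ((fun x : ℝ × ℝ × E => x.1) • fun _ : ℝ × ℝ × E => c) y) x u v = _
  rw [h6, _root_.add_apply, _root_.add_apply, h7]
  refine (congrArg (_ + ·) h5).trans ?_
  change _ + (x.1 * 0 + u.1 * v.2.1 - v.1 * u.2.1) = _
  ring

/-- The differential is `da + ds ∧ dφ`. Pairing with `∂_s`, which lies in the kernel, removes the
angular component of a degenerate vector; pairing with `ker a` then removes the component in `E`;
the remaining `s`-component is removed by a lift of `∂_φ` to the kernel. -/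
lemma isContactPair_stripForm (ha : ContDiffAt ℝ ∞ a x.2.2)
    (hc : IsContactPair (a x.2.2) (dForm a x.2.2)) :
    IsContactPair (stripForm a x) (dForm (stripForm a) x) := by
  obtain ⟨w₀, hw₀⟩ : ∃ w₀, a x.2.2 w₀ = 1 := by
    obtain ⟨w, hw⟩ : ∃ w, a x.2.2 w ≠ 0 := by
      by_contra! h0
      exact hc.1 (ContinuousLinearMap.ext h0)
    exact ⟨(a x.2.2 w)⁻¹ • w, by rw [map_smul, smul_eq_mul, inv_mul_cancel₀ hw]⟩
  refine ⟨fun h => ?_, fun u hu h => ?_⟩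
  · have := congrArg (fun L => L (0, 0, w₀)) h
    simp [stripForm_apply, hw₀] at this
  · simp only [dForm_stripForm ha, stripForm_apply] at hu h
    have h1 := h (1, 0, 0) (by simp)
    simp only [map_zero, mul_zero, zero_add, one_mul, zero_sub, neg_eq_zero] at h1
    have h2 : u.2.2 = 0 := hc.2 _ (by rw [h1] at hu; linarith) fun w hw => by
      have := h (0, 0, w) (by simp [hw])
      simpa using this
    -- The correction by `w₀`, on which `a` is one, brings `∂_φ` into the kernel of `a + s dφ`.
    have h3 := h (0, 1, -x.1 • w₀) (by simp [hw₀])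
    simp [h2] at h3
    exact Prod.ext h3 (Prod.ext h1 h2)

end Strip

/-- A parametrization of a part of the collar. -/
def collarParam (d : ℕ) {N : Type u} [TopologicalSpace N]
    [ChartedSpace (EuclideanSpace ℝ (Fin d)) N] (i : N)
    (x : ℝ × ℝ × EuclideanSpace ℝ (Fin d)) : ℝ × Circle × N :=
  (x.1, Circle.exp x.2.1, (extChartAt (𝓡 d) i).symm x.2.2)

variable {i : N} {x : ℝ × ℝ × EuclideanSpace ℝ (Fin d)}

lemma contMDiffAt_collarParam (hx : x.2.2 ∈ (extChartAt (𝓡 d) i).target) :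
    ContMDiffAt 𝓘(ℝ, ℝ × ℝ × EuclideanSpace ℝ (Fin d)) (collarModel d) ∞ (collarParam d i) x := by
  have h1 : ContMDiffAt 𝓘(ℝ, ℝ × ℝ × EuclideanSpace ℝ (Fin d)) (𝓡 1) ∞
      (fun x : ℝ × ℝ × EuclideanSpace ℝ (Fin d) => Circle.exp x.2.1) x :=
    contMDiff_circleExp.contMDiffAt.comp x (contDiffAt_fst.comp x contDiffAt_snd).contMDiffAt
  have h2 : ContMDiffAt 𝓘(ℝ, ℝ × ℝ × EuclideanSpace ℝ (Fin d)) (𝓡 d) ∞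
      (fun x : ℝ × ℝ × EuclideanSpace ℝ (Fin d) => (extChartAt (𝓡 d) i).symm x.2.2) x :=
    ContMDiffAt.comp (g := (extChartAt (𝓡 d) i).symm) x (contMDiffAt_extChartAt_symm i hx)
      (contDiffAt_snd.comp x contDiffAt_snd).contMDiffAt
  exact contDiffAt_fst.contMDiffAt.prodMk (h1.prodMk h2)

lemma tderiv_collarParam (hx : x.2.2 ∈ (extChartAt (𝓡 d) i).target)
    (v : ℝ × ℝ × EuclideanSpace ℝ (Fin d)) :
    tderiv 𝓘(ℝ, ℝ × ℝ × EuclideanSpace ℝ (Fin d)) (collarModel d) (collarParam d i) x v =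
      (v.1, tderiv 𝓘(ℝ, ℝ) (𝓡 1) Circle.exp x.2.1 v.2.1,
        tderiv 𝓘(ℝ, _) (𝓡 d) (extChartAt (𝓡 d) i).symm x.2.2 v.2.2) := by
  have h0 : MDifferentiableAt 𝓘(ℝ, ℝ × ℝ × EuclideanSpace ℝ (Fin d)) 𝓘(ℝ, ℝ)
      (fun x : ℝ × ℝ × EuclideanSpace ℝ (Fin d) => x.1) x :=
    differentiableAt_fst.mdifferentiableAt
  have h1' : DifferentiableAt ℝ (fun x : ℝ × ℝ × EuclideanSpace ℝ (Fin d) => x.2.1) x :=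
    differentiableAt_fst.comp x differentiableAt_snd
  have h2' : DifferentiableAt ℝ (fun x : ℝ × ℝ × EuclideanSpace ℝ (Fin d) => x.2.2) x :=
    differentiableAt_snd.comp x differentiableAt_snd
  have h1 : MDifferentiableAt 𝓘(ℝ, ℝ × ℝ × EuclideanSpace ℝ (Fin d)) (𝓡 1)
      (fun x : ℝ × ℝ × EuclideanSpace ℝ (Fin d) => Circle.exp x.2.1) x :=
    MDifferentiableAt.comp (g := Circle.exp) x (mdifferentiable_circleExp _) h1'.mdifferentiableAt
  have h2 : MDifferentiableAt 𝓘(ℝ, ℝ × ℝ × EuclideanSpace ℝ (Fin d)) (𝓡 d)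
      (fun x : ℝ × ℝ × EuclideanSpace ℝ (Fin d) => (extChartAt (𝓡 d) i).symm x.2.2) x :=
    MDifferentiableAt.comp (g := (extChartAt (𝓡 d) i).symm) x (mdifferentiableAt_chart_symm hx)
      h2'.mdifferentiableAt
  refine (tderiv_prodMk h0 (h1.prodMk h2) v).trans ?_
  rw [tderiv_prodMk h1 h2]
  refine Prod.ext ?_ (Prod.ext ?_ ?_)
  · change tderiv _ _ _ _ _ = _
    rw [tderiv_eq_fderiv, fderiv_fst_fst]
  · refine (tderiv_comp_apply (g := Circle.exp) (mdifferentiable_circleExp _)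
      h1'.mdifferentiableAt rfl v).trans ?_
    congr 1
    rw [tderiv_eq_fderiv]
    have h : HasFDerivAt (fun x : ℝ × ℝ × EuclideanSpace ℝ (Fin d) => x.2.1)
        (ContinuousLinearMap.fst ℝ _ _ ∘L ContinuousLinearMap.snd ℝ _ _) x :=
      (ContinuousLinearMap.fst ℝ ℝ (EuclideanSpace ℝ (Fin d)) ∘L
        ContinuousLinearMap.snd ℝ ℝ _).hasFDerivAt
    rw [h.fderiv]
    rfl
  · refine (tderiv_comp_apply (g := (extChartAt (𝓡 d) i).symm) (mdifferentiableAt_chart_symm hx)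
      h2'.mdifferentiableAt rfl v).trans ?_
    congr 1
    rw [tderiv_eq_fderiv, fderiv_snd_snd]

lemma injective_tderiv_collarParam (hx : x.2.2 ∈ (extChartAt (𝓡 d) i).target) :
    Function.Injective
      (tderiv 𝓘(ℝ, ℝ × ℝ × EuclideanSpace ℝ (Fin d)) (collarModel d) (collarParam d i) x) := by
  refine (injective_iff_map_eq_zero _).2 fun v hv => ?_
  rw [tderiv_collarParam hx, Prod.mk_eq_zero, Prod.mk_eq_zero] at hv
  refine Prod.ext hv.1 (Prod.ext ?_ ?_)
  · have := angularForm_circleExp x.2.1 v.2.1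
    rw [hv.2.1, map_zero] at this
    rw [← this]
    simp [angularForm]
  · exact (Function.LeftInverse.injective fun v => tderiv_chart_chart_symm hx v).eq_iff.1
      (hv.2.2.trans (map_zero _).symm)

lemma collarCLM_collarParam (αN : OneForm d N) (hx : x.2.2 ∈ (extChartAt (𝓡 d) i).target)
    (v : ℝ × ℝ × EuclideanSpace ℝ (Fin d)) :
    collarCLM αN (collarParam d i x)
      (tderiv 𝓘(ℝ, ℝ × ℝ × EuclideanSpace ℝ (Fin d)) (collarModel d) (collarParam d i) x v) =
      stripForm (αN.pull (extChartAt (𝓡 d) i).symm) x v := by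
  rw [tderiv_collarParam hx, collarCLM_apply, stripForm_apply]
  congr 1
  exact congrArg (x.1 * ·) (angularForm_circleExp x.2.1 v.2.1)

/-- The image of `αN + s dφ` under a diffeomorphism is a contact form. -/
lemma exists_push_collar {m : ℕ} (hm : m = d + 2) {X : Type u} [TopologicalSpace X]
    [ChartedSpace (EuclideanSpace ℝ (Fin m)) X] [IsManifold (𝓡 m) ∞ X] {f : ℝ × Circle × N → X}
    {s : Set (ℝ × Circle × N)} (h : IsOpenDiffeoOn (collarModel d) (𝓡 m) f s) {αN : OneForm d N}
    (hα : ∀ x, αN.SmoothAt x) (hc : ∀ x, αN.ContactAt x) :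
    ∃ α : OneForm m X, (∀ y ∈ s, ∀ v, α.cov (f y) (tderiv (collarModel d) (𝓡 m) f y v) =
      collarCLM αN y v) ∧ ∀ x ∈ f '' s, α.SmoothAt x ∧ α.ContactAt x := by
  obtain ⟨α, h1, h2⟩ := h.exists_push (collarCLM αN)
  refine ⟨α, h1, ?_⟩
  rintro _ ⟨⟨s, θ, p⟩, hy, rfl⟩
  have hx : (s, Complex.arg θ, extChartAt (𝓡 d) p p).2.2 ∈ (extChartAt (𝓡 d) p).target :=
    mem_extChartAt_target p
  -- Any angle that represents `θ` would do, since the parametrization only has to be an immersion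
  -- at this point.
  have hxy : collarParam d p (s, Complex.arg θ, extChartAt (𝓡 d) p p) = (s, θ, p) := by
    simp [collarParam]
  have hsm : ContDiffAt ℝ ∞ (αN.pull (extChartAt (𝓡 d) p).symm) (extChartAt (𝓡 d) p p) :=
    (OneForm.smoothAt_iff_pull (mem_extChartAt_source p)).1 (hα p)
  have h3 := h2 (collarParam d p) (s, Complex.arg θ, extChartAt (𝓡 d) p p) (by rwa [hxy])
    (contMDiffAt_collarParam hx) (injective_tderiv_collarParam hx) (by simp [hm]; ring)
    (stripForm (αN.pull (extChartAt (𝓡 d) p).symm)) ?_ (contDiffAt_stripForm hsm)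
    (isContactPair_stripForm hsm (OneForm.isContactPair_pull_chart_symm hα hc p hx))
  · rwa [hxy] at h3
  · have hcont : Filter.Tendsto (fun x : ℝ × ℝ × EuclideanSpace ℝ (Fin d) => x.2.2)
        (𝓝 (s, Complex.arg θ, extChartAt (𝓡 d) p p)) (𝓝 (extChartAt (𝓡 d) p p)) :=
      (continuous_snd.comp continuous_snd).tendsto _
    filter_upwards [hcont.eventually ((isOpen_extChartAt_target p).mem_nhds hx)] with z hz v
    exact (collarCLM_collarParam αN hz v).symm

end CollarContact

/-! ### The underlying set of a fiber sum -/

section GluedSet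

variable {Y₁ Y₂ Z : Type u} (s₁ : Set Y₁) (s₂ : Set Y₂)

/-- The union of `s₁`, `s₂` and the middle `Z` of the collar. -/
inductive GluedSet (s₁ : Set Y₁) (s₂ : Set Y₂) (Z : Type u) : Type u
  | left (x : Y₁) (h : x ∈ s₁)
  | right (x : Y₂) (h : x ∈ s₂)
  | middle (z : Z)

variable [Nonempty Z]

open Classical in
/-- The inclusion of `s₁`. -/
def gluedIncl₁ (Z : Type u) [Nonempty Z] (x : Y₁) : GluedSet s₁ s₂ Z :=
  if h : x ∈ s₁ then .left x h else .middle (Classical.arbitrary Z)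

open Classical in
/-- The inclusion of `s₂`. -/
def gluedIncl₂ (Z : Type u) [Nonempty Z] (x : Y₂) : GluedSet s₁ s₂ Z :=
  if h : x ∈ s₂ then .right x h else .middle (Classical.arbitrary Z)

variable {s₁ s₂}

lemma gluedIncl₁_of_mem {x : Y₁} (h : x ∈ s₁) :
    gluedIncl₁ s₁ s₂ Z x = .left x h := dif_pos h

lemma gluedIncl₂_of_mem {x : Y₂} (h : x ∈ s₂) :
    gluedIncl₂ s₁ s₂ Z x = .right x h := dif_pos h

variable (s₁ s₂) in
/-- The inclusion of the collar. -/
def gluedCollar (g₁ : ℝ × Z → Y₁) (g₂ : ℝ × Z → Y₂) (q : ℝ × Z) : GluedSet s₁ s₂ Z :=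
  if 0 < q.1 then gluedIncl₁ s₁ s₂ Z (g₁ q) else
    if q.1 < 0 then gluedIncl₂ s₁ s₂ Z (g₂ q) else .middle q.2

variable {g₁ : ℝ × Z → Y₁} {g₂ : ℝ × Z → Y₂} {ε : ℝ}

lemma gluedCollar_of_pos {q : ℝ × Z} (h : 0 < q.1) :
    gluedCollar s₁ s₂ g₁ g₂ q = gluedIncl₁ s₁ s₂ Z (g₁ q) := if_pos h

lemma gluedCollar_of_neg {q : ℝ × Z} (h : q.1 < 0) :
    gluedCollar s₁ s₂ g₁ g₂ q = gluedIncl₂ s₁ s₂ Z (g₂ q) := by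
  rw [gluedCollar, if_neg h.not_gt, if_pos h]

lemma gluedCollar_zero (z : Z) : gluedCollar s₁ s₂ g₁ g₂ (0, z) = .middle z := by
  simp [gluedCollar]

lemma injOn_gluedIncl₁ : InjOn (gluedIncl₁ s₁ s₂ Z) s₁ := by
  intro x hx y hy h
  rw [gluedIncl₁_of_mem hx, gluedIncl₁_of_mem hy] at h
  exact (GluedSet.left.inj h)

lemma injOn_gluedIncl₂ : InjOn (gluedIncl₂ s₁ s₂ Z) s₂ := by
  intro x hx y hy h
  rw [gluedIncl₂_of_mem hx, gluedIncl₂_of_mem hy] at h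
  exact (GluedSet.right.inj h)

lemma gluedIncl₁_ne_gluedIncl₂ {x : Y₁} {y : Y₂} (hx : x ∈ s₁) (hy : y ∈ s₂) :
    gluedIncl₁ s₁ s₂ Z x ≠ gluedIncl₂ s₁ s₂ Z y := by
  rw [gluedIncl₁_of_mem hx, gluedIncl₂_of_mem hy]
  exact fun h => by cases h

lemma gluedIncl₁_ne_middle {x : Y₁} (hx : x ∈ s₁) (z : Z) :
    gluedIncl₁ s₁ s₂ Z x ≠ .middle z := by
  rw [gluedIncl₁_of_mem hx]
  exact fun h => by cases h

lemma gluedIncl₂_ne_middle {x : Y₂} (hx : x ∈ s₂) (z : Z) :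
    gluedIncl₂ s₁ s₂ Z x ≠ .middle z := by
  rw [gluedIncl₂_of_mem hx]
  exact fun h => by cases h

lemma disjoint_gluedIncl :
    Disjoint (gluedIncl₁ s₁ s₂ Z '' s₁) (gluedIncl₂ s₁ s₂ Z '' s₂) := by
  rw [Set.disjoint_left]
  rintro _ ⟨x, hx, rfl⟩ ⟨y, hy, h⟩
  exact gluedIncl₁_ne_gluedIncl₂ hx hy h.symm

lemma disjoint_gluedCollar_zero : Disjoint (gluedCollar s₁ s₂ g₁ g₂ '' ({0} ×ˢ univ))
    (gluedIncl₁ s₁ s₂ Z '' s₁ ∪ gluedIncl₂ s₁ s₂ Z '' s₂) := by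
  rw [Set.disjoint_left]
  rintro _ ⟨⟨s, z⟩, ⟨rfl, -⟩, rfl⟩ h
  rw [gluedCollar_zero] at h
  rcases h with ⟨x, hx, h⟩ | ⟨x, hx, h⟩
  · exact gluedIncl₁_ne_middle hx z h
  · exact gluedIncl₂_ne_middle hx z h

lemma glued_cover (hε : 0 < ε) : gluedIncl₁ s₁ s₂ Z '' s₁ ∪ gluedIncl₂ s₁ s₂ Z '' s₂ ∪
    gluedCollar s₁ s₂ g₁ g₂ '' (Ioo (-ε) ε ×ˢ univ) = univ := by
  refine eq_univ_of_forall fun x => ?_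
  rcases x with ⟨x, hx⟩ | ⟨x, hx⟩ | z
  · exact Or.inl (Or.inl ⟨x, hx, gluedIncl₁_of_mem hx⟩)
  · exact Or.inl (Or.inr ⟨x, hx, gluedIncl₂_of_mem hx⟩)
  · exact Or.inr ⟨(0, z), ⟨⟨by simpa using hε, hε⟩, trivial⟩, gluedCollar_zero z⟩

/-- The sign of `s` decides which of the three disjoint parts of the glued set contains the point.
No quotient is needed, because the two open halves of the collar already lie in the complements of
`N`. -/
lemma gluedCollar_cases (hg₁ : MapsTo g₁ (Ioo 0 ε ×ˢ univ) s₁)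
    (hg₂ : MapsTo g₂ (Ioo (-ε) 0 ×ˢ univ) s₂) {q : ℝ × Z}
    (hq : q ∈ Ioo (-ε) ε ×ˢ (univ : Set Z)) :
    (q ∈ Ioo 0 ε ×ˢ (univ : Set Z) ∧ g₁ q ∈ s₁ ∧
      gluedCollar s₁ s₂ g₁ g₂ q = gluedIncl₁ s₁ s₂ Z (g₁ q)) ∨
    (q ∈ Ioo (-ε) 0 ×ˢ (univ : Set Z) ∧ g₂ q ∈ s₂ ∧
      gluedCollar s₁ s₂ g₁ g₂ q = gluedIncl₂ s₁ s₂ Z (g₂ q)) ∨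
    (q.1 = 0 ∧ gluedCollar s₁ s₂ g₁ g₂ q = .middle q.2) := by
  rcases lt_trichotomy q.1 0 with h | h | h
  · have hq' : q ∈ Ioo (-ε) 0 ×ˢ (univ : Set Z) := ⟨⟨hq.1.1, h⟩, trivial⟩
    exact Or.inr (Or.inl ⟨hq', hg₂ hq', gluedCollar_of_neg h⟩)
  · exact Or.inr (Or.inr ⟨h, by rw [← gluedCollar_zero (g₁ := g₁) (g₂ := g₂), ← h]⟩)
  · have hq' : q ∈ Ioo 0 ε ×ˢ (univ : Set Z) := ⟨⟨h, hq.1.2⟩, trivial⟩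
    exact Or.inl ⟨hq', hg₁ hq', gluedCollar_of_pos h⟩

lemma mem_of_gluedCollar_mem₁ (hg₁ : MapsTo g₁ (Ioo 0 ε ×ˢ univ) s₁)
    (hg₂ : MapsTo g₂ (Ioo (-ε) 0 ×ˢ univ) s₂) {q : ℝ × Z}
    (hq : q ∈ Ioo (-ε) ε ×ˢ (univ : Set Z))
    (h : gluedCollar s₁ s₂ g₁ g₂ q ∈ gluedIncl₁ s₁ s₂ Z '' s₁) : q ∈ Ioo 0 ε ×ˢ (univ : Set Z) := by
  obtain ⟨x, hx, h⟩ := h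
  rcases gluedCollar_cases hg₁ hg₂ hq with ⟨h1, -, -⟩ | ⟨-, h2, h3⟩ | ⟨-, h3⟩
  · exact h1
  · exact absurd (h.trans h3) (gluedIncl₁_ne_gluedIncl₂ hx h2)
  · exact absurd (h.trans h3) (gluedIncl₁_ne_middle hx _)

lemma mem_of_gluedCollar_mem₂ (hg₁ : MapsTo g₁ (Ioo 0 ε ×ˢ univ) s₁)
    (hg₂ : MapsTo g₂ (Ioo (-ε) 0 ×ˢ univ) s₂) {q : ℝ × Z}
    (hq : q ∈ Ioo (-ε) ε ×ˢ (univ : Set Z))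
    (h : gluedCollar s₁ s₂ g₁ g₂ q ∈ gluedIncl₂ s₁ s₂ Z '' s₂) :
    q ∈ Ioo (-ε) 0 ×ˢ (univ : Set Z) := by
  obtain ⟨x, hx, h⟩ := h
  rcases gluedCollar_cases hg₁ hg₂ hq with ⟨-, h2, h3⟩ | ⟨h1, -, -⟩ | ⟨-, h3⟩
  · exact absurd (h3.symm.trans h.symm) (gluedIncl₁_ne_gluedIncl₂ h2 hx)
  · exact h1
  · exact absurd (h.trans h3) (gluedIncl₂_ne_middle hx _)

lemma injOn_gluedCollar (hg₁ : MapsTo g₁ (Ioo 0 ε ×ˢ univ) s₁)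
    (hg₂ : MapsTo g₂ (Ioo (-ε) 0 ×ˢ univ) s₂) (hi₁ : InjOn g₁ (Ioo 0 ε ×ˢ univ))
    (hi₂ : InjOn g₂ (Ioo (-ε) 0 ×ˢ univ)) :
    InjOn (gluedCollar s₁ s₂ g₁ g₂) (Ioo (-ε) ε ×ˢ univ) := by
  intro q hq q' hq' h
  rcases gluedCollar_cases hg₁ hg₂ hq with ⟨h1, h2, h3⟩ | ⟨h1, h2, h3⟩ | ⟨h1, h3⟩
  · have h4 := mem_of_gluedCollar_mem₁ hg₁ hg₂ hq' ⟨g₁ q, h2, h3.symm.trans h⟩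
    rw [h3, gluedCollar_of_pos h4.1.1] at h
    exact hi₁ h1 h4 (injOn_gluedIncl₁ h2 (hg₁ h4) h)
  · have h4 := mem_of_gluedCollar_mem₂ hg₁ hg₂ hq' ⟨g₂ q, h2, h3.symm.trans h⟩
    rw [h3, gluedCollar_of_neg h4.1.2] at h
    exact hi₂ h1 h4 (injOn_gluedIncl₂ h2 (hg₂ h4) h)
  · rcases gluedCollar_cases hg₁ hg₂ hq' with ⟨-, h2', h3'⟩ | ⟨-, h2', h3'⟩ | ⟨h1', h3'⟩
    · exact absurd (h3'.symm.trans (h.symm.trans h3)) (gluedIncl₁_ne_middle h2' _)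
    · exact absurd (h3'.symm.trans (h.symm.trans h3)) (gluedIncl₂_ne_middle h2' _)
    · exact Prod.ext (h1.trans h1'.symm) (GluedSet.middle.inj (h3.symm.trans (h.trans h3')))

end GluedSet

/-! ### The ends of the complement of `N` -/

section Ends

set_option linter.unusedSectionVars false

variable {d e : ℕ} {N M : Type u}
  [TopologicalSpace N] [ChartedSpace (EuclideanSpace ℝ (Fin d)) N] [IsManifold (𝓡 d) ∞ N]
  [TopologicalSpace M] [ChartedSpace (EuclideanSpace ℝ (Fin e)) M] [IsManifold (𝓡 e) ∞ M]
  {j : N → M} {ξ : ContactStructure e M} {αN : OneForm d N} {ε : ℝ} {Ψ : ℂ × N → M}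

lemma isOpenDiffeoOn_polar [Nonempty N] (ε : ℝ) :
    IsOpenDiffeoOn (collarModel d) (𝓘(ℝ, ℂ).prod (𝓡 d)) (polar (N := N)) (Ioo 0 ε ×ˢ univ) :=
  isOpenDiffeoOn_of_injective (isOpen_Ioo.prod isOpen_univ) (fun _ hq => contMDiffAt_polar hq.1.1)
    (fun _ hq => injective_tderiv_polar hq.1.1)
    (injOn_polar.mono (prod_mono_left fun _ h => h.1)) (by simp; ring)

lemma mapsTo_polar (ε : ℝ) :
    MapsTo (polar (N := N)) (Ioo 0 ε ×ˢ univ) (Metric.ball (0 : ℂ) (√ε) ×ˢ univ) := by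
  intro q hq
  refine ⟨?_, trivial⟩
  rw [mem_ball_zero_iff, norm_polar_fst]
  exact Real.sqrt_lt_sqrt hq.1.1.le hq.1.2

lemma exists_polar_eq {z : ℂ} (hz : z ≠ 0) (p : N) :
    ∃ θ : Circle, polar (‖z‖ ^ 2, θ, p) = (z, p) := by
  refine ⟨⟨z / ‖z‖, by simp [Submonoid.unitSphere, hz]⟩, ?_⟩
  refine Prod.ext ?_ rfl
  have h : (‖z‖ : ℂ) ≠ 0 := by simpa using hz
  simp only [polar, Real.sqrt_sq (norm_nonneg z), Complex.real_smul]
  exact mul_div_cancel₀ z h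

lemma isOpenDiffeoOn_reflect [Nonempty N] (ε : ℝ) :
    IsOpenDiffeoOn (collarModel d) (collarModel d) (reflect (N := N)) (Ioo (-ε) 0 ×ˢ univ) := by
  refine isOpenDiffeoOn_of_injective (isOpen_Ioo.prod isOpen_univ)
    (fun q _ => contMDiff_reflect q) (fun q _ => ?_)
    (Function.LeftInverse.injective reflect_reflect).injOn rfl
  have h := contMDiff_reflect (d := d) (N := N)
  exact Function.LeftInverse.injective fun v => tderiv_left_inverse rfl
    ((h q).mdifferentiableAt (by simp)) ((h _).mdifferentiableAt (by simp))
    (Filter.Eventually.of_forall reflect_reflect) v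

lemma mapsTo_reflect (ε : ℝ) :
    MapsTo (reflect (N := N)) (Ioo (-ε) 0 ×ˢ univ) (Ioo 0 ε ×ˢ univ) :=
  fun _ hq => ⟨⟨neg_pos.2 hq.1.2, neg_lt.1 hq.1.1⟩, trivial⟩

/-- The end `(0, ε) × S¹ × N` of the complement of `N`. -/
lemma IsModelNeighborhood.isOpenDiffeoOn_end [Nonempty N] (h : IsModelNeighborhood ξ j αN ε Ψ) :
    IsOpenDiffeoOn (collarModel d) (𝓡 e) (Ψ ∘ polar) (Ioo 0 ε ×ˢ univ) :=
  h.diffeo.comp (isOpenDiffeoOn_polar ε) (mapsTo_polar ε)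

lemma IsModelNeighborhood.notMem_range (h : IsModelNeighborhood ξ j αN ε Ψ) (hε : 0 < ε) {z : ℂ}
    {p : N} (hz : ‖z‖ < √ε) (hz0 : z ≠ 0) : Ψ (z, p) ∉ range j := by
  rintro ⟨p', hp'⟩
  rw [← h.zero] at hp'
  have h1 := h.diffeo.injOn ⟨Metric.mem_ball_self (Real.sqrt_pos.2 hε), trivial⟩
    ⟨mem_ball_zero_iff.2 hz, trivial⟩ hp'
  exact hz0 (congrArg Prod.fst h1).symm

lemma IsModelNeighborhood.mapsTo_end (h : IsModelNeighborhood ξ j αN ε Ψ) (hε : 0 < ε) :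
    MapsTo (Ψ ∘ polar) (Ioo 0 ε ×ˢ univ) (range j)ᶜ := by
  intro q hq
  have h1 := (mapsTo_polar ε hq).1
  have h2 : (polar q).1 ≠ 0 := by
    rw [← norm_ne_zero_iff, norm_polar_fst]
    exact (Real.sqrt_pos.2 hq.1.1).ne'
  exact h.notMem_range hε (mem_ball_zero_iff.1 h1) h2

/-- The set is the image of the closed tube of radius `√(ε / 2)`, which is compact because `N` is,
hence closed. It contains the inner half of the end and, apart from `N`, nothing outside the end;
this is what the Hausdorff property of the glued manifold rests on. -/
lemma IsModelNeighborhood.exists_closed [CompactSpace N] [T2Space M]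
    (h : IsModelNeighborhood ξ j αN ε Ψ) (hε : 0 < ε) : ∃ K : Set M, IsClosed K ∧
      (∀ q ∈ Ioo 0 ε ×ˢ (univ : Set (Circle × N)), q.1 < ε / 2 → (Ψ ∘ polar) q ∈ K) ∧
      ∀ x ∈ (range j)ᶜ ∩ K, ∃ q ∈ Ioo 0 ε ×ˢ (univ : Set (Circle × N)), (Ψ ∘ polar) q = x := by
  have hlt : √(ε / 2) < √ε := Real.sqrt_lt_sqrt (by positivity) (by linarith)
  have hsub : Metric.closedBall (0 : ℂ) √(ε / 2) ×ˢ (univ : Set N) ⊆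
      Metric.ball (0 : ℂ) (√ε) ×ˢ univ :=
    prod_mono_left (Metric.closedBall_subset_ball hlt)
  refine ⟨Ψ '' (Metric.closedBall (0 : ℂ) √(ε / 2) ×ˢ univ), ?_, ?_, ?_⟩
  · exact (((isCompact_closedBall _ _).prod isCompact_univ).image_of_continuousOn
      (h.diffeo.2.2.1.continuousOn.mono hsub)).isClosed
  · intro q hq hq2
    refine mem_image_of_mem Ψ ⟨?_, trivial⟩
    rw [mem_closedBall_zero_iff, norm_polar_fst]
    exact Real.sqrt_le_sqrt hq2.le
  · rintro _ ⟨hx, ⟨z, p⟩, ⟨hz, -⟩, rfl⟩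
    have hz0 : z ≠ 0 := by
      rintro rfl
      exact hx ⟨p, (h.zero p).symm⟩
    obtain ⟨θ, hθ⟩ := exists_polar_eq hz0 p
    refine ⟨(‖z‖ ^ 2, θ, p), ⟨⟨by positivity, ?_⟩, trivial⟩, congrArg Ψ hθ⟩
    have h2 : ‖z‖ < √ε := (mem_closedBall_zero_iff.1 hz).trans_lt hlt
    exact (Real.lt_sqrt (norm_nonneg z)).1 h2

lemma IsModelNeighborhood.pos_end [Nonempty N] (h : IsModelNeighborhood ξ j αN ε Ψ)
    {α : OneForm e M} (hα : ξ.IsPositiveForm α) {q : ℝ × Circle × N}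
    (hq : q ∈ Ioo 0 ε ×ˢ (univ : Set (Circle × N))) (v : CollarSpace d) :
    0 < α.cov ((Ψ ∘ polar) q) (tderiv (collarModel d) (𝓡 e) (Ψ ∘ polar) q v) ↔
      0 < collarCLM αN q v := by
  have h1 := mapsTo_polar ε hq
  rw [tderiv_comp_apply (h.diffeo.mdifferentiableAt h1)
    ((isOpenDiffeoOn_polar ε).mdifferentiableAt hq) rfl, ← discForm_polar αN hq.1.1]
  exact (hα.2 _ _).2.symm.trans (h.contact _ h1 _).2

end Ends

/-! ### The fiber sum as a manifold -/

section GluedManifold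

set_option linter.unusedSectionVars false

variable {d e : ℕ} {N M₁ M₂ : Type u}
  [TopologicalSpace N] [ChartedSpace (EuclideanSpace ℝ (Fin d)) N] [IsManifold (𝓡 d) ∞ N]
  [TopologicalSpace M₁] [ChartedSpace (EuclideanSpace ℝ (Fin e)) M₁] [IsManifold (𝓡 e) ∞ M₁]
  [TopologicalSpace M₂] [ChartedSpace (EuclideanSpace ℝ (Fin e)) M₂] [IsManifold (𝓡 e) ∞ M₂]

lemma isOpenDiffeoOn_empty {E : Type*} [NormedAddCommGroup E] [NormedSpace ℝ E] {H : Type*}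
    [TopologicalSpace H] (I : ModelWithCorners ℝ E H) {X : Type*} [TopologicalSpace X]
    [ChartedSpace H X] {E' : Type*} [NormedAddCommGroup E'] [NormedSpace ℝ E'] {H' : Type*}
    [TopologicalSpace H'] (I' : ModelWithCorners ℝ E' H') {Y : Type*} [TopologicalSpace Y]
    [ChartedSpace H' Y] [Nonempty X] (f : X → Y) : IsOpenDiffeoOn I I' f ∅ := by
  refine ⟨isOpen_empty, by simp, contMDiffOn_empty, mapsTo_empty _ _,
    fun _ => Classical.arbitrary X, ?_⟩
  rw [image_empty]
  exact ⟨contMDiffOn_empty, mapsTo_empty _ _, fun _ h => h.elim, fun _ h => h.elim⟩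

/-- The collar overlaps the two complements exactly in `s > 0` and `s < 0`, with `g₁` and `g₂` as
transition maps. The closed sets `K₁` and `K₂` keep the middle of the collar away from the points of
the complements that lie outside the ends. -/
lemma exists_gluedManifold [Nonempty N] [Nonempty M₁] [Nonempty M₂]
    [T2Space N] [T2Space M₁] [T2Space M₂] [SecondCountableTopology N]
    [SecondCountableTopology M₁] [SecondCountableTopology M₂] (hde : e = d + 2)
    {s₁ : Set M₁} {s₂ : Set M₂} (hs₁ : IsOpen s₁) (hs₂ : IsOpen s₂) {ε : ℝ} (hε : 0 < ε)
    {g₁ : ℝ × Circle × N → M₁} {g₂ : ℝ × Circle × N → M₂}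
    (h₁ : IsOpenDiffeoOn (collarModel d) (𝓡 e) g₁ (Ioo 0 ε ×ˢ univ))
    (h₂ : IsOpenDiffeoOn (collarModel d) (𝓡 e) g₂ (Ioo (-ε) 0 ×ˢ univ))
    (hm₁ : MapsTo g₁ (Ioo 0 ε ×ˢ univ) s₁) (hm₂ : MapsTo g₂ (Ioo (-ε) 0 ×ˢ univ) s₂)
    {K₁ : Set M₁} {K₂ : Set M₂} (hK₁ : IsClosed K₁) (hK₂ : IsClosed K₂)
    (hi₁ : ∀ q ∈ Ioo 0 ε ×ˢ (univ : Set (Circle × N)), q.1 < ε / 2 → g₁ q ∈ K₁)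
    (hi₂ : ∀ q ∈ Ioo (-ε) 0 ×ˢ (univ : Set (Circle × N)), -(ε / 2) < q.1 → g₂ q ∈ K₂)
    (ho₁ : ∀ x ∈ s₁ ∩ K₁, ∃ q ∈ Ioo 0 ε ×ˢ (univ : Set (Circle × N)), g₁ q = x)
    (ho₂ : ∀ x ∈ s₂ ∩ K₂, ∃ q ∈ Ioo (-ε) 0 ×ˢ (univ : Set (Circle × N)), g₂ q = x) :
    ∃ (_ : TopologicalSpace (GluedSet s₁ s₂ (Circle × N)))
      (_ : ChartedSpace (EuclideanSpace ℝ (Fin e)) (GluedSet s₁ s₂ (Circle × N)))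
      (_ : IsManifold (𝓡 e) ∞ (GluedSet s₁ s₂ (Circle × N))),
      T2Space (GluedSet s₁ s₂ (Circle × N)) ∧
      SecondCountableTopology (GluedSet s₁ s₂ (Circle × N)) ∧
      IsOpenDiffeoOn (𝓡 e) (𝓡 e) (gluedIncl₁ s₁ s₂ (Circle × N)) s₁ ∧
      IsOpenDiffeoOn (𝓡 e) (𝓡 e) (gluedIncl₂ s₁ s₂ (Circle × N)) s₂ ∧
      IsOpenDiffeoOn (collarModel d) (𝓡 e) (gluedCollar s₁ s₂ g₁ g₂) (Ioo (-ε) ε ×ˢ univ) := by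
  have hsub₁ : Ioo 0 ε ×ˢ (univ : Set (Circle × N)) ⊆ Ioo (-ε) ε ×ˢ univ :=
    prod_mono_left (Ioo_subset_Ioo_left (by linarith))
  have hsub₂ : Ioo (-ε) 0 ×ˢ (univ : Set (Circle × N)) ⊆ Ioo (-ε) ε ×ˢ univ :=
    prod_mono_left (Ioo_subset_Ioo_right hε.le)
  have hcover := glued_cover (s₁ := s₁) (s₂ := s₂) (g₁ := g₁) (g₂ := g₂) hε
  obtain ⟨t, c, hM, hd₁, hd₂, hd₃⟩ := exists_manifold_of_pieces (m := e) (I₃ := collarModel d)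
    (ContinuousLinearEquiv.ofFinrankEq (by simp [hde]; ring))
    (injOn_gluedIncl₁ (s₁ := s₁) (s₂ := s₂) (Z := Circle × N)) injOn_gluedIncl₂
    (injOn_gluedCollar hm₁ hm₂ h₁.injOn h₂.injOn) hs₁ hs₂ (isOpen_Ioo.prod isOpen_univ)
    ⟨∅, fun _ => Classical.arbitrary M₂, empty_subset _, isOpenDiffeoOn_empty _ _ _,
      fun _ h => h.elim, fun y hy h =>
        (Set.disjoint_left.1 disjoint_gluedIncl (mem_image_of_mem _ hy) h).elim⟩
    ⟨Ioo 0 ε ×ˢ univ, g₁, hsub₁, h₁, fun y hy => ⟨hm₁ hy, (gluedCollar_of_pos hy.1.1).symm⟩,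
      fun y hy h => mem_of_gluedCollar_mem₁ hm₁ hm₂ hy h⟩
    ⟨Ioo (-ε) 0 ×ˢ univ, g₂, hsub₂, h₂, fun y hy => ⟨hm₂ hy, (gluedCollar_of_neg hy.1.2).symm⟩,
      fun y hy h => mem_of_gluedCollar_mem₂ hm₁ hm₂ hy h⟩ hcover
  refine ⟨t, c, hM, ?_⟩
  -- A point of the first piece outside the collar is not in `K₁`, and a collar point outside the
  -- first piece has `s ≤ 0`. The complement of `K₁` and the part `s < ε / 2` of the collar are
  -- disjoint open sets around them, since the inner half of the end lies in `K₁`.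
  have hsep₁ : SeparatedNhds
      (gluedIncl₁ s₁ s₂ (Circle × N) '' s₁ \ gluedCollar s₁ s₂ g₁ g₂ '' (Ioo (-ε) ε ×ˢ univ))
      (gluedCollar s₁ s₂ g₁ g₂ '' (Ioo (-ε) ε ×ˢ univ) \ gluedIncl₁ s₁ s₂ (Circle × N) '' s₁) := by
    refine ⟨gluedIncl₁ s₁ s₂ (Circle × N) '' (s₁ \ K₁),
      gluedCollar s₁ s₂ g₁ g₂ '' (Ioo (-ε) (ε / 2) ×ˢ univ),
      hd₁.isOpen_image (hs₁.sdiff hK₁) sdiff_subset,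
      hd₃.isOpen_image (isOpen_Ioo.prod isOpen_univ)
        (prod_mono_left (Ioo_subset_Ioo_right (by linarith))), ?_, ?_, ?_⟩
    · rintro _ ⟨⟨x, hx, rfl⟩, h⟩
      refine ⟨x, ⟨hx, fun hxK => h ?_⟩, rfl⟩
      obtain ⟨q, hq, rfl⟩ := ho₁ x ⟨hx, hxK⟩
      exact ⟨q, hsub₁ hq, gluedCollar_of_pos hq.1.1⟩
    · rintro _ ⟨⟨q, hq, rfl⟩, h⟩
      refine ⟨q, ⟨⟨hq.1.1, ?_⟩, trivial⟩, rfl⟩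
      by_contra! hle
      have hq' : q ∈ Ioo 0 ε ×ˢ (univ : Set (Circle × N)) := ⟨⟨by linarith, hq.1.2⟩, trivial⟩
      exact h ⟨g₁ q, hm₁ hq', (gluedCollar_of_pos hq'.1.1).symm⟩
    · rw [Set.disjoint_left]
      rintro _ ⟨x, hx, rfl⟩ ⟨q, hq, h⟩
      have hq' := mem_of_gluedCollar_mem₁ hm₁ hm₂ (ε := ε)
        ⟨⟨hq.1.1, by linarith [hq.1.2]⟩, trivial⟩ ⟨x, hx.1, h.symm⟩
      rw [gluedCollar_of_pos hq'.1.1] at h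
      rw [← injOn_gluedIncl₁ (hm₁ hq') hx.1 h] at hx
      exact hx.2 (hi₁ q hq' hq.1.2)
  have hsep₂ : SeparatedNhds
      (gluedIncl₂ s₁ s₂ (Circle × N) '' s₂ \ gluedCollar s₁ s₂ g₁ g₂ '' (Ioo (-ε) ε ×ˢ univ))
      (gluedCollar s₁ s₂ g₁ g₂ '' (Ioo (-ε) ε ×ˢ univ) \ gluedIncl₂ s₁ s₂ (Circle × N) '' s₂) := by
    refine ⟨gluedIncl₂ s₁ s₂ (Circle × N) '' (s₂ \ K₂),
      gluedCollar s₁ s₂ g₁ g₂ '' (Ioo (-(ε / 2)) ε ×ˢ univ),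
      hd₂.isOpen_image (hs₂.sdiff hK₂) sdiff_subset,
      hd₃.isOpen_image (isOpen_Ioo.prod isOpen_univ)
        (prod_mono_left (Ioo_subset_Ioo_left (by linarith))), ?_, ?_, ?_⟩
    · rintro _ ⟨⟨x, hx, rfl⟩, h⟩
      refine ⟨x, ⟨hx, fun hxK => h ?_⟩, rfl⟩
      obtain ⟨q, hq, rfl⟩ := ho₂ x ⟨hx, hxK⟩
      exact ⟨q, hsub₂ hq, gluedCollar_of_neg hq.1.2⟩
    · rintro _ ⟨⟨q, hq, rfl⟩, h⟩
      refine ⟨q, ⟨⟨?_, hq.1.2⟩, trivial⟩, rfl⟩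
      by_contra! hle
      have hq' : q ∈ Ioo (-ε) 0 ×ˢ (univ : Set (Circle × N)) := ⟨⟨hq.1.1, by linarith⟩, trivial⟩
      exact h ⟨g₂ q, hm₂ hq', (gluedCollar_of_neg hq'.1.2).symm⟩
    · rw [Set.disjoint_left]
      rintro _ ⟨x, hx, rfl⟩ ⟨q, hq, h⟩
      have hq' := mem_of_gluedCollar_mem₂ hm₁ hm₂ (ε := ε)
        ⟨⟨by linarith [hq.1.1], hq.1.2⟩, trivial⟩ ⟨x, hx.1, h.symm⟩
      rw [gluedCollar_of_neg hq'.1.2] at h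
      rw [← injOn_gluedIncl₂ (hm₂ hq') hx.1 h] at hx
      exact hx.2 (hi₂ q hq' hq.1.1)
  obtain ⟨hT, hS⟩ := topology_of_pieces hd₁ hd₂ hd₃ hcover disjoint_gluedIncl hsep₁ hsep₂
  exact ⟨hT, hS, hd₁, hd₂, hd₃⟩

end GluedManifold

/-! ### The contact structure of the fiber sum -/

section GluedContact

set_option linter.unusedSectionVars false

variable {d e : ℕ} {N M₁ M₂ X : Type u}
  [TopologicalSpace N] [ChartedSpace (EuclideanSpace ℝ (Fin d)) N] [IsManifold (𝓡 d) ∞ N]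
  [TopologicalSpace M₁] [ChartedSpace (EuclideanSpace ℝ (Fin e)) M₁] [IsManifold (𝓡 e) ∞ M₁]
  [TopologicalSpace M₂] [ChartedSpace (EuclideanSpace ℝ (Fin e)) M₂] [IsManifold (𝓡 e) ∞ M₂]
  [TopologicalSpace X] [ChartedSpace (EuclideanSpace ℝ (Fin e)) X] [IsManifold (𝓡 e) ∞ X]

/-- The image of a contact form under a diffeomorphism is a contact form. -/
lemma exists_push_contact {f : M₁ → X} {s : Set M₁} (h : IsOpenDiffeoOn (𝓡 e) (𝓡 e) f s)
    {α₁ : OneForm e M₁} (hα : α₁.IsContactForm) :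
    ∃ α : OneForm e X, (∀ y ∈ s, ∀ v, α.cov (f y) (tderiv (𝓡 e) (𝓡 e) f y v) = α₁.cov y v) ∧
      ∀ x ∈ f '' s, α.SmoothAt x ∧ α.ContactAt x := by
  rw [OneForm.isContactForm_iff] at hα
  obtain ⟨α, h1, h2⟩ := h.exists_push (fun y => α₁.cov y)
  refine ⟨α, h1, ?_⟩
  rintro _ ⟨y, hy, rfl⟩
  have hy0 := mem_extChartAt_target (I := 𝓡 e) y
  have hyy := extChartAt_to_inv (I := 𝓡 e) y
  have h3 := h2 (extChartAt (𝓡 e) y).symm (extChartAt (𝓡 e) y y) (by rwa [hyy])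
    (contMDiffAt_extChartAt_symm y hy0)
    (Function.LeftInverse.injective fun v => tderiv_chart_chart_symm hy0 v) (by simp)
    (α₁.pull (extChartAt (𝓡 e) y).symm) (Filter.Eventually.of_forall fun z v => rfl)
    ((OneForm.smoothAt_iff_pull (mem_extChartAt_source y)).1 (hα y).1)
    (OneForm.isContactPair_pull_chart_symm (fun x => (hα x).1) (fun x => (hα x).2) y hy0)
  rwa [hyy] at h3

/-- Every tangent vector on the overlap is the image of one of the collar. There the first form
becomes the pull-back of `α₁` under `g`, whose positive vectors are those of the collar form by
hypothesis. -/
lemma pos_iff_of_overlap {incl : M₁ → X} {s₁ : Set M₁}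
    (hd₁ : IsOpenDiffeoOn (𝓡 e) (𝓡 e) incl s₁) {collar : ℝ × Circle × N → X}
    {W A : Set (ℝ × Circle × N)} (hd₃ : IsOpenDiffeoOn (collarModel d) (𝓡 e) collar W)
    {g : ℝ × Circle × N → M₁} (hg : IsOpenDiffeoOn (collarModel d) (𝓡 e) g A)
    (hgm : MapsTo g A s₁) (hAW : A ⊆ W) (hgc : ∀ q ∈ A, collar q = incl (g q))
    {α₁ : OneForm e M₁} {αN : OneForm d N} {β₁ β₃ : OneForm e X}
    (hβ₁ : ∀ y ∈ s₁, ∀ v, β₁.cov (incl y) (tderiv (𝓡 e) (𝓡 e) incl y v) = α₁.cov y v)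
    (hβ₃ : ∀ y ∈ W, ∀ v, β₃.cov (collar y) (tderiv (collarModel d) (𝓡 e) collar y v) =
      collarCLM αN y v)
    (hpos : ∀ q ∈ A, ∀ v, 0 < α₁.cov (g q) (tderiv (collarModel d) (𝓡 e) g q v) ↔
      0 < collarCLM αN q v) {q : ℝ × Circle × N} (hq : q ∈ A) (v : EuclideanSpace ℝ (Fin e)) :
    0 < β₁.cov (collar q) v ↔ 0 < β₃.cov (collar q) v := by
  obtain ⟨k, -, -, -, hk⟩ := hd₃.exists_inverse
  rw [← hk q (hAW hq) v, hβ₃ q (hAW hq), ← hpos q hq, ← hβ₁ _ (hgm hq), hgc q hq,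
    ← tderiv_comp_apply (hd₁.mdifferentiableAt (hgm hq)) (hg.mdifferentiableAt hq) rfl]
  rw [tderiv_congr (f := collar) (g := incl ∘ g)]
  filter_upwards [hg.1.mem_nhds hq] with z hz using hgc z hz

end GluedContact

/-! ### Existence of fiber sums along compact submanifolds -/

section ExistsFiberSum

set_option linter.unusedSectionVars false

variable {d e : ℕ} {N M₁ M₂ X : Type u}
  [TopologicalSpace N] [ChartedSpace (EuclideanSpace ℝ (Fin d)) N] [IsManifold (𝓡 d) ∞ N]
  [TopologicalSpace M₁] [ChartedSpace (EuclideanSpace ℝ (Fin e)) M₁] [IsManifold (𝓡 e) ∞ M₁]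
  [TopologicalSpace M₂] [ChartedSpace (EuclideanSpace ℝ (Fin e)) M₂] [IsManifold (𝓡 e) ∞ M₂]
  [TopologicalSpace X] [ChartedSpace (EuclideanSpace ℝ (Fin e)) X] [IsManifold (𝓡 e) ∞ X]

lemma IsModelNeighborhood.isOpenDiffeoOn_reflected_end [Nonempty N] {ξ : ContactStructure e M₂}
    {j : N → M₂} {αN : OneForm d N} {ε : ℝ} {Ψ : ℂ × N → M₂}
    (h : IsModelNeighborhood ξ j αN ε Ψ) :
    IsOpenDiffeoOn (collarModel d) (𝓡 e) ((Ψ ∘ polar) ∘ reflect) (Ioo (-ε) 0 ×ˢ univ) :=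
  h.isOpenDiffeoOn_end.comp (isOpenDiffeoOn_reflect ε) (mapsTo_reflect ε)

lemma IsModelNeighborhood.pos_reflected_end [Nonempty N] {ξ : ContactStructure e M₂}
    {j : N → M₂} {αN : OneForm d N} {ε : ℝ} {Ψ : ℂ × N → M₂}
    (h : IsModelNeighborhood ξ j αN ε Ψ) {α : OneForm e M₂} (hα : ξ.IsPositiveForm α)
    {q : ℝ × Circle × N} (hq : q ∈ Ioo (-ε) 0 ×ˢ (univ : Set (Circle × N))) (v : CollarSpace d) :
    0 < α.cov (((Ψ ∘ polar) ∘ reflect) q)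
      (tderiv (collarModel d) (𝓡 e) ((Ψ ∘ polar) ∘ reflect) q v) ↔ 0 < collarCLM αN q v := by
  have hq' := mapsTo_reflect ε hq
  rw [tderiv_comp_apply (h.isOpenDiffeoOn_end.mdifferentiableAt hq')
    ((isOpenDiffeoOn_reflect ε).mdifferentiableAt hq) rfl, ← collarCLM_reflect]
  exact h.pos_end hα hq' _

/-- The contact structure on a manifold that is glued from two contact manifolds and a collar. -/
lemma exists_glued_contactStructure [T2Space X] [SecondCountableTopology X] (hde : e = d + 2)
    {ξ₁ : ContactStructure e M₁} {ξ₂ : ContactStructure e M₂} {αN : OneForm d N}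
    (hαN : αN.IsContactForm) {s₁ : Set M₁} {s₂ : Set M₂}
    {g₁ : ℝ × Circle × N → M₁} {g₂ : ℝ × Circle × N → M₂} {A₁ A₂ W : Set (ℝ × Circle × N)}
    (h₁ : IsOpenDiffeoOn (collarModel d) (𝓡 e) g₁ A₁)
    (h₂ : IsOpenDiffeoOn (collarModel d) (𝓡 e) g₂ A₂)
    (hm₁ : MapsTo g₁ A₁ s₁) (hm₂ : MapsTo g₂ A₂ s₂) (hA₁ : A₁ ⊆ W) (hA₂ : A₂ ⊆ W)
    {i₁ : M₁ → X} {i₂ : M₂ → X} {c : ℝ × Circle × N → X}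
    (hd₁ : IsOpenDiffeoOn (𝓡 e) (𝓡 e) i₁ s₁) (hd₂ : IsOpenDiffeoOn (𝓡 e) (𝓡 e) i₂ s₂)
    (hd₃ : IsOpenDiffeoOn (collarModel d) (𝓡 e) c W)
    (hc₁ : ∀ q ∈ A₁, c q = i₁ (g₁ q)) (hc₂ : ∀ q ∈ A₂, c q = i₂ (g₂ q))
    (hi₁ : ∀ q ∈ W, c q ∈ i₁ '' s₁ → q ∈ A₁) (hi₂ : ∀ q ∈ W, c q ∈ i₂ '' s₂ → q ∈ A₂)
    (hdisj : Disjoint (i₁ '' s₁) (i₂ '' s₂)) (hcover : i₁ '' s₁ ∪ i₂ '' s₂ ∪ c '' W = univ)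
    (hp₁ : ∀ α, ξ₁.IsPositiveForm α → ∀ q ∈ A₁, ∀ v,
      0 < α.cov (g₁ q) (tderiv (collarModel d) (𝓡 e) g₁ q v) ↔ 0 < collarCLM αN q v)
    (hp₂ : ∀ α, ξ₂.IsPositiveForm α → ∀ q ∈ A₂, ∀ v,
      0 < α.cov (g₂ q) (tderiv (collarModel d) (𝓡 e) g₂ q v) ↔ 0 < collarCLM αN q v) :
    ∃ ξ : ContactStructure e X, IsOpenContactEmbeddingOn ξ₁ ξ i₁ s₁ ∧
      IsOpenContactEmbeddingOn ξ₂ ξ i₂ s₂ ∧ ∀ q ∈ W, ∀ v,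
        (tderiv (collarModel d) (𝓡 e) c q v ∈ ξ.plane (c q) ↔ collarForm αN q v = 0) ∧
        (tderiv (collarModel d) (𝓡 e) c q v ∈ ξ.pos (c q) ↔ 0 < collarForm αN q v) := by
  obtain ⟨α₁, hα₁⟩ : ∃ α, ξ₁.IsPositiveForm α := ξ₁.exists_form
  obtain ⟨α₂, hα₂⟩ : ∃ α, ξ₂.IsPositiveForm α := ξ₂.exists_form
  obtain ⟨β₁, hβ₁, hβ₁c⟩ := exists_push_contact hd₁ hα₁.1
  obtain ⟨β₂, hβ₂, hβ₂c⟩ := exists_push_contact hd₂ hα₂.1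
  have hαN' := OneForm.isContactForm_iff.1 hαN
  obtain ⟨β₃, hβ₃, hβ₃c⟩ := exists_push_collar hde hd₃ (fun x => (hαN' x).1) (fun x => (hαN' x).2)
  have h13 : ∀ x ∈ i₁ '' s₁, x ∈ c '' W → ∀ v, 0 < β₁.cov x v ↔ 0 < β₃.cov x v := by
    rintro _ hx ⟨q, hq, rfl⟩ v
    exact pos_iff_of_overlap hd₁ hd₃ h₁ hm₁ hA₁ hc₁ hβ₁ hβ₃ (hp₁ α₁ hα₁) (hi₁ q hq hx) v
  have h23 : ∀ x ∈ i₂ '' s₂, x ∈ c '' W → ∀ v, 0 < β₂.cov x v ↔ 0 < β₃.cov x v := by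
    rintro _ hx ⟨q, hq, rfl⟩ v
    exact pos_iff_of_overlap hd₂ hd₃ h₂ hm₂ hA₂ hc₂ hβ₂ hβ₃ (hp₂ α₂ hα₂) (hi₂ q hq hx) v
  have := ChartedSpace.locallyCompactSpace (EuclideanSpace ℝ (Fin e)) X
  obtain ⟨ξ, hξ⟩ := exists_contactStructure (X := X) (m := e)
    (![i₁ '' s₁, i₂ '' s₂, c '' W] : Fin 3 → Set X)
    (by intro i; fin_cases i; exacts [hd₁.2.1, hd₂.2.1, hd₃.2.1])
    (by
      refine eq_univ_of_forall fun x => ?_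
      have hx := mem_univ x
      rw [← hcover] at hx
      rcases hx with (hx | hx) | hx
      exacts [mem_iUnion.2 ⟨0, hx⟩, mem_iUnion.2 ⟨1, hx⟩, mem_iUnion.2 ⟨2, hx⟩])
    (![β₁, β₂, β₃] : Fin 3 → OneForm e X)
    (by intro i; fin_cases i; exacts [hβ₁c, hβ₂c, hβ₃c])
    (by
      rintro i k x ⟨hi, hk⟩ v
      fin_cases i <;> fin_cases k
      · exact Iff.rfl
      · exact (Set.disjoint_left.1 hdisj hi hk).elim
      · exact h13 x hi hk v
      · exact (Set.disjoint_left.1 hdisj hk hi).elim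
      · exact Iff.rfl
      · exact h23 x hi hk v
      · exact (h13 x hk hi v).symm
      · exact (h23 x hk hi v).symm
      · exact Iff.rfl)
  refine ⟨ξ, ⟨hd₁, fun x hx v => ?_⟩, ⟨hd₂, fun x hx v => ?_⟩, fun q hq v => ?_⟩
  · have h := hξ 0 (i₁ x) (mem_image_of_mem i₁ hx) (tderiv (𝓡 e) (𝓡 e) i₁ x v)
    have hv : (![β₁, β₂, β₃] 0).cov (i₁ x) (tderiv (𝓡 e) (𝓡 e) i₁ x v) = α₁.cov x v := hβ₁ x hx v
    rw [hv] at h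
    exact ⟨h.1.trans (hα₁.2 x v).1.symm, h.2.trans (hα₁.2 x v).2.symm⟩
  · have h := hξ 1 (i₂ x) (mem_image_of_mem i₂ hx) (tderiv (𝓡 e) (𝓡 e) i₂ x v)
    have hv : (![β₁, β₂, β₃] 1).cov (i₂ x) (tderiv (𝓡 e) (𝓡 e) i₂ x v) = α₂.cov x v := hβ₂ x hx v
    rw [hv] at h
    exact ⟨h.1.trans (hα₂.2 x v).1.symm, h.2.trans (hα₂.2 x v).2.symm⟩
  · have h := hξ 2 (c q) (mem_image_of_mem c hq) (tderiv (collarModel d) (𝓡 e) c q v)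
    have hv : (![β₁, β₂, β₃] 2).cov (c q) (tderiv (collarModel d) (𝓡 e) c q v) =
      collarForm αN q v := (hβ₃ q hq v).trans (collarForm_eq αN q v).symm
    rw [hv] at h
    exact h

end ExistsFiberSum

/-- Fiber sums along compact contact submanifolds exist. -/
theorem exists_fiberSum {n : ℕ} {N M₁ M₂ : Type u}
    [TopologicalSpace N] [T2Space N] [SecondCountableTopology N]
    [ChartedSpace (EuclideanSpace ℝ (Fin (2 * n + 1))) N] [IsManifold (𝓡 (2 * n + 1)) ∞ N]
    [TopologicalSpace M₁] [T2Space M₁] [SecondCountableTopology M₁]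
    [ChartedSpace (EuclideanSpace ℝ (Fin (2 * (n + 1) + 1))) M₁]
    [IsManifold (𝓡 (2 * (n + 1) + 1)) ∞ M₁]
    [TopologicalSpace M₂] [T2Space M₂] [SecondCountableTopology M₂]
    [ChartedSpace (EuclideanSpace ℝ (Fin (2 * (n + 1) + 1))) M₂]
    [IsManifold (𝓡 (2 * (n + 1) + 1)) ∞ M₂] [CompactSpace N] [Nonempty N]
    {ξN : ContactStructure (2 * n + 1) N}
    {ξ₁ : ContactStructure (2 * (n + 1) + 1) M₁} {ξ₂ : ContactStructure (2 * (n + 1) + 1) M₂}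
    {j₁ : N → M₁} (hj₁ : IsContactEmbedding ξN ξ₁ j₁)
    (hν₁ : HasTrivialNormalBundle (2 * n + 1) (2 * (n + 1) + 1) j₁)
    {j₂ : N → M₂} (hj₂ : IsContactEmbedding ξN ξ₂ j₂)
    (hν₂ : HasTrivialNormalBundle (2 * n + 1) (2 * (n + 1) + 1) j₂)
    {αN : OneForm (2 * n + 1) N} (hαN : ξN.IsPositiveForm αN) :
    ∃ (M' : Type u) (_ : TopologicalSpace M') (_ : T2Space M') (_ : SecondCountableTopology M')
        (_ : ChartedSpace (EuclideanSpace ℝ (Fin (2 * (n + 1) + 1))) M')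
        (_ : IsManifold (𝓡 (2 * (n + 1) + 1)) ∞ M')
        (ξ' : ContactStructure (2 * (n + 1) + 1) M')
        (F : FiberSum ξN ξ₁ ξ₂ j₁ j₂ ξ'), F.form = αN := by
  have hde : 2 * (n + 1) + 1 = 2 * n + 1 + 2 := by ring
  obtain ⟨ε₁, hε₁, Ψ₁, hΨ₁⟩ := exists_modelNeighborhood hde hj₁ hν₁ hαN
  obtain ⟨ε₂, hε₂, Ψ₂, hΨ₂⟩ := exists_modelNeighborhood hde hj₂ hν₂ hαN
  -- The collar must have the same width on both sides.
  obtain ⟨ε, hε, hm₁, hm₂⟩ : ∃ ε > 0, IsModelNeighborhood ξ₁ j₁ αN ε Ψ₁ ∧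
      IsModelNeighborhood ξ₂ j₂ αN ε Ψ₂ :=
    ⟨min ε₁ ε₂, lt_min hε₁ hε₂, hΨ₁ _ (min_le_left _ _), hΨ₂ _ (min_le_right _ _)⟩
  obtain ⟨p₀⟩ := ‹Nonempty N›
  have : Nonempty N := ⟨p₀⟩
  have : Nonempty M₁ := ⟨j₁ p₀⟩
  have : Nonempty M₂ := ⟨j₂ p₀⟩
  have hs₁ := hj₁.isClosedEmbedding.isClosed_range.isOpen_compl
  have hs₂ := hj₂.isClosedEmbedding.isClosed_range.isOpen_compl
  have hmt₁ := hm₁.mapsTo_end hε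
  -- The negative half of the collar enters the second end through `reflect`, which is the gluing
  -- map.
  have hmt₂ := (hm₂.mapsTo_end hε).comp (mapsTo_reflect ε)
  obtain ⟨K₁, hK₁, hin₁, hout₁⟩ := hm₁.exists_closed hε
  obtain ⟨K₂, hK₂, hin₂, hout₂⟩ := hm₂.exists_closed hε
  obtain ⟨_, _, _, hT2, hSC, hd₁, hd₂, hd₃⟩ := exists_gluedManifold hde hs₁ hs₂ hε
    hm₁.isOpenDiffeoOn_end hm₂.isOpenDiffeoOn_reflected_end hmt₁ hmt₂ hK₁ hK₂ hin₁
    (fun q hq hlt => hin₂ _ (mapsTo_reflect ε hq) (neg_lt.1 hlt)) hout₁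
    (fun x hx => by
      obtain ⟨q, hq, rfl⟩ := hout₂ x hx
      refine ⟨reflect q, ⟨⟨neg_lt_neg hq.1.2, neg_neg_iff_pos.2 hq.1.1⟩, trivial⟩, ?_⟩
      rw [Function.comp_apply, reflect_reflect])
  have hcover := glued_cover (s₁ := (range j₁)ᶜ) (s₂ := (range j₂)ᶜ) (g₁ := Ψ₁ ∘ polar)
    (g₂ := (Ψ₂ ∘ polar) ∘ reflect) hε
  obtain ⟨ξ', he₁, he₂, he₃⟩ := exists_glued_contactStructure hde (ξ₁ := ξ₁) (ξ₂ := ξ₂) hαN.1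
    hm₁.isOpenDiffeoOn_end hm₂.isOpenDiffeoOn_reflected_end hmt₁ hmt₂
    (prod_mono_left (Ioo_subset_Ioo_left (by linarith))) (prod_mono_left (Ioo_subset_Ioo_right hε.le))
    hd₁ hd₂ hd₃ (fun q hq => gluedCollar_of_pos hq.1.1) (fun q hq => gluedCollar_of_neg hq.1.2)
    (fun q hq h => mem_of_gluedCollar_mem₁ hmt₁ hmt₂ hq h)
    (fun q hq h => mem_of_gluedCollar_mem₂ hmt₁ hmt₂ hq h) disjoint_gluedIncl hcover
    (fun α hα q hq v => hm₁.pos_end hα hq v) (fun α hα q hq v => hm₂.pos_reflected_end hα hq v)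
  exact ⟨_, _, hT2, hSC, _, inferInstance, ξ',
    { form := αN
      form_positive := hαN
      width := ε
      width_pos := hε
      nbhd₁ := Ψ₁
      nbhd₂ := Ψ₂
      isModel₁ := hm₁
      isModel₂ := hm₂
      incl₁ := _
      incl₂ := _
      incl₁_contact := he₁
      incl₂_contact := he₂
      collar := _
      collar_diffeo := hd₃
      collar_contact := he₃
      glue₁ := fun s hs θ p => gluedCollar_of_pos hs.1
      glue₂ := fun s hs θ p => by
        rw [gluedCollar_of_neg (neg_lt_zero.2 hs.1)]
        simp [polar, reflect]
      cover := hcover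
      disjoint := disjoint_gluedIncl
      disjoint_zero := disjoint_gluedCollar_zero }, rfl⟩

/-! ### Changing the model of a manifold -/

section Remodel

set_option linter.unusedSectionVars false

variable {E : Type*} [NormedAddCommGroup E] [NormedSpace ℝ E] {H : Type*} [TopologicalSpace H]
  {I : ModelWithCorners ℝ E H} {X : Type*} [TopologicalSpace X] [ChartedSpace H X]
  {E' : Type*} [NormedAddCommGroup E'] [NormedSpace ℝ E'] {H' : Type*} [TopologicalSpace H']
  {I' : ModelWithCorners ℝ E' H'} {L : E ≃L[ℝ] E'}

/-- The charts of `X`, composed with a homeomorphism of the models. -/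
@[reducible] def remodel (Φ : H ≃ₜ H') (X : Type*) [TopologicalSpace X] [ChartedSpace H X] :
    ChartedSpace H' X where
  atlas := (fun c : OpenPartialHomeomorph X H => c.trans Φ.toOpenPartialHomeomorph) '' atlas H X
  chartAt x := (chartAt H x).trans Φ.toOpenPartialHomeomorph
  mem_chart_source x := by simp
  chart_mem_atlas x := mem_image_of_mem _ (chart_mem_atlas H x)

/-- Transition maps are conjugated by the linear isomorphism `L`. The change of model is needed
because a bLob must be modelled on one half-space, whereas the product of the circle with `P`
carries a product model. -/
lemma isManifold_remodel (Φ : H ≃ₜ H') (hΦ : ∀ h, I' (Φ h) = L (I h)) [IsManifold I ∞ X] :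
    @IsManifold ℝ _ E' _ _ H' _ I' ∞ X _ (remodel Φ X) := by
  let _ := remodel Φ X
  refine isManifold_of_contDiffOn I' ∞ X ?_
  rintro _ _ ⟨c, hc, rfl⟩ ⟨c', hc', rfl⟩
  have h := (contDiffGroupoid ∞ I).compatible hc hc'
  rw [contDiffGroupoid, mem_groupoid_of_pregroupoid] at h
  have h1 : ContDiffOn ℝ ∞ (I ∘ (c.symm.trans c') ∘ I.symm)
    (I.symm ⁻¹' (c.symm.trans c').source ∩ range I) := h.1
  have hs : ∀ z, I'.symm (L (I z)) = Φ z := fun z => by rw [← hΦ, I'.left_inv]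
  have h2 := L.contDiff.comp_contDiffOn (h1.comp L.symm.contDiff.contDiffOn
    (s := I'.symm ⁻¹' ((c.trans Φ.toOpenPartialHomeomorph).symm.trans
      (c'.trans Φ.toOpenPartialHomeomorph)).source ∩ range I') ?_)
  · refine h2.congr ?_
    rintro _ ⟨hz, z, rfl⟩
    obtain ⟨z, rfl⟩ := Φ.surjective z
    simp [hΦ, hs]
  · rintro _ ⟨hz, z, rfl⟩
    obtain ⟨z, rfl⟩ := Φ.surjective z
    simpa [hΦ, hs] using hz

variable [ChartedSpace H' X] {Φ : H ≃ₜ H'} 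

lemma range_remodel (hΦ : ∀ h, I' (Φ h) = L (I h)) : range I' = L '' range I := by
  ext y
  constructor
  · rintro ⟨h, rfl⟩
    exact ⟨I (Φ.symm h), mem_range_self _, by rw [← hΦ, Φ.apply_symm_apply]⟩
  · rintro ⟨_, ⟨h, rfl⟩, rfl⟩
    exact ⟨Φ h, hΦ h⟩

lemma extChartAt_remodel (hΦ : ∀ h, I' (Φ h) = L (I h))
    (hc : ∀ x : X, chartAt H' x = (chartAt H x).trans Φ.toOpenPartialHomeomorph) (x y : X) :
    extChartAt I' x y = L (extChartAt I x y) := by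
  simp only [extChartAt_coe, hc, Function.comp_apply]
  exact hΦ _

/-- The derivative is computed in the preferred charts, in which the identity is the linear map
`L.symm`. -/
lemma hasMFDerivAt_remodel_symm (hΦ : ∀ h, I' (Φ h) = L (I h))
    (hc : ∀ x : X, chartAt H' x = (chartAt H x).trans Φ.toOpenPartialHomeomorph) (x : X) :
    HasMFDerivAt I' I (id : X → X) x (L.symm : E' →L[ℝ] E) := by
  refine ⟨continuousAt_id, ?_⟩
  have key : ∀ z ∈ (extChartAt I' x).target, writtenInExtChartAt I' I x (id : X → X) z = L.symm z := by
    intro z hz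
    have h := extChartAt_remodel (X := X) hΦ hc x ((extChartAt I' x).symm z)
    rw [(extChartAt I' x).right_inv hz] at h
    rw [h]
    simp only [writtenInExtChartAt, Function.comp_apply, id, L.symm_apply_apply]
    rw [← h]
  refine (L.symm : E' →L[ℝ] E).hasFDerivWithinAt.congr_of_eventuallyEq ?_ ?_
  · filter_upwards [extChartAt_target_mem_nhdsWithin (I := I') x] with y hy using key y hy
  · exact key _ (mem_extChartAt_target x)

lemma contMDiff_remodel (hΦ : ∀ h, I' (Φ h) = L (I h))
    (hc : ∀ x : X, chartAt H' x = (chartAt H x).trans Φ.toOpenPartialHomeomorph) :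
    ContMDiff I I' ∞ (id : X → X) := by
  intro x
  rw [contMDiffAt_iff]
  refine ⟨continuousAt_id, ?_⟩
  refine L.contDiff.contDiffWithinAt.congr_of_eventuallyEq ?_ ?_
  · filter_upwards [extChartAt_target_mem_nhdsWithin (I := I) x] with y hy
    simp only [Function.comp_apply, id]
    rw [extChartAt_remodel hΦ hc, (extChartAt I x).right_inv hy]
  · simp only [Function.comp_apply, id]
    rw [extChartAt_remodel hΦ hc, extChartAt_to_inv]

lemma contMDiff_remodel_symm (hΦ : ∀ h, I' (Φ h) = L (I h))
    (hc : ∀ x : X, chartAt H' x = (chartAt H x).trans Φ.toOpenPartialHomeomorph) :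
    ContMDiff I' I ∞ (id : X → X) := by
  intro x
  rw [contMDiffAt_iff]
  refine ⟨continuousAt_id, ?_⟩
  have key : ∀ z ∈ (extChartAt I' x).target,
      (extChartAt I x ∘ id ∘ (extChartAt I' x).symm) z = L.symm z := by
    intro z hz
    have h := extChartAt_remodel (X := X) hΦ hc x ((extChartAt I' x).symm z)
    rw [(extChartAt I' x).right_inv hz] at h
    rw [h]
    simp only [Function.comp_apply, id, L.symm_apply_apply]
    rw [← h]
  refine L.symm.contDiff.contDiffWithinAt.congr_of_eventuallyEq ?_ ?_
  · filter_upwards [extChartAt_target_mem_nhdsWithin (I := I') x] with y hy using key y hy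
  · exact key _ (mem_extChartAt_target x)

lemma boundary_remodel (hΦ : ∀ h, I' (Φ h) = L (I h))
    (hc : ∀ x : X, chartAt H' x = (chartAt H x).trans Φ.toOpenPartialHomeomorph) :
    I'.boundary X = I.boundary X := by
  ext x
  change extChartAt I' x x ∈ frontier (range I') ↔ extChartAt I x x ∈ frontier (range I)
  rw [range_remodel hΦ, extChartAt_remodel hΦ hc, show L '' range I = L.toHomeomorph '' range I from rfl,
    ← L.toHomeomorph.image_frontier]
  exact L.injective.mem_set_image

/-- The derivative at `x` is itself taken in the preferred chart at `x`, where that chart is the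
identity. Hence the tangent space of the boundary is the hyperplane on which coordinate `0`
vanishes, in any model. -/
lemma tderiv_extChartAt_self (x : X) :
    tderiv I 𝓘(ℝ, E) (extChartAt I x) x = ContinuousLinearMap.id ℝ E := by
  refine HasMFDerivAt.mfderiv ⟨continuousAt_extChartAt x, ?_⟩
  refine (hasFDerivWithinAt_id _ _).congr_of_eventuallyEq ?_ ?_
  · filter_upwards [extChartAt_target_mem_nhdsWithin (I := I) x] with y hy
    simp only [writtenInExtChartAt, Function.comp_apply, extChartAt_model_space_eq_id,
      PartialEquiv.refl_coe, id]
    exact (extChartAt I x).right_inv hy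
  · simp only [writtenInExtChartAt, Function.comp_apply, extChartAt_model_space_eq_id,
      PartialEquiv.refl_coe, id]
    exact congrArg _ (extChartAt_to_inv x)

end Remodel

/-! ### The product of the circle and a manifold with boundary -/

/-- The isomorphism `ℝ × ℝⁿ⁺¹ ≃ ℝⁿ⁺²` that preserves the first coordinate of `ℝⁿ⁺¹`. -/
def snocEquiv (n : ℕ) : (EuclideanSpace ℝ (Fin 1) × EuclideanSpace ℝ (Fin (n + 1))) ≃L[ℝ]
    EuclideanSpace ℝ (Fin (n + 1 + 1)) :=
  LinearEquiv.toContinuousLinearEquiv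
    -- The circle coordinate is appended at the end, so that coordinate `0`, which cuts out the
    -- half-space, remains that of `P`.
    { toFun := fun v => WithLp.toLp 2 (Fin.snoc (α := fun _ => ℝ) v.2 (v.1 0))
      map_add' := fun v w => by
        ext i
        refine Fin.lastCases ?_ (fun i => ?_) i <;> simp
      map_smul' := fun c v => by
        ext i
        refine Fin.lastCases ?_ (fun i => ?_) i <;> simp
      invFun := fun y => (WithLp.toLp 2 fun _ => y (Fin.last _), WithLp.toLp 2 fun i => y i.castSucc)
      left_inv := fun v => by
        refine Prod.ext ?_ ?_
        · ext i
          simp [Subsingleton.elim i 0]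
        · ext i
          simp
      right_inv := fun y => by
        ext i
        refine Fin.lastCases ?_ (fun i => ?_) i <;> simp }

lemma snocEquiv_zero (n : ℕ) (v : EuclideanSpace ℝ (Fin 1) × EuclideanSpace ℝ (Fin (n + 1))) :
    snocEquiv n v 0 = v.2 0 :=
  Fin.snoc_castSucc (α := fun _ => ℝ) (v.1 0) v.2 0

/-- The model of the product of the circle and a manifold with boundary. -/
abbrev circleModel (n : ℕ) := (𝓡 1).prod (𝓡∂ (n + 1))

/-- The homeomorphism `ℝ × ℝⁿ⁺¹₊ ≃ ℝⁿ⁺²₊`. -/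
def snocHomeo (n : ℕ) : ModelProd (EuclideanSpace ℝ (Fin 1)) (EuclideanHalfSpace (n + 1)) ≃ₜ
    EuclideanHalfSpace (n + 1 + 1) where
  toFun x := ⟨snocEquiv n (x.1, x.2.1), by rw [snocEquiv_zero]; exact x.2.2⟩
  invFun y := (((snocEquiv n).symm y.1).1, ⟨((snocEquiv n).symm y.1).2, by
    rw [← snocEquiv_zero, ContinuousLinearEquiv.apply_symm_apply]; exact y.2⟩)
  left_inv x := by
    refine Prod.ext ?_ (Subtype.ext ?_)
    · simp only [ContinuousLinearEquiv.symm_apply_apply]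
    · simp only [ContinuousLinearEquiv.symm_apply_apply]
  right_inv y := by
    refine Subtype.ext ?_
    simp only [Prod.mk.eta, ContinuousLinearEquiv.apply_symm_apply]
  continuous_toFun := ((snocEquiv n).continuous.comp
    (continuous_fst.prodMk (continuous_subtype_val.comp continuous_snd))).subtype_mk _
  continuous_invFun :=
    (continuous_fst.comp ((snocEquiv n).symm.continuous.comp continuous_subtype_val)).prodMk
      ((continuous_snd.comp
        ((snocEquiv n).symm.continuous.comp continuous_subtype_val)).subtype_mk _)

lemma snocHomeo_model (n : ℕ)
    (x : ModelProd (EuclideanSpace ℝ (Fin 1)) (EuclideanHalfSpace (n + 1))) :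
    (𝓡∂ (n + 1 + 1)) (snocHomeo n x) = snocEquiv n (circleModel n x) := rfl

section CircleProd

set_option linter.unusedSectionVars false

variable {n : ℕ} {P : Type u} [TopologicalSpace P] [ChartedSpace (EuclideanHalfSpace (n + 1)) P]

/-- The product of the circle and a manifold with boundary, as a manifold with boundary. -/
@[reducible] def circleProd (n : ℕ) (P : Type u) [TopologicalSpace P]
    [ChartedSpace (EuclideanHalfSpace (n + 1)) P] :
    ChartedSpace (EuclideanHalfSpace (n + 1 + 1)) (Circle × P) := remodel (snocHomeo n) (Circle × P)

attribute [local instance] circleProd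

lemma isManifold_circleProd [IsManifold (𝓡∂ (n + 1)) ∞ P] :
    IsManifold (𝓡∂ (n + 1 + 1)) ∞ (Circle × P) :=
  isManifold_remodel (I := circleModel n) (L := snocEquiv n) (snocHomeo n) (snocHomeo_model n)

lemma contMDiff_toCircleProd :
    ContMDiff (circleModel n) (𝓡∂ (n + 1 + 1)) ∞ (id : Circle × P → Circle × P) :=
  contMDiff_remodel (L := snocEquiv n) (snocHomeo_model n) fun _ => rfl

lemma contMDiff_ofCircleProd :
    ContMDiff (𝓡∂ (n + 1 + 1)) (circleModel n) ∞ (id : Circle × P → Circle × P) :=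
  contMDiff_remodel_symm (L := snocEquiv n) (snocHomeo_model n) fun _ => rfl

lemma boundary_circleProd : (𝓡∂ (n + 1 + 1)).boundary (Circle × P) =
    univ ×ˢ (𝓡∂ (n + 1)).boundary P := by
  rw [boundary_remodel (I := circleModel n) (L := snocEquiv n) (snocHomeo_model n) fun _ => rfl]
  exact ModelWithCorners.boundary_of_boundaryless_left

lemma interior_circleProd : (𝓡∂ (n + 1 + 1)).interior (Circle × P) =
    univ ×ˢ (𝓡∂ (n + 1)).interior P := by
  rw [← ModelWithCorners.compl_boundary, boundary_circleProd, ← ModelWithCorners.compl_boundary]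
  ext q
  simp

variable {E : Type*} [NormedAddCommGroup E] [NormedSpace ℝ E] {H : Type*} [TopologicalSpace H]
  {J : ModelWithCorners ℝ E H} {Y : Type*} [TopologicalSpace Y] [ChartedSpace H Y]

lemma tderiv_circleProd {f : Circle × P → Y} {q : Circle × P}
    (hf : MDifferentiableAt (circleModel n) J f q)
    (v : EuclideanSpace ℝ (Fin 1) × EuclideanSpace ℝ (Fin (n + 1))) :
    tderiv (𝓡∂ (n + 1 + 1)) J f q (snocEquiv n v) = tderiv (circleModel n) J f q v := by
  have h := hasMFDerivAt_remodel_symm (I := circleModel n) (L := snocEquiv n) (X := Circle × P)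
    (snocHomeo_model n) (fun _ => rfl) q
  have h1 : tderiv (𝓡∂ (n + 1 + 1)) (circleModel n) (id : Circle × P → Circle × P) q =
    ((snocEquiv n).symm : _ →L[ℝ] _) := h.mfderiv
  refine (tderiv_comp_apply (f := id) hf h.mdifferentiableAt rfl _).trans ?_
  rw [h1]
  exact congrArg _ ((snocEquiv n).symm_apply_apply v)

lemma IsDiffeoOn.change_model {E₂ H₂ E₃ H₃ : Type*} [NormedAddCommGroup E₂] [NormedSpace ℝ E₂]
    [TopologicalSpace H₂] {I₂ : ModelWithCorners ℝ E₂ H₂} [NormedAddCommGroup E₃]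
    [NormedSpace ℝ E₃] [TopologicalSpace H₃] {I₃ : ModelWithCorners ℝ E₃ H₃}
    {E₄ H₄ : Type*} [NormedAddCommGroup E₄] [NormedSpace ℝ E₄]
    [TopologicalSpace H₄] {I₄ : ModelWithCorners ℝ E₄ H₄}
    {X : Type*} [TopologicalSpace X] [ChartedSpace H₂ X] [ChartedSpace H₃ X] [ChartedSpace H₄ Y]
    (hX : ContMDiff I₃ I₂ ∞ (id : X → X)) (hX' : ContMDiff I₂ I₃ ∞ (id : X → X))
    (hY : ContMDiff J I₄ ∞ (id : Y → Y)) (hY' : ContMDiff I₄ J ∞ (id : Y → Y))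
    {f : X → Y} {s : Set X} {t : Set Y} (h : IsDiffeoOn I₂ J f s t) : IsDiffeoOn I₃ I₄ f s t := by
  obtain ⟨hf, hm, g, hg, hgm, hl, hr⟩ := h
  exact ⟨(hY.comp_contMDiffOn hf).comp hX.contMDiffOn (mapsTo_id s), hm, g,
    (hX'.comp_contMDiffOn hg).comp hY'.contMDiffOn (mapsTo_id t), hgm, hl, hr⟩

lemma mem_boundaryTangent_iff (p : P) (v : EuclideanSpace ℝ (Fin (n + 1))) :
    v ∈ boundaryTangent (k := n) p ↔ v 0 = 0 := by
  have h := tderiv_extChartAt_self (I := 𝓡∂ (n + 1)) p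
  have h1 : (tderiv (𝓡∂ (n + 1)) 𝓘(ℝ, EuclideanSpace ℝ (Fin (n + 1)))
    (extChartAt (𝓡∂ (n + 1)) p) p v) 0 = v 0 := by rw [h]; rfl
  exact Eq.congr_left h1

/-- The product of the circle with a relative open book is a relative open book. -/
lemma IsRelativeOpenBook.circleProd {B : Set P} {ϑ : P → Circle} (h : IsRelativeOpenBook n B ϑ) :
    IsRelativeOpenBook (n + 1) (univ ×ˢ B : Set (Circle × P)) (fun q => ϑ q.2) where
  boundary_nonempty := by
    rw [boundary_circleProd]
    exact univ_nonempty.prod h.boundary_nonempty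
  binding_nonempty := univ_nonempty.prod h.binding_nonempty
  binding_closed := isClosed_univ.prod h.binding_closed
  binding_interior := by
    rw [interior_circleProd]
    exact prod_mono_right h.binding_interior
  smooth := by
    have h1 : ContMDiffOn (circleModel n) (𝓡 1) ∞ (fun q : Circle × P => ϑ q.2)
        (univ ×ˢ B : Set (Circle × P))ᶜ :=
      h.smooth.comp contMDiff_snd.contMDiffOn fun q hq hqB => hq ⟨trivial, hqB⟩
    exact h1.comp contMDiff_ofCircleProd.contMDiffOn (mapsTo_id _)
  fibration := by
    intro θ₀
    obtain ⟨V, hV, hθ₀, ρ, hρ, hm, g, hg, hgm, hl, hr⟩ := h.fibration θ₀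
    refine ⟨V, hV, hθ₀, fun q => (q.1, ρ q.2), ?_⟩
    have hid : ContMDiff ((𝓡 1).prod (circleModel n)) ((𝓡 1).prod (𝓡∂ (n + 1 + 1))) ∞
        (id : Circle × Circle × P → Circle × Circle × P) :=
      contMDiff_id.prodMap contMDiff_toCircleProd
    have hid' : ContMDiff ((𝓡 1).prod (𝓡∂ (n + 1 + 1))) ((𝓡 1).prod (circleModel n)) ∞
        (id : Circle × Circle × P → Circle × Circle × P) :=
      contMDiff_id.prodMap contMDiff_ofCircleProd
    refine IsDiffeoOn.change_model contMDiff_ofCircleProd contMDiff_toCircleProd hid hid' ?_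
    have hmaps : MapsTo (Prod.snd : Circle × P → P) ((fun q : Circle × P => ϑ q.2) ⁻¹' V \ univ ×ˢ B)
      (ϑ ⁻¹' V \ B) := fun q hq => ⟨hq.1, fun hB => hq.2 ⟨trivial, hB⟩⟩
    have hsnd : ContMDiffOn (circleModel n) ((𝓡 1).prod (𝓡∂ (n + 1))) ∞
        (fun q : Circle × P => (ϑ q.2, ρ q.2)) ((fun q : Circle × P => ϑ q.2) ⁻¹' V \ univ ×ˢ B) :=
      hρ.comp contMDiff_snd.contMDiffOn hmaps
    have hmaps' : MapsTo (fun r : Circle × Circle × P => (r.1, r.2.2))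
        (V ×ˢ ((fun q : Circle × P => ϑ q.2) ⁻¹' {θ₀} \ univ ×ˢ B)) (V ×ˢ (ϑ ⁻¹' {θ₀} \ B)) :=
      fun r hr => ⟨hr.1, hr.2.1, fun hB => hr.2.2 ⟨trivial, hB⟩⟩
    refine ⟨?_, ?_, fun r => (r.2.1, g (r.1, r.2.2)), ?_, ?_, ?_, ?_⟩
    · exact (contMDiff_fst.comp_contMDiffOn hsnd).prodMk
        (contMDiff_fst.contMDiffOn.prodMk (contMDiff_snd.comp_contMDiffOn hsnd))
    · intro q hq
      have := hm (hmaps hq)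
      exact ⟨this.1, this.2.1, fun hB => this.2.2 hB.2⟩
    · have h1 : ContMDiff ((𝓡 1).prod (circleModel n)) ((𝓡 1).prod (𝓡∂ (n + 1))) ∞
          (fun r : Circle × Circle × P => (r.1, r.2.2)) :=
        contMDiff_fst.prodMk (contMDiff_snd.comp contMDiff_snd)
      exact (contMDiff_fst.comp contMDiff_snd).contMDiffOn.prodMk
        (hg.comp h1.contMDiffOn hmaps')
    · intro r hr'
      have := hgm (hmaps' hr')
      exact ⟨this.1, fun hB => this.2 hB.2⟩
    · intro q hq
      exact Prod.ext rfl (hl (hmaps hq))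
    · intro r hr'
      obtain ⟨h1, h2⟩ := Prod.ext_iff.1 (hr (hmaps' hr'))
      exact Prod.ext h1 (Prod.ext rfl h2)
  transverse := by
    intro q hq
    rw [boundary_circleProd] at hq
    have hqB : q.2 ∉ B := fun hB => by
      have h1 := h.binding_interior hB
      rw [← ModelWithCorners.compl_boundary] at h1
      exact h1 hq.2
    have hsm : MDifferentiableAt (𝓡∂ (n + 1)) (𝓡 1) ϑ q.2 :=
      (h.smooth.contMDiffAt (h.binding_closed.isOpen_compl.mem_nhds hqB)).mdifferentiableAt
        (by simp)
    rw [eq_top_iff]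
    rintro (v : EuclideanSpace ℝ (Fin (n + 1 + 1))) -
    obtain ⟨⟨τ, w⟩, rfl⟩ := (snocEquiv n).surjective v
    have hsup : ∀ w : TangentSpace (𝓡∂ (n + 1)) q.2,
        ∃ a ∈ LinearMap.ker (mfderiv (𝓡∂ (n + 1)) (𝓡 1) ϑ q.2).toLinearMap,
          ∃ b ∈ boundaryTangent (k := n) q.2, a + b = w := fun w => Submodule.mem_sup.1 (by
      rw [h.transverse q.2 hq.2]
      trivial)
    obtain ⟨a, ha, b, hb, hab⟩ : ∃ a : EuclideanSpace ℝ (Fin (n + 1)),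
        tderiv (𝓡∂ (n + 1)) (𝓡 1) ϑ q.2 a = 0 ∧ ∃ b : EuclideanSpace ℝ (Fin (n + 1)),
          b ∈ boundaryTangent (k := n) q.2 ∧ a + b = w := hsup w
    subst hab
    -- Transversality in `P` splits the second component. The circle direction is tangent both to
    -- the fibre and to the boundary and is put with the fibre.
    refine Submodule.mem_sup.2 ⟨snocEquiv n (τ, a), ?_, snocEquiv n (0, b), ?_, ?_⟩
    · have h1 := tderiv_circleProd (MDifferentiableAt.comp (g := ϑ) q hsm mdifferentiableAt_snd)
        (τ, a)
      have h2 := tderiv_comp_snd (I := 𝓡 1) (f := ϑ) (q := q) hsm (τ, a)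
      exact (h1.trans h2).trans ha
    · have h1 := (mem_boundaryTangent_iff q.2 b).1 hb
      exact (mem_boundaryTangent_iff q _).2 ((snocEquiv_zero n (0, b)).trans h1)
    · have h1 : snocEquiv n (τ, a) + snocEquiv n (0, b) = snocEquiv n (τ, a + b) := by
        rw [← map_add]
        simp
      exact h1
  tubular := by
    obtain ⟨U, π, z, hU, hBU, ⟨hf, hm, g, hg, hgm, hl, hr⟩, hB, hz⟩ := h.tubular
    have hid : ContMDiff ((circleModel n).prod 𝓘(ℝ, ℂ)) ((𝓡∂ (n + 1 + 1)).prod 𝓘(ℝ, ℂ)) ∞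
        (id : (Circle × P) × ℂ → (Circle × P) × ℂ) :=
      contMDiff_toCircleProd.prodMap contMDiff_id
    have hid' : ContMDiff ((𝓡∂ (n + 1 + 1)).prod 𝓘(ℝ, ℂ)) ((circleModel n).prod 𝓘(ℝ, ℂ)) ∞
        (id : (Circle × P) × ℂ → (Circle × P) × ℂ) :=
      contMDiff_ofCircleProd.prodMap contMDiff_id
    refine ⟨univ ×ˢ U, fun q => (q.1, π q.2), fun q => z q.2, isOpen_univ.prod hU,
      prod_mono_right hBU, ?_, ?_, ?_⟩
    · refine IsDiffeoOn.change_model contMDiff_ofCircleProd contMDiff_toCircleProd hid hid' ?_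
      have hsnd : ContMDiffOn (circleModel n) ((𝓡∂ (n + 1)).prod 𝓘(ℝ, ℂ)) ∞
          (fun q : Circle × P => (π q.2, z q.2)) (univ ×ˢ U) :=
        hf.comp contMDiff_snd.contMDiffOn fun q hq => hq.2
      have hmaps' : MapsTo (fun r : (Circle × P) × ℂ => (r.1.2, r.2))
          ((univ ×ˢ B) ×ˢ Metric.ball (0 : ℂ) 1) (B ×ˢ Metric.ball (0 : ℂ) 1) :=
        fun r hr => ⟨hr.1.2, hr.2⟩
      refine ⟨?_, ?_, fun r => (r.1.1, g (r.1.2, r.2)), ?_, ?_, ?_, ?_⟩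
      · exact (contMDiff_fst.contMDiffOn.prodMk (contMDiff_fst.comp_contMDiffOn hsnd)).prodMk
          (contMDiff_snd.comp_contMDiffOn hsnd)
      · exact fun q hq => ⟨⟨trivial, (hm hq.2).1⟩, (hm hq.2).2⟩
      · have h1 : ContMDiff ((circleModel n).prod 𝓘(ℝ, ℂ)) ((𝓡∂ (n + 1)).prod 𝓘(ℝ, ℂ)) ∞
            (fun r : (Circle × P) × ℂ => (r.1.2, r.2)) :=
          (contMDiff_snd.comp contMDiff_fst).prodMk contMDiff_snd
        exact (contMDiff_fst.comp contMDiff_fst).contMDiffOn.prodMk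
          (hg.comp h1.contMDiffOn hmaps')
      · exact fun r hr' => ⟨trivial, hgm (hmaps' hr')⟩
      · exact fun q hq => Prod.ext rfl (hl hq.2)
      · intro r hr'
        obtain ⟨h1, h2⟩ := Prod.ext_iff.1 (hr (hmaps' hr'))
        exact Prod.ext (Prod.ext rfl h1) h2
    · exact fun b hb => ⟨Prod.ext rfl (hB b.2 hb.2).1, (hB b.2 hb.2).2⟩
    · exact fun q hq => hz q.2 ⟨hq.1.2, fun hqB => hq.2 ⟨trivial, hqB⟩⟩

end CircleProd

/-! ### Foliations -/

/-- The value of `b ∧ w` at three vectors. -/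
def wedge {E : Type*} [NormedAddCommGroup E] [NormedSpace ℝ E] (b : E →L[ℝ] ℝ)
    (w : E →L[ℝ] E →L[ℝ] ℝ) (u v z : E) : ℝ := b u * w v z - b v * w u z + b z * w u v

/-- If `c = f b`, then `c ∧ dc = f² b ∧ db`, because `b ∧ df ∧ b = 0`. Integrability can therefore
be tested on any form of the conformal class. -/
lemma exists_wedge_of_conformal {E : Type} [NormedAddCommGroup E] [NormedSpace ℝ E]
    {b c : E → E →L[ℝ] ℝ} {x : E} (hb : ContDiffAt ℝ ∞ b x) (hc : ContDiffAt ℝ ∞ c x)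
    (hb0 : b x ≠ 0) (h : ∀ᶠ x in 𝓝 x, ∃ l : ℝ, 0 < l ∧ ∀ v, c x v = l * b x v) :
    ∃ l : ℝ, ∀ u v z, wedge (c x) (dForm c x) u v z = l * wedge (b x) (dForm b x) u v z := by
  obtain ⟨w, hw0⟩ : ∃ w, b x w ≠ 0 := by
    by_contra! h0
    exact hb0 (ContinuousLinearMap.ext h0)
  have hbw : ContDiffAt ℝ ∞ (fun x => b x w) x := hb.clm_apply contDiffAt_const
  have hl : ContDiffAt ℝ ∞ (fun x => c x w / b x w) x :=
    (hc.clm_apply contDiffAt_const).div hbw hw0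
  have heq : c =ᶠ[𝓝 x] fun x => (c x w / b x w) • b x := by
    filter_upwards [h, hbw.continuousAt.eventually_ne hw0] with z ⟨l, _, hl⟩ hz
    ext v
    rw [_root_.smul_apply, hl, hl, mul_div_cancel_right₀ _ hz, smul_eq_mul]
  obtain ⟨l, hl0, hlx⟩ := h.self_of_nhds
  refine ⟨l ^ 2, fun u v z => ?_⟩
  simp only [wedge, dForm_congr heq,
    dForm_smul (hl.differentiableAt (by simp)) (hb.differentiableAt (by simp)), hlx,
    mul_div_cancel_right₀ _ hw0]
  ring

/-! ### The foliation on the middle slice of the collar -/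

section CollarFoliation

set_option linter.unusedSectionVars false

variable {d e n : ℕ} {N M : Type u}
  [TopologicalSpace N] [ChartedSpace (EuclideanSpace ℝ (Fin d)) N] [IsManifold (𝓡 d) ∞ N]
  [TopologicalSpace M] [ChartedSpace (EuclideanSpace ℝ (Fin e)) M] [IsManifold (𝓡 e) ∞ M]
  {P : Type u} [TopologicalSpace P] [ChartedSpace (EuclideanHalfSpace (n + 1)) P]
  {ξN : ContactStructure d N} {ξ : ContactStructure e M} {αN : OneForm d N} {ι : P → N}
  {c : ℝ × Circle × N → M} {W : Set (ℝ × Circle × N)}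

attribute [local instance] circleProd

/-- The middle of the collar. -/
def collarMid (ι : P → N) (q : Circle × P) : ℝ × Circle × N := (0, q.1, ι q.2)

lemma contMDiff_collarMid (hι : ContMDiff (𝓡∂ (n + 1)) (𝓡 d) ∞ ι) :
    ContMDiff (circleModel n) (collarModel d) ∞ (collarMid ι) :=
  contMDiff_const.prodMk (contMDiff_fst.prodMk (hι.comp contMDiff_snd))

lemma tderiv_collarMid (hι : ContMDiff (𝓡∂ (n + 1)) (𝓡 d) ∞ ι) (q : Circle × P)
    (v : EuclideanSpace ℝ (Fin 1) × EuclideanSpace ℝ (Fin (n + 1))) :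
    tderiv (circleModel n) (collarModel d) (collarMid ι) q v =
      (0, v.1, tderiv (𝓡∂ (n + 1)) (𝓡 d) ι q.2 v.2) := by
  have hιq : MDifferentiableAt (𝓡∂ (n + 1)) (𝓡 d) ι q.2 := (hι q.2).mdifferentiableAt (by simp)
  have h1 : MDifferentiableAt (circleModel n) (𝓡 d) (fun q : Circle × P => ι q.2) q :=
    hιq.comp q mdifferentiableAt_snd
  have h2 : MDifferentiableAt (circleModel n) (𝓡 1) (fun q : Circle × P => q.1) q :=
    mdifferentiableAt_fst
  refine (tderiv_prodMk (f := fun _ : Circle × P => (0 : ℝ)) mdifferentiableAt_const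
    (h2.prodMk h1) v).trans ?_
  rw [tderiv_prodMk h2 h1, tderiv_comp_snd (f := ι) hιq,
    tderiv_comp_fst (f := fun θ : Circle => θ) mdifferentiableAt_id]
  refine Prod.ext ?_ (Prod.ext ?_ rfl)
  · exact congrArg (fun L : EuclideanSpace ℝ (Fin 1) × EuclideanSpace ℝ (Fin (n + 1)) →L[ℝ] ℝ => L v)
      mfderiv_const
  · exact congrArg (fun L : EuclideanSpace ℝ (Fin 1) →L[ℝ] EuclideanSpace ℝ (Fin 1) => L v.1)
      (tderiv_id (I := 𝓡 1))

lemma contMDiff_comp_collarMid (hι : ContMDiff (𝓡∂ (n + 1)) (𝓡 d) ∞ ι)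
    (hc : IsOpenDiffeoOn (collarModel d) (𝓡 e) c W) (hW : ∀ q : Circle × P, collarMid ι q ∈ W) :
    ContMDiff (circleModel n) (𝓡 e) ∞ (c ∘ collarMid ι) :=
  fun q => (hc.contMDiffAt (hW q)).comp q (contMDiff_collarMid hι q)

lemma tderiv_comp_collarMid (hι : ContMDiff (𝓡∂ (n + 1)) (𝓡 d) ∞ ι)
    (hc : IsOpenDiffeoOn (collarModel d) (𝓡 e) c W) (hW : ∀ q : Circle × P, collarMid ι q ∈ W)
    (q : Circle × P) (v : EuclideanSpace ℝ (Fin 1) × EuclideanSpace ℝ (Fin (n + 1))) :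
    tderiv (𝓡∂ (n + 1 + 1)) (𝓡 e) (c ∘ collarMid ι) q (snocEquiv n v) =
      tderiv (collarModel d) (𝓡 e) c (collarMid ι q)
        (0, v.1, tderiv (𝓡∂ (n + 1)) (𝓡 d) ι q.2 v.2) := by
  rw [tderiv_circleProd ((contMDiff_comp_collarMid hι hc hW q).mdifferentiableAt (by simp)),
    tderiv_comp_apply (hc.mdifferentiableAt (hW q))
      ((contMDiff_collarMid hι q).mdifferentiableAt (by simp)) rfl, tderiv_collarMid hι]

lemma injective_tderiv_comp_collarMid (hι : ContMDiff (𝓡∂ (n + 1)) (𝓡 d) ∞ ι)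
    (hc : IsOpenDiffeoOn (collarModel d) (𝓡 e) c W) (hW : ∀ q : Circle × P, collarMid ι q ∈ W)
    (hinj : ∀ p, Function.Injective (tderiv (𝓡∂ (n + 1)) (𝓡 d) ι p)) (q : Circle × P) :
    Function.Injective (tderiv (𝓡∂ (n + 1 + 1)) (𝓡 e) (c ∘ collarMid ι) q) := by
  refine (injective_iff_map_eq_zero _).2 fun v hv => ?_
  obtain ⟨v, rfl⟩ := (snocEquiv n).surjective v
  rw [tderiv_comp_collarMid hι hc hW] at hv
  have h1 := (hc.injective_tderiv (hW q)).eq_iff.1 (hv.trans (map_zero _).symm)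
  have h2 := Prod.ext_iff.1 (Prod.ext_iff.1 h1).2
  have h3 : v.2 = 0 := (hinj q.2).eq_iff.1 (h2.2.trans (map_zero _).symm)
  have h4 : v = 0 := Prod.ext h2.1 h3
  rw [h4, map_zero]

/-- On the slice the coefficient `s` of `dφ` is zero, so only the component along `P` decides. -/
lemma mem_plane_collarMid_iff (hαN : ξN.IsPositiveForm αN)
    (hι : ContMDiff (𝓡∂ (n + 1)) (𝓡 d) ∞ ι)
    (hc : IsOpenDiffeoOn (collarModel d) (𝓡 e) c W) (hW : ∀ q : Circle × P, collarMid ι q ∈ W)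
    (hcc : ∀ q ∈ W, ∀ v, tderiv (collarModel d) (𝓡 e) c q v ∈ ξ.plane (c q) ↔
      collarForm αN q v = 0) (q : Circle × P)
    (v : EuclideanSpace ℝ (Fin 1) × EuclideanSpace ℝ (Fin (n + 1))) :
    snocEquiv n v ∈ inducedDistribution (n + 1) ξ (c ∘ collarMid ι) q ↔
      v.2 ∈ inducedDistribution n ξN ι q.2 := by
  have h1 := tderiv_comp_collarMid hι hc hW q v
  have h2 := hcc _ (hW q) (0, v.1, tderiv (𝓡∂ (n + 1)) (𝓡 d) ι q.2 v.2)
  have h3 : collarForm αN (collarMid ι q) (0, v.1, tderiv (𝓡∂ (n + 1)) (𝓡 d) ι q.2 v.2) =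
      αN.cov (ι q.2) (tderiv (𝓡∂ (n + 1)) (𝓡 d) ι q.2 v.2) := by
    refine (collarForm_eq _ _ _).trans ?_
    rw [collarCLM_apply]
    simp [collarMid]
  have h4 : snocEquiv n v ∈ inducedDistribution (n + 1) ξ (c ∘ collarMid ι) q ↔
      tderiv (collarModel d) (𝓡 e) c (collarMid ι q)
        (0, v.1, tderiv (𝓡∂ (n + 1)) (𝓡 d) ι q.2 v.2) ∈ ξ.plane (c (collarMid ι q)) := by
    rw [← h1]
    exact Iff.rfl
  exact h4.trans (h2.trans ((Eq.congr_left h3).trans (hαN.2 _ _).1.symm))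

lemma mem_singularSet_collarMid_iff (hαN : ξN.IsPositiveForm αN)
    (hι : ContMDiff (𝓡∂ (n + 1)) (𝓡 d) ∞ ι)
    (hc : IsOpenDiffeoOn (collarModel d) (𝓡 e) c W) (hW : ∀ q : Circle × P, collarMid ι q ∈ W)
    (hcc : ∀ q ∈ W, ∀ v, tderiv (collarModel d) (𝓡 e) c q v ∈ ξ.plane (c q) ↔
      collarForm αN q v = 0) (q : Circle × P) :
    q ∈ singularSet (n + 1) ξ (c ∘ collarMid ι) ↔ q.2 ∈ singularSet n ξN ι := by
  have h := mem_plane_collarMid_iff hαN hι hc hW hcc q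
  constructor
  · intro hq
    refine eq_top_iff.2 fun w _ => (h (0, w)).1 ?_
    rw [show inducedDistribution (n + 1) ξ (c ∘ collarMid ι) q = ⊤ from hq]
    trivial
  · intro hq
    refine eq_top_iff.2 fun w _ => ?_
    obtain ⟨v, rfl⟩ := (snocEquiv n).surjective w
    refine (h v).2 ?_
    rw [show inducedDistribution n ξN ι q.2 = ⊤ from hq]
    trivial

/-- By conformal invariance the given form may be replaced by `a + s dφ` in the coordinates of
`collarParam`. Vectors tangent to the slice have no `s`-component, so `ds ∧ dφ` vanishes on them and
`s dφ` vanishes as well; what remains is the integrability of the foliation on `P`. -/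
lemma isFoliated_collarMid (hαN : ξN.IsPositiveForm αN)
    (hι : ContMDiff (𝓡∂ (n + 1)) (𝓡 d) ∞ ι) (hf : IsFoliated n ξN ι)
    (hc : IsOpenDiffeoOn (collarModel d) (𝓡 e) c W) (hW : ∀ q : Circle × P, collarMid ι q ∈ W)
    (hcc : ∀ q ∈ W, ∀ v, tderiv (collarModel d) (𝓡 e) c q v ∈ ξ.pos (c q) ↔
      0 < collarForm αN q v) : IsFoliated (n + 1) ξ (c ∘ collarMid ι) := by
  intro α hα q u v w
  have hα' := OneForm.isContactForm_iff.1 hα.1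
  have hαN' := OneForm.isContactForm_iff.1 hαN.1
  change wedge (α.cov (c (collarMid ι q))) (α.dcov (c (collarMid ι q)))
    (tderiv (𝓡∂ (n + 1 + 1)) (𝓡 e) (c ∘ collarMid ι) q u)
    (tderiv (𝓡∂ (n + 1 + 1)) (𝓡 e) (c ∘ collarMid ι) q v)
    (tderiv (𝓡∂ (n + 1 + 1)) (𝓡 e) (c ∘ collarMid ι) q w) = 0
  obtain ⟨u, rfl⟩ := (snocEquiv n).surjective u
  obtain ⟨v, rfl⟩ := (snocEquiv n).surjective v
  obtain ⟨w, rfl⟩ := (snocEquiv n).surjective w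
  rw [tderiv_comp_collarMid hι hc hW, tderiv_comp_collarMid hι hc hW,
    tderiv_comp_collarMid hι hc hW]
  obtain ⟨θ, p⟩ := q
  let x₀ : ℝ × ℝ × EuclideanSpace ℝ (Fin d) := (0, Complex.arg θ, extChartAt (𝓡 d) (ι p) (ι p))
  have hx₀ : x₀.2.2 ∈ (extChartAt (𝓡 d) (ι p)).target := mem_extChartAt_target _
  have hxp : collarParam d (ι p) x₀ = collarMid ι (θ, p) := by
    simp [collarParam, collarMid, x₀]
  let a := αN.pull (extChartAt (𝓡 d) (ι p)).symm
  have ha : ContDiffAt ℝ ∞ a x₀.2.2 :=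
    (OneForm.smoothAt_iff_pull (mem_extChartAt_source (ι p))).1 (hαN' (ι p)).1
  have hac : IsContactPair (a x₀.2.2) (dForm a x₀.2.2) :=
    OneForm.isContactPair_pull_chart_symm (fun x => (hαN' x).1) (fun x => (hαN' x).2) (ι p) hx₀
  have hparam := contMDiffAt_collarParam hx₀
  have hWp : collarParam d (ι p) x₀ ∈ W := by rw [hxp]; exact hW _
  have hC : ContMDiffAt 𝓘(ℝ, ℝ × ℝ × EuclideanSpace ℝ (Fin d)) (𝓡 e) ∞
      (c ∘ collarParam d (ι p)) x₀ := ContMDiffAt.comp x₀ (hc.contMDiffAt hWp) hparam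
  have hCd : ∀ x : ℝ × ℝ × EuclideanSpace ℝ (Fin d), x.2.2 ∈ (extChartAt (𝓡 d) (ι p)).target →
      collarParam d (ι p) x ∈ W → ∀ v, tderiv 𝓘(ℝ, ℝ × ℝ × EuclideanSpace ℝ (Fin d)) (𝓡 e)
        (c ∘ collarParam d (ι p)) x v = tderiv (collarModel d) (𝓡 e) c (collarParam d (ι p) x)
        (tderiv 𝓘(ℝ, ℝ × ℝ × EuclideanSpace ℝ (Fin d)) (collarModel d) (collarParam d (ι p)) x v) :=
    fun x hx hxW v => tderiv_comp_apply (hc.mdifferentiableAt hxW)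
      ((contMDiffAt_collarParam hx).mdifferentiableAt (by simp)) rfl v
  -- the form on `M` is conformal to the form on the strip
  have hconf : ∀ᶠ x in 𝓝 x₀, ∃ l : ℝ, 0 < l ∧ ∀ v,
      α.pull (c ∘ collarParam d (ι p)) x v = l * stripForm a x v := by
    have hcont : Filter.Tendsto (fun x : ℝ × ℝ × EuclideanSpace ℝ (Fin d) => x.2.2)
        (𝓝 x₀) (𝓝 (x₀.2.2)) := (continuous_snd.comp continuous_snd).tendsto _
    filter_upwards [hcont.eventually ((isOpen_extChartAt_target (ι p)).mem_nhds hx₀),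
      hparam.continuousAt.eventually (hc.1.mem_nhds hWp)] with x hx hxW
    have hax : IsContactPair (a x.2.2) (dForm a x.2.2) :=
      OneForm.isContactPair_pull_chart_symm (fun x => (hαN' x).1) (fun x => (hαN' x).2) (ι p) hx
    refine exists_pos_eq_smul (fun h0 => hax.1 (ContinuousLinearMap.ext fun w => ?_)) fun v => ?_
    · have := congrArg (fun L => L (0, 0, w)) h0
      simpa [stripForm_apply] using this
    · rw [← collarCLM_collarParam αN hx v]
      change _ ↔ 0 < α.cov (c (collarParam d (ι p) x)) (tderiv _ _ (c ∘ collarParam d (ι p)) x v)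
      rw [hCd x hx hxW, ← collarForm_eq]
      exact (hcc _ hxW _).symm.trans (hα.2 _ _).2
  have hsm : α.SmoothAt ((c ∘ collarParam d (ι p)) x₀) := (hα' _).1
  obtain ⟨l, hl⟩ := exists_wedge_of_conformal (contDiffAt_stripForm ha) (hsm.contDiffAt_pull hC)
    (isContactPair_stripForm ha hac).1 hconf
  -- The coordinate vector that represents the image of `u`. Its first entry is zero because the
  -- slice has constant `s`.
  let lift := fun u : EuclideanSpace ℝ (Fin 1) × EuclideanSpace ℝ (Fin (n + 1)) =>
    ((0, angularForm θ (circleDeriv θ u.1), tderiv (𝓡 d) 𝓘(ℝ, _) (extChartAt (𝓡 d) (ι p)) (ι p)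
      (tderiv (𝓡∂ (n + 1)) (𝓡 d) ι p u.2)) : ℝ × ℝ × EuclideanSpace ℝ (Fin d))
  have hlift : ∀ u, tderiv 𝓘(ℝ, ℝ × ℝ × EuclideanSpace ℝ (Fin d)) (𝓡 e)
      (c ∘ collarParam d (ι p)) x₀ (lift u) = tderiv (collarModel d) (𝓡 e) c (collarMid ι (θ, p))
        (0, u.1, tderiv (𝓡∂ (n + 1)) (𝓡 d) ι p u.2) := by
    intro u
    rw [hCd x₀ hx₀ hWp, tderiv_collarParam hx₀, hxp]
    congr 1
    refine Prod.ext rfl (Prod.ext ?_ ?_)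
    · have h1 := angularForm_circleExp (Complex.arg θ) (angularForm θ (circleDeriv θ u.1))
      rw [Circle.exp_arg] at h1
      refine sub_eq_zero.1 (eq_zero_of_angularForm (θ := θ) ?_)
      rw [map_sub, ← angularCLM_apply, map_sub, angularCLM_apply, angularCLM_apply, sub_eq_zero]
      exact h1
    · exact tderiv_chart_symm_chart (mem_extChartAt_source (ι p)) _
  have hstrip : ∀ u v w, wedge (stripForm a x₀) (dForm (stripForm a) x₀) (lift u) (lift v) (lift w) =
      wedge (αN.cov (ι p)) (αN.dcov (ι p)) (tderiv (𝓡∂ (n + 1)) (𝓡 d) ι p u.2)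
        (tderiv (𝓡∂ (n + 1)) (𝓡 d) ι p v.2) (tderiv (𝓡∂ (n + 1)) (𝓡 d) ι p w.2) := by
    have h1 : ∀ u, stripForm a x₀ (lift u) =
        αN.cov (ι p) (tderiv (𝓡∂ (n + 1)) (𝓡 d) ι p u.2) := by
      intro u
      rw [stripForm_apply, zero_mul, add_zero]
      change αN.cov ((extChartAt (𝓡 d) (ι p)).symm (extChartAt (𝓡 d) (ι p) (ι p)))
        (tderiv _ _ _ _ (tderiv _ _ _ _ _)) = _
      rw [tderiv_chart_symm_chart (mem_extChartAt_source (ι p)), extChartAt_to_inv]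
    have h2 : ∀ u v, dForm (stripForm a) x₀ (lift u) (lift v) =
        αN.dcov (ι p) (tderiv (𝓡∂ (n + 1)) (𝓡 d) ι p u.2)
          (tderiv (𝓡∂ (n + 1)) (𝓡 d) ι p v.2) := by
      intro u v
      rw [dForm_stripForm ha, zero_mul, zero_mul, add_zero, sub_zero]
      rfl
    intro u v w
    simp only [wedge, h1, h2]
  have h1 := hl (lift u) (lift v) (lift w)
  rw [hstrip, show wedge (αN.cov (ι p)) (αN.dcov (ι p)) (tderiv (𝓡∂ (n + 1)) (𝓡 d) ι p u.2)
    (tderiv (𝓡∂ (n + 1)) (𝓡 d) ι p v.2) (tderiv (𝓡∂ (n + 1)) (𝓡 d) ι p w.2) = 0 from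
    hf αN hαN p u.2 v.2 w.2, mul_zero] at h1
  refine Eq.trans ?_ h1
  have h2 : ∀ u, α.pull (c ∘ collarParam d (ι p)) x₀ u = α.cov (c (collarMid ι (θ, p)))
      (tderiv 𝓘(ℝ, ℝ × ℝ × EuclideanSpace ℝ (Fin d)) (𝓡 e) (c ∘ collarParam d (ι p)) x₀ u) := by
    intro u
    rw [← hxp]
    rfl
  have h3 : ∀ u v, dForm (α.pull (c ∘ collarParam d (ι p))) x₀ u v =
      α.dcov (c (collarMid ι (θ, p)))
        (tderiv 𝓘(ℝ, ℝ × ℝ × EuclideanSpace ℝ (Fin d)) (𝓡 e) (c ∘ collarParam d (ι p)) x₀ u)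
        (tderiv 𝓘(ℝ, ℝ × ℝ × EuclideanSpace ℝ (Fin d)) (𝓡 e) (c ∘ collarParam d (ι p)) x₀ v) := by
    intro u v
    rw [hsm.dForm_pull hC, ← hxp]
    rfl
  simp only [wedge, h2, h3, hlift]

/-- A curve in `S¹ × P` that is tangent to the foliation and avoids the singular set projects to
such a curve in `P`. So a function pulled back from `P` is constant on leaves as soon as it is on
the leaves in `P`. -/
lemma regularLeaf_collarMid (hαN : ξN.IsPositiveForm αN)
    (hι : ContMDiff (𝓡∂ (n + 1)) (𝓡 d) ∞ ι)
    (hc : IsOpenDiffeoOn (collarModel d) (𝓡 e) c W) (hW : ∀ q : Circle × P, collarMid ι q ∈ W)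
    (hcc : ∀ q ∈ W, ∀ v, tderiv (collarModel d) (𝓡 e) c q v ∈ ξ.plane (c q) ↔
      collarForm αN q v = 0) {q q' : Circle × P}
    (h : q' ∈ regularLeaf (n + 1) ξ (c ∘ collarMid ι) q) : q'.2 ∈ regularLeaf n ξN ι q.2 := by
  obtain ⟨γ, hγ, h0, h1, hγ'⟩ := h
  have hγs : ContMDiff 𝓘(ℝ, ℝ) (circleModel n) ∞ γ := contMDiff_ofCircleProd.comp hγ
  refine ⟨fun t => (γ t).2, contMDiff_snd.comp hγs, congrArg Prod.snd h0, congrArg Prod.snd h1,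
    fun t => ⟨fun hs => (hγ' t).1 ((mem_singularSet_collarMid_iff hαN hι hc hW hcc _).2 hs), ?_⟩⟩
  have hγt : MDifferentiableAt 𝓘(ℝ, ℝ) (circleModel n) γ t := (hγs t).mdifferentiableAt (by simp)
  have h2 : tderiv 𝓘(ℝ, ℝ) (𝓡∂ (n + 1 + 1)) γ t 1 =
      snocEquiv n (tderiv 𝓘(ℝ, ℝ) (circleModel n) γ t 1) := by
    have h3 := tderiv_comp_apply (g := (id : Circle × P → Circle × P))
      ((contMDiff_toCircleProd (n := n) (γ t)).mdifferentiableAt (by simp)) hγt rfl 1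
    refine h3.trans ?_
    rw [← tderiv_circleProd ((contMDiff_toCircleProd (n := n) (γ t)).mdifferentiableAt (by simp)),
      tderiv_id]
    rfl
  have h4 : tderiv 𝓘(ℝ, ℝ) (𝓡∂ (n + 1)) (fun t => (γ t).2) t 1 =
      (tderiv 𝓘(ℝ, ℝ) (circleModel n) γ t 1).2 := by
    refine (tderiv_comp_apply (g := (Prod.snd : Circle × P → P)) mdifferentiableAt_snd hγt rfl
      1).trans ?_
    rw [tderiv_comp_snd (f := fun p : P => p) mdifferentiableAt_id]
    exact congrArg (fun L : EuclideanSpace ℝ (Fin (n + 1)) →L[ℝ] EuclideanSpace ℝ (Fin (n + 1)) =>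
      L _) (tderiv_id (I := 𝓡∂ (n + 1)))
  have h5 : snocEquiv n (tderiv 𝓘(ℝ, ℝ) (circleModel n) γ t 1) ∈
      inducedDistribution (n + 1) ξ (c ∘ collarMid ι) (γ t) := by
    rw [← h2]
    exact (hγ' t).2
  have h6 := (mem_plane_collarMid_iff hαN hι hc hW hcc (γ t) _).1 h5
  rw [← h4] at h6
  exact h6

end CollarFoliation

attribute [local instance] circleProd in
/-- The product of the circle with a bordered Legendrian open book in `N` is one in the collar. -/
theorem IsBLob.collar {n : ℕ} {N M : Type u} [TopologicalSpace N] [T2Space N]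
    [ChartedSpace (EuclideanSpace ℝ (Fin (2 * n + 1))) N] [IsManifold (𝓡 (2 * n + 1)) ∞ N]
    [TopologicalSpace M] [T2Space M] [ChartedSpace (EuclideanSpace ℝ (Fin (2 * (n + 1) + 1))) M]
    [IsManifold (𝓡 (2 * (n + 1) + 1)) ∞ M] {ξN : ContactStructure (2 * n + 1) N}
    {ξ : ContactStructure (2 * (n + 1) + 1) M} {αN : OneForm (2 * n + 1) N}
    (hαN : ξN.IsPositiveForm αN) {c : ℝ × Circle × N → M} {W : Set (ℝ × Circle × N)}
    (hc : IsOpenDiffeoOn (collarModel (2 * n + 1)) (𝓡 (2 * (n + 1) + 1)) c W)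
    (hW : {0} ×ˢ univ ⊆ W)
    (hcc : ∀ q ∈ W, ∀ v,
      (tderiv (collarModel (2 * n + 1)) (𝓡 (2 * (n + 1) + 1)) c q v ∈ ξ.plane (c q) ↔
        collarForm αN q v = 0) ∧
      (tderiv (collarModel (2 * n + 1)) (𝓡 (2 * (n + 1) + 1)) c q v ∈ ξ.pos (c q) ↔
        0 < collarForm αN q v)) {S : Set N} (hS : IsBLob ξN S) :
    IsBLob ξ (c '' ({0} ×ˢ (univ ×ˢ S))) := by
  obtain ⟨P, _, _, _, _, _, ι, B, ϑ, rfl, hemb, hι, hinj, hfol, hob, hleaf, hsing⟩ := hS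
  have hmid : ∀ q : Circle × P, collarMid ι q ∈ W := fun q => hW ⟨rfl, trivial⟩
  have hplane := fun q hq v => (hcc q hq v).1
  have hmem := mem_singularSet_collarMid_iff hαN hι hc hmid hplane
  have hsm := contMDiff_comp_collarMid hι hc hmid
  refine ⟨Circle × P, inferInstance, circleProd n P, isManifold_circleProd, inferInstance,
    inferInstance, c ∘ collarMid ι, univ ×ˢ B, fun q => ϑ q.2, ?_, ?_,
    hsm.comp contMDiff_ofCircleProd, injective_tderiv_comp_collarMid hι hc hmid hinj,
    isFoliated_collarMid hαN hι hfol hc hmid fun q hq v => (hcc q hq v).2, hob.circleProd, ?_, ?_⟩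
  · rw [range_comp]
    congr 1
    ext ⟨s, θ, p⟩
    constructor
    · rintro ⟨q, hq⟩
      rw [← hq]
      exact ⟨rfl, trivial, mem_range_self _⟩
    · rintro ⟨hs, -, x, hx⟩
      exact ⟨(θ, x), Prod.ext (Eq.symm hs) (Prod.ext rfl hx)⟩
  -- The circle and `P` are compact and `M` is Hausdorff, so continuity and injectivity suffice.
  · refine (hsm.continuous.isClosedEmbedding ?_).isEmbedding
    intro q q' h
    have h1 := hc.injOn (hmid q) (hmid q') h
    have h2 := Prod.ext_iff.1 (Prod.ext_iff.1 h1).2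
    exact Prod.ext h2.1 (hemb.injective h2.2)
  · intro q hq q' hq'
    exact hleaf q.2 (fun h => hq ((hmem q).2 h)) q'.2
      (regularLeaf_collarMid hαN hι hc hmid hplane hq')
  · ext q
    rw [hmem, hsing]
    have hb := boundary_circleProd (n := n) (P := P)
    rw [hb]
    simp

end ContactFiberSum

end

theorem mainTheorem3 {n : ℕ} {N M₁ M₂ : Type u}
    [TopologicalSpace N] [T2Space N] [SecondCountableTopology N]
    [ChartedSpace (EuclideanSpace ℝ (Fin (2 * n + 1))) N] [IsManifold (𝓡 (2 * n + 1)) ∞ N]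
    [TopologicalSpace M₁] [T2Space M₁] [SecondCountableTopology M₁]
    [ChartedSpace (EuclideanSpace ℝ (Fin (2 * (n + 1) + 1))) M₁]
    [IsManifold (𝓡 (2 * (n + 1) + 1)) ∞ M₁]
    [TopologicalSpace M₂] [T2Space M₂] [SecondCountableTopology M₂]
    [ChartedSpace (EuclideanSpace ℝ (Fin (2 * (n + 1) + 1))) M₂]
    [IsManifold (𝓡 (2 * (n + 1) + 1)) ∞ M₂]
    (ξN : ContactStructure (2 * n + 1) N)
    (ξ₁ : ContactStructure (2 * (n + 1) + 1) M₁) (ξ₂ : ContactStructure (2 * (n + 1) + 1) M₂)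
    (hN : IsPSOvertwisted ξN)
    (j₁ : N → M₁) (hj₁ : IsContactEmbedding ξN ξ₁ j₁)
    (hν₁ : HasTrivialNormalBundle (2 * n + 1) (2 * (n + 1) + 1) j₁)
    (j₂ : N → M₂) (hj₂ : IsContactEmbedding ξN ξ₂ j₂)
    (hν₂ : HasTrivialNormalBundle (2 * n + 1) (2 * (n + 1) + 1) j₂) :
    (CompactSpace N → ∀ αN : OneForm (2 * n + 1) N, ξN.IsPositiveForm αN →
      ∃ (M' : Type u) (_ : TopologicalSpace M') (_ : T2Space M') (_ : SecondCountableTopology M')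
        (_ : ChartedSpace (EuclideanSpace ℝ (Fin (2 * (n + 1) + 1))) M')
        (_ : IsManifold (𝓡 (2 * (n + 1) + 1)) ∞ M')
        (ξ' : ContactStructure (2 * (n + 1) + 1) M')
        (F : FiberSum ξN ξ₁ ξ₂ j₁ j₂ ξ'), F.form = αN) ∧
    ∀ (M' : Type u) [TopologicalSpace M'] [T2Space M'] [SecondCountableTopology M']
      [ChartedSpace (EuclideanSpace ℝ (Fin (2 * (n + 1) + 1))) M']
      [IsManifold (𝓡 (2 * (n + 1) + 1)) ∞ M']
      (ξ' : ContactStructure (2 * (n + 1) + 1) M')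
      (F : FiberSum ξN ξ₁ ξ₂ j₁ j₂ ξ'),
      (∀ S : Set N, IsBLob ξN S → IsBLob ξ' (F.collar '' ({0} ×ˢ (univ ×ˢ S)))) ∧
      IsPSOvertwisted ξ' := by
  obtain ⟨S₀, hS₀⟩ := id hN
  refine ⟨fun _ αN hαN => ?_, fun M' _ _ _ _ _ ξ' F => ?_⟩
  -- The binding of a bLob is nonempty, hence so is `N`; the gluing needs points of `N`, `M₁` and
  -- `M₂` for its default values.
  · have : Nonempty N := by
      obtain ⟨P, _, _, _, _, _, ι, B, ϑ, -, -, -, -, -, hob, -, -⟩ := hS₀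
      exact ⟨ι hob.binding_nonempty.some⟩
    exact exists_fiberSum hj₁ hν₁ hj₂ hν₂ hαN
  · have h : ∀ S : Set N, IsBLob ξN S → IsBLob ξ' (F.collar '' ({0} ×ˢ (univ ×ˢ S))) :=
      fun S hS => hS.collar F.form_positive F.collar_diffeo
        (prod_mono_left (singleton_subset_iff.2 ⟨neg_lt_zero.2 F.width_pos, F.width_pos⟩))
        F.collar_contact
    exact ⟨h, _, h S₀ hS₀⟩
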